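/- \textbf{Setting.} Let $\Gamma\subset\mathbb R^3$ be a polyhedral surface, possibly with boundary $\partial\Gamma$, and let $\mathcal T_i,\mathcal T_j$ be two meshes of it: finite, purely two-dimensional simplicial complexes with flat triangles and with the same underlying space $\Gamma$, in which every edge lies in at most two triangles and the triangles around each node form a single chain or cycle of triangles joined along edges. $\Gamma$ is oriented, i.e. the triangles of $\mathcal T_j$ are oriented consistently. Write $\mathcal T^0,\mathcal T^1,\mathcal T^2$ for the nodes, edges and triangles of a mesh $\mathcal T$. Assume that the boundary trace on $\partial\Gamma$ of one of the two complexes below (Whitney or Buffa–Christiansen) vanishes. If $\partial\Gamma=\emptyset$ this is no condition, and both cases amount to the same. \textbf{Whitney spaces.} $\mathcal W^r$ ($r=0,1,2$) is the span of the Whitney forms $\lambda^r_t=r!\sum_k(-1)^k\lambda_k\,d\lambda_0\wedge\dots\widehat{d\lambda_k}\dots\wedge d\lambda_r$ of the simplices $t\in\mathcal T^r$, where $\lambda_k$ are the barycentric coordinates of the nodes of $t$; in the case of vanishing Whitney traces, only of those $t$ not contained in $\partial\Gamma$. These $t$ are called active (all $t$ are active in the other case). The exterior derivative $d$ is taken triangle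 by triangle, and forms are identified if they agree in the interiors of the triangles. \textbf{Buffa–Christiansen (B-C) spaces on $\mathcal T=\mathcal T_j$.} Let $\widetilde{\mathcal T}$ be the barycentric refinement, with Whitney basis $\tilde\lambda^q_w$, $w\in\widetilde{\mathcal T}^q$. For $t\in\mathcal T^r$, $q=2-r$, let $\star t$ be the barycentric dual $q$-cell (truncated at $\partial\Gamma$), oriented so that $(\star t,t)$ is in the orientation of $\Gamma$. Nodes are positive and triangles carry the orientation of $\Gamma$, and $\star t=\sum_w c_w w$ with $c_w\in\{-1,0,1\}$. Put $U_t=\bigcup_a\star a$ over the nodes $a$ of $t$. A B-C basis consists of forms $\mu^q_{\star t}=\sum_w R_w\tilde\lambda^q_w$, $t$ active, such that (1) $R_w=0$ for $w\not\subset U_t$ and for $w\subset\partial U_t$; if the Whitney traces vanish, $\partial U_t$ is replaced here by the closure of $\partial U_t\setminus\partial\Gamma$; (2) $R_w=c_w/\sum_{w'}|c_{w'}|$ whenever $c_w\neq0$; (3) if $r=q=1$, then $R_w=0$ for the two halves $w\subset t$ of the edge $t$, except for a half whose end node lies on $\partial\Gamma$; (4) if $d\lambda^r_s=\sum_{t}D^r_{st}\lambda^{r+1}_t$,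 then for active $t\in\mathcal T^{r+1}$, with $q=2-r$, $d\mu^{q-1}_{\star t}=(-1)^r\sum_{s}D^r_{st}\,\mu^q_{\star s}$ on $U_t$, the sum running over the active $s\in\mathcal T^r$; (5) if the Whitney traces vanish, the 0-forms $\mu^0_{\star t}$ are nonnegative at the nodes of $\mathcal T$ on $\partial\Gamma$. Given a B-C basis, $\mathcal B^q_j$ is the span of the $\mu^q_{\star t}$. \textbf{Theorem (Commuting Property).} B-C bases exist, and for every choice of a B-C basis on $\mathcal T_j$ the following holds, with $b(\beta,\omega)=\int_\Gamma\beta\wedge\omega$. (a) For $q+r=2$ there is exactly one linear operator $Q^r_{ji}:\mathcal W^r_i\to\mathcal W^r_j$ such that $\omega_j=Q^r_{ji}\omega_i$ satisfies $$b(\beta,\omega_j)=b(\beta,\omega_i)\qquad\text{for all }\beta\in\mathcal B^q_j .$$ (b) $Q^r_{ji}$ is a projector: if $\omega\in\mathcal W^r_i$ coincides almost everywhere on $\Gamma$ with some $\eta\in\mathcal W^r_j$, then $Q^r_{ji}\omega=\eta$. In particular $Q^r_{jj}=\mathrm{Id}$. (c) For $r=0,1$ one has $d\,\mathcal W^r_i\subset\mathcal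 W^{r+1}_i$ and $$d\circ Q^r_{ji}=Q^{r+1}_{ji}\circ d\quad\text{on }\mathcal W^r_i .$$ -/

import Mathlib

namespace MeshCoupling

section

open scoped Classical

/-- Euclidean three-space, in which the interface lives. -/
abbrev E3 : Type := EuclideanSpace ℝ (Fin 3)

/-! ### Interface meshes -/

/-- A mesh of a polyhedral interface: a finite, purely two-dimensional geometric simplicial complex
in three-space whose underlying space is a surface, possibly with boundary. The surface condition is
combinatorial: an edge lies in at most two triangles, and the triangles around a vertex form one
chain or one cycle of triangles joined along edges. -/
structure SurfaceMesh extends Geometry.SimplicialComplex ℝ E3 where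
  finite : faces.Finite
  pure : ∀ s ∈ faces, ∃ T ∈ faces, T.card = 3 ∧ s ⊆ T
  edge_le_two : ∀ e ∈ faces, e.card = 2 → {T | T ∈ faces ∧ T.card = 3 ∧ e ⊆ T}.ncard ≤ 2
  star_connected : ∀ (a : E3), ∀ T ∈ faces, ∀ T' ∈ faces,
    T.card = 3 → T'.card = 3 → a ∈ T → a ∈ T' →
      Relation.ReflTransGen
        (fun S S' : Finset E3 => S ∈ faces ∧ S' ∈ faces ∧ S.card = 3 ∧ S'.card = 3 ∧
          a ∈ S ∧ a ∈ S' ∧ {x | x ∈ S ∧ x ∈ S'}.ncard = 2) T T'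

namespace SurfaceMesh

variable (K : SurfaceMesh)

/-- The finite set of all nodes, edges and triangles. -/
noncomputable def faceFinset : Finset (Finset E3) := K.finite.toFinset

/-- The triangles of the mesh. -/
noncomputable def triangles : Finset (Finset E3) := K.faceFinset.filter (fun T => T.card = 3)

/-- A node, edge or triangle contained in the boundary of the interface: it is a face of an edge
that belongs to exactly one triangle. -/
def OnBoundary (s : Finset E3) : Prop :=
  ∃ e ∈ K.faces, e.card = 2 ∧ s ⊆ e ∧ (K.triangles.filter (fun T => e ⊆ T)).card = 1

/-- An orientation of the interface: each triangle gets an ordering of its nodes (relevant up to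
cyclic permutations), and two distinct triangles never run through an edge in the same direction. -/
structure Orientation where
  ord : Finset E3 → Fin 3 → E3
  image_ord : ∀ T ∈ K.triangles, Finset.univ.image (ord T) = T
  compat : ∀ T ∈ K.triangles, ∀ T' ∈ K.triangles, T ≠ T' → ∀ i j : Fin 3,
    ¬ (ord T i = ord T' j ∧ ord T (i + 1) = ord T' (j + 1))

/-- Incidence number of the oriented edge from `a` to `b` and the oriented triangle `T`: `1` if the
boundary of `T` runs from `a` to `b`, `-1` if it runs from `b` to `a`, and `0` otherwise. -/
noncomputable def Orientation.inc {K : SurfaceMesh} (o : K.Orientation) (T : Finset E3)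
    (a b : E3) : ℝ :=
  if ∃ i, o.ord T i = a ∧ o.ord T (i + 1) = b then 1
  else if ∃ i, o.ord T i = b ∧ o.ord T (i + 1) = a then -1
  else 0

end SurfaceMesh

/-! ### Differential forms on the interface -/

/-- A field of alternating `r`-forms. A form on the polyhedral interface is represented by the field
of forms on three-space that have the same value on tangent vectors and vanish if one argument is
normal to the interface; the field is set to zero at all points that are not in the relative
interior of a triangle. -/
abbrev Form (r : ℕ) : Type := E3 → E3 [⋀^Fin r]→L[ℝ] ℝ

/-- The barycenter of a simplex, given by its nodes. -/
noncomputable def center (s : Finset E3) : E3 := s.centroid ℝ id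

/-- The altitude vector of the simplex `s` at its node `a`, from the opposite face to `a`. -/
noncomputable def altitude (s : Finset E3) (a : E3) : E3 :=
  (vectorSpan ℝ (s.erase a : Set E3))ᗮ.starProjection (a - center (s.erase a))

/-- The differential of the barycentric coordinate of the simplex `s` at the node `a`. -/
noncomputable def baryDiff (s : Finset E3) (a : E3) : E3 →L[ℝ] ℝ :=
  (‖altitude s a‖ ^ 2)⁻¹ • innerSL ℝ (altitude s a)

/-- The barycentric coordinate of the simplex `s` at the node `a`, extended to three-space so that
it is constant along the normals of `s`. -/
noncomputable def baryCoord (s : Finset E3) (a : E3) (x : E3) : ℝ := 1 + baryDiff s a (x - a)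

theorem baryCoord_self (s : Finset E3) (a : E3) : baryCoord s a a = 1 := by
  simp [baryCoord]

theorem baryCoord_of_ne {s : Finset E3} (hs : AffineIndependent ℝ ((↑) : s → E3)) {a b : E3}
    (ha : a ∈ s) (hb : b ∈ s) (hab : b ≠ a) : baryCoord s a b = 0 := by
  have hbe : b ∈ s.erase a := Finset.mem_erase.2 ⟨hab, hb⟩
  have hc : center (s.erase a) ∈ affineSpan ℝ (s.erase a : Set E3) := by
    have h := centroid_mem_affineSpan_of_nonempty ℝ (s := (s.erase a).attach)
      ((↑) : (s.erase a) → E3) ⟨⟨b, hbe⟩, by simp⟩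
    have h2 : Finset.centroid ℝ (s.erase a).attach ((↑) : (s.erase a) → E3)
        = center (s.erase a) := by
      have h3 := Finset.centroid_map ℝ (s.erase a).attach
        (Function.Embedding.subtype (· ∈ s.erase a)) (id : E3 → E3)
      rw [Finset.attach_map_val] at h3
      exact h3.symm
    rw [h2] at h
    rwa [Subtype.range_coe_subtype, show {x | x ∈ s.erase a} = (s.erase a : Set E3) from rfl] at h
  have hbs : b ∈ affineSpan ℝ (s.erase a : Set E3) := subset_affineSpan ℝ _ (Finset.mem_coe.2 hbe)
  have hbc : b - center (s.erase a) ∈ vectorSpan ℝ (s.erase a : Set E3) := by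
    rw [← direction_affineSpan]
    exact AffineSubspace.vsub_mem_direction hbs hc
  have hne : altitude s a ≠ 0 := by
    intro h0
    have h1 : a - center (s.erase a) ∈ vectorSpan ℝ (s.erase a : Set E3) := by
      have := (Submodule.starProjection_apply_eq_zero_iff _).1 h0
      rwa [Submodule.orthogonal_orthogonal] at this
    have h2 : a ∈ affineSpan ℝ (s.erase a : Set E3) := by
      have := AffineSubspace.vadd_mem_of_mem_direction
        (by rw [direction_affineSpan]; exact h1) hc
      simpa using this
    have h3 := hs.notMem_affineSpan_sdiff ⟨a, ha⟩ Set.univ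
    apply h3
    convert h2
    ext x
    simp only [Set.mem_image, Set.mem_sdiff, Set.mem_univ, true_and, Set.mem_singleton_iff,
      Finset.coe_erase, Finset.mem_coe]
    constructor
    · rintro ⟨y, hy, rfl⟩
      exact ⟨y.2, fun h => hy (Subtype.ext h)⟩
    · rintro ⟨hx, hxa⟩
      exact ⟨⟨x, hx⟩, fun h => hxa (congrArg Subtype.val h), rfl⟩
  have h1 : inner ℝ (altitude s a) (b - center (s.erase a)) = 0 :=
    Submodule.inner_left_of_mem_orthogonal hbc (Submodule.starProjection_apply_mem _ _)
  have h2 : inner ℝ (altitude s a) (a - center (s.erase a)) = ‖altitude s a‖ ^ 2 := by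
    exact Submodule.re_inner_starProjection_eq_normSq (𝕜 := ℝ)
      (vectorSpan ℝ (s.erase a : Set E3))ᗮ (a - center (s.erase a))
  have h3 : inner ℝ (altitude s a) (b - a) = - ‖altitude s a‖ ^ 2 := by
    rw [← h2, show b - a = (b - center (s.erase a)) - (a - center (s.erase a)) by abel,
      inner_sub_right, h1, zero_sub]
  have hn : ‖altitude s a‖ ^ 2 ≠ 0 := by positivity
  simp only [baryCoord, baryDiff, _root_.smul_apply, innerSL_apply_apply, h3,
    smul_eq_mul]
  field_simp
  ring

/-- The relative interior of the triangle with node set `s`. -/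
def openTriangle (s : Finset E3) : Set E3 :=
  {x | x ∈ convexHull ℝ (s : Set E3) ∧ ∀ a ∈ s, 0 < baryCoord s a x}

/-- The orthogonal projection of three-space to the plane of the triangle `s`. -/
noncomputable def planeProj (s : Finset E3) (y : E3) : E3 :=
  center s + (vectorSpan ℝ (s : Set E3)).starProjection (y - center s)

/-- The exterior product of `r` linear functionals, a determinant. -/
noncomputable def wedgeOneForms {r : ℕ} (l : Fin r → E3 →L[ℝ] ℝ) : E3 [⋀^Fin r]→L[ℝ] ℝ :=
  ((ContinuousMultilinearMap.mkPiAlgebra ℝ (Fin r) ℝ).compContinuousLinearMap l).alternatization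

/-- The Whitney form `r! ∑ₖ (-1)ᵏ λₖ dλ₀ ∧ ⋯ ∧ dλₖ₋₁ ∧ dλₖ₊₁ ∧ ⋯ ∧ dλᵣ` of the ordered simplex `v`
on a triangle `s` that has it as a face. -/
noncomputable def whitneyLocal (s : Finset E3) {r : ℕ} (v : Fin (r + 1) → E3) : Form r := fun x =>
  (r.factorial : ℝ) • ∑ k : Fin (r + 1),
    ((-1 : ℝ) ^ (k : ℕ) * baryCoord s (v k) x) •
      wedgeOneForms (fun i : Fin r => baryDiff s (v (k.succAbove i)))

/-- The Whitney basis form of the ordered simplex `v` on the triangulated surface with triangles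
`F`. It is supported on the triangles that contain `v`. -/
noncomputable def whitney (F : Finset (Finset E3)) {r : ℕ} (v : Fin (r + 1) → E3) : Form r :=
  fun x => ∑ s ∈ F.filter (fun s => Finset.univ.image v ⊆ s),
    (openTriangle s).indicator (whitneyLocal s v) x

/-- The exterior derivative on the triangulated surface with triangles `F`: inside a triangle, the
form is continued constantly along the normals, and the exterior derivative is taken there. -/
noncomputable def surfaceD (F : Finset (Finset E3)) {r : ℕ} (ω : Form r) : Form (r + 1) :=
  fun x => ∑ s ∈ F, (openTriangle s).indicator (extDeriv (fun y => ω (planeProj s y))) x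

/-- The exterior product `β ∧ ω`, evaluated at a tuple of vectors. -/
noncomputable def wedge {q r : ℕ} (β : E3 [⋀^Fin q]→L[ℝ] ℝ) (ω : E3 [⋀^Fin r]→L[ℝ] ℝ)
    (u : Fin (q + r) → E3) : ℝ :=
  ((q.factorial : ℝ) * (r.factorial : ℝ))⁻¹ * ∑ g : Equiv.Perm (Fin (q + r)),
    ((Equiv.Perm.sign g : ℤ) : ℝ) * β (fun i => u (g (Fin.castAdd r i))) *
      ω (fun j => u (g (Fin.natAdd q j)))

/-- The reference triangle. -/
def refTriangle : Set (ℝ × ℝ) := {p | 0 ≤ p.1 ∧ 0 ≤ p.2 ∧ p.1 + p.2 ≤ 1}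

/-- The pairing `b(β, ω) = ∫ β ∧ ω` over the oriented interface: the sum over all triangles of the
integral of the pull-back to the reference triangle. -/
noncomputable def pairing {K : SurfaceMesh} (o : K.Orientation) {q r : ℕ} (h : q + r = 2)
    (β : Form q) (ω : Form r) : ℝ :=
  ∑ T ∈ K.triangles, ∫ p in refTriangle,
    wedge (β (o.ord T 0 + p.1 • (o.ord T 1 - o.ord T 0) + p.2 • (o.ord T 2 - o.ord T 0)))
      (ω (o.ord T 0 + p.1 • (o.ord T 1 - o.ord T 0) + p.2 • (o.ord T 2 - o.ord T 0)))
      (fun k => ![o.ord T 1 - o.ord T 0, o.ord T 2 - o.ord T 0] (Fin.cast h k))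

/-! ### Whitney spaces -/

/-- Which of the two complexes has vanishing trace on the boundary of the interface. If the
interface has no boundary, both choices amount to the same. -/
inductive ZeroTrace
  | buffaChristiansen
  | whitney

/-- The nodes, edges and triangles that carry degrees of freedom: all of them, or, if the traces of
the Whitney forms vanish, those that are not contained in the boundary of the interface. -/
def SurfaceMesh.IsDof (K : SurfaceMesh) (tr : ZeroTrace) (s : Finset E3) : Prop :=
  s ∈ K.faces ∧ (tr = ZeroTrace.whitney → ¬ K.OnBoundary s)

/-- The space of Whitney `r`-forms, with zero boundary trace if `tr = ZeroTrace.whitney`. -/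
noncomputable def whitneySpace (K : SurfaceMesh) (tr : ZeroTrace) (r : ℕ) :
    Submodule ℝ (Form r) :=
  Submodule.span ℝ {ω | ∃ v : Fin (r + 1) → E3, Function.Injective v ∧
    K.IsDof tr (Finset.univ.image v) ∧ ω = whitney K.triangles v}

/-! ### The barycentric refinement

A `q`-simplex of the barycentric refinement is a flag `w 0 ⊂ ⋯ ⊂ w q` of simplices of the mesh; its
nodes are the barycenters, and it is always oriented by the order of the flag. -/

namespace SurfaceMesh

variable (K : SurfaceMesh)

/-- The `q`-simplices of the barycentric refinement. -/
noncomputable def flags (q : ℕ) : Finset (Fin (q + 1) → Finset E3) :=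
  (Fintype.piFinset (fun _ : Fin (q + 1) => K.faceFinset)).filter StrictMono

/-- The node sets of the triangles of the barycentric refinement. -/
noncomputable def sdTriangles : Finset (Finset E3) :=
  (K.flags 2).image (fun w => Finset.univ.image (fun i => center (w i)))

end SurfaceMesh

/-- `w` is a face of `z`, for simplices of the barycentric refinement. -/
def IsSubflag {p q : ℕ} (w : Fin (p + 1) → Finset E3) (z : Fin (q + 1) → Finset E3) : Prop :=
  Set.range w ⊆ Set.range z

/-- The coboundary of a cochain on the barycentric refinement. For the coefficients of a Whitney
form, this gives the coefficients of its exterior derivative. -/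
def coboundary {q : ℕ} (R : (Fin (q + 1) → Finset E3) → ℝ) (z : Fin (q + 2) → Finset E3) : ℝ :=
  ∑ k : Fin (q + 2), (-1 : ℝ) ^ (k : ℕ) * R (fun i => z (k.succAbove i))

/-! ### The Buffa-Christiansen complex -/

namespace SurfaceMesh

variable (K : SurfaceMesh)

/-- The triangles of the barycentric refinement that make up the support `U` of the basis form
associated with the dual cell of the simplex `t`: those in the dual cells of the nodes of `t`. -/
noncomputable def region (t : Finset E3) : Finset (Fin 3 → Finset E3) :=
  (K.flags 2).filter (fun z => z 0 ⊆ t)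

/-- `w ⊂ U`. -/
def InRegion (t : Finset E3) {q : ℕ} (w : Fin (q + 1) → Finset E3) : Prop :=
  ∃ z ∈ K.region t, IsSubflag w z

/-- The edge `f` of the barycentric refinement is contained in the boundary of the interface. -/
def SdBoundaryEdge (f : Fin 2 → Finset E3) : Prop :=
  ((K.flags 2).filter (fun z => IsSubflag (p := 1) (q := 2) f z)).card = 1

/-- `w ⊂ ∂U`. If the Whitney forms have zero trace, the part of `∂U` in the boundary of the
interface is left out, since no trace condition is imposed on the Buffa-Christiansen forms there. -/
def InRegionBoundary (tr : ZeroTrace) (t : Finset E3) {q : ℕ} (w : Fin (q + 1) → Finset E3) :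
    Prop :=
  ∃ f ∈ K.flags 1, IsSubflag w f ∧
    ((K.region t).filter (fun z => IsSubflag (p := 1) (q := 2) f z)).card = 1 ∧
    (tr = ZeroTrace.whitney → ¬ K.SdBoundaryEdge f)

/-- The coefficients of the basis 2-form of the dual cell of the node `a`: equal weights, with the
sign given by the orientation, on all small triangles in the dual cell. -/
noncomputable def coeff2 (o : K.Orientation) (a : E3) (w : Fin 3 → Finset E3) : ℝ :=
  if w ∈ K.flags 2 ∧ w 0 = {a} then
    (∑ b ∈ w 1, o.inc (w 2) a b) / ((K.flags 2).filter (fun z => z 0 = {a})).card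
  else 0

end SurfaceMesh

/-- The coefficients, with respect to the Whitney bases of the barycentric refinement, of a
Buffa-Christiansen basis: `R1 a b` belongs to the dual edge of the edge from `a` to `b`, and `R0 T`
to the dual node of the triangle `T`; those of the 2-forms are `SurfaceMesh.coeff2`. The dual cell
of a simplex is oriented such that its orientation, followed by that of the simplex, is the
orientation of the interface; nodes and dual nodes are positive.

* `support1`, `support0`: the forms are supported in `U`, with zero trace on `∂U`;
* `same1`, `same0`: the small cells that make up the dual cell contribute with equal weights, which
  add up to one;
* `stable`: the two halves of a primal edge do not contribute to the form of its dual edge. Halves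
  that end at a boundary node are exempt: their coefficients are determined by the zero trace of
  the Buffa-Christiansen forms, or else only have to be chosen such that `nonneg` holds;
* `deriv1`, `deriv0`: up to sign, the matrix of the exterior derivative is the transpose of the
  incidence matrix of the mesh (restricted to the degrees of freedom). -/
structure BCBasis (K : SurfaceMesh) (o : K.Orientation) (tr : ZeroTrace) where
  R1 : E3 → E3 → (Fin 2 → Finset E3) → ℝ
  R0 : Finset E3 → (Fin 1 → Finset E3) → ℝ
  antisymm : ∀ a b w, R1 b a w = - R1 a b w
  support1 : ∀ a b, a ≠ b → K.IsDof tr {a, b} → ∀ w ∈ K.flags 1,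
    (¬ K.InRegion {a, b} (q := 1) w ∨ K.InRegionBoundary tr {a, b} (q := 1) w) → R1 a b w = 0
  same1 : ∀ a b, a ≠ b → K.IsDof tr {a, b} → ∀ w ∈ K.flags 1, w 0 = {a, b} →
    R1 a b w = - o.inc (w 1) a b / ((K.flags 1).filter (fun w' => w' 0 = {a, b})).card
  stable : ∀ a b, a ≠ b → K.IsDof tr {a, b} → ∀ w ∈ K.flags 1, w 1 = {a, b} →
    ¬ K.OnBoundary (w 0) → R1 a b w = 0
  deriv1 : ∀ a b, a ≠ b → K.IsDof tr {a, b} → ∀ z ∈ K.flags 2, K.InRegion {a, b} (q := 2) z →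
    coboundary (R1 a b) z =
      (if K.IsDof tr {b} then K.coeff2 o b z else 0) -
        (if K.IsDof tr {a} then K.coeff2 o a z else 0)
  support0 : ∀ T ∈ K.triangles, ∀ w ∈ K.flags 0,
    (¬ K.InRegion T (q := 0) w ∨ K.InRegionBoundary tr T (q := 0) w) → R0 T w = 0
  same0 : ∀ T ∈ K.triangles, ∀ w ∈ K.flags 0, w 0 = T → R0 T w = 1
  deriv0 : ∀ T ∈ K.triangles, ∀ z ∈ K.flags 1, K.InRegion T (q := 1) z →
    coboundary (R0 T) z = - ∑ i : Fin 3,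
      if K.IsDof tr {o.ord T i, o.ord T (i + 1)} then R1 (o.ord T i) (o.ord T (i + 1)) z else 0
  nonneg : tr = ZeroTrace.whitney → ∀ T ∈ K.triangles, ∀ w ∈ K.flags 0,
    K.OnBoundary (w 0) → (w 0).card = 1 → 0 ≤ R0 T w

/-- The coefficient families of the basis `q`-forms. -/
def BCBasis.coeffs {K : SurfaceMesh} {o : K.Orientation} {tr : ZeroTrace} (μ : BCBasis K o tr) :
    (q : ℕ) → Set ((Fin (q + 1) → Finset E3) → ℝ)
  | 0 => {R | ∃ T ∈ K.triangles, R = μ.R0 T}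
  | 1 => {R | ∃ a b : E3, a ≠ b ∧ K.IsDof tr {a, b} ∧ R = μ.R1 a b}
  | 2 => {R | ∃ a : E3, K.IsDof tr {a} ∧ R = K.coeff2 o a}
  | _ => ∅

/-- The Buffa-Christiansen space of `q`-forms, spanned by the basis forms. -/
noncomputable def BCBasis.space {K : SurfaceMesh} {o : K.Orientation} {tr : ZeroTrace}
    (μ : BCBasis K o tr) (q : ℕ) : Submodule ℝ (Form q) :=
  Submodule.span ℝ {β | ∃ R ∈ μ.coeffs q,
    β = ∑ w ∈ K.flags q, R w • whitney K.sdTriangles (fun i => center (w i))}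

/-! ### Mesh coupling operators -/

/-- `Q` is the projection-based mesh coupling operator from the Whitney `r`-forms on the mesh `K'`
to those on the mesh `K`, with the Buffa-Christiansen `q`-forms on `K` as multipliers. -/
def IsCouplingOperator (K' : SurfaceMesh) {K : SurfaceMesh} {o : K.Orientation} {tr : ZeroTrace}
    (μ : BCBasis K o tr) {q r : ℕ} (h : q + r = 2)
    (Q : whitneySpace K' tr r →ₗ[ℝ] whitneySpace K tr r) : Prop :=
  ∀ ω : whitneySpace K' tr r, ∀ β ∈ μ.space q,
    pairing o h β (Q ω : Form r) = pairing o h β (ω : Form r)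

/-- Two forms on the interface, given piecewise on the meshes `K'` and `K`, coincide (at all points
in the relative interiors of a triangle of either mesh, which are almost all points). -/
def Coincide (K' K : SurfaceMesh) {r : ℕ} (ω η : Form r) : Prop :=
  ∀ T' ∈ K'.triangles, ∀ T ∈ K.triangles, ∀ x ∈ openTriangle T' ∩ openTriangle T, ω x = η x

end

end MeshCoupling

/-! Two facts carry the theorem. A Whitney form on `Kj` that is orthogonal to all of `μ.space q`
vanishes, and the exterior derivatives of the two complexes are adjoint up to sign, even when the
Whitney form lives on the other mesh. Nondegeneracy (`BCBasis.nondegenerate_and_exists`) yields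
existence and uniqueness of the coupling operator, and the projection property is uniqueness again,
because forms that coincide almost everywhere have the same moments. For the commutation, the
derivative of a basis form is a combination of basis forms; adjointness therefore expresses the
moments of `d Q ω` by those of `Q ω`, hence of `ω`, hence of `d ω`, and nondegeneracy concludes
(`BCBasis.surfaceD_coupling`).

Adjointness is integration by parts for functions that are piecewise linear on two unrelated
triangulations of the surface. On a triangle of `Kj` they are only Lipschitz, so Stokes' theorem is
needed for Lipschitz functions (`integral_jac_refTriangle`). Summed over the triangles (`stokes`),
interior edges cancel by orientation and boundary edges drop out because one of the complexes has
zero trace. If this is the Whitney complex of `Ki`, one has to know that both meshes have the same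
boundary as a point set, which is a geometric argument about half planes
(`SurfaceMesh.exists_boundary_edge`).

Nondegeneracy is a discrete maximum principle in each degree. For 0-forms, the moment over a dual
cell weighs its node with 11/18 and all others with 7/18 together (`nodeForm_eq_zero_of_pairing`).
For 2-forms the transposed problem is treated: a combination of the basis 0-forms with zero integral
over every triangle vanishes, since the maximal modulus of its coefficients would otherwise spread
around a boundary node until it reaches a boundary edge, where it cannot occur
(`BCBasis.eq_zero_of_values`). A 1-form that is orthogonal to the basis 1-forms is closed, by
adjointness and the case of 2-forms; for closed forms the moment is the coefficient of the edge plus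
a difference of two averages, each at most 7/18 of the maximum (`BCBasis.pairing_R1`,
`BCBasis.edgeForm_eq_zero_of_pairing`).

For the existence of bases (`exists_bcBasis`), the coefficients of a basis 1-form around an end node
of its edge solve a linear system over the small triangles at that node. The multipliers that
annihilate the system are constant around the node (`SurfaceMesh.eq_of_balanced`), so that
solvability is one scalar condition (`SurfaceMesh.exists_edge_weights`). The basis 0-forms are
primitives of the 1-forms. -/

namespace MeshCoupling

open Filter Topology MeasureTheory
open scoped Classical NNReal

/-! ### Stokes' theorem for Lipschitz functions in the plane -/

section LipschitzStokes

open Set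

/-- The Jacobian determinant of a pair of functions on the plane. -/
noncomputable def jac (f w : ℝ × ℝ → ℝ) (p : ℝ × ℝ) : ℝ :=
  fderiv ℝ f p (1, 0) * fderiv ℝ w p (0, 1) - fderiv ℝ f p (0, 1) * fderiv ℝ w p (1, 0)

theorem jac_congr {f f' w w' : ℝ × ℝ → ℝ} {p : ℝ × ℝ} (hf : f =ᶠ[𝓝 p] f') (hw : w =ᶠ[𝓝 p] w') :
    jac f w p = jac f' w' p := by
  simp [jac, hf.fderiv_eq, hw.fderiv_eq]

theorem norm_fderiv_le {f : ℝ × ℝ → ℝ} {C : ℝ≥0} (hf : LipschitzWith C f) (p v : ℝ × ℝ) :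
    ‖fderiv ℝ f p v‖ ≤ C * ‖v‖ :=
  (ContinuousLinearMap.le_opNorm _ _).trans
    (mul_le_mul_of_nonneg_right (norm_fderiv_le_of_lipschitz ℝ hf) (norm_nonneg _))

theorem measurable_jac (f w : ℝ × ℝ → ℝ) : Measurable (jac f w) :=
  ((measurable_fderiv_apply_const ℝ f _).mul (measurable_fderiv_apply_const ℝ w _)).sub
    ((measurable_fderiv_apply_const ℝ f _).mul (measurable_fderiv_apply_const ℝ w _))

theorem norm_jac_le {f w : ℝ × ℝ → ℝ} {C D : ℝ≥0} (hf : LipschitzWith C f)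
    (hw : LipschitzWith D w) (p : ℝ × ℝ) : ‖jac f w p‖ ≤ 2 * C * D := by
  have h1 : ‖((1 : ℝ), (0 : ℝ))‖ = 1 := by simp [Prod.norm_def]
  have h2 : ‖((0 : ℝ), (1 : ℝ))‖ = 1 := by simp [Prod.norm_def]
  have a1 := norm_fderiv_le hf p (1, 0)
  have a2 := norm_fderiv_le hf p (0, 1)
  have b1 := norm_fderiv_le hw p (1, 0)
  have b2 := norm_fderiv_le hw p (0, 1)
  rw [h1, mul_one] at a1 b1
  rw [h2, mul_one] at a2 b2
  calc ‖jac f w p‖ ≤ ‖fderiv ℝ f p (1, 0) * fderiv ℝ w p (0, 1)‖ +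
        ‖fderiv ℝ f p (0, 1) * fderiv ℝ w p (1, 0)‖ := norm_sub_le _ _
    _ ≤ C * D + C * D := by
        rw [norm_mul, norm_mul]; gcongr
    _ = 2 * C * D := by ring

/-- For smooth functions this is integration by parts and the symmetry of second derivatives.
Lipschitz functions have none, so one derivative is first replaced by a difference quotient in
direction `v`: integrating by parts in direction `u` and translating moves the quotient from `w` to
`f`, and then the step tends to zero. -/
theorem integral_jac_eq_zero {f w : ℝ × ℝ → ℝ} {C D : ℝ≥0} (hf : LipschitzWith C f)
    (hfc : HasCompactSupport f) (hw : LipschitzWith D w) : ∫ p, jac f w p = 0 := by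
  set u : ℝ × ℝ := (1, 0)
  set v : ℝ × ℝ := (0, 1)
  -- The thickening by `‖v‖` makes `K` contain the supports of all translates of `f` by `t • v` with
  -- `t ≤ 1`.
  set K := Metric.cthickening (‖v‖) (tsupport f) with hK
  have Kc : IsCompact K := IsCompact.cthickening hfc
  have hfx : ∀ x ∉ K, f x = 0 := fun x hx => by
    rw [← Function.notMem_support]
    contrapose hx
    exact Metric.self_subset_cthickening _ (subset_tsupport _ hx)
  have hfd : ∀ e, ∀ x ∉ K, lineDeriv ℝ f x e = 0 := fun e x hx => by
    have : f =ᶠ[𝓝 x] fun _ => 0 := by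
      have : x ∉ tsupport f := fun h => hx (Metric.self_subset_cthickening _ h)
      exact notMem_tsupport_iff_eventuallyEq.1 this
    rw [this.lineDeriv_eq]
    simp [lineDeriv]
  have hbd : ∀ (g : ℝ × ℝ → ℝ) (M : ℝ), AEStronglyMeasurable g volume → (∀ x, ‖g x‖ ≤ M) →
      (∀ x ∉ K, g x = 0) → Integrable g := by
    intro g M hg hM h0
    have : g = K.indicator g := by
      ext x; by_cases hx : x ∈ K
      · rw [indicator_of_mem hx]
      · rw [indicator_of_notMem hx, h0 x hx]
    rw [this, integrable_indicator_iff Kc.measurableSet]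
    exact Measure.integrableOn_of_bounded Kc.measure_lt_top.ne hg (ae_of_all _ hM)
  have hmul : ∀ (g h : ℝ × ℝ → ℝ) (M : ℝ), AEStronglyMeasurable g volume →
      AEStronglyMeasurable h volume → (∀ x, ‖g x‖ ≤ M) → (∃ N, ∀ x ∈ K, ‖h x‖ ≤ N) →
      (∀ x ∉ K, g x = 0) → Integrable fun x => h x * g x := by
    rintro g h M hg hh hM ⟨N, hN⟩ h0
    have M0 := (norm_nonneg _).trans (hM 0)
    refine hbd _ (max N 0 * M) (hh.mul hg) (fun x => ?_) fun x hx => by rw [h0 x hx, mul_zero]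
    by_cases hx : x ∈ K
    · rw [norm_mul]
      exact mul_le_mul ((hN x hx).trans (le_max_left _ _)) (hM x) (norm_nonneg _) (le_max_right _ _)
    · rw [h0 x hx, mul_zero, norm_zero]; positivity
  have mf : ∀ e, AEStronglyMeasurable (fun x => lineDeriv ℝ f x e) volume := fun e =>
    aestronglyMeasurable_lineDeriv hf.continuous _
  have mw : ∀ e, AEStronglyMeasurable (fun x => lineDeriv ℝ w x e) volume := fun e =>
    aestronglyMeasurable_lineDeriv hw.continuous _
  have bf : ∀ e x, ‖lineDeriv ℝ f x e‖ ≤ C * ‖e‖ := fun e x => norm_lineDeriv_le_of_lipschitz ℝ hf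
  have bw : ∀ e x, ‖lineDeriv ℝ w x e‖ ≤ D * ‖e‖ := fun e x => norm_lineDeriv_le_of_lipschitz ℝ hw
  have ifu : Integrable (fun x => lineDeriv ℝ f x u) := hbd _ _ (mf u) (bf u) (hfd u)
  have A := hw.integral_inv_smul_sub_mul_tendsto_integral_lineDeriv_mul (μ := volume) ifu v
  -- The derivative of `w` need not be integrable on the plane. Cutting it off to `K` changes
  -- nothing below, because it is multiplied by difference quotients of `f`.
  have ig : Integrable (K.indicator (fun x => lineDeriv ℝ w x u)) :=
    hbd _ (D * ‖u‖) ((mw u).indicator Kc.measurableSet)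
      (fun x => (norm_indicator_le_norm_self _ _).trans (bw u x))
      (fun x hx => indicator_of_notMem hx _)
  have B := hf.integral_inv_smul_sub_mul_tendsto_integral_lineDeriv_mul (μ := volume) ig (-v)
  have key : ∀ᶠ t : ℝ in 𝓝[>] 0, ∫ x, (t⁻¹ • (w (x + t • v) - w x)) * lineDeriv ℝ f x u =
      - ∫ x, (t⁻¹ • (f (x + t • (-v)) - f x)) * K.indicator (fun x => lineDeriv ℝ w x u) x := by
    filter_upwards [Ioc_mem_nhdsGT zero_lt_one] with t ht
    have hwt : LipschitzWith D (fun x => w (x + t • v)) :=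
      LipschitzWith.of_dist_le_mul fun x y => by
        simpa using hw.dist_le_mul (x + t • v) (y + t • v)
    have e1 := hwt.integral_lineDeriv_mul_eq (μ := volume) hf hfc u
    have e2 := hw.integral_lineDeriv_mul_eq (μ := volume) hf hfc u
    have neg : ∀ x, lineDeriv ℝ f x (-u) = - lineDeriv ℝ f x u := fun x => lineDeriv_neg
    have sh : ∀ x, lineDeriv ℝ (fun x => w (x + t • v)) x u = lineDeriv ℝ w (x + t • v) u := by
      intro x; simp only [lineDeriv]; congr 1; ext s; congr 1; abel
    simp only [neg, sh] at e1 e2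
    have e3 : ∫ x, lineDeriv ℝ w (x + t • v) u * f x = ∫ x, lineDeriv ℝ w x u * f (x + t • (-v)) := by
      rw [← integral_add_right_eq_self _ (t • (-v))]; simp
    have fK : ∀ x ∉ K, f (x + t • (-v)) = 0 := by
      intro x hx
      rw [← Function.notMem_support]
      contrapose hx
      apply Metric.mem_cthickening_of_dist_le _ _ (‖v‖) (tsupport f) (subset_tsupport _ hx)
      simp only [dist_eq_norm, sub_add_cancel_left, norm_smul, Real.norm_eq_abs,
        abs_of_nonneg ht.1.le, smul_neg, neg_neg]
      exact mul_le_of_le_one_left (norm_nonneg v) ht.2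
    obtain ⟨M, hM⟩ := hfc.exists_bound_of_continuous hf.continuous
    have i1 : Integrable (fun x => w (x + t • v) * lineDeriv ℝ f x u) :=
      hmul _ _ _ (mf u) hwt.continuous.aestronglyMeasurable (bf u)
        (Kc.exists_bound_of_continuousOn hwt.continuous.continuousOn) (hfd u)
    have i2 : Integrable (fun x => w x * lineDeriv ℝ f x u) :=
      hmul _ _ _ (mf u) hw.continuous.aestronglyMeasurable (bf u)
        (Kc.exists_bound_of_continuousOn hw.continuous.continuousOn) (hfd u)
    have i3 : Integrable (fun x => lineDeriv ℝ w x u * f (x + t • (-v))) :=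
      hmul _ _ M (hf.continuous.comp (continuous_add_const _)).aestronglyMeasurable (mw u)
        (fun x => hM _) ⟨_, fun x _ => bw u x⟩ fK
    have i4 : Integrable (fun x => lineDeriv ℝ w x u * f x) :=
      hmul _ _ M hf.continuous.aestronglyMeasurable (mw u) hM ⟨_, fun x _ => bw u x⟩ hfx
    have l : ∫ x, (t⁻¹ • (w (x + t • v) - w x)) * lineDeriv ℝ f x u =
        t⁻¹ * (∫ x, w (x + t • v) * lineDeriv ℝ f x u) - t⁻¹ * ∫ x, w x * lineDeriv ℝ f x u := by
      rw [← mul_sub, ← integral_sub i1 i2, ← integral_const_mul]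
      congr 1; ext x; simp only [smul_eq_mul]; ring
    have r : ∫ x, (t⁻¹ • (f (x + t • (-v)) - f x)) * K.indicator (fun x => lineDeriv ℝ w x u) x =
        t⁻¹ * (∫ x, lineDeriv ℝ w x u * f (x + t • (-v))) - t⁻¹ * ∫ x, lineDeriv ℝ w x u * f x := by
      rw [← mul_sub, ← integral_sub i3 i4, ← integral_const_mul]
      congr 1; ext x
      by_cases hx : x ∈ K
      · rw [indicator_of_mem hx]; simp only [smul_eq_mul]; ring
      · rw [indicator_of_notMem hx, fK x hx, hfx x hx]; simp
    rw [l, r, ← e3, e1, e2]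
    have c1 : ∫ x, -lineDeriv ℝ f x u * w (x + t • v) = - ∫ x, w (x + t • v) * lineDeriv ℝ f x u := by
      rw [← integral_neg]; congr 1; ext x; ring
    have c2 : ∫ x, -lineDeriv ℝ f x u * w x = - ∫ x, w x * lineDeriv ℝ f x u := by
      rw [← integral_neg]; congr 1; ext x; ring
    rw [c1, c2]; ring
  have lim := tendsto_nhds_unique (A.congr' key) B.neg
  have neg : ∀ x, lineDeriv ℝ f x (-v) = - lineDeriv ℝ f x v := fun x => lineDeriv_neg
  simp only [neg] at lim
  have j1 : ∀ a b, Integrable fun x => lineDeriv ℝ w x a * lineDeriv ℝ f x b := fun a b =>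
    hmul _ _ _ (mf b) (mw a) (bf b) ⟨_, fun x _ => bw a x⟩ (hfd b)
  have e : ∫ x, -lineDeriv ℝ f x v * K.indicator (fun x => lineDeriv ℝ w x u) x =
      - ∫ x, lineDeriv ℝ w x u * lineDeriv ℝ f x v := by
    rw [← integral_neg]; congr 1; ext x
    by_cases hx : x ∈ K
    · rw [indicator_of_mem hx]; ring
    · rw [indicator_of_notMem hx, hfd v x hx]; simp
  rw [e, neg_neg] at lim
  have fin : ∫ p, jac f w p = (∫ x, lineDeriv ℝ w x v * lineDeriv ℝ f x u) -
      ∫ x, lineDeriv ℝ w x u * lineDeriv ℝ f x v := by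
    rw [← integral_sub (j1 v u) (j1 u v)]
    refine integral_congr_ae ?_
    filter_upwards [hf.ae_differentiableAt (μ := volume), hw.ae_differentiableAt (μ := volume)]
      with x h1 h2
    rw [h1.lineDeriv_eq_fderiv, h1.lineDeriv_eq_fderiv, h2.lineDeriv_eq_fderiv,
      h2.lineDeriv_eq_fderiv, jac]
    ring
  rw [fin, lim, sub_self]

/-- A bounded Lipschitz function. -/
def BddLip {α : Type*} [PseudoEMetricSpace α] (f : α → ℝ) : Prop :=
  (∃ C, LipschitzWith C f) ∧ ∃ M, ∀ x, |f x| ≤ M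

theorem BddLip.mul {α : Type*} [PseudoMetricSpace α] {f g : α → ℝ} (hf : BddLip f)
    (hg : BddLip g) : BddLip (fun x => f x * g x) := by
  obtain ⟨⟨C, hC⟩, M, hM⟩ := hf
  obtain ⟨⟨D, hD⟩, N, hN⟩ := hg
  refine ⟨⟨C * N.toNNReal + M.toNNReal * D, LipschitzWith.of_dist_le_mul fun x y => ?_⟩,
    M * N, ?_⟩
  · have h1 := hC.dist_le_mul x y
    have h2 := hD.dist_le_mul x y
    have hM0 : 0 ≤ M := (abs_nonneg _).trans (hM x)
    have hN0 : 0 ≤ N := (abs_nonneg _).trans (hN x)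
    rw [Real.dist_eq] at h1 h2 ⊢
    have : f x * g x - f y * g y = (f x - f y) * g x + f y * (g x - g y) := by ring
    rw [this]
    refine (abs_add_le _ _).trans ?_
    rw [abs_mul, abs_mul]
    push_cast
    rw [Real.coe_toNNReal _ hM0, Real.coe_toNNReal _ hN0]
    have := mul_le_mul h1 (hN x) (abs_nonneg _) (by positivity)
    have := mul_le_mul (hM y) h2 (abs_nonneg _) hM0
    nlinarith
  · intro x
    rw [abs_mul]
    exact mul_le_mul (hM x) (hN x) (abs_nonneg _) ((abs_nonneg _).trans (hM x))

theorem BddLip.comp {α β : Type*} [PseudoEMetricSpace α] [PseudoEMetricSpace β] {f : β → ℝ}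
    (hf : BddLip f) {g : α → β} {D : ℝ≥0} (hg : LipschitzWith D g) : BddLip (fun x => f (g x)) :=
  ⟨⟨_, hf.1.choose_spec.comp hg⟩, hf.2.choose, fun _ => hf.2.choose_spec _⟩

theorem lineDeriv_fst (F : ℝ × ℝ → ℝ) (x y : ℝ) :
    lineDeriv ℝ F (x, y) (1, 0) = deriv (fun s => F (s, y)) x := by
  have := deriv_comp_const_add (fun s => F (s, y)) x 0
  simp only [add_zero] at this
  rw [← this, lineDeriv]; simp

theorem lineDeriv_snd (F : ℝ × ℝ → ℝ) (x y : ℝ) :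
    lineDeriv ℝ F (x, y) (0, 1) = deriv (fun s => F (x, s)) y := by
  have := deriv_comp_const_add (fun s => F (x, s)) y 0
  simp only [add_zero] at this
  rw [← this, lineDeriv]; simp

theorem jac_eq_deriv {F W : ℝ × ℝ → ℝ} {x y : ℝ} (hF : DifferentiableAt ℝ F (x, y))
    (hW : DifferentiableAt ℝ W (x, y)) :
    jac F W (x, y) = deriv (fun s => F (s, y)) x * deriv (fun s => W (x, s)) y -
      deriv (fun s => F (x, s)) y * deriv (fun s => W (s, y)) x := by
  rw [jac, ← hF.lineDeriv_eq_fderiv, ← hF.lineDeriv_eq_fderiv, ← hW.lineDeriv_eq_fderiv,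
    ← hW.lineDeriv_eq_fderiv, lineDeriv_fst, lineDeriv_fst, lineDeriv_snd, lineDeriv_snd]

theorem integrable_jac {f w : ℝ × ℝ → ℝ} {C D : ℝ≥0} (hf : LipschitzWith C f)
    (hfc : HasCompactSupport f) (hw : LipschitzWith D w) : Integrable (jac f w) := by
  have h0 : jac f w = (tsupport f).indicator (jac f w) := by
    ext x
    by_cases hx : x ∈ tsupport f
    · rw [indicator_of_mem hx]
    · rw [indicator_of_notMem hx, jac_congr (notMem_tsupport_iff_eventuallyEq.1 hx)
        (EventuallyEq.refl _ w)]
      simp [jac]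
  rw [h0, integrable_indicator_iff (isClosed_tsupport f).measurableSet]
  exact Measure.integrableOn_of_bounded hfc.isCompact.measure_lt_top.ne
    (measurable_jac f w).aestronglyMeasurable (ae_of_all _ (norm_jac_le hf hw))

/-- The integral of `f dw` along the segment from `p` to `q`. -/
noncomputable def edgeInt {E : Type*} [AddCommGroup E] [Module ℝ E] (f w : E → ℝ) (p q : E) : ℝ :=
  ∫ t in (0 : ℝ)..1, f (p + t • (q - p)) * deriv (fun s : ℝ => w (p + s • (q - p))) t

theorem edgeInt_symm {E : Type*} [AddCommGroup E] [Module ℝ E] (f w : E → ℝ) (p q : E) :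
    edgeInt f w q p = - edgeInt f w p q := by
  have h := intervalIntegral.integral_comp_sub_left
    (fun t => f (p + t • (q - p)) * deriv (fun s : ℝ => w (p + s • (q - p))) t) (1 : ℝ)
    (a := 0) (b := 1)
  simp only [sub_self, sub_zero] at h
  rw [edgeInt, edgeInt, ← h, ← intervalIntegral.integral_neg]
  refine intervalIntegral.integral_congr fun t _ => ?_
  have e : ∀ s : ℝ, q + s • (p - q) = p + (1 - s) • (q - p) := fun s => by module
  simp only [e]
  rw [deriv_comp_const_sub (f := fun s : ℝ => w (p + s • (q - p))) (1 : ℝ) t]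
  ring

theorem ae_line_ne {a b : ℝ} (c : ℝ) (h : a ≠ 0 ∨ b ≠ 0) : ∀ᵐ p : ℝ × ℝ, a * p.1 + b * p.2 ≠ c := by
  by_cases hb : b = 0
  · have ha : a ≠ 0 := h.resolve_right (not_not.2 hb)
    have h : ∀ᵐ x : ℝ, x ≠ c / a := Measure.ae_ne volume _
    filter_upwards [Measure.quasiMeasurePreserving_fst.ae h] with p h1 h2
    apply h1
    rw [hb, zero_mul, add_zero] at h2
    rw [← h2]; field_simp
  · rw [ae_iff]
    have : MeasurableSet {p : ℝ × ℝ | ¬ (a * p.1 + b * p.2 ≠ c)} := by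
      simp only [not_not]
      exact (isClosed_eq (by fun_prop) continuous_const).measurableSet
    rw [Measure.volume_eq_prod, Measure.measure_prod_null this]
    refine ae_of_all _ fun x => ?_
    have : Prod.mk x ⁻¹' {p : ℝ × ℝ | ¬ (a * p.1 + b * p.2 ≠ c)} ⊆ {(c - a * x) / b} := by
      intro y hy
      simp only [not_not, mem_preimage, mem_ofPred_eq] at hy
      simp only [mem_singleton_iff]
      rw [← hy]; field_simp; ring
    exact measure_mono_null this (by simp)

/-- The interior of the reference triangle. -/
def refInterior : Set (ℝ × ℝ) := {p | 0 < p.1 ∧ 0 < p.2 ∧ p.1 + p.2 < 1}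

theorem isOpen_refInterior : IsOpen refInterior :=
  (isOpen_lt continuous_const continuous_fst).inter
    ((isOpen_lt continuous_const continuous_snd).inter
      (isOpen_lt (continuous_fst.add continuous_snd) continuous_const))

theorem isClosed_refTriangle : IsClosed refTriangle :=
  (isClosed_le continuous_const continuous_fst).inter
    ((isClosed_le continuous_const continuous_snd).inter
      (isClosed_le (continuous_fst.add continuous_snd) continuous_const))

theorem refInterior_subset : refInterior ⊆ refTriangle := fun _ hp =>
  ⟨hp.1.le, hp.2.1.le, hp.2.2.le⟩

theorem isCompact_refTriangle : IsCompact refTriangle := by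
  refine (isCompact_Icc (a := ((0 : ℝ), (0 : ℝ))) (b := (1, 1))).of_isClosed_subset
    isClosed_refTriangle fun p hp => ?_
  exact ⟨⟨hp.1, hp.2.1⟩, ⟨by have := hp.2; simp; linarith [this.1, this.2],
    by have := hp.1; simp; linarith [hp.2.2]⟩⟩

theorem convex_refTriangle : Convex ℝ refTriangle := by
  rintro ⟨x, y⟩ ⟨h1, h2, h3⟩ ⟨x', y'⟩ ⟨h1', h2', h3'⟩ a b ha hb hab
  simp only at h1 h2 h3 h1' h2' h3'
  refine ⟨?_, ?_, ?_⟩ <;> simp only [Prod.smul_mk, Prod.mk_add_mk, smul_eq_mul]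
  · positivity
  · positivity
  · nlinarith

theorem refTriangle_ae_eq : refTriangle =ᵐ[volume] refInterior := by
  filter_upwards [ae_line_ne (a := 1) (b := 0) 0 (Or.inl one_ne_zero),
    ae_line_ne (a := 0) (b := 1) 0 (Or.inr one_ne_zero),
    ae_line_ne (a := 1) (b := 1) 1 (Or.inl one_ne_zero)] with p h1 h2 h3
  simp only [one_mul, zero_mul, add_zero, zero_add] at h1 h2 h3
  exact propext ⟨fun hp => ⟨hp.1.lt_of_ne h1.symm, hp.2.1.lt_of_ne h2.symm, hp.2.2.lt_of_ne h3⟩,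
    fun hp => refInterior_subset hp⟩

theorem ae_mem_refInterior : ∀ᵐ p ∂(volume.restrict refTriangle), p ∈ refInterior := by
  filter_upwards [ae_restrict_mem isClosed_refTriangle.measurableSet,
    ae_restrict_of_ae refTriangle_ae_eq] with p h1 h2
  exact h2.mp h1

/-- The circulation of `f dw` around the reference triangle. -/
noncomputable def circulation (f w : ℝ × ℝ → ℝ) : ℝ :=
  edgeInt f w (0, 0) (1, 0) + edgeInt f w (1, 0) (0, 1) + edgeInt f w (0, 1) (0, 0)

/-- If `v * w` vanishes along the segment, then near a parameter with `v ≠ 0` continuity forces `w =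
0`, so its derivative vanishes too; at the other parameters the factor `v` kills the integrand. -/
theorem edgeInt_eq_zero {E : Type*} [AddCommGroup E] [Module ℝ E] {u v w : E → ℝ} {p q : E}
    (h : (∀ x ∈ segment ℝ p q, u x = 0) ∨ ∀ x ∈ segment ℝ p q, v x * w x = 0)
    (hv : ContinuousOn (fun t : ℝ => v (p + t • (q - p))) (Icc 0 1)) :
    edgeInt (fun x => u x * v x) w p q = 0 := by
  have hm : ∀ t ∈ Icc (0 : ℝ) 1, p + t • (q - p) ∈ segment ℝ p q := fun t ht => by
    rw [segment_eq_image']; exact ⟨t, ht, rfl⟩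
  rw [edgeInt, intervalIntegral.integral_of_le zero_le_one, integral_Ioc_eq_integral_Ioo]
  refine setIntegral_eq_zero_of_forall_eq_zero fun t ht => ?_
  rcases h with h | h
  · rw [h _ (hm t (Ioo_subset_Icc_self ht)), zero_mul, zero_mul]
  · by_cases h0 : v (p + t • (q - p)) = 0
    · rw [h0, mul_zero, zero_mul]
    · have hc := hv.continuousAt (Icc_mem_nhds ht.1 ht.2)
      have : (fun s : ℝ => w (p + s • (q - p))) =ᶠ[𝓝 t] fun _ => 0 := by
        filter_upwards [hc.eventually_ne h0, Ioo_mem_nhds ht.1 ht.2] with s hs hs'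
        exact (mul_eq_zero.1 (h _ (hm s (Ioo_subset_Icc_self hs')))).resolve_left hs
      rw [this.deriv_eq, deriv_const, mul_zero]

theorem setIntegral_affine (c u v : ℝ × ℝ) (hD : u.1 * v.2 - u.2 * v.1 ≠ 0) {s : Set (ℝ × ℝ)}
    (hs : MeasurableSet s) (g : ℝ × ℝ → ℝ) :
    ∫ q in (fun p : ℝ × ℝ => c + p.1 • u + p.2 • v) '' s, g q =
      |u.1 * v.2 - u.2 * v.1| * ∫ p in s, g (c + p.1 • u + p.2 • v) := by
  set L : ℝ × ℝ →L[ℝ] ℝ × ℝ := LinearMap.toContinuousLinearMap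
    (Matrix.toLin (Module.Basis.finTwoProd ℝ) (Module.Basis.finTwoProd ℝ)
      !![u.1, v.1; u.2, v.2]) with hL
  have hLa : ∀ p : ℝ × ℝ, L p = p.1 • u + p.2 • v := by
    intro p
    rw [hL, LinearMap.coe_toContinuousLinearMap', Matrix.toLin_finTwoProd_apply]
    ext <;> simp <;> ring
  have hdet : L.det = u.1 * v.2 - u.2 * v.1 := by
    rw [hL, LinearMap.det_toContinuousLinearMap, LinearMap.det_toLin, Matrix.det_fin_two_of]
    ring
  have hd : ∀ p ∈ s, HasFDerivWithinAt (fun p : ℝ × ℝ => c + p.1 • u + p.2 • v) L s p := by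
    intro p _
    have : (fun p : ℝ × ℝ => c + p.1 • u + p.2 • v) = fun p => c + L p := by
      ext1 p; rw [hLa, add_assoc]
    rw [this]
    exact (L.hasFDerivWithinAt).const_add c
  have hinj : InjOn (fun p : ℝ × ℝ => c + p.1 • u + p.2 • v) s := by
    intro p _ q _ h
    simp only [add_assoc, add_right_inj] at h
    have h1 : p.1 * u.1 + p.2 * v.1 = q.1 * u.1 + q.2 * v.1 := by simpa using congrArg Prod.fst h
    have h2 : p.1 * u.2 + p.2 * v.2 = q.1 * u.2 + q.2 * v.2 := by simpa using congrArg Prod.snd h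
    ext
    · apply mul_right_cancel₀ hD; linear_combination v.2 * h1 - v.1 * h2
    · apply mul_right_cancel₀ hD; linear_combination u.1 * h2 - u.2 * h1
  rw [integral_image_eq_integral_abs_det_fderiv_smul volume hs hd hinj, hdet]
  simp only [smul_eq_mul]
  rw [integral_const_mul]

theorem integrableOn_jac {f w : ℝ × ℝ → ℝ} {C D : ℝ≥0} (hf : LipschitzWith C f)
    (hw : LipschitzWith D w) : IntegrableOn (jac f w) refTriangle :=
  Measure.integrableOn_of_bounded isCompact_refTriangle.measure_lt_top.ne
    (measurable_jac f w).aestronglyMeasurable (ae_of_all _ (norm_jac_le hf hw))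

/-- The Lipschitz extension is truncated at a bound of `f` on `s`; boundedness is what makes
products of extensions Lipschitz. -/
theorem exists_bddLip_extend {α : Type*} [PseudoMetricSpace α] {f : α → ℝ} {s : Set α} {C : ℝ≥0}
    (hf : LipschitzOnWith C f s) (hs : IsCompact s) : ∃ g, BddLip g ∧ EqOn f g s := by
  obtain ⟨g, hg, hfg⟩ := hf.extend_real
  obtain ⟨M, hM⟩ := hs.exists_bound_of_continuousOn hf.continuousOn
  refine ⟨fun x => max (-|M|) (min |M| (g x)), ⟨⟨_, (hg.const_min _).const_max _⟩, |M|, ?_⟩, ?_⟩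
  · intro x
    rw [abs_le]
    exact ⟨le_max_left _ _, max_le (by linarith [abs_nonneg M]) (min_le_left _ _)⟩
  · intro x hx
    have h := abs_le.1 ((hM x hx).trans (le_abs_self M))
    rw [hfg hx] at h ⊢
    simp only
    rw [min_eq_right h.2, max_eq_right h.1]

/-- Used on strips outside the triangle, where the extended functions depend on one coordinate up to
a linear cut-off. As `W` has no derivative in the other coordinate, the derivative of `φ` never
enters. -/
theorem jac_eq_of_fst {F W : ℝ × ℝ → ℝ} {φ ψ : ℝ → ℝ} {p : ℝ × ℝ} (a b : ℝ)
    (hF : DifferentiableAt ℝ F p) (hW : DifferentiableAt ℝ W p)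
    (h1 : F =ᶠ[𝓝 p] fun q => φ q.1 * (a + b * q.2)) (h2 : W =ᶠ[𝓝 p] fun q => ψ q.1) :
    jac F W p = -b * (φ p.1 * deriv ψ p.1) := by
  obtain ⟨x, y⟩ := p
  rw [jac_eq_deriv hF hW]
  have cx : Tendsto (fun s : ℝ => (s, y)) (𝓝 x) (𝓝 (x, y)) := (Continuous.prodMk_left y).tendsto x
  have cy : Tendsto (fun s : ℝ => (x, s)) (𝓝 y) (𝓝 (x, y)) := (Continuous.prodMk_right x).tendsto y
  have e1 := (h1.comp_tendsto cy).deriv_eq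
  have e2 := (h2.comp_tendsto cy).deriv_eq
  have e3 := (h2.comp_tendsto cx).deriv_eq
  simp only [Function.comp_def] at e1 e2 e3
  rw [e1, e2, e3]
  simp
  ring

theorem jac_eq_of_snd {F W : ℝ × ℝ → ℝ} {φ ψ : ℝ → ℝ} {p : ℝ × ℝ} (a b : ℝ)
    (hF : DifferentiableAt ℝ F p) (hW : DifferentiableAt ℝ W p)
    (h1 : F =ᶠ[𝓝 p] fun q => φ q.2 * (a + b * q.1)) (h2 : W =ᶠ[𝓝 p] fun q => ψ q.2) :
    jac F W p = b * (φ p.2 * deriv ψ p.2) := by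
  obtain ⟨x, y⟩ := p
  rw [jac_eq_deriv hF hW]
  have cx : Tendsto (fun s : ℝ => (s, y)) (𝓝 x) (𝓝 (x, y)) := (Continuous.prodMk_left y).tendsto x
  have cy : Tendsto (fun s : ℝ => (x, s)) (𝓝 y) (𝓝 (x, y)) := (Continuous.prodMk_right x).tendsto y
  have e1 := (h1.comp_tendsto cx).deriv_eq
  have e2 := (h2.comp_tendsto cx).deriv_eq
  have e3 := (h2.comp_tendsto cy).deriv_eq
  simp only [Function.comp_def] at e1 e2 e3
  rw [e1, e2, e3]
  simp
  ring

/-- A Lipschitz retraction of the plane onto the reference triangle. -/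
noncomputable def retract (p : ℝ × ℝ) : ℝ × ℝ :=
  (max 0 (min p.1 1), max 0 (min p.2 (1 - max 0 (min p.1 1))))

theorem lipschitz_retract : ∃ K, LipschitzWith K retract :=
  have h1 := ((LipschitzWith.prod_fst (α := ℝ) (β := ℝ)).min_const 1).const_max 0
  ⟨_, h1.prodMk ((LipschitzWith.prod_snd.min ((LipschitzWith.const 1).sub h1)).const_max 0)⟩

theorem retract_mem (p : ℝ × ℝ) : retract p ∈ refTriangle := by
  simp only [refTriangle, retract, mem_ofPred_eq]
  grind

/-- The Lipschitz cut-off function that is `1` on `[0, 1]` and `0` outside `[-1, 2]`. -/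
noncomputable def trap (s : ℝ) : ℝ := max 0 (min 1 (min (1 + s) (2 - s)))

theorem bddLip_trap : BddLip trap := by
  refine ⟨⟨_, (((((LipschitzWith.const 1).add LipschitzWith.id).min
    ((LipschitzWith.const 2).sub LipschitzWith.id)).const_min 1).const_max 0)⟩, 1, fun x => ?_⟩
  rw [abs_of_nonneg (le_max_left _ _)]
  exact max_le zero_le_one (min_le_left _ _)

theorem bddLip_comp_retract {f : ℝ × ℝ → ℝ} {C : ℝ≥0} (hf : LipschitzOnWith C f refTriangle) :
    BddLip fun p => f (retract p) := by
  obtain ⟨K, hK⟩ := lipschitz_retract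
  obtain ⟨M, hM⟩ := isCompact_refTriangle.exists_bound_of_continuousOn hf.continuousOn
  exact ⟨⟨_, lipschitzOnWith_univ.1 (hf.comp (lipschitzOnWith_univ.2 hK) fun p _ => retract_mem p)⟩,
    M, fun p => hM _ (retract_mem p)⟩

/-- Away from the triangle and three unit squares next to it, almost every point falls under one of
three cases: the retraction is locally constant, the cut-off vanishes, or, between the hypotenuse
and the corner `(1, 1)`, both functions depend on the first coordinate only. -/
theorem ae_jac_retract_eq_zero {f w : ℝ × ℝ → ℝ} {C D : ℝ≥0}
    (hF : LipschitzWith C fun p => f (retract p) * (trap p.1 * trap p.2))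
    (hW : LipschitzWith D fun p => w (retract p)) : ∀ᵐ p : ℝ × ℝ,
      p ∉ ((refInterior ∪ Ioo 0 1 ×ˢ Ioo (-1) 0) ∪ Ioo 0 1 ×ˢ Ioo 1 2) ∪ Ioo (-1) 0 ×ˢ Ioo 0 1 →
      jac (fun p => f (retract p) * (trap p.1 * trap p.2)) (fun p => w (retract p)) p = 0 := by
  set F : ℝ × ℝ → ℝ := fun p => f (retract p) * (trap p.1 * trap p.2)
  set W : ℝ × ℝ → ℝ := fun p => w (retract p)
  have hn : ∀ {s : Set (ℝ × ℝ)} {p}, IsOpen s → p ∈ s → ∀ᶠ q in 𝓝 p, q ∈ s :=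
    fun hs hp => hs.mem_nhds hp
  have l1 := fun c => ae_line_ne (a := 1) (b := 0) c (Or.inl one_ne_zero)
  have l2 := fun c => ae_line_ne (a := 0) (b := 1) c (Or.inr one_ne_zero)
  filter_upwards [hF.ae_differentiableAt, hW.ae_differentiableAt, l1 0, l1 1, l1 (-1), l2 0, l2 1, l2 (-1), l2 2,
    ae_line_ne (a := 1) (b := 1) 1 (Or.inl one_ne_zero)] with p h1 h2 a1 a2 a3 b1 b2 b3 b4 c hp
  simp only [one_mul, zero_mul, add_zero, zero_add, mem_union, mem_prod, mem_Ioo, refInterior,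
    mem_ofPred_eq, not_or] at a1 a2 a3 b1 b2 b3 b4 c hp
  have o1 : ∀ c : ℝ, IsOpen {q : ℝ × ℝ | q.1 < c} := fun c => isOpen_lt continuous_fst continuous_const
  have o2 : ∀ c : ℝ, IsOpen {q : ℝ × ℝ | c < q.1} := fun c => isOpen_lt continuous_const continuous_fst
  have o3 : ∀ c : ℝ, IsOpen {q : ℝ × ℝ | q.2 < c} := fun c => isOpen_lt continuous_snd continuous_const
  have o4 : ∀ c : ℝ, IsOpen {q : ℝ × ℝ | c < q.2} := fun c => isOpen_lt continuous_const continuous_snd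
  have const : ∀ c, (∀ᶠ q in 𝓝 p, retract q = c) → jac F W p = 0 := fun c h => by
    rw [jac_congr (EventuallyEq.refl _ F) (h.mono fun q hq => show W q = w c by rw [← hq])]
    simp [jac]
  have null : (∀ᶠ q in 𝓝 p, trap q.1 * trap q.2 = 0) → jac F W p = 0 := fun h => by
    rw [jac_congr (h.mono fun q hq => show F q = 0 by simp only [F, hq, mul_zero])
      (EventuallyEq.refl _ W)]
    simp [jac]
  rcases lt_or_gt_of_ne a2 with x1 | x1
  swap
  · refine const (1, 0) ?_
    filter_upwards [hn (o2 1) x1] with q (hq : 1 < q.1)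
    clear * - hq; ext <;> simp only [retract] <;> grind
  rcases lt_or_gt_of_ne b1 with y0 | y0
  · rcases lt_or_gt_of_ne a1 with x0 | x0
    · refine const (0, 0) ?_
      filter_upwards [hn (o1 0) x0, hn (o3 0) y0] with q (hq : q.1 < 0) (hq' : q.2 < 0)
      clear * - hq hq'; ext <;> simp only [retract] <;> grind
    · refine null ?_
      filter_upwards [hn (o3 (-1)) (show p.2 < -1 by grind)] with q (hq : q.2 < -1)
      clear * - hq; simp only [trap]; grind
  rcases lt_or_gt_of_ne a1 with x0 | x0
  · rcases lt_or_gt_of_ne b2 with y1 | y1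
    · refine null ?_
      filter_upwards [hn (o1 (-1)) (show p.1 < -1 by grind)] with q (hq : q.1 < -1)
      clear * - hq; simp only [trap]; grind
    · refine const (0, 1) ?_
      filter_upwards [hn (o1 0) x0, hn (o4 1) y1] with q (hq : q.1 < 0) (hq' : 1 < q.2)
      clear * - hq hq'; ext <;> simp only [retract] <;> grind
  rcases lt_or_gt_of_ne b2 with y1 | y1
  · have hc : 1 < p.1 + p.2 := by grind
    rw [jac_eq_of_fst (φ := fun x => f (x, 1 - x)) (ψ := fun x => w (x, 1 - x)) 1 0 h1 h2]
    · ring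
    all_goals
      filter_upwards [hn (isOpen_Ioo.prod isOpen_Ioo) ⟨⟨x0, x1⟩, y0, y1⟩,
        hn (isOpen_lt continuous_const (continuous_fst.add continuous_snd)) hc] with q hq hq'
      obtain ⟨⟨e1, e2⟩, e3, e4⟩ := hq
      have hq' : 1 < q.1 + q.2 := hq'
      have : retract q = (q.1, 1 - q.1) := by
          clear * - hq' e1 e2 e3 e4; ext <;> simp only [retract] <;> grind
      simp only [F, W, this]
    have t1 : trap q.1 = 1 := by clear * - hq' e1 e2 e3 e4; simp only [trap]; grind
    have t2 : trap q.2 = 1 := by clear * - hq' e1 e2 e3 e4; simp only [trap]; grind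
    rw [t1, t2, zero_mul, add_zero, one_mul]
  · refine null ?_
    filter_upwards [hn (o4 2) (show 2 < p.2 by grind)] with q (hq : 2 < q.2)
    clear * - hq; simp only [trap]; grind

/-- Stokes' theorem for Lipschitz functions on the reference triangle. -/
theorem integral_jac_refTriangle {f w : ℝ × ℝ → ℝ} {C D : ℝ≥0}
    (hf : LipschitzOnWith C f refTriangle) (hw : LipschitzOnWith D w refTriangle) :
    ∫ p in refTriangle, jac f w p = circulation f w := by
  -- The extended and cut-off pair has total integral zero over the plane. Across each of the three
  -- squares the cut-off is linear with slope of modulus one and the square has width one, so its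
  -- contribution is exactly an integral along one side of the triangle.
  set W : ℝ × ℝ → ℝ := fun p => w (retract p) with hWd
  set F : ℝ × ℝ → ℝ := fun p => f (retract p) * (trap p.1 * trap p.2) with hFd
  obtain ⟨⟨D', hW⟩, -⟩ : BddLip W := bddLip_comp_retract hw
  obtain ⟨⟨C', hF⟩, -⟩ : BddLip F := (bddLip_comp_retract hf).mul
    ((bddLip_trap.comp LipschitzWith.prod_fst).mul (bddLip_trap.comp LipschitzWith.prod_snd))
  have hFc : HasCompactSupport F := by
    refine HasCompactSupport.of_support_subset_isCompact
      (isCompact_Icc (a := ((-1 : ℝ), (-1 : ℝ))) (b := (2, 2))) fun p hp => ?_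
    simp only [hFd, Function.mem_support, ne_eq, mul_eq_zero, not_or, trap] at hp
    exact ⟨⟨by grind, by grind⟩, ⟨by grind, by grind⟩⟩
  have dF := hF.ae_differentiableAt (μ := volume)
  have dW := hW.ae_differentiableAt (μ := volume)
  have hn : ∀ {s : Set (ℝ × ℝ)} {p}, IsOpen s → p ∈ s → ∀ᶠ q in 𝓝 p, q ∈ s :=
    fun hs hp => hs.mem_nhds hp
  set J : Set ℝ := Ioo 0 1
  have mJ : ∀ a b : ℝ, MeasurableSet (Ioo a b) := fun a b => measurableSet_Ioo
  have oJ : ∀ a b c d : ℝ, IsOpen (Ioo a b ×ˢ Ioo c d) := fun a b c d => isOpen_Ioo.prod isOpen_Ioo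
  have one : ∀ g : ℝ → ℝ, ∫ x in J, g x = ∫ x in (0 : ℝ)..1, g x := fun g => by
    rw [intervalIntegral.integral_of_le zero_le_one, integral_Ioc_eq_integral_Ioo]
  have mul : ∀ (g h : ℝ → ℝ) (s t : Set ℝ), ∫ p in s ×ˢ t, g p.1 * h p.2 =
      (∫ x in s, g x) * ∫ y in t, h y := fun g h s t => setIntegral_prod_mul g h s t
  have iT : ∫ p in refInterior, jac F W p = ∫ p in refTriangle, jac f w p := by
    rw [setIntegral_congr_set refTriangle_ae_eq]
    refine setIntegral_congr_fun isOpen_refInterior.measurableSet fun p hp => jac_congr ?_ ?_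
    all_goals
      filter_upwards [hn isOpen_refInterior hp] with q hq
      obtain ⟨h1, h2, h3⟩ := hq
      have : retract q = q := by ext <;> simp only [retract] <;> grind
      simp only [hFd, hWd, this]
    have t1 : trap q.1 = 1 := by simp only [trap]; grind
    have t2 : trap q.2 = 1 := by simp only [trap]; grind
    rw [t1, t2, mul_one, mul_one]
  have iC : ∫ p in J ×ˢ Ioo (-1 : ℝ) 0, jac F W p =
      -∫ x in (0 : ℝ)..1, f (x, 0) * deriv (fun s => w (s, 0)) x := by
    have := mul (fun x => f (x, 0) * deriv (fun s => w (s, 0)) x) (fun _ => -1) J (Ioo (-1 : ℝ) 0)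
    rw [one] at this
    refine Eq.trans (setIntegral_congr_ae ((mJ _ _).prod (mJ _ _)) ?_) (this.trans (by simp))
    filter_upwards [dF, dW] with p h1 h2 hp
    rw [jac_eq_of_fst (φ := fun x => f (x, 0)) (ψ := fun x => w (x, 0)) 1 1 h1 h2]
    · ring
    all_goals
      filter_upwards [hn (oJ _ _ _ _) hp] with q hq
      obtain ⟨⟨a1, a2⟩, a3, a4⟩ := hq
      have : retract q = (q.1, 0) := by ext <;> simp only [retract] <;> grind
      simp only [hFd, hWd, this]
    have t1 : trap q.1 = 1 := by simp only [trap]; grind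
    have t2 : trap q.2 = 1 + q.2 := by simp only [trap]; grind
    rw [t1, t2, one_mul, one_mul]
  -- The retraction maps this square vertically onto the hypotenuse, which is thus parametrized by
  -- its first coordinate.
  have iB : ∫ p in J ×ˢ Ioo (1 : ℝ) 2, jac F W p =
      ∫ x in (0 : ℝ)..1, f (x, 1 - x) * deriv (fun s => w (s, 1 - s)) x := by
    have := mul (fun x => f (x, 1 - x) * deriv (fun s => w (s, 1 - s)) x) (fun _ => 1) J (Ioo (1 : ℝ) 2)
    rw [one] at this
    refine Eq.trans (setIntegral_congr_ae ((mJ _ _).prod (mJ _ _)) ?_) (this.trans (by norm_num))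
    filter_upwards [dF, dW] with p h1 h2 hp
    rw [jac_eq_of_fst (φ := fun x => f (x, 1 - x)) (ψ := fun x => w (x, 1 - x)) 2 (-1) h1 h2]
    · ring
    all_goals
      filter_upwards [hn (oJ _ _ _ _) hp] with q hq
      obtain ⟨⟨a1, a2⟩, a3, a4⟩ := hq
      have : retract q = (q.1, 1 - q.1) := by ext <;> simp only [retract] <;> grind
      simp only [hFd, hWd, this]
    have t1 : trap q.1 = 1 := by simp only [trap]; grind
    have t2 : trap q.2 = 2 + -1 * q.2 := by simp only [trap]; grind
    rw [t1, t2, one_mul]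
  have iD : ∫ p in Ioo (-1 : ℝ) 0 ×ˢ J, jac F W p =
      ∫ y in (0 : ℝ)..1, f (0, y) * deriv (fun s => w (0, s)) y := by
    have := mul (fun _ => 1) (fun y => f (0, y) * deriv (fun s => w (0, s)) y) (Ioo (-1 : ℝ) 0) J
    rw [one] at this
    refine Eq.trans (setIntegral_congr_ae ((mJ _ _).prod (mJ _ _)) ?_) (this.trans (by simp))
    filter_upwards [dF, dW] with p h1 h2 hp
    rw [jac_eq_of_snd (φ := fun y => f (0, y)) (ψ := fun y => w (0, y)) 1 1 h1 h2]
    all_goals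
      filter_upwards [hn (oJ _ _ _ _) hp] with q hq
      obtain ⟨⟨a1, a2⟩, a3, a4⟩ := hq
      have : retract q = (0, q.2) := by ext <;> simp only [retract] <;> grind
      simp only [hFd, hWd, this]
    have t1 : trap q.2 = 1 := by simp only [trap]; grind
    have t2 : trap q.1 = 1 + q.1 := by simp only [trap]; grind
    rw [t1, t2, one_mul, mul_one]
  have tot := setIntegral_univ.trans (integral_jac_eq_zero hF hFc hW)
  rw [setIntegral_eq_of_subset_of_ae_sdiff_eq_zero MeasurableSet.univ.nullMeasurableSet
    (subset_univ _) ((ae_jac_retract_eq_zero hF hW).mono fun p hp h => hp h.2)] at tot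
  have hi := integrable_jac hF hFc hW
  have m1 : ∀ a b c d : ℝ, MeasurableSet (Ioo a b ×ˢ Ioo c d) := fun a b c d => (oJ _ _ _ _).measurableSet
  rw [setIntegral_union ?_ (m1 _ _ _ _) hi.integrableOn hi.integrableOn,
    setIntegral_union ?_ (m1 _ _ _ _) hi.integrableOn hi.integrableOn,
    setIntegral_union ?_ (m1 _ _ _ _) hi.integrableOn hi.integrableOn, iT, iC, iB, iD] at tot
  · rw [circulation, edgeInt_symm f w (0, 1) (1, 0), edgeInt_symm f w (0, 0) (0, 1)]
    simp only [sub_eq_add_neg] at tot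
    simp [edgeInt]
    linarith
  all_goals
    rw [Set.disjoint_left]
    rintro ⟨x, y⟩ h1 h2
    simp only [mem_union, mem_prod, mem_Ioo, refInterior, mem_ofPred_eq] at h1 h2
    grind

end LipschitzStokes

/-! ### Pasting Lipschitz functions along closed pieces -/

section Pasting

open Set

/-- A mean value inequality with right-hand slopes. Among finitely many pieces one has points
arbitrarily close to the right of `s`; being closed, it contains `s` as well, and the slopes along
it are at most `K`. The pieces need not be ordered along the interval. -/
theorem abs_sub_le_of_cover {ι : Type*} (F : Finset ι) (D : ι → Set ℝ) {g : ℝ → ℝ} {K : ℝ}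
    (hD : ∀ i ∈ F, IsClosed (D i)) (hcov : ∀ t ∈ Icc (0 : ℝ) 1, ∃ i ∈ F, t ∈ D i)
    (hg : ∀ i ∈ F, ∀ s ∈ D i ∩ Icc 0 1, ∀ t ∈ D i ∩ Icc 0 1, |g s - g t| ≤ K * |s - t|) :
    g 1 - g 0 ≤ K := by
  have hcont : ContinuousOn g (Icc 0 1) := by
    have h1 : ∀ i : F, ContinuousOn g (D i ∩ Icc 0 1) := fun i => by
      have : LipschitzOnWith K.toNNReal g (D i ∩ Icc 0 1) :=
        LipschitzOnWith.of_dist_le_mul fun s hs t ht => by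
          rw [Real.dist_eq, Real.dist_eq]
          refine (hg i i.2 s hs t ht).trans ?_
          gcongr
          exact Real.le_coe_toNNReal K
      exact this.continuousOn
    have h2 := LocallyFinite.continuousOn_iUnion
      (locallyFinite_of_finite (fun i : F => D i ∩ Icc (0 : ℝ) 1))
      (fun i => (hD i i.2).inter isClosed_Icc) h1
    refine h2.mono fun t ht => ?_
    obtain ⟨i, hi, hti⟩ := hcov t ht
    exact mem_iUnion.2 ⟨⟨i, hi⟩, hti, ht⟩
  have key : ∀ ε > 0, g 1 - g 0 ≤ K + ε := by
    -- The comparison theorem asks for a strict inequality between the slope bound and the slope of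
    -- the comparison line, hence the slack `ε`.
    intro ε hε
    have := image_le_of_liminf_slope_right_lt_deriv_boundary (f := g) (f' := fun _ => K) hcont
      (B := fun x => g 0 + (K + ε) * x) (B' := fun _ => K + ε) (by
        intro s hs r hr
        obtain ⟨i, hi, hfr⟩ : ∃ i ∈ F, ∃ᶠ z in 𝓝[>] s, z ∈ D i := by
          by_contra hcon
          push Not at hcon
          have h1 : ∀ᶠ z in 𝓝[>] s, ∀ i ∈ F, z ∉ D i :=
            (Filter.eventually_all_finset F).2 fun i hi => by simpa using hcon i hi
          have h2 : ∀ᶠ z in 𝓝[>] s, z ∈ Ioo s 1 := Ioo_mem_nhdsGT hs.2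
          obtain ⟨z, hz1, hz2⟩ := (h1.and h2).exists
          obtain ⟨i, hi, hz⟩ := hcov z ⟨hs.1.trans hz2.1.le, hz2.2.le⟩
          exact hz1 i hi hz
        have hsi : s ∈ D i := by
          have : s ∈ closure (D i) := mem_closure_iff_frequently.2 (hfr.filter_mono nhdsWithin_le_nhds)
          rwa [(hD i hi).closure_eq] at this
        have h2 : ∀ᶠ z in 𝓝[>] s, z ∈ Ioo s 1 := Ioo_mem_nhdsGT hs.2
        refine (hfr.and_eventually h2).mono fun z hz => ?_
        have hb := hg i hi z ⟨hz.1, hs.1.trans hz.2.1.le, hz.2.2.le⟩ s ⟨hsi, hs.1, hs.2.le⟩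
        have hpos : 0 < z - s := sub_pos.2 hz.2.1
        rw [abs_of_pos hpos] at hb
        rw [slope_def_field, div_lt_iff₀ hpos]
        exact ((le_abs_self _).trans hb).trans_lt (mul_lt_mul_of_pos_right hr hpos))
      (by simp) (fun x => by
        have := ((hasDerivAt_id x).const_mul (K + ε)).const_add (g 0)
        simpa using this)
      (fun x _ _ => by linarith) (right_mem_Icc.2 zero_le_one)
    simp only [mul_one] at this
    linarith
  exact le_of_forall_pos_le_add key

/-- A function that is Lipschitz on finitely many closed pieces is Lipschitz on a convex set
covered by them. -/
theorem lipschitzOnWith_of_cover {E ι : Type*} [NormedAddCommGroup E] [NormedSpace ℝ E]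
    {T : Set E} (hT : Convex ℝ T) (F : Finset ι) (D : ι → Set E) {f : E → ℝ} {K : ℝ≥0}
    (hD : ∀ i ∈ F, IsClosed (D i)) (hcov : ∀ x ∈ T, ∃ i ∈ F, x ∈ D i)
    (hf : ∀ i ∈ F, LipschitzOnWith K f (D i ∩ T)) : LipschitzOnWith K f T := by
  have key : ∀ x ∈ T, ∀ y ∈ T, f y - f x ≤ K * dist x y := by
    intro x hx y hy
    have hm : ∀ t ∈ Icc (0 : ℝ) 1, x + t • (y - x) ∈ T := fun t ht =>
      hT.add_smul_sub_mem hx hy ht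
    have hc : Continuous fun t : ℝ => x + t • (y - x) := by fun_prop
    have := abs_sub_le_of_cover F (fun i => (fun t : ℝ => x + t • (y - x)) ⁻¹' D i)
      (g := fun t => f (x + t • (y - x))) (K := K * dist x y)
      (fun i hi => (hD i hi).preimage hc) (fun t ht => hcov _ (hm t ht))
      (fun i hi s hs t ht => by
        have h := (hf i hi).dist_le_mul _ ⟨hs.1, hm s hs.2⟩ _ ⟨ht.1, hm t ht.2⟩
        rw [Real.dist_eq, dist_add_left, dist_eq_norm, ← sub_smul, norm_smul, ← dist_eq_norm y x,
          dist_comm y x, Real.norm_eq_abs] at h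
        linarith)
    simpa using this
  refine LipschitzOnWith.of_dist_le_mul fun x hx y hy => ?_
  rw [Real.dist_eq, abs_le]
  have h1 := key x hx y hy
  have h2 := key y hy x hx
  rw [dist_comm] at h2
  constructor <;> linarith

end Pasting

/-! ### Barycentric coordinates and hat functions of triangulated surfaces -/

section Barycentric

open Set

theorem baryCoord_add (s : Finset E3) (a x v : E3) :
    baryCoord s a (x + v) = baryCoord s a x + baryDiff s a v := by
  rw [baryCoord, baryCoord, show x + v - a = (x - a) + v by abel, map_add, add_assoc]

theorem baryCoord_sub (s : Finset E3) (a x y : E3) :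
    baryCoord s a x - baryCoord s a y = baryDiff s a (x - y) := by
  have := baryCoord_add s a y (x - y)
  rw [add_sub_cancel] at this
  rw [this]; ring

theorem baryCoord_sum_smul (s : Finset E3) (a : E3) {ι : Type*} (t : Finset ι) (w : ι → ℝ)
    (z : ι → E3) (hw : ∑ i ∈ t, w i = 1) :
    baryCoord s a (∑ i ∈ t, w i • z i) = ∑ i ∈ t, w i * baryCoord s a (z i) := by
  have : ∑ i ∈ t, w i • z i - a = ∑ i ∈ t, w i • (z i - a) := by
    simp only [smul_sub, Finset.sum_sub_distrib, ← Finset.sum_smul, hw, one_smul]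
  rw [baryCoord, this, map_sum]
  simp only [baryCoord, map_smul, smul_eq_mul, mul_add, mul_one, Finset.sum_add_distrib, hw]

theorem continuous_baryCoord (s : Finset E3) (a : E3) : Continuous (baryCoord s a) := by
  unfold baryCoord; fun_prop

variable {s t : Finset E3} {x : E3}

theorem baryCoord_combo (hs : AffineIndependent ℝ ((↑) : s → E3)) {w : E3 → ℝ}
    (hw : ∑ b ∈ s, w b = 1) {a : E3} (ha : a ∈ s) :
    baryCoord s a (∑ b ∈ s, w b • b) = w a := by
  rw [baryCoord_sum_smul _ _ _ _ _ hw, Finset.sum_eq_single a]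
  · rw [baryCoord_self, mul_one]
  · intro b hb hba
    rw [baryCoord_of_ne hs ha hb hba, mul_zero]
  · exact fun h => absurd ha h

theorem baryCoord_nonneg (hs : AffineIndependent ℝ ((↑) : s → E3))
    (hx : x ∈ convexHull ℝ (s : Set E3)) {a : E3} (ha : a ∈ s) : 0 ≤ baryCoord s a x := by
  obtain ⟨w, hw0, hw1, rfl⟩ := Finset.mem_convexHull'.1 hx
  rw [baryCoord_combo hs hw1 ha]; exact hw0 a ha

theorem sum_baryCoord (hs : AffineIndependent ℝ ((↑) : s → E3))
    (hx : x ∈ convexHull ℝ (s : Set E3)) : ∑ a ∈ s, baryCoord s a x = 1 := by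
  obtain ⟨w, hw0, hw1, rfl⟩ := Finset.mem_convexHull'.1 hx
  rw [← hw1]
  exact Finset.sum_congr rfl fun a ha => by rw [baryCoord_combo hs hw1 ha]

theorem sum_baryCoord_smul (hs : AffineIndependent ℝ ((↑) : s → E3))
    (hx : x ∈ convexHull ℝ (s : Set E3)) : ∑ a ∈ s, baryCoord s a x • a = x := by
  obtain ⟨w, hw0, hw1, rfl⟩ := Finset.mem_convexHull'.1 hx
  exact Finset.sum_congr rfl fun a ha => by rw [baryCoord_combo hs hw1 ha]

theorem baryCoord_of_mem_convexHull_subset (hs : AffineIndependent ℝ ((↑) : s → E3))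
    (ht : AffineIndependent ℝ ((↑) : t → E3)) (hts : t ⊆ s) (hx : x ∈ convexHull ℝ (t : Set E3))
    {a : E3} (ha : a ∈ s) : baryCoord s a x = if a ∈ t then baryCoord t a x else 0 := by
  obtain ⟨w, hw0, hw1, rfl⟩ := Finset.mem_convexHull'.1 hx
  rw [baryCoord_sum_smul _ _ _ _ _ hw1]
  split_ifs with hat
  · rw [Finset.sum_eq_single a, baryCoord_self, mul_one, baryCoord_combo ht hw1 hat]
    · intro b hb hba
      rw [baryCoord_of_ne hs ha (hts hb) hba, mul_zero]
    · exact fun h => absurd hat h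
  · refine Finset.sum_eq_zero fun b hb => ?_
    rw [baryCoord_of_ne hs ha (hts hb) (fun h => hat (h ▸ hb)), mul_zero]

theorem mem_convexHull_of_baryCoord (hs : AffineIndependent ℝ ((↑) : s → E3)) (hts : t ⊆ s)
    (hx : x ∈ convexHull ℝ (s : Set E3)) (h0 : ∀ a ∈ s, a ∉ t → baryCoord s a x = 0) :
    x ∈ convexHull ℝ (t : Set E3) := by
  have hsum : ∀ {M : Type} [AddCommMonoid M] (f : E3 → M), (∀ a ∈ s, a ∉ t → f a = 0) →
      ∑ a ∈ t, f a = ∑ a ∈ s, f a := fun f hf => Finset.sum_subset hts hf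
  refine Finset.mem_convexHull'.2 ⟨fun a => baryCoord s a x,
    fun a ha => baryCoord_nonneg hs hx (hts ha), ?_, ?_⟩
  · rw [hsum _ h0, sum_baryCoord hs hx]
  · rw [hsum (fun a => baryCoord s a x • a) (fun a ha hat => by
      simp only [h0 a ha hat, zero_smul]), sum_baryCoord_smul hs hx]

theorem affineIndependent_subset (hs : AffineIndependent ℝ ((↑) : s → E3)) (hts : t ⊆ s) :
    AffineIndependent ℝ ((↑) : t → E3) :=
  hs.mono (s := (t : Set E3)) (t := (s : Set E3)) hts

/-- A finite set of triangles in three-space that intersect along common faces and cover `S`. -/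
structure IsTriangulation (F : Finset (Finset E3)) (S : Set E3) : Prop where
  card_eq : ∀ s ∈ F, s.card = 3
  indep : ∀ s ∈ F, AffineIndependent ℝ ((↑) : s → E3)
  inter : ∀ s ∈ F, ∀ t ∈ F, convexHull ℝ (s : Set E3) ∩ convexHull ℝ (t : Set E3) ⊆
    convexHull ℝ ((s ∩ t : Finset E3) : Set E3)
  subset : ∀ s ∈ F, convexHull ℝ (s : Set E3) ⊆ S
  cover : ∀ x ∈ S, ∃ s ∈ F, x ∈ convexHull ℝ (s : Set E3)

/-- The piecewise linear function on a triangulated surface that is `1` at the node `a` and `0` at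
all other nodes. -/
noncomputable def hat (F : Finset (Finset E3)) (a x : E3) : ℝ :=
  if h : ∃ T ∈ F, x ∈ convexHull ℝ (T : Set E3) then
    (if a ∈ h.choose then baryCoord h.choose a x else 0) else 0

variable {F : Finset (Finset E3)} {S : Set E3}

/-- The triangle chosen in `hat` does not matter: a point of two triangles lies in the hull of their
common nodes, where the coordinates of either triangle reduce to those of the common face. -/
theorem IsTriangulation.hat_eq (hF : IsTriangulation F S) (hs : s ∈ F)
    (hx : x ∈ convexHull ℝ (s : Set E3)) (a : E3) :
    hat F a x = if a ∈ s then baryCoord s a x else 0 := by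
  have h : ∃ T ∈ F, x ∈ convexHull ℝ (T : Set E3) := ⟨s, hs, hx⟩
  rw [hat, dif_pos h]
  obtain ⟨hT, hxT⟩ := h.choose_spec
  set T := h.choose
  have hi := hF.inter s hs T hT ⟨hx, hxT⟩
  have iT := hF.indep T hT
  have is := hF.indep s hs
  have iI := affineIndependent_subset is (t := s ∩ T) Finset.inter_subset_left
  by_cases h1 : a ∈ T
  · rw [if_pos h1, baryCoord_of_mem_convexHull_subset iT iI Finset.inter_subset_right hi h1]
    by_cases h2 : a ∈ s
    · rw [if_pos h2, baryCoord_of_mem_convexHull_subset is iI Finset.inter_subset_left hi h2]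
    · rw [if_neg h2, if_neg (fun h => h2 (Finset.mem_inter.1 h).1)]
  · rw [if_neg h1]
    by_cases h2 : a ∈ s
    · rw [if_pos h2, baryCoord_of_mem_convexHull_subset is iI Finset.inter_subset_left hi h2,
        if_neg (fun h => h1 (Finset.mem_inter.1 h).2)]
    · rw [if_neg h2]

/-- On the common face the coordinates of the remaining nodes of `s` vanish, whereas all of them are
positive in the relative interior. -/
theorem IsTriangulation.eq_of_mem_openTriangle (hF : IsTriangulation F S) (hs : s ∈ F) (ht : t ∈ F)
    (hx : x ∈ openTriangle s) (hx' : x ∈ convexHull ℝ (t : Set E3)) : s = t := by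
  have hi := hF.inter s hs t ht ⟨hx.1, hx'⟩
  have iI := affineIndependent_subset (hF.indep s hs) (t := s ∩ t) Finset.inter_subset_left
  have hst : s ⊆ t := by
    intro a ha
    have := baryCoord_of_mem_convexHull_subset (hF.indep s hs) iI Finset.inter_subset_left hi ha
    have hp := hx.2 a ha
    rw [this] at hp
    by_contra hat
    rw [if_neg (fun h => hat (Finset.mem_inter.1 h).2)] at hp
    exact lt_irrefl _ hp
  exact Finset.eq_of_subset_of_card_le hst (by rw [hF.card_eq s hs, hF.card_eq t ht])

end Barycentric

/-! ### Affine parametrization; almost every point is interior to a piece -/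

section Param

open Set

/-- The affine parametrization of the triangle with corners `v` by the reference triangle. -/
noncomputable def param (v : Fin 3 → E3) (p : ℝ × ℝ) : E3 :=
  v 0 + p.1 • (v 1 - v 0) + p.2 • (v 2 - v 0)

theorem param_eq (v : Fin 3 → E3) (p : ℝ × ℝ) :
    param v p = (1 - p.1 - p.2) • v 0 + p.1 • v 1 + p.2 • v 2 := by
  rw [param]; module

theorem continuous_param (v : Fin 3 → E3) : Continuous (param v) := by
  unfold param; fun_prop

theorem param_mem {v : Fin 3 → E3} {p : ℝ × ℝ} (hp : p ∈ refTriangle) :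
    param v p ∈ convexHull ℝ (Finset.univ.image v : Set E3) := by
  have hm : ∀ i, v i ∈ convexHull ℝ (Finset.univ.image v : Set E3) := fun i =>
    subset_convexHull ℝ _ (by simp)
  have hc := convex_convexHull ℝ (Finset.univ.image v : Set E3)
  have h := hc.sum_mem (t := Finset.univ) (w := ![1 - p.1 - p.2, p.1, p.2]) (z := v)
    (by intro i _; fin_cases i
        · simp; linarith [hp.2.2]
        · exact hp.1
        · exact hp.2.1)
    (by simp [Fin.sum_univ_three]; ring)
    (fun i _ => hm i)
  simpa [Fin.sum_univ_three, param_eq] using h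

theorem hasFDerivAt_baryCoord_param (s : Finset E3) (a : E3) (v : Fin 3 → E3) (p : ℝ × ℝ) :
    HasFDerivAt (fun p => baryCoord s a (param v p))
      (baryDiff s a (v 1 - v 0) • ContinuousLinearMap.fst ℝ ℝ ℝ +
        baryDiff s a (v 2 - v 0) • ContinuousLinearMap.snd ℝ ℝ ℝ) p := by
  have : (fun p => baryCoord s a (param v p)) = fun p : ℝ × ℝ => baryCoord s a (v 0) +
      (baryDiff s a (v 1 - v 0) • ContinuousLinearMap.fst ℝ ℝ ℝ +
        baryDiff s a (v 2 - v 0) • ContinuousLinearMap.snd ℝ ℝ ℝ) p := by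
    ext1 p
    rw [param, add_assoc, baryCoord_add]
    simp [mul_comm]
  rw [this]
  exact (ContinuousLinearMap.hasFDerivAt _).const_add _

theorem isClosed_convexHull_finset (s : Finset E3) : IsClosed (convexHull ℝ (s : Set E3)) :=
  s.finite_toSet.isClosed_convexHull (𝕜 := ℝ)

variable {F : Finset (Finset E3)} {S : Set E3}

/-- The triangle with corners `v` need not belong to `F`: hat functions of one mesh are pulled back
to triangles of another, where they are only piecewise linear, and the pieces are pasted. -/
theorem IsTriangulation.lipschitzOn_hat_param (hF : IsTriangulation F S) {v : Fin 3 → E3}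
    (hv : convexHull ℝ (Finset.univ.image v : Set E3) ⊆ S) (a : E3) :
    ∃ C, LipschitzOnWith C (fun p => hat F a (param v p)) refTriangle := by
  have hl : ∀ s : Finset E3, ∃ C, LipschitzWith C (fun p => baryCoord s a (param v p)) := by
    intro s
    refine ⟨‖baryDiff s a (v 1 - v 0) • ContinuousLinearMap.fst ℝ ℝ ℝ +
        baryDiff s a (v 2 - v 0) • ContinuousLinearMap.snd ℝ ℝ ℝ‖₊, ?_⟩
    refine lipschitzWith_of_nnnorm_fderiv_le (𝕜 := ℝ)
      (fun p => (hasFDerivAt_baryCoord_param s a v p).differentiableAt) fun p => ?_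
    rw [(hasFDerivAt_baryCoord_param s a v p).fderiv]
  choose C hC using hl
  refine ⟨F.sup C, lipschitzOnWith_of_cover convex_refTriangle F
    (fun s => param v ⁻¹' convexHull ℝ (s : Set E3))
    (fun s _ => (isClosed_convexHull_finset s).preimage (continuous_param v))
    (fun p hp => hF.cover _ (hv (param_mem hp))) fun s hs => ?_⟩
  have h0 : EqOn (fun p => hat F a (param v p))
      (fun p => if a ∈ s then baryCoord s a (param v p) else 0)
      (param v ⁻¹' convexHull ℝ (s : Set E3) ∩ refTriangle) := fun p hp => hF.hat_eq hs hp.1 a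
  have h1 : LipschitzWith (F.sup C) (fun p => if a ∈ s then baryCoord s a (param v p) else 0) := by
    split_ifs
    · exact (hC s).weaken (Finset.le_sup hs)
    · exact (LipschitzWith.const 0).weaken zero_le
  intro p hp q hq
  rw [h0 hp, h0 hq]
  exact h1 p q

theorem param_injective {v : Fin 3 → E3} (hv : AffineIndependent ℝ v) :
    Function.Injective (param v) := by
  have hl : LinearIndependent ℝ ![v 1 - v 0, v 2 - v 0] := by
    have h := (affineIndependent_iff_linearIndependent_vsub ℝ v 0).1 hv
    let e : Fin 2 → {x : Fin 3 // x ≠ 0} := ![⟨1, by decide⟩, ⟨2, by decide⟩]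
    have he : Function.Injective e := by
      intro i j hij
      fin_cases i <;> fin_cases j <;> simp_all [e]
    have h2 := h.comp e he
    have h3 : ![v 1 - v 0, v 2 - v 0] = (fun i : {x : Fin 3 // x ≠ 0} => v i -ᵥ v 0) ∘ e := by
      ext i j
      fin_cases i <;> simp [e]
    rw [h3]; exact h2
  intro p q h
  have h' : (p.1 - q.1) • (v 1 - v 0) + (p.2 - q.2) • (v 2 - v 0) = 0 := by
    rw [param, param] at h
    have := sub_eq_zero.2 h
    rw [← this]; module
  have := (LinearIndependent.pair_iff.1 hl) _ _ h'
  ext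
  · linarith [this.1]
  · linarith [this.2]

theorem param_add_fst (v : Fin 3 → E3) (p : ℝ × ℝ) (t : ℝ) :
    param v (p + (t, 0)) = param v p + t • (v 1 - v 0) := by
  simp only [param, Prod.fst_add, Prod.snd_add]; module

theorem param_add_snd (v : Fin 3 → E3) (p : ℝ × ℝ) (t : ℝ) :
    param v (p + (0, t)) = param v p + t • (v 2 - v 0) := by
  simp only [param, Prod.fst_add, Prod.snd_add]; module

theorem convex_preimage_param (v : Fin 3 → E3) {A : Set E3} (hA : Convex ℝ A) :
    Convex ℝ (param v ⁻¹' A) := by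
  intro p hp q hq a b ha hb hab
  have : param v (a • p + b • q) = a • param v p + b • param v q := by
    simp only [param_eq, Prod.fst_add, Prod.snd_add, Prod.smul_fst, Prod.smul_snd, smul_eq_mul]
    have : (1 : ℝ) = a + b := hab.symm
    rw [this]
    have h2 : a = 1 - b := by linarith
    subst h2
    module
  simp only [mem_preimage, this]
  exact hA hp hq ha hb hab

/-- The preimage is closed and convex, so it is null as soon as it has no interior point; an
interior point would allow steps in two independent directions along one line. -/
theorem volume_preimage_segment {v : Fin 3 → E3} (hv : AffineIndependent ℝ v) (b c : E3) :
    volume (param v ⁻¹' segment ℝ b c) = 0 := by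
  have hcl : IsClosed (param v ⁻¹' segment ℝ b c) := by
    rw [← convexHull_pair]
    exact ((Set.toFinite {b, c}).isClosed_convexHull (𝕜 := ℝ)).preimage (continuous_param v)
  have hint : interior (param v ⁻¹' segment ℝ b c) = ∅ := by
    by_contra hne
    obtain ⟨p, hp⟩ := Set.nonempty_iff_ne_empty.2 hne
    have hn := mem_interior_iff_mem_nhds.1 hp
    have c1 : Tendsto (fun t : ℝ => p + (t, (0 : ℝ))) (𝓝 0) (𝓝 p) := by
      have : Continuous fun t : ℝ => p + (t, (0 : ℝ)) := by fun_prop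
      simpa [show ((0 : ℝ), (0 : ℝ)) = 0 from rfl] using this.tendsto 0
    have c2 : Tendsto (fun t : ℝ => p + ((0 : ℝ), t)) (𝓝 0) (𝓝 p) := by
      have : Continuous fun t : ℝ => p + ((0 : ℝ), t) := by fun_prop
      simpa [show ((0 : ℝ), (0 : ℝ)) = 0 from rfl] using this.tendsto 0
    have hev : ∀ᶠ t : ℝ in 𝓝[>] 0, 0 < t ∧ p + (t, (0 : ℝ)) ∈ param v ⁻¹' segment ℝ b c ∧
        p + ((0 : ℝ), t) ∈ param v ⁻¹' segment ℝ b c := by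
      filter_upwards [self_mem_nhdsWithin, nhdsWithin_le_nhds (c1 hn), nhdsWithin_le_nhds (c2 hn)]
        with t h1 h2 h3 using ⟨h1, h2, h3⟩
    obtain ⟨ε, hε, h1, h2⟩ := hev.exists
    have h0' : p ∈ param v ⁻¹' segment ℝ b c := interior_subset hp
    have h0 : param v p ∈ segment ℝ b c := h0'
    rw [mem_preimage, param_add_fst] at h1
    rw [mem_preimage, param_add_snd] at h2
    rw [segment_eq_image'] at h0 h1 h2
    obtain ⟨t0, -, e0⟩ := h0
    obtain ⟨t1, -, e1⟩ := h1
    obtain ⟨t2, -, e2⟩ := h2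
    have f1 : ε • (v 1 - v 0) = (t1 - t0) • (c - b) := by
      rw [sub_smul, eq_sub_iff_add_eq, ← add_right_inj b, ← add_assoc, add_comm b, add_assoc]
      simp only at e0 e1
      rw [e0, e1, add_comm]
    have f2 : ε • (v 2 - v 0) = (t2 - t0) • (c - b) := by
      rw [sub_smul, eq_sub_iff_add_eq, ← add_right_inj b, ← add_assoc, add_comm b, add_assoc]
      simp only at e0 e2
      rw [e0, e2, add_comm]
    -- Both steps are multiples of `c - b`; scaled crosswise they end at the same point, which
    -- injectivity allows only if they are zero.
    have g : param v (p + ((t2 - t0) * ε, 0)) = param v (p + (0, (t1 - t0) * ε)) := by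
      rw [param_add_fst, param_add_snd, mul_smul, mul_smul, f1, f2, smul_comm]
    have g' := param_injective hv g
    have k1 : (t1 - t0) * ε = 0 := by simpa using (congrArg Prod.snd g').symm
    have k2 : t1 - t0 = 0 := (mul_eq_zero.1 k1).resolve_right hε.ne'
    rw [k2, zero_smul] at f1
    have g2 : param v (p + (ε, 0)) = param v p := by rw [param_add_fst, f1, add_zero]
    have g3 := congrArg Prod.fst (param_injective hv g2)
    simp at g3
    exact hε.ne' g3
  have hfr := (convex_preimage_param v (convex_segment b c)).addHaar_frontier volume
  rwa [frontier, hcl.closure_eq, hint, sdiff_empty] at hfr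

/-- Almost every point of a triangle lies in the interior of a piece of the triangulation. -/
theorem IsTriangulation.ae_mem (hF : IsTriangulation F S) {v : Fin 3 → E3}
    (hv : AffineIndependent ℝ v) (hvS : convexHull ℝ (Finset.univ.image v : Set E3) ⊆ S) :
    ∀ᵐ p ∂(volume.restrict refTriangle), ∃ s ∈ F, param v p ∈ openTriangle s ∧
      ∀ᶠ q in 𝓝 p, param v q ∈ convexHull ℝ (s : Set E3) := by
  -- Two null sets are avoided: the frontiers of the pieces, so that a whole neighbourhood is mapped
  -- to one triangle, and the edges, so that all coordinates are positive.
  have h1 : ∀ᵐ p : ℝ × ℝ, ∀ s ∈ F, p ∉ frontier (param v ⁻¹' convexHull ℝ (s : Set E3)) := by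
    rw [Finset.eventually_all]
    intro s _
    exact measure_eq_zero_iff_ae_notMem.1 ((convex_preimage_param v (convex_convexHull ℝ _)).addHaar_frontier volume)
  have h2 : ∀ᵐ p : ℝ × ℝ, ∀ s ∈ F, ∀ a ∈ s, param v p ∉ convexHull ℝ (s.erase a : Set E3) := by
    rw [Finset.eventually_all]
    intro s hs
    rw [Finset.eventually_all]
    intro a ha
    obtain ⟨b, c, -, hbc⟩ := Finset.card_eq_two.1
      (show (s.erase a).card = 2 by rw [Finset.card_erase_of_mem ha, hF.card_eq s hs])
    rw [hbc, Finset.coe_pair, convexHull_pair]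
    exact measure_eq_zero_iff_ae_notMem.1 (volume_preimage_segment hv b c)
  filter_upwards [ae_restrict_mem isClosed_refTriangle.measurableSet, ae_restrict_of_ae h1,
    ae_restrict_of_ae h2] with p hp hp1 hp2
  obtain ⟨s, hs, hps⟩ := hF.cover _ (hvS (param_mem hp))
  refine ⟨s, hs, ⟨hps, fun a ha => ?_⟩, ?_⟩
  · refine lt_of_le_of_ne (baryCoord_nonneg (hF.indep s hs) hps ha) fun h0 => ?_
    refine hp2 s hs a ha (mem_convexHull_of_baryCoord (hF.indep s hs) (s.erase_subset a) hps ?_)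
    intro b hb hba
    have : b = a := by
      by_contra h; exact hba (Finset.mem_erase.2 ⟨h, hb⟩)
    rw [this, ← h0]
  · have hcl : IsClosed (param v ⁻¹' convexHull ℝ (s : Set E3)) :=
      (isClosed_convexHull_finset s).preimage (continuous_param v)
    have : p ∈ interior (param v ⁻¹' convexHull ℝ (s : Set E3)) := by
      by_contra h
      exact hp1 s hs (by rw [frontier, hcl.closure_eq]; exact ⟨hps, h⟩)
    exact mem_interior_iff_mem_nhds.1 this

end Param

/-! ### Whitney forms and exterior derivatives inside the triangles -/

section Forms

open Set

theorem wedgeOneForms_zero (l : Fin 0 → E3 →L[ℝ] ℝ) (u : Fin 0 → E3) : wedgeOneForms l u = 1 := by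
  simp [wedgeOneForms, ContinuousMultilinearMap.alternatization_apply_apply]

theorem wedgeOneForms_one (l : Fin 1 → E3 →L[ℝ] ℝ) (u : Fin 1 → E3) :
    wedgeOneForms l u = l 0 (u 0) := by
  simp [wedgeOneForms, ContinuousMultilinearMap.alternatization_apply_apply]

theorem sum_perm_two {M : Type*} [AddCommMonoid M] (f : Equiv.Perm (Fin 2) → M) :
    ∑ g, f g = f 1 + f (Equiv.swap 0 1) := by
  have : (Finset.univ : Finset (Equiv.Perm (Fin 2))) = {1, Equiv.swap 0 1} := by decide
  rw [this, Finset.sum_pair (by decide)]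

theorem wedgeOneForms_two (l : Fin 2 → E3 →L[ℝ] ℝ) (u : Fin 2 → E3) :
    wedgeOneForms l u = l 0 (u 0) * l 1 (u 1) - l 0 (u 1) * l 1 (u 0) := by
  simp [wedgeOneForms, ContinuousMultilinearMap.alternatization_apply_apply, sum_perm_two,
    Fin.prod_univ_two, sub_eq_add_neg]

theorem wedge_zero_two (β : E3 [⋀^Fin 0]→L[ℝ] ℝ) (ω : E3 [⋀^Fin 2]→L[ℝ] ℝ) (h : 0 + 2 = 2)
    (e₁ e₂ : E3) : wedge β ω (fun k => ![e₁, e₂] (Fin.cast h k)) = β ![] * ω ![e₁, e₂] := by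
  have h1 : ∀ g : Equiv.Perm (Fin (0 + 2)), β (fun i => ![e₁, e₂] (Fin.cast h (g (Fin.castAdd 2 i))))
      = β ![] := fun g => congrArg β (Subsingleton.elim _ _)
  simp only [wedge, h1]
  change _ * ∑ g : Equiv.Perm (Fin 2), _ = _
  rw [sum_perm_two]
  have h2 : (fun j : Fin 2 => ![e₁, e₂] (Fin.cast h ((1 : Equiv.Perm (Fin 2)) (Fin.natAdd 0 j)))) =
      ![e₁, e₂] := by ext j; fin_cases j <;> rfl
  have h3 : (fun j : Fin 2 => ![e₁, e₂] (Fin.cast h (Equiv.swap (0 : Fin 2) 1 (Fin.natAdd 0 j)))) =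
      ![e₁, e₂] ∘ Equiv.swap (0 : Fin 2) 1 := by ext j; fin_cases j <;> rfl
  have h4 : ω (![e₁, e₂] ∘ Equiv.swap (0 : Fin 2) 1) = _ := ω.toAlternatingMap.map_perm _ _
  rw [h2, h3, h4]
  simp [Nat.factorial]
  ring

theorem wedge_two_zero (β : E3 [⋀^Fin 2]→L[ℝ] ℝ) (ω : E3 [⋀^Fin 0]→L[ℝ] ℝ) (h : 2 + 0 = 2)
    (e₁ e₂ : E3) : wedge β ω (fun k => ![e₁, e₂] (Fin.cast h k)) = β ![e₁, e₂] * ω ![] := by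
  have h1 : ∀ g : Equiv.Perm (Fin (2 + 0)), ω (fun i => ![e₁, e₂] (Fin.cast h (g (Fin.natAdd 2 i))))
      = ω ![] := fun g => congrArg ω (Subsingleton.elim _ _)
  simp only [wedge, h1]
  change _ * ∑ g : Equiv.Perm (Fin 2), _ = _
  rw [sum_perm_two]
  have h2 : (fun j : Fin 2 => ![e₁, e₂] (Fin.cast h ((1 : Equiv.Perm (Fin 2)) (Fin.castAdd 0 j)))) =
      ![e₁, e₂] := by ext j; fin_cases j <;> rfl
  have h3 : (fun j : Fin 2 => ![e₁, e₂] (Fin.cast h (Equiv.swap (0 : Fin 2) 1 (Fin.castAdd 0 j)))) =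
      ![e₁, e₂] ∘ Equiv.swap (0 : Fin 2) 1 := by ext j; fin_cases j <;> rfl
  have h4 : β (![e₁, e₂] ∘ Equiv.swap (0 : Fin 2) 1) = _ := β.toAlternatingMap.map_perm _ _
  rw [h2, h3, h4]
  simp [Nat.factorial]
  ring

theorem wedge_one_one (β ω : E3 [⋀^Fin 1]→L[ℝ] ℝ) (h : 1 + 1 = 2) (e₁ e₂ : E3) :
    wedge β ω (fun k => ![e₁, e₂] (Fin.cast h k)) = β ![e₁] * ω ![e₂] - β ![e₂] * ω ![e₁] := by
  simp only [wedge]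
  change _ * ∑ g : Equiv.Perm (Fin 2), _ = _
  rw [sum_perm_two]
  have h1 : (fun j : Fin 1 => ![e₁, e₂] (Fin.cast h ((1 : Equiv.Perm (Fin 2)) (Fin.castAdd 1 j)))) =
      ![e₁] := by ext j; fin_cases j; rfl
  have h2 : (fun j : Fin 1 => ![e₁, e₂] (Fin.cast h ((1 : Equiv.Perm (Fin 2)) (Fin.natAdd 1 j)))) =
      ![e₂] := by ext j; fin_cases j; rfl
  have h3 : (fun j : Fin 1 => ![e₁, e₂] (Fin.cast h (Equiv.swap (0 : Fin 2) 1 (Fin.castAdd 1 j)))) =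
      ![e₂] := by ext j; fin_cases j; rfl
  have h4 : (fun j : Fin 1 => ![e₁, e₂] (Fin.cast h (Equiv.swap (0 : Fin 2) 1 (Fin.natAdd 1 j)))) =
      ![e₁] := by ext j; fin_cases j; rfl
  rw [h1, h2, h3, h4]
  simp [Nat.factorial]
  ring

variable {s : Finset E3}

theorem whitneyLocal_zero_apply (s : Finset E3) (w : Fin 1 → E3) (x : E3) (u : Fin 0 → E3) :
    whitneyLocal s w x u = baryCoord s (w 0) x := by
  simp [whitneyLocal, wedgeOneForms_zero]

theorem whitneyLocal_one_apply (s : Finset E3) (w : Fin 2 → E3) (x : E3) (u : Fin 1 → E3) :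
    whitneyLocal s w x u = baryCoord s (w 0) x * baryDiff s (w 1) (u 0) -
      baryCoord s (w 1) x * baryDiff s (w 0) (u 0) := by
  simp [whitneyLocal, wedgeOneForms_one, Fin.sum_univ_two, sub_eq_add_neg]

theorem differentiable_whitneyLocal (s : Finset E3) {r : ℕ} (w : Fin (r + 1) → E3) :
    Differentiable ℝ (whitneyLocal s w) := by
  have h : ∀ a, Differentiable ℝ (baryCoord s a) := fun a => by unfold baryCoord; fun_prop
  have h2 : Differentiable ℝ (fun x => ∑ k : Fin (r + 1),
      ((-1 : ℝ) ^ (k : ℕ) * baryCoord s (w k) x) •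
        wedgeOneForms (fun i : Fin r => baryDiff s (w (k.succAbove i)))) :=
    Differentiable.fun_sum fun k _ => ((h (w k)).const_mul ((-1 : ℝ) ^ (k : ℕ))).smul_const
      (wedgeOneForms (fun i : Fin r => baryDiff s (w (k.succAbove i))))
  exact h2.const_smul (r.factorial : ℝ)

theorem fderiv_baryCoord (s : Finset E3) (a x : E3) : fderiv ℝ (baryCoord s a) x = baryDiff s a := by
  have : baryCoord s a = fun y => (1 - baryDiff s a a) + baryDiff s a y := by
    ext y; simp [baryCoord]; ring
  rw [this, fderiv_const_add, ContinuousLinearMap.fderiv]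

theorem extDeriv_whitneyLocal_zero (s : Finset E3) (w : Fin 1 → E3) (x : E3) (u : Fin 1 → E3) :
    extDeriv (whitneyLocal s w) x u = baryDiff s (w 0) (u 0) := by
  rw [extDeriv_apply (differentiable_whitneyLocal s w x)]
  simp only [whitneyLocal_zero_apply]
  rw [show (fun x => baryCoord s (w 0) x) = baryCoord s (w 0) from rfl]
  simp [fderiv_baryCoord]

theorem extDeriv_whitneyLocal_one (s : Finset E3) (w : Fin 2 → E3) (x : E3) (u : Fin 2 → E3) :
    extDeriv (whitneyLocal s w) x u = 2 * (baryDiff s (w 0) (u 0) * baryDiff s (w 1) (u 1) -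
      baryDiff s (w 0) (u 1) * baryDiff s (w 1) (u 0)) := by
  rw [extDeriv_apply (differentiable_whitneyLocal s w x)]
  simp only [whitneyLocal_one_apply]
  have h : ∀ a, DifferentiableAt ℝ (baryCoord s a) x := fun a => by unfold baryCoord; fun_prop
  have hd : ∀ c d : ℝ, fderiv ℝ (fun y => baryCoord s (w 0) y * c - baryCoord s (w 1) y * d) x =
      c • baryDiff s (w 0) - d • baryDiff s (w 1) := by
    intro c d
    rw [fderiv_fun_sub ((h _).mul_const c) ((h _).mul_const d), fderiv_mul_const (h _),
      fderiv_mul_const (h _), fderiv_baryCoord, fderiv_baryCoord]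
  simp only [hd]
  simp [Fin.sum_univ_two, Fin.removeNth]
  ring

theorem altitude_mem {a : E3} (ha : a ∈ s) (hne : (s.erase a).Nonempty) :
    altitude s a ∈ vectorSpan ℝ (s : Set E3) := by
  have h1 : a - center (s.erase a) ∈ vectorSpan ℝ (s : Set E3) := by
    rw [← direction_affineSpan]
    refine AffineSubspace.vsub_mem_direction (subset_affineSpan ℝ _ (Finset.mem_coe.2 ha)) ?_
    have h := centroid_mem_affineSpan_of_nonempty ℝ (s := (s.erase a).attach)
      ((↑) : (s.erase a) → E3) (by simpa using hne)
    have h2 : Finset.centroid ℝ (s.erase a).attach ((↑) : (s.erase a) → E3)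
        = center (s.erase a) := by
      have h3 := Finset.centroid_map ℝ (s.erase a).attach
        (Function.Embedding.subtype (· ∈ s.erase a)) (id : E3 → E3)
      rw [Finset.attach_map_val] at h3
      exact h3.symm
    rw [h2] at h
    refine affineSpan_mono ℝ ?_ h
    rintro _ ⟨y, rfl⟩
    exact (Finset.mem_erase.1 y.2).2
  have h2 : altitude s a = (a - center (s.erase a)) -
      (vectorSpan ℝ (s.erase a : Set E3)).starProjection (a - center (s.erase a)) := by
    rw [altitude, eq_sub_iff_add_eq, add_comm]
    exact Submodule.starProjection_add_starProjection_orthogonal _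
  rw [h2]
  refine Submodule.sub_mem _ h1 ?_
  exact vectorSpan_mono ℝ (by simp)
    (Submodule.starProjection_apply_mem _ _)

theorem baryDiff_orthogonal {a : E3} (ha : a ∈ s) (hne : (s.erase a).Nonempty) {u : E3}
    (hu : u ∈ (vectorSpan ℝ (s : Set E3))ᗮ) : baryDiff s a u = 0 := by
  have := Submodule.inner_right_of_mem_orthogonal (altitude_mem ha hne) hu
  simp [baryDiff, this]

theorem erase_nonempty_of_card (hs : s.card = 3) {a : E3} (ha : a ∈ s) : (s.erase a).Nonempty := by
  rw [← Finset.card_pos, Finset.card_erase_of_mem ha, hs]; norm_num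

/-- On tangent vectors, which are spanned by differences of nodes, this differentiates the identity
that the coordinates add up to one; on normals each summand vanishes. -/
theorem sum_baryDiff (hs : AffineIndependent ℝ ((↑) : s → E3)) (hc : s.card = 3) :
    ∑ a ∈ s, baryDiff s a = 0 := by
  have h1 : ∀ u ∈ vectorSpan ℝ (s : Set E3), ∑ a ∈ s, baryDiff s a u = 0 := by
    intro u hu
    rw [vectorSpan_def] at hu
    induction hu using Submodule.span_induction with
    | mem u hu =>
      obtain ⟨b, hb, c, hc, rfl⟩ := hu
      have : ∀ a ∈ s, baryDiff s a (b -ᵥ c) = (if a = b then 1 else 0) - if a = c then 1 else 0 := by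
        intro a ha
        rw [vsub_eq_sub, ← baryCoord_sub]
        congr 1
        · split_ifs with h
          · rw [h, baryCoord_self]
          · exact baryCoord_of_ne hs ha hb (Ne.symm h)
        · split_ifs with h
          · rw [h, baryCoord_self]
          · exact baryCoord_of_ne hs ha hc (Ne.symm h)
      rw [Finset.sum_congr rfl this, Finset.sum_sub_distrib, Finset.sum_ite_eq', Finset.sum_ite_eq',
        if_pos (Finset.mem_coe.1 hb), if_pos (Finset.mem_coe.1 hc), sub_self]
    | zero => simp
    | add u v _ _ h1 h2 => simp only [map_add, Finset.sum_add_distrib, h1, h2, add_zero]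
    | smul c u _ h => simp only [map_smul, ← Finset.smul_sum, h, smul_zero]
  ext u
  rw [_root_.sum_apply, _root_.zero_apply]
  have hdec := Submodule.starProjection_add_starProjection_orthogonal
    (K := vectorSpan ℝ (s : Set E3)) u
  rw [← hdec]
  simp only [map_add, Finset.sum_add_distrib]
  rw [h1 _ (Submodule.starProjection_apply_mem _ _), zero_add]
  exact Finset.sum_eq_zero fun a ha => baryDiff_orthogonal ha (erase_nonempty_of_card hc ha)
    (Submodule.starProjection_apply_mem _ _)

/-- The altitude vectors are tangent to the triangle, so a step along the normal does not change the
coordinate. -/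
theorem baryCoord_planeProj (hc : s.card = 3) {a : E3} (ha : a ∈ s) (y : E3) :
    baryCoord s a (planeProj s y) = baryCoord s a y := by
  have hdec := Submodule.starProjection_add_starProjection_orthogonal
    (K := vectorSpan ℝ (s : Set E3)) (y - center s)
  have : y = planeProj s y + (vectorSpan ℝ (s : Set E3))ᗮ.starProjection (y - center s) := by
    rw [planeProj, add_assoc, hdec]; abel
  conv_rhs => rw [this, baryCoord_add,
    baryDiff_orthogonal ha (erase_nonempty_of_card hc ha) (Submodule.starProjection_apply_mem _ _),
    add_zero]

theorem center_eq (h : s.Nonempty) : center s = ∑ b ∈ s, (s.card : ℝ)⁻¹ • b := by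
  rw [center, Finset.centroid_def, Finset.affineCombination_eq_linear_combination]
  · simp [Finset.centroidWeights_apply]
  · exact Finset.sum_centroidWeights_eq_one_of_nonempty ℝ s h

theorem mem_convexHull_of_mem_affineSpan (hs : AffineIndependent ℝ ((↑) : s → E3)) {y : E3}
    (hy : y ∈ affineSpan ℝ (s : Set E3)) (h0 : ∀ a ∈ s, 0 ≤ baryCoord s a y) :
    y ∈ convexHull ℝ (s : Set E3) := by
  have hr : (s : Set E3) = Set.range ((↑) : s → E3) := by simp
  rw [hr] at hy
  obtain ⟨w, hw, hyw⟩ := eq_affineCombination_of_mem_affineSpan_of_fintype hy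
  rw [Finset.affineCombination_eq_linear_combination _ _ _ hw] at hyw
  set w' : E3 → ℝ := fun a => if h : a ∈ s then w ⟨a, h⟩ else 0 with hw'
  have e1 : ∑ a ∈ s, w' a = 1 := by
    rw [← Finset.sum_coe_sort, ← hw]
    exact Finset.sum_congr rfl fun a _ => by simp [hw']
  have e2 : y = ∑ a ∈ s, w' a • a := by
    rw [← Finset.sum_coe_sort s (fun a => w' a • a), hyw]
    exact Finset.sum_congr rfl fun a _ => by simp [hw']
  rw [e2] at h0 ⊢
  refine Finset.mem_convexHull'.2 ⟨w', fun a ha => ?_, e1, rfl⟩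
  have := h0 a ha
  rwa [baryCoord_combo hs e1 ha] at this

theorem center_mem (h : s.Nonempty) : center s ∈ convexHull ℝ (s : Set E3) := by
  rw [center_eq h]
  have : (s.card : ℝ) ≠ 0 := by exact_mod_cast h.card_pos.ne'
  exact Finset.mem_convexHull'.2 ⟨fun _ => (s.card : ℝ)⁻¹, fun _ _ => by positivity,
    by simp [this], rfl⟩

theorem planeProj_mem (h : s.Nonempty) (y : E3) : planeProj s y ∈ affineSpan ℝ (s : Set E3) := by
  have h1 := convexHull_subset_affineSpan (𝕜 := ℝ) (s : Set E3) (center_mem h)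
  rw [planeProj, add_comm]
  refine AffineSubspace.vadd_mem_of_mem_direction ?_ h1
  rw [direction_affineSpan]
  exact Submodule.starProjection_apply_mem _ _

theorem nonempty_of_card (hc : s.card = 3) : s.Nonempty := by
  rw [← Finset.card_pos, hc]; norm_num

/-- Positivity of the coordinates is open in three-space and invariant under the projection. This
lets `surfaceD` be computed by ordinary differentiation at interior points. -/
theorem eventually_planeProj_mem (hs : AffineIndependent ℝ ((↑) : s → E3)) (hc : s.card = 3)
    {x : E3} (hx : x ∈ openTriangle s) : ∀ᶠ y in 𝓝 x, planeProj s y ∈ openTriangle s := by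
  have : ∀ᶠ y in 𝓝 x, ∀ a ∈ s, 0 < baryCoord s a y :=
    (Filter.eventually_all_finset s).2 fun a ha =>
      (isOpen_lt continuous_const (continuous_baryCoord s a)).mem_nhds (hx.2 a ha)
  filter_upwards [this] with y hy
  have hp : ∀ a ∈ s, 0 < baryCoord s a (planeProj s y) := fun a ha => by
    rw [baryCoord_planeProj hc ha]; exact hy a ha
  exact ⟨mem_convexHull_of_mem_affineSpan hs (planeProj_mem (nonempty_of_card hc) y)
    fun a ha => (hp a ha).le, hp⟩

variable {F : Finset (Finset E3)} {S : Set E3}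

/-- Relative interiors of distinct triangles are disjoint, so at most one term survives. -/
theorem IsTriangulation.sum_indicator (hF : IsTriangulation F S) (hs : s ∈ F) {x : E3}
    (hx : x ∈ openTriangle s) {M : Type*} [AddCommMonoid M] (G : Finset (Finset E3)) (hG : G ⊆ F)
    (f : Finset E3 → E3 → M) :
    ∑ t ∈ G, (openTriangle t).indicator (f t) x = if s ∈ G then f s x else 0 := by
  rw [← Finset.sum_ite_eq' G s (fun t => f t x)]
  refine Finset.sum_congr rfl fun t ht => ?_
  split_ifs with h
  · rw [h, indicator_of_mem hx]
  · exact indicator_of_notMem (fun hxt => h (hF.eq_of_mem_openTriangle hs (hG ht) hx hxt.1).symm) _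

theorem IsTriangulation.whitney_eq (hF : IsTriangulation F S) (hs : s ∈ F) {x : E3}
    (hx : x ∈ openTriangle s) {r : ℕ} (w : Fin (r + 1) → E3) :
    whitney F w x = if Finset.univ.image w ⊆ s then whitneyLocal s w x else 0 := by
  rw [whitney, hF.sum_indicator hs hx _ (Finset.filter_subset _ _) (fun s => whitneyLocal s w)]
  simp [hs]

theorem IsTriangulation.surfaceD_eq (hF : IsTriangulation F S) (hs : s ∈ F) {x : E3}
    (hx : x ∈ openTriangle s) {r : ℕ} (ω : Form r) :
    surfaceD F ω x = extDeriv (fun y => ω (planeProj s y)) x := by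
  rw [surfaceD, hF.sum_indicator hs hx F subset_rfl
    (fun s => extDeriv (fun y => ω (planeProj s y))), if_pos hs]

theorem whitneyLocal_planeProj (hc : s.card = 3) {r : ℕ} {w : Fin (r + 1) → E3}
    (hw : Finset.univ.image w ⊆ s) (y : E3) :
    whitneyLocal s w (planeProj s y) = whitneyLocal s w y := by
  have : ∀ k, baryCoord s (w k) (planeProj s y) = baryCoord s (w k) y := fun k =>
    baryCoord_planeProj hc (hw (Finset.mem_image_of_mem w (Finset.mem_univ k))) y
  simp only [whitneyLocal, this]

theorem IsTriangulation.whitney_planeProj (hF : IsTriangulation F S) (hs : s ∈ F) {x : E3}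
    (hx : x ∈ openTriangle s) {r : ℕ} (w : Fin (r + 1) → E3) :
    (fun y => whitney F w (planeProj s y)) =ᶠ[𝓝 x]
      if Finset.univ.image w ⊆ s then whitneyLocal s w else fun _ => 0 := by
  filter_upwards [eventually_planeProj_mem (hF.indep s hs) (hF.card_eq s hs) hx] with y hy
  rw [hF.whitney_eq hs hy]
  split_ifs with h
  · exact whitneyLocal_planeProj (hF.card_eq s hs) h y
  · rfl

theorem IsTriangulation.differentiableAt_whitney (hF : IsTriangulation F S) (hs : s ∈ F) {x : E3}
    (hx : x ∈ openTriangle s) {r : ℕ} (w : Fin (r + 1) → E3) :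
    DifferentiableAt ℝ (fun y => whitney F w (planeProj s y)) x := by
  refine (hF.whitney_planeProj hs hx w).differentiableAt_iff.2 ?_
  split_ifs
  · exact differentiable_whitneyLocal s w x
  · exact differentiableAt_const _

theorem IsTriangulation.surfaceD_whitney (hF : IsTriangulation F S) (hs : s ∈ F) {x : E3}
    (hx : x ∈ openTriangle s) {r : ℕ} (w : Fin (r + 1) → E3) :
    surfaceD F (whitney F w) x =
      if Finset.univ.image w ⊆ s then extDeriv (whitneyLocal s w) x else 0 := by
  rw [hF.surfaceD_eq hs hx, (hF.whitney_planeProj hs hx w).extDeriv_eq]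
  split_ifs
  · rfl
  · ext u
    rw [extDeriv_apply (differentiableAt_const _)]
    simp

end Forms

/-! ### Pull-back of Whitney forms to the parameter plane -/

section Pullback

open Set

variable {F : Finset (Finset E3)} {S : Set E3} {s : Finset E3} {v : Fin 3 → E3} {p : ℝ × ℝ}

/-- The parameter `p` belongs to a point in the interior of the triangle `s`, and a neighbourhood
of `p` is mapped to `s`. -/
def GoodPoint (v : Fin 3 → E3) (s : Finset E3) (p : ℝ × ℝ) : Prop :=
  param v p ∈ openTriangle s ∧ ∀ᶠ q in 𝓝 p, param v q ∈ convexHull ℝ (s : Set E3)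

/-- The neighbourhood in `GoodPoint` matters: a priori the plane of `v` could cross that of `s` at
the given point. -/
theorem IsTriangulation.hasFDerivAt_hat (hF : IsTriangulation F S) (hs : s ∈ F)
    (hp : GoodPoint v s p) (a : E3) :
    HasFDerivAt (fun p => hat F a (param v p)) (if a ∈ s then
      (baryDiff s a (v 1 - v 0) • ContinuousLinearMap.fst ℝ ℝ ℝ +
        baryDiff s a (v 2 - v 0) • ContinuousLinearMap.snd ℝ ℝ ℝ) else 0) p := by
  have h : (fun p => hat F a (param v p)) =ᶠ[𝓝 p]
      fun q => if a ∈ s then baryCoord s a (param v q) else 0 := by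
    filter_upwards [hp.2] with q hq using hF.hat_eq hs hq a
  refine HasFDerivAt.congr_of_eventuallyEq ?_ h
  split_ifs
  · exact hasFDerivAt_baryCoord_param s a v p
  · exact hasFDerivAt_const _ _

theorem IsTriangulation.fderiv_hat_fst (hF : IsTriangulation F S) (hs : s ∈ F)
    (hp : GoodPoint v s p) (a : E3) :
    fderiv ℝ (fun p => hat F a (param v p)) p (1, 0) =
      if a ∈ s then baryDiff s a (v 1 - v 0) else 0 := by
  rw [(hF.hasFDerivAt_hat hs hp a).fderiv]
  split_ifs <;> simp

theorem IsTriangulation.fderiv_hat_snd (hF : IsTriangulation F S) (hs : s ∈ F)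
    (hp : GoodPoint v s p) (a : E3) :
    fderiv ℝ (fun p => hat F a (param v p)) p (0, 1) =
      if a ∈ s then baryDiff s a (v 2 - v 0) else 0 := by
  rw [(hF.hasFDerivAt_hat hs hp a).fderiv]
  split_ifs <;> simp

theorem IsTriangulation.whitney_zero_apply (hF : IsTriangulation F S) (hs : s ∈ F) {x : E3}
    (hx : x ∈ openTriangle s) (w : Fin 1 → E3) (u : Fin 0 → E3) :
    whitney F w x u = hat F (w 0) x := by
  rw [hF.whitney_eq hs hx, hF.hat_eq hs hx.1]
  have : (Finset.univ.image w ⊆ s) ↔ w 0 ∈ s := by simp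
  simp only [this]
  split_ifs
  · exact whitneyLocal_zero_apply s w x u
  · rfl

theorem image_two_subset (w : Fin (1 + 1) → E3) :
    Finset.univ.image w ⊆ s ↔ w 0 ∈ s ∧ w 1 ∈ s := by
  rw [Finset.image_subset_iff]
  simp [Fin.forall_fin_two]

/-- The triangle `s` disappears from the right-hand side. This expression of the form by pulled-back
hat functions, valid at almost every parameter, is what Stokes' theorem can be applied to. -/
theorem IsTriangulation.whitney_one_fst (hF : IsTriangulation F S) (hs : s ∈ F)
    (hp : GoodPoint v s p) (w : Fin 2 → E3) :
    whitney F w (param v p) ![v 1 - v 0] =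
      hat F (w 0) (param v p) * fderiv ℝ (fun p => hat F (w 1) (param v p)) p (1, 0) -
      hat F (w 1) (param v p) * fderiv ℝ (fun p => hat F (w 0) (param v p)) p (1, 0) := by
  rw [hF.whitney_eq hs hp.1, hF.fderiv_hat_fst hs hp, hF.fderiv_hat_fst hs hp,
    hF.hat_eq hs hp.1.1, hF.hat_eq hs hp.1.1]
  simp only [image_two_subset]
  by_cases h0 : w 0 ∈ s <;> by_cases h1 : w 1 ∈ s <;> simp [h0, h1, whitneyLocal_one_apply] <;> ring

theorem IsTriangulation.whitney_one_snd (hF : IsTriangulation F S) (hs : s ∈ F)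
    (hp : GoodPoint v s p) (w : Fin 2 → E3) :
    whitney F w (param v p) ![v 2 - v 0] =
      hat F (w 0) (param v p) * fderiv ℝ (fun p => hat F (w 1) (param v p)) p (0, 1) -
      hat F (w 1) (param v p) * fderiv ℝ (fun p => hat F (w 0) (param v p)) p (0, 1) := by
  rw [hF.whitney_eq hs hp.1, hF.fderiv_hat_snd hs hp, hF.fderiv_hat_snd hs hp,
    hF.hat_eq hs hp.1.1, hF.hat_eq hs hp.1.1]
  simp only [image_two_subset]
  by_cases h0 : w 0 ∈ s <;> by_cases h1 : w 1 ∈ s <;> simp [h0, h1, whitneyLocal_one_apply] <;> ring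

theorem IsTriangulation.surfaceD_whitney_zero_fst (hF : IsTriangulation F S) (hs : s ∈ F)
    (hp : GoodPoint v s p) (w : Fin 1 → E3) :
    surfaceD F (whitney F w) (param v p) ![v 1 - v 0] =
      fderiv ℝ (fun p => hat F (w 0) (param v p)) p (1, 0) := by
  rw [hF.surfaceD_whitney hs hp.1, hF.fderiv_hat_fst hs hp]
  have : (Finset.univ.image w ⊆ s) ↔ w 0 ∈ s := by simp
  simp only [this]
  split_ifs
  · rw [extDeriv_whitneyLocal_zero]; rfl
  · rfl

theorem IsTriangulation.surfaceD_whitney_zero_snd (hF : IsTriangulation F S) (hs : s ∈ F)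
    (hp : GoodPoint v s p) (w : Fin 1 → E3) :
    surfaceD F (whitney F w) (param v p) ![v 2 - v 0] =
      fderiv ℝ (fun p => hat F (w 0) (param v p)) p (0, 1) := by
  rw [hF.surfaceD_whitney hs hp.1, hF.fderiv_hat_snd hs hp]
  have : (Finset.univ.image w ⊆ s) ↔ w 0 ∈ s := by simp
  simp only [this]
  split_ifs
  · rw [extDeriv_whitneyLocal_zero]; rfl
  · rfl

theorem IsTriangulation.surfaceD_whitney_one (hF : IsTriangulation F S) (hs : s ∈ F)
    (hp : GoodPoint v s p) (w : Fin 2 → E3) :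
    surfaceD F (whitney F w) (param v p) ![v 1 - v 0, v 2 - v 0] =
      2 * jac (fun p => hat F (w 0) (param v p)) (fun p => hat F (w 1) (param v p)) p := by
  rw [hF.surfaceD_whitney hs hp.1, jac, hF.fderiv_hat_snd hs hp, hF.fderiv_hat_snd hs hp,
    hF.fderiv_hat_fst hs hp, hF.fderiv_hat_fst hs hp]
  simp only [image_two_subset]
  by_cases h0 : w 0 ∈ s <;> by_cases h1 : w 1 ∈ s <;> simp [h0, h1, extDeriv_whitneyLocal_one] <;> ring

end Pullback

/-! ### Measurable, locally bounded forms and the bilinear pairing -/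

section Regular

open Set

/-- The measurable, locally bounded forms. -/
def regularForms (r : ℕ) : Submodule ℝ (Form r) where
  carrier := {ω | ∀ u, Measurable (fun x => ω x u) ∧
    ∀ C : Set E3, IsCompact C → ∃ M, ∀ x ∈ C, |ω x u| ≤ M}
  add_mem' := by
    intro ω η h1 h2 u
    refine ⟨(h1 u).1.add (h2 u).1, fun C hC => ?_⟩
    obtain ⟨M, hM⟩ := (h1 u).2 C hC
    obtain ⟨N, hN⟩ := (h2 u).2 C hC
    exact ⟨M + N, fun x hx => (abs_add_le _ _).trans (add_le_add (hM x hx) (hN x hx))⟩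
  zero_mem' := fun u => ⟨measurable_const, fun C _ => ⟨0, fun x _ => by simp⟩⟩
  smul_mem' := by
    intro c ω h u
    refine ⟨(h u).1.const_mul c, fun C hC => ?_⟩
    obtain ⟨M, hM⟩ := (h u).2 C hC
    refine ⟨|c| * M, fun x hx => ?_⟩
    have : (c • ω) x u = c * ω x u := rfl
    rw [this, abs_mul]
    exact mul_le_mul_of_nonneg_left (hM x hx) (abs_nonneg c)

theorem measurableSet_openTriangle (s : Finset E3) : MeasurableSet (openTriangle s) := by
  have : openTriangle s = convexHull ℝ (s : Set E3) ∩ ⋂ a ∈ s, {x | 0 < baryCoord s a x} := by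
    ext x; simp [openTriangle]
  rw [this]
  refine (isClosed_convexHull_finset s).measurableSet.inter ?_
  exact Finset.measurableSet_biInter s fun a _ =>
    (isOpen_lt continuous_const (continuous_baryCoord s a)).measurableSet

theorem whitney_mem_regularForms (F : Finset (Finset E3)) {r : ℕ} (w : Fin (r + 1) → E3) :
    whitney F w ∈ regularForms r := by
  have : whitney F w = ∑ s ∈ F.filter (fun s => Finset.univ.image w ⊆ s),
      (openTriangle s).indicator (whitneyLocal s w) := by
    ext x : 1; simp [whitney]
  rw [this]
  refine Submodule.sum_mem _ fun s _ u => ?_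
  have hc : Continuous fun x => whitneyLocal s w x u := by
    have h1 := (differentiable_whitneyLocal s w).continuous
    exact (ContinuousAlternatingMap.apply ℝ E3 ℝ u).continuous.comp h1
  have he : (fun x => (openTriangle s).indicator (whitneyLocal s w) x u) =
      (openTriangle s).indicator fun x => whitneyLocal s w x u := by
    ext x; by_cases hx : x ∈ openTriangle s <;> simp [hx]
  refine ⟨?_, fun C hC => ?_⟩
  · rw [he]
    exact hc.measurable.indicator (measurableSet_openTriangle s)
  · obtain ⟨M, hM⟩ := hC.exists_bound_of_continuousOn hc.continuousOn
    refine ⟨M, fun x hx => ?_⟩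
    have := congrFun he x
    rw [this]
    exact (norm_indicator_le_norm_self (fun x => whitneyLocal s w x u) x).trans (hM x hx)

theorem whitneySpace_le (K : SurfaceMesh) (tr : ZeroTrace) (r : ℕ) :
    whitneySpace K tr r ≤ regularForms r := by
  refine Submodule.span_le.2 ?_
  rintro _ ⟨w, -, -, rfl⟩
  exact whitney_mem_regularForms _ w

theorem BCBasis.space_le {K : SurfaceMesh} {o : K.Orientation} {tr : ZeroTrace}
    (μ : BCBasis K o tr) (q : ℕ) : μ.space q ≤ regularForms q := by
  refine Submodule.span_le.2 ?_
  rintro _ ⟨R, -, rfl⟩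
  exact Submodule.sum_mem _ fun w _ => Submodule.smul_mem _ _ (whitney_mem_regularForms _ _)

/-- The integrand of the pairing on the triangle with corners `v`. -/
noncomputable def integrand {q r : ℕ} (h : q + r = 2) (β : Form q) (ω : Form r) (v : Fin 3 → E3)
    (p : ℝ × ℝ) : ℝ :=
  wedge (β (param v p)) (ω (param v p)) (fun k => ![v 1 - v 0, v 2 - v 0] (Fin.cast h k))

theorem pairing_eq {K : SurfaceMesh} (o : K.Orientation) {q r : ℕ} (h : q + r = 2) (β : Form q)
    (ω : Form r) : pairing o h β ω = ∑ T ∈ K.triangles, ∫ p in refTriangle,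
      integrand h β ω (o.ord T) p := rfl

/-- Additivity of the pairing needs integrable integrands; boundedness on the compact image of the
reference triangle provides this. -/
theorem integrable_integrand {q r : ℕ} (h : q + r = 2) {β : Form q} {ω : Form r}
    (hβ : β ∈ regularForms q) (hω : ω ∈ regularForms r) (v : Fin 3 → E3) :
    IntegrableOn (integrand h β ω v) refTriangle := by
  unfold integrand wedge
  refine Integrable.const_mul (integrable_finsetSum _ fun g _ => ?_) _
  obtain ⟨m1, b1⟩ := hβ fun i =>
    ![v 1 - v 0, v 2 - v 0] (Fin.cast h (g (Fin.castAdd r i)))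
  obtain ⟨m2, b2⟩ := hω fun j =>
    ![v 1 - v 0, v 2 - v 0] (Fin.cast h (g (Fin.natAdd q j)))
  have hc : IsCompact (param v '' refTriangle) := isCompact_refTriangle.image (continuous_param v)
  obtain ⟨M, hM⟩ := b1 _ hc
  obtain ⟨N, hN⟩ := b2 _ hc
  have hm := (continuous_param v).measurable
  refine IntegrableOn.of_bound isCompact_refTriangle.measure_lt_top
    (((measurable_const.mul (m1.comp hm)).mul (m2.comp hm)).aestronglyMeasurable)
    (‖((Equiv.Perm.sign g : ℤ) : ℝ)‖ * M * N) ?_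
  filter_upwards [ae_restrict_mem isClosed_refTriangle.measurableSet] with p hp
  rw [norm_mul, norm_mul]
  have h1 := hM _ (mem_image_of_mem _ hp)
  have h2 := hN _ (mem_image_of_mem _ hp)
  have : 0 ≤ M := (abs_nonneg _).trans h1
  exact mul_le_mul (mul_le_mul_of_nonneg_left h1 (norm_nonneg _)) h2 (norm_nonneg _)
    (by positivity)

variable {K : SurfaceMesh} (o : K.Orientation) {q r : ℕ} (h : q + r = 2)

/-- The pairing of regular forms as a bilinear map. -/
noncomputable def pairingMap : regularForms q →ₗ[ℝ] regularForms r →ₗ[ℝ] ℝ :=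
  LinearMap.mk₂ ℝ (fun β ω => pairing o h (β : Form q) (ω : Form r))
    (by
      intro β β' ω
      simp only [pairing_eq, ← Finset.sum_add_distrib]
      refine Finset.sum_congr rfl fun T _ => ?_
      rw [← integral_add (integrable_integrand h β.2 ω.2 _) (integrable_integrand h β'.2 ω.2 _)]
      refine integral_congr_ae (ae_of_all _ fun p => ?_)
      simp only [integrand, wedge, ← mul_add, ← Finset.sum_add_distrib]
      congr 1
      refine Finset.sum_congr rfl fun g _ => ?_
      have : ∀ u, ((β + β' : regularForms q) : Form q) (param (o.ord T) p) u =
        (β : Form q) (param (o.ord T) p) u + (β' : Form q) (param (o.ord T) p) u := fun u => rfl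
      rw [this]; ring)
    (by
      intro c β ω
      simp only [pairing_eq, smul_eq_mul, Finset.mul_sum, ← integral_const_mul]
      refine Finset.sum_congr rfl fun T _ => integral_congr_ae (ae_of_all _ fun p => ?_)
      simp only [integrand, wedge, Finset.mul_sum]
      congr 1; ext g
      have : ∀ u, ((c • β : regularForms q) : Form q) (param (o.ord T) p) u =
        c * (β : Form q) (param (o.ord T) p) u := fun u => rfl
      rw [this]; ring)
    (by
      intro β ω ω'
      simp only [pairing_eq, ← Finset.sum_add_distrib]
      refine Finset.sum_congr rfl fun T _ => ?_
      rw [← integral_add (integrable_integrand h β.2 ω.2 _) (integrable_integrand h β.2 ω'.2 _)]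
      refine integral_congr_ae (ae_of_all _ fun p => ?_)
      simp only [integrand, wedge, ← mul_add, ← Finset.sum_add_distrib]
      congr 1)
    (by
      intro c β ω
      simp only [pairing_eq, smul_eq_mul, Finset.mul_sum, ← integral_const_mul]
      refine Finset.sum_congr rfl fun T _ => integral_congr_ae (ae_of_all _ fun p => ?_)
      simp only [integrand, wedge, Finset.mul_sum]
      congr 1; ext g
      have : ∀ u, ((c • ω : regularForms r) : Form r) (param (o.ord T) p) u =
        c * (ω : Form r) (param (o.ord T) p) u := fun u => rfl
      rw [this]; ring)

end Regular

/-! ### Barycentric coordinates of a triangle with numbered corners -/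

section Corners

open Finset

variable {v : Fin 3 → E3}

theorem affineIndependent_image (hv : AffineIndependent ℝ v) :
    AffineIndependent ℝ ((↑) : ↥(univ.image v) → E3) := by
  have h := hv.range
  have e : ((univ.image v : Finset E3) : Set E3) = Set.range v := by simp
  exact h.mono e.subset

theorem affineIndependent_of_image (h : AffineIndependent ℝ
    ((↑) : ↥(univ.image v) → E3)) (hv : Function.Injective v) :
    AffineIndependent ℝ v := by
  set f : Fin 3 ↪ ↥(univ.image v) :=
    ⟨fun i => ⟨v i, mem_image_of_mem v (mem_univ i)⟩,
      fun _ _ hij => hv (Subtype.ext_iff.1 hij)⟩ with hf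
  have h1 := h.comp_embedding f
  have h2 : (fun i => ((f i : ↥(univ.image v)) : E3)) = v := rfl
  rw [← h2]
  exact h1

theorem sum_baryCoord_corners (hv : AffineIndependent ℝ v) {x : E3}
    (hx : x ∈ convexHull ℝ ((univ.image v : Finset E3) : Set E3)) :
    ∑ i, baryCoord (univ.image v) (v i) x = 1 ∧
      ∑ i, baryCoord (univ.image v) (v i) x • v i = x := by
  have h1 := sum_baryCoord (affineIndependent_image hv) hx
  have h2 := sum_baryCoord_smul (affineIndependent_image hv) hx
  rw [sum_image (fun i _ j _ h => hv.injective h)] at h1 h2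
  exact ⟨h1, h2⟩

theorem baryCoord_corners (hv : AffineIndependent ℝ v) {w : Fin 3 → ℝ} (hw : ∑ i, w i = 1)
    (i : Fin 3) : baryCoord (univ.image v) (v i) (∑ j, w j • v j) = w i := by
  rw [baryCoord_sum_smul _ _ _ _ _ hw, sum_eq_single i]
  · rw [baryCoord_self, mul_one]
  · intro j _ hj
    rw [baryCoord_of_ne (affineIndependent_image hv) (mem_image_of_mem v (mem_univ i))
      (mem_image_of_mem v (mem_univ j)) (hv.injective.ne hj), mul_zero]
  · exact fun h => absurd (mem_univ i) h

theorem card_image_corners (hv : AffineIndependent ℝ v) : (univ.image v).card = 3 := by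
  rw [card_image_of_injective _ hv.injective]; simp

end Corners

/-! ### Flags of a mesh; the barycentric refinement is a triangulation -/

namespace SurfaceMesh

open Finset

variable {K : SurfaceMesh} {s t T : Finset E3} {a b c : E3}

theorem mem_faceFinset : s ∈ K.faceFinset ↔ s ∈ K.faces := by simp [faceFinset]

theorem mem_triangles : T ∈ K.triangles ↔ T ∈ K.faces ∧ T.card = 3 := by
  simp [triangles, mem_faceFinset]

theorem exists_triangle (hs : s ∈ K.faces) : ∃ T ∈ K.triangles, s ⊆ T := by
  obtain ⟨T, hT, hc, hsT⟩ := K.pure s hs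
  exact ⟨T, mem_triangles.2 ⟨hT, hc⟩, hsT⟩

theorem isTriangulation (K : SurfaceMesh) : IsTriangulation K.triangles K.space where
  card_eq s hs := (mem_triangles.1 hs).2
  indep s hs := K.indep (mem_triangles.1 hs).1
  inter s hs t ht := by
    rw [coe_inter]
    exact K.inter_subset_convexHull (mem_triangles.1 hs).1 (mem_triangles.1 ht).1
  subset s hs := Geometry.SimplicialComplex.convexHull_subset_space (mem_triangles.1 hs).1
  cover x hx := by
    obtain ⟨s, hs, hxs⟩ := Geometry.SimplicialComplex.mem_space_iff.1 hx
    obtain ⟨T, hT, hsT⟩ := exists_triangle hs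
    exact ⟨T, hT, convexHull_mono hsT hxs⟩

/-- The nodes `a`, `b`, `c` are the corners of a triangle. -/
def Tri (K : SurfaceMesh) (a b c : E3) : Prop :=
  a ≠ b ∧ a ≠ c ∧ b ≠ c ∧ {a, b, c} ∈ K.triangles

theorem Tri.swap (h : K.Tri a b c) : K.Tri a c b :=
  ⟨h.2.1, h.1, h.2.2.1.symm, by rw [pair_comm c b]; exact h.2.2.2⟩

theorem Tri.swap_left (h : K.Tri a b c) : K.Tri b a c :=
  ⟨h.1.symm, h.2.2.1, h.2.1, by rw [insert_comm]; exact h.2.2.2⟩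

theorem exists_tri (hT : T ∈ K.triangles) (ha : a ∈ T) : ∃ b c, K.Tri a b c ∧ T = {a, b, c} := by
  have hc : (T.erase a).card = 2 := by
    rw [card_erase_of_mem ha, (mem_triangles.1 hT).2]
  obtain ⟨b, c, hbc, h⟩ := card_eq_two.1 hc
  have hb : b ∈ T.erase a := by simp [h]
  have hc : c ∈ T.erase a := by simp [h]
  have hT' : T = {a, b, c} := by rw [← h, insert_erase ha]
  exact ⟨b, c, ⟨(ne_of_mem_erase hb).symm, (ne_of_mem_erase hc).symm, hbc,
    hT' ▸ hT⟩, hT'⟩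

theorem exists_tri_edge (hT : T ∈ K.triangles) (ha : a ∈ T) (hb : b ∈ T) (hab : a ≠ b) :
    ∃ c, K.Tri a b c ∧ T = {a, b, c} := by
  obtain ⟨b', c', h, rfl⟩ := exists_tri hT ha
  have : b = b' ∨ b = c' := by
    simpa [hab.symm] using hb
  rcases this with rfl | rfl
  · exact ⟨c', h, rfl⟩
  · exact ⟨b', h.swap, by rw [pair_comm]⟩

theorem card_le (hs : s ∈ K.faces) : s.card ≤ 3 := by
  obtain ⟨T, hT, hsT⟩ := exists_triangle hs
  exact (mem_triangles.1 hT).2 ▸ card_le_card hsT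

theorem card_pos (hs : s ∈ K.faces) : 0 < s.card :=
  (K.nonempty_of_mem_faces hs).card_pos

theorem Tri.mem_faces (h : K.Tri a b c) {s : Finset E3} (hs : s ⊆ {a, b, c}) (hne : s.Nonempty) :
    s ∈ K.faces := K.down_closed (mem_triangles.1 h.2.2.2).1 hs hne

theorem mem_flags {q : ℕ} {w : Fin (q + 1) → Finset E3} :
    w ∈ K.flags q ↔ (∀ i, w i ∈ K.faces) ∧ StrictMono w := by
  simp [flags, mem_faceFinset]

theorem mem_flags_zero {w : Fin 1 → Finset E3} : w ∈ K.flags 0 ↔ w 0 ∈ K.faces := by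
  rw [mem_flags]
  refine ⟨fun h => h.1 0, fun h => ⟨fun (i : Fin 1) => by rwa [Subsingleton.elim i 0], ?_⟩⟩
  exact fun (i j : Fin 1) hij => absurd hij (by simp [Subsingleton.elim i j])

theorem mem_flags_one {w : Fin 2 → Finset E3} :
    w ∈ K.flags 1 ↔ w 0 ∈ K.faces ∧ w 1 ∈ K.faces ∧ w 0 ⊂ w 1 := by
  rw [mem_flags, Fin.strictMono_iff_lt_succ]
  simp [Fin.forall_fin_two, and_assoc]

/-- The small triangle at the node `a`, the edge `a b` and the triangle `a b c`. -/
noncomputable def flag (a b c : E3) : Fin 3 → Finset E3 := ![{a}, {a, b}, {a, b, c}]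

@[simp] theorem flag_zero (a b c : E3) : flag a b c 0 = {a} := rfl
@[simp] theorem flag_one (a b c : E3) : flag a b c 1 = {a, b} := rfl
@[simp] theorem flag_two (a b c : E3) : flag a b c 2 = {a, b, c} := rfl

theorem Tri.flag_mem (h : K.Tri a b c) : flag a b c ∈ K.flags 2 := by
  rw [mem_flags, Fin.strictMono_iff_lt_succ]
  refine ⟨fun i => ?_, fun i => ?_⟩
  · fin_cases i
    · exact h.mem_faces (by simp) (by simp)
    · exact h.mem_faces (by intro x; simp; tauto) (by simp)
    · exact h.mem_faces (by simp) (by simp)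
  · obtain ⟨h1, h2, h3, -⟩ := h
    fin_cases i
    · refine ssubset_iff_of_subset (by simp) |>.2 ⟨b, by simp, by simp [h1.symm]⟩
    · refine ssubset_iff_of_subset (by intro x; simp; tauto) |>.2
        ⟨c, by simp, by simp [h2.symm, h3.symm]⟩

theorem mem_flags_two {z : Fin 3 → Finset E3} :
    z ∈ K.flags 2 ↔ ∃ a b c, K.Tri a b c ∧ z = flag a b c := by
  refine ⟨fun h => ?_, by rintro ⟨a, b, c, h, rfl⟩; exact h.flag_mem⟩
  obtain ⟨hf, hm⟩ := mem_flags.1 h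
  have h01 := card_lt_card (hm (show (0 : Fin 3) < 1 by decide))
  have h12 := card_lt_card (hm (show (1 : Fin 3) < 2 by decide))
  have h0 := card_pos (hf 0)
  have h2 := card_le (hf 2)
  obtain ⟨a, ha⟩ := card_eq_one.1 (show (z 0).card = 1 by omega)
  have ha1 : a ∈ z 1 := (hm (show (0 : Fin 3) < 1 by decide)).1 (by simp [ha])
  obtain ⟨b, hb⟩ := card_eq_one.1 (show ((z 1).erase a).card = 1 by
    rw [card_erase_of_mem ha1]; omega)
  have hz1 : z 1 = {a, b} := by rw [← hb, insert_erase ha1]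
  have hab : a ≠ b := by
    have : b ∈ (z 1).erase a := by simp [hb]
    exact (ne_of_mem_erase this).symm
  have h12s := (hm (show (1 : Fin 3) < 2 by decide)).1
  obtain ⟨c, hc, hz2⟩ := exists_tri_edge (K := K) (a := a) (b := b) (T := z 2)
    (mem_triangles.2 ⟨hf 2, by omega⟩) (h12s (by simp [hz1])) (h12s (by simp [hz1])) hab
  refine ⟨a, b, c, hc, ?_⟩
  ext i : 1
  fin_cases i
  · exact ha
  · exact hz1
  · exact hz2

theorem hat_center (hs : s ∈ K.faces) (a : E3) :
    hat K.triangles a (center s) = if a ∈ s then (s.card : ℝ)⁻¹ else 0 := by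
  obtain ⟨T, hT, hsT⟩ := exists_triangle hs
  have hne := K.nonempty_of_mem_faces hs
  have hcard : (s.card : ℝ) ≠ 0 := by exact_mod_cast hne.card_pos.ne'
  rw [K.isTriangulation.hat_eq hT (convexHull_mono hsT (center_mem hne))]
  have iT := K.isTriangulation.indep T hT
  by_cases haT : a ∈ T
  · rw [if_pos haT, center_eq hne, baryCoord_sum_smul _ _ _ _ _ (by simp [hcard]), ← mul_sum]
    split_ifs with has
    · rw [sum_eq_single a, baryCoord_self, mul_one]
      · exact fun b hb hba => baryCoord_of_ne iT haT (hsT hb) hba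
      · exact fun h => absurd has h
    · rw [sum_eq_zero, mul_zero]
      exact fun b hb => baryCoord_of_ne iT haT (hsT hb) (fun h => has (h ▸ hb))
  · rw [if_neg haT, if_neg (fun h => haT (hsT h))]

/-- The nodes of a simplex are recovered from its barycenter as those whose hat function does not
vanish there. -/
theorem center_injective (hs : s ∈ K.faces) (ht : t ∈ K.faces) (h : center s = center t) :
    s = t := by
  ext a
  have h1 := hat_center hs a
  rw [h, hat_center ht a] at h1
  have := card_pos hs
  have := card_pos ht
  constructor <;> intro ha
  · by_contra hn
    rw [if_neg hn, if_pos ha] at h1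
    exact (inv_ne_zero (by positivity : (s.card : ℝ) ≠ 0)) h1.symm
  · by_contra hn
    rw [if_neg hn, if_pos ha] at h1
    exact (inv_ne_zero (by positivity : (t.card : ℝ) ≠ 0)) h1

theorem Tri.hat_flag_sum (h : K.Tri a b c) {w : Fin 3 → ℝ} (h0 : ∀ i, 0 ≤ w i) (h1 : ∑ i, w i = 1)
    (q : E3) : hat K.triangles q (∑ i, w i • center (flag a b c i)) =
      ∑ i, w i * hat K.triangles q (center (flag a b c i)) := by
  have hf := (mem_flags.1 h.flag_mem).1
  have hsub : ∀ i, flag a b c i ⊆ {a, b, c} := by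
    intro i; fin_cases i <;> intro x <;> simp [flag] <;> tauto
  have hm : ∀ i, center (flag a b c i) ∈ convexHull ℝ (({a, b, c} : Finset E3) : Set E3) :=
    fun i => convexHull_mono (coe_subset.2 (hsub i)) (center_mem (K.nonempty_of_mem_faces (hf i)))
  have hx : ∑ i, w i • center (flag a b c i) ∈ convexHull ℝ (({a, b, c} : Finset E3) : Set E3) :=
    (convex_convexHull ℝ _).sum_mem (fun i _ => h0 i) h1 (fun i _ => hm i)
  rw [K.isTriangulation.hat_eq h.2.2.2 hx]
  simp only [fun i => K.isTriangulation.hat_eq h.2.2.2 (hm i) q]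
  split_ifs with hq
  · exact baryCoord_sum_smul _ _ _ _ _ h1
  · simp

theorem Tri.hat_flag (h : K.Tri a b c) {w : Fin 3 → ℝ} (h0 : ∀ i, 0 ≤ w i) (h1 : ∑ i, w i = 1)
    (q : E3) : hat K.triangles q (∑ i, w i • center (flag a b c i)) =
      if q = a then w 0 + w 1 / 2 + w 2 / 3 else if q = b then w 1 / 2 + w 2 / 3 else
        if q = c then w 2 / 3 else 0 := by
  have hf := (mem_flags.1 h.flag_mem).1
  rw [h.hat_flag_sum h0 h1]
  simp only [fun i => hat_center (hf i)]
  have c3 := (mem_triangles.1 h.2.2.2).2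
  have c2 : ({a, b} : Finset E3).card = 2 := card_pair h.1
  simp only [Fin.sum_univ_three, flag_zero, flag_one, flag_two, card_singleton, c2, c3,
    mem_singleton, mem_insert]
  obtain ⟨n1, n2, n3, -⟩ := h
  by_cases e1 : q = a
  · simp [e1]; ring
  by_cases e2 : q = b
  · simp [e2, n1.symm]; ring
  by_cases e3 : q = c
  · simp [e3, n2.symm, n3.symm]; ring
  · simp [e1, e2, e3]

/-- The coarse coordinates are triangular on the three barycenters: only the last one has a nonzero
coordinate at `c`, and only the last two have one at `b`. -/
theorem flag_center_affineIndependent (h : K.Tri a b c) :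
    AffineIndependent ℝ (fun i => center (flag a b c i)) := by
  rw [affineIndependent_iff]
  intro s w hw hs
  set w' : Fin 3 → ℝ := fun i => if i ∈ s then w i else 0 with hw'
  have e1 : ∑ i, w' i = 0 := by simp [hw', hw]
  have e2 : ∑ i, w' i • center (flag a b c i) = 0 := by simp [hw', hs]
  have hf := (mem_flags.1 h.flag_mem).1
  have key : ∀ q ∈ ({a, b, c} : Finset E3),
      ∑ i, w' i * hat K.triangles q (center (flag a b c i)) = 0 := by
    intro q hq
    have hsub : ∀ i, flag a b c i ⊆ {a, b, c} := by
      intro i; fin_cases i <;> intro x <;> simp [flag] <;> tauto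
    have hm : ∀ i, center (flag a b c i) ∈ convexHull ℝ (({a, b, c} : Finset E3) : Set E3) :=
      fun i => convexHull_mono (coe_subset.2 (hsub i))
        (center_mem (K.nonempty_of_mem_faces (hf i)))
    simp only [fun i => K.isTriangulation.hat_eq h.2.2.2 (hm i) q, if_pos hq, baryCoord, mul_add,
      mul_one, map_sub, mul_sub, sum_add_distrib, sum_sub_distrib, ← sum_mul, e1]
    have := congrArg (baryDiff {a, b, c} q) e2
    simp only [map_sum, map_smul, smul_eq_mul, map_zero] at this
    rw [this]; ring
  have c3 := (mem_triangles.1 h.2.2.2).2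
  have c2 : ({a, b} : Finset E3).card = 2 := card_pair h.1
  have hb := key b (by simp)
  have hc := key c (by simp)
  simp only [fun i => hat_center (hf i), Fin.sum_univ_three] at hb hc e1
  simp [c2, c3, h.1.symm, h.2.1.symm, h.2.2.1.symm] at hb hc
  have h2 : w' 2 = 0 := hc
  have h1 : w' 1 = 0 := by rw [h2] at hb; linarith
  have h0 : w' 0 = 0 := by rw [h1, h2] at e1; linarith
  intro i hi
  have : w' i = w i := by simp [hw', hi]
  rw [← this]
  fin_cases i
  · exact h0
  · exact h1
  · exact h2

/-- The node set of a simplex of the barycentric refinement. -/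
noncomputable def sdNodes {q : ℕ} (w : Fin (q + 1) → Finset E3) : Finset E3 :=
  univ.image fun i => center (w i)

theorem Tri.hat_of_mem (h : K.Tri a b c) {x : E3}
    (hx : x ∈ convexHull ℝ (sdNodes (flag a b c) : Set E3)) :
    ∃ w : Fin 3 → ℝ, (∀ i, w i = baryCoord (sdNodes (flag a b c)) (center (flag a b c i)) x) ∧
      (∀ i, 0 ≤ w i) ∧ ∀ q, hat K.triangles q x =
        if q = a then w 0 + w 1 / 2 + w 2 / 3 else if q = b then w 1 / 2 + w 2 / 3 else
          if q = c then w 2 / 3 else 0 := by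
  have hi := flag_center_affineIndependent h
  obtain ⟨h1, h2⟩ := sum_baryCoord_corners hi hx
  have h0 : ∀ i, 0 ≤ baryCoord (sdNodes (flag a b c)) (center (flag a b c i)) x := fun i =>
    baryCoord_nonneg (affineIndependent_image hi) hx
      (mem_image_of_mem _ (mem_univ i))
  refine ⟨_, fun i => rfl, h0, fun q => ?_⟩
  rw [← h.hat_flag h0 h1 q]
  exact congrArg _ h2.symm

/-- In the small triangle the coarse coordinates decrease from `a` over `b` to `c`, with gaps `w 0`
and `w 1 / 2` and last value `w 2 / 3`. A superlevel set is therefore an initial piece of this list.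
-/
theorem Tri.superlevel (h : K.Tri a b c) {x : E3}
    (hx : x ∈ convexHull ℝ (sdNodes (flag a b c) : Set E3)) {τ : ℝ} (hτ : 0 < τ) :
    {q | τ ≤ hat K.triangles q x} = ∅ ∨
      ∃ i, {q | τ ≤ hat K.triangles q x} = (flag a b c i : Set E3) := by
  obtain ⟨w, -, h0, hq⟩ := h.hat_of_mem hx
  have n0 := h0 0
  have n1 := h0 1
  have n2 := h0 2
  obtain ⟨d1, d2, d3, -⟩ := h
  by_cases t2 : τ ≤ w 2 / 3
  · right; refine ⟨2, ?_⟩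
    ext q
    simp only [Set.mem_ofPred_eq, flag_two, coe_insert, coe_singleton,
      Set.mem_insert_iff, Set.mem_singleton_iff, hq]
    grind
  by_cases t1 : τ ≤ w 1 / 2 + w 2 / 3
  · right; refine ⟨1, ?_⟩
    ext q
    simp only [Set.mem_ofPred_eq, flag_one, coe_insert, coe_singleton,
      Set.mem_insert_iff, Set.mem_singleton_iff, hq]
    grind
  by_cases t0 : τ ≤ w 0 + w 1 / 2 + w 2 / 3
  · right; refine ⟨0, ?_⟩
    ext q
    simp only [Set.mem_ofPred_eq, flag_zero, coe_singleton, Set.mem_singleton_iff, hq]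
    grind
  · left
    ext q
    simp only [Set.mem_ofPred_eq, Set.mem_empty_iff_false, iff_false, hq]
    grind

/-- A nonzero weight makes the corresponding gap strict, so the threshold just reached by the last
node of the flag member cuts out that member. With `Tri.superlevel` this recovers the small simplex
carrying `x` from the coarse coordinates, independently of the small triangle used. -/
theorem Tri.exists_superlevel (h : K.Tri a b c) {x : E3}
    (hx : x ∈ convexHull ℝ (sdNodes (flag a b c) : Set E3)) (i : Fin 3)
    (hpos : baryCoord (sdNodes (flag a b c)) (center (flag a b c i)) x ≠ 0) :
    ∃ τ > 0, {q | τ ≤ hat K.triangles q x} = (flag a b c i : Set E3) := by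
  obtain ⟨w, hw, h0, hq⟩ := h.hat_of_mem hx
  rw [← hw] at hpos
  have hwi : 0 < w i := lt_of_le_of_ne (h0 i) (Ne.symm hpos)
  have n0 := h0 0
  have n1 := h0 1
  have n2 := h0 2
  obtain ⟨d1, d2, d3, -⟩ := h
  fin_cases i
  · have hwi : 0 < w 0 := hwi
    refine ⟨w 0 + w 1 / 2 + w 2 / 3, by positivity, ?_⟩
    ext q
    simp only [Set.mem_ofPred_eq, Fin.zero_eta, flag_zero, coe_singleton,
      Set.mem_singleton_iff, hq]
    grind
  · have hwi : 0 < w 1 := hwi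
    refine ⟨w 1 / 2 + w 2 / 3, by positivity, ?_⟩
    ext q
    simp only [Set.mem_ofPred_eq, Fin.mk_one, flag_one, coe_insert, coe_singleton,
      Set.mem_insert_iff, Set.mem_singleton_iff, hq]
    grind
  · have hwi : 0 < w 2 := hwi
    refine ⟨w 2 / 3, by positivity, ?_⟩
    ext q
    simp only [Set.mem_ofPred_eq, Fin.reduceFinMk, flag_two, coe_insert,
      coe_singleton, Set.mem_insert_iff, Set.mem_singleton_iff, hq]
    grind

theorem mem_sdTriangles {s : Finset E3} :
    s ∈ K.sdTriangles ↔ ∃ a b c, K.Tri a b c ∧ s = sdNodes (flag a b c) := by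
  rw [sdTriangles, mem_image]
  constructor
  · rintro ⟨w, hw, rfl⟩
    obtain ⟨a, b, c, h, rfl⟩ := mem_flags_two.1 hw
    exact ⟨a, b, c, h, rfl⟩
  · rintro ⟨a, b, c, h, rfl⟩; exact ⟨_, h.flag_mem, rfl⟩

theorem Tri.sdNodes_subset (h : K.Tri a b c) :
    (sdNodes (flag a b c) : Set E3) ⊆ convexHull ℝ (({a, b, c} : Finset E3) : Set E3) := by
  intro x hx
  obtain ⟨i, -, rfl⟩ := mem_image.1 (mem_coe.1 hx)
  have hsub : flag a b c i ⊆ {a, b, c} := by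
    fin_cases i <;> intro x <;> simp [flag] <;> tauto
  exact convexHull_mono (coe_subset.2 hsub)
    (center_mem (K.nonempty_of_mem_faces ((mem_flags.1 h.flag_mem).1 i)))

theorem exists_tri_sorted (hT : T ∈ K.triangles) (f : E3 → ℝ) :
    ∃ a b c, K.Tri a b c ∧ T = {a, b, c} ∧ f b ≤ f a ∧ f c ≤ f b := by
  have hne : T.Nonempty := nonempty_of_card (mem_triangles.1 hT).2
  obtain ⟨a, ha, hmax⟩ := T.exists_max_image f hne
  obtain ⟨b, c, h, rfl⟩ := exists_tri hT ha
  rcases le_total (f c) (f b) with hcb | hbc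
  · exact ⟨a, b, c, h, rfl, hmax b (by simp), hcb⟩
  · exact ⟨a, c, b, h.swap, by rw [pair_comm], hmax c (by simp), hbc⟩

theorem isTriangulation_sd (K : SurfaceMesh) : IsTriangulation K.sdTriangles K.space where
  card_eq s hs := by
    obtain ⟨a, b, c, h, rfl⟩ := mem_sdTriangles.1 hs
    exact card_image_corners (flag_center_affineIndependent h)
  indep s hs := by
    obtain ⟨a, b, c, h, rfl⟩ := mem_sdTriangles.1 hs
    exact affineIndependent_image (flag_center_affineIndependent h)
  inter s hs t ht := by
    obtain ⟨a, b, c, h, rfl⟩ := mem_sdTriangles.1 hs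
    obtain ⟨a', b', c', h', rfl⟩ := mem_sdTriangles.1 ht
    rintro x ⟨hx, hx'⟩
    -- A corner with nonzero weight in the first small triangle is a superlevel set at `x`, hence
    -- also a corner of the second one.
    refine mem_convexHull_of_baryCoord (affineIndependent_image (flag_center_affineIndependent h))
      inter_subset_left hx ?_
    intro p hp hpn
    obtain ⟨i, -, rfl⟩ := mem_image.1 hp
    by_contra hpos
    obtain ⟨τ, hτ, he⟩ := h.exists_superlevel hx i hpos
    rcases h'.superlevel hx' hτ with h0 | ⟨j, hj⟩
    · rw [h0] at he
      have := K.nonempty_of_mem_faces ((mem_flags.1 h.flag_mem).1 i)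
      rw [← coe_nonempty, ← he] at this
      exact Set.not_nonempty_empty this
    · rw [hj] at he
      refine hpn (mem_inter.2 ⟨hp, mem_image.2 ⟨j, mem_univ j, ?_⟩⟩)
      rw [coe_injective he]
  subset s hs := by
    obtain ⟨a, b, c, h, rfl⟩ := mem_sdTriangles.1 hs
    exact (convexHull_min h.sdNodes_subset (convex_convexHull ℝ _)).trans
      (K.isTriangulation.subset _ h.2.2.2)
  cover x hx := by
    obtain ⟨T, hT, hxT⟩ := K.isTriangulation.cover x hx
    -- Ordering the nodes by their coordinates selects the small triangle; the weights of its
    -- corners are the successive differences times the number of nodes of the flag member.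
    obtain ⟨a, b, c, h, rfl, hba, hcb⟩ := exists_tri_sorted hT (fun a => baryCoord T a x)
    have iT := K.isTriangulation.indep _ hT
    refine ⟨_, mem_sdTriangles.2 ⟨a, b, c, h, rfl⟩, ?_⟩
    have hc0 := baryCoord_nonneg iT hxT (a := c) (by simp)
    have e1 := sum_baryCoord iT hxT
    have e2 := sum_baryCoord_smul iT hxT
    have c3 := (mem_triangles.1 h.2.2.2).2
    have c2 : ({a, b} : Finset E3).card = 2 := card_pair h.1
    have hab : a ∉ ({b, c} : Finset E3) := by simp [h.1, h.2.1]
    have hbc : b ∉ ({c} : Finset E3) := by simp [h.2.2.1]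
    rw [sum_insert hab, sum_insert hbc, sum_singleton] at e1 e2
    set la := baryCoord {a, b, c} a x
    set lb := baryCoord {a, b, c} b x
    set lc := baryCoord {a, b, c} c x
    have : x = (la - lb) • center {a} + (2 * (lb - lc)) • center {a, b} +
        (3 * lc) • center {a, b, c} := by
      rw [center_eq (by simp), center_eq (by simp), center_eq (by simp), c3, c2,
        sum_insert hab, sum_insert hbc, sum_singleton,
        sum_pair h.1, sum_singleton, card_singleton, ← e2]
      module
    rw [this]
    have hm : ∀ i, center (flag a b c i) ∈ convexHull ℝ (sdNodes (flag a b c) : Set E3) :=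
      fun i => subset_convexHull ℝ _ (mem_image_of_mem _ (mem_univ i))
    have := (convex_convexHull ℝ (sdNodes (flag a b c) : Set E3)).sum_mem (t := univ)
      (w := ![la - lb, 2 * (lb - lc), 3 * lc]) (z := fun i => center (flag a b c i))
      (by intro i _; fin_cases i <;> simp <;> assumption)
      (by simp [Fin.sum_univ_three]; linarith) (fun i _ => hm i)
    simpa [Fin.sum_univ_three] using this

end SurfaceMesh

/-! ### Incidence numbers and cancellation along interior edges -/

section Oriented

open Set

namespace SurfaceMesh

variable {K : SurfaceMesh} (o : K.Orientation) {T T' : Finset E3} {a b c : E3}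

namespace Orientation

theorem ord_injective (hT : T ∈ K.triangles) : Function.Injective (o.ord T) := by
  have h : (Finset.univ.image (o.ord T)).card = (Finset.univ : Finset (Fin 3)).card := by
    rw [o.image_ord T hT, (mem_triangles.1 hT).2]; rfl
  have := Finset.card_image_iff.1 h
  rwa [Finset.coe_univ, injOn_univ] at this

theorem ord_mem (hT : T ∈ K.triangles) (i : Fin 3) : o.ord T i ∈ T := by
  have := Finset.mem_image_of_mem (o.ord T) (Finset.mem_univ i)
  rwa [o.image_ord T hT] at this

theorem exists_ord (hT : T ∈ K.triangles) (ha : a ∈ T) : ∃ i, o.ord T i = a := by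
  rw [← o.image_ord T hT] at ha
  simpa using ha

theorem ord_affineIndependent (hT : T ∈ K.triangles) : AffineIndependent ℝ (o.ord T) := by
  refine affineIndependent_of_image ?_ (o.ord_injective hT)
  rw [o.image_ord T hT]
  exact K.isTriangulation.indep T hT

theorem inc_next (hT : T ∈ K.triangles) (i : Fin 3) :
    o.inc T (o.ord T i) (o.ord T (i + 1)) = 1 := by
  rw [inc, if_pos ⟨i, rfl, rfl⟩]

theorem inc_prev (hT : T ∈ K.triangles) (i : Fin 3) :
    o.inc T (o.ord T (i + 1)) (o.ord T i) = -1 := by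
  rw [inc, if_neg, if_pos ⟨i, rfl, rfl⟩]
  rintro ⟨j, h1, h2⟩
  have e1 := o.ord_injective hT h1
  have e2 := o.ord_injective hT h2
  subst e1
  revert e2; fin_cases i <;> simp

theorem inc_self (hT : T ∈ K.triangles) : o.inc T a a = 0 := by
  have : ¬ ∃ i, o.ord T i = a ∧ o.ord T (i + 1) = a := by
    rintro ⟨i, h1, h2⟩
    have := o.ord_injective hT (h1.trans h2.symm)
    revert this; fin_cases i <;> simp
  rw [inc, if_neg this, if_neg this]

theorem inc_of_notMem (hT : T ∈ K.triangles) (h : ¬ (a ∈ T ∧ b ∈ T)) : o.inc T a b = 0 := by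
  rw [inc, if_neg, if_neg]
  · rintro ⟨i, rfl, rfl⟩; exact h ⟨o.ord_mem hT _, o.ord_mem hT _⟩
  · rintro ⟨i, rfl, rfl⟩; exact h ⟨o.ord_mem hT _, o.ord_mem hT _⟩

/-- Up to cyclic shifts, three nodes have only two orders. -/
theorem ord_cases (h : K.Tri a b c) :
    (∃ i, o.ord {a, b, c} i = a ∧ o.ord {a, b, c} (i + 1) = b ∧ o.ord {a, b, c} (i + 2) = c) ∨
    ∃ i, o.ord {a, b, c} i = b ∧ o.ord {a, b, c} (i + 1) = a ∧ o.ord {a, b, c} (i + 2) = c := by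
  obtain ⟨n1, n2, n3, hT⟩ := h
  obtain ⟨i, hi⟩ := o.exists_ord hT (a := a) (by simp)
  have hinj := o.ord_injective hT
  set f := o.ord {a, b, c} with hf
  have m1 : f (i + 1) = b ∨ f (i + 1) = c := by
    have := o.ord_mem hT (i + 1)
    rw [← hf] at this
    simp only [Finset.mem_insert, Finset.mem_singleton] at this
    refine this.resolve_left fun h => ?_
    have := hinj (h.trans hi.symm)
    revert this; fin_cases i <;> simp
  have m2 : f (i + 2) = b ∨ f (i + 2) = c := by
    have := o.ord_mem hT (i + 2)
    rw [← hf] at this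
    simp only [Finset.mem_insert, Finset.mem_singleton] at this
    refine this.resolve_left fun h => ?_
    have := hinj (h.trans hi.symm)
    revert this; fin_cases i <;> simp
  have m3 : f (i + 1) ≠ f (i + 2) := fun h => by
    have := hinj h
    revert this; fin_cases i <;> simp
  rcases m1 with h1 | h1 <;> rcases m2 with h2 | h2
  · exact absurd (h1.trans h2.symm) m3
  · exact Or.inl ⟨i, hi, h1, h2⟩
  · refine Or.inr ⟨i + 2, h2, ?_, ?_⟩
    · rw [← hi]; congr 1; fin_cases i <;> rfl
    · rw [← h1]; congr 1; fin_cases i <;> rfl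
  · exact absurd (h1.trans h2.symm) m3

theorem inc_third (h : K.Tri a b c) :
    o.inc {a, b, c} a c = - o.inc {a, b, c} a b := by
  have hT := h.2.2.2
  rcases o.ord_cases h with ⟨i, h1, h2, h3⟩ | ⟨i, h1, h2, h3⟩
  · have e1 := o.inc_next hT i
    have e2 := o.inc_prev hT (i + 2)
    rw [show i + 2 + 1 = i by fin_cases i <;> rfl] at e2
    rw [h1, h2] at e1; rw [h1, h3] at e2
    rw [e1, e2]
  · have e1 := o.inc_prev hT i
    have e2 := o.inc_next hT (i + 1)
    rw [show i + 1 + 1 = i + 2 by fin_cases i <;> rfl] at e2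
    rw [h1, h2] at e1; rw [h2, h3] at e2
    rw [e1, e2]; norm_num

theorem inc_eq_or (h : K.Tri a b c) : o.inc {a, b, c} a b = 1 ∨ o.inc {a, b, c} a b = -1 := by
  rcases o.ord_cases h with ⟨i, h1, h2, h3⟩ | ⟨i, h1, h2, h3⟩
  · left; rw [← o.inc_next h.2.2.2 i, h1, h2]
  · right; rw [← o.inc_prev h.2.2.2 i, h1, h2]

theorem inc_swap (hT : T ∈ K.triangles) (a b : E3) : o.inc T b a = - o.inc T a b := by
  by_cases hab : a = b
  · rw [hab, o.inc_self hT, neg_zero]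
  by_cases h : a ∈ T ∧ b ∈ T
  · obtain ⟨c, hc, rfl⟩ := exists_tri_edge hT h.1 h.2 hab
    rcases o.ord_cases hc with ⟨i, h1, h2, h3⟩ | ⟨i, h1, h2, h3⟩
    · have e1 := o.inc_next hT i
      have e2 := o.inc_prev hT i
      rw [h1, h2] at e1 e2; rw [e1, e2]
    · have e1 := o.inc_next hT i
      have e2 := o.inc_prev hT i
      rw [h1, h2] at e1 e2; rw [e1, e2, neg_neg]
  · rw [o.inc_of_notMem hT h, o.inc_of_notMem hT (fun h' => h h'.symm), neg_zero]

theorem exists_ord_of_inc (h : o.inc T a b = 1) : ∃ i, o.ord T i = a ∧ o.ord T (i + 1) = b := by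
  by_contra hn
  rw [inc, if_neg hn] at h
  split_ifs at h <;> norm_num at h

/-- Equal signs would mean that both triangles run through the edge in the same direction, which
`compat` forbids. -/
theorem inc_compat (hT : T ∈ K.triangles) (hT' : T' ∈ K.triangles) (hne : T ≠ T')
    (ha : a ∈ T) (hb : b ∈ T) (ha' : a ∈ T') (hb' : b ∈ T') :
    o.inc T' a b = - o.inc T a b := by
  by_cases hab : a = b
  · rw [hab, o.inc_self hT, o.inc_self hT', neg_zero]
  obtain ⟨c, h, rfl⟩ := exists_tri_edge hT ha hb hab
  obtain ⟨c', h', rfl⟩ := exists_tri_edge hT' ha' hb' hab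
  rcases o.inc_eq_or h with h1 | h1 <;> rcases o.inc_eq_or h' with h2 | h2
  · obtain ⟨i, hi⟩ := o.exists_ord_of_inc h1
    obtain ⟨j, hj⟩ := o.exists_ord_of_inc h2
    exact absurd ⟨hi.1.trans hj.1.symm, hi.2.trans hj.2.symm⟩ (o.compat _ hT _ hT' hne i j)
  · rw [h1, h2]
  · rw [h1, h2, neg_neg]
  · obtain ⟨i, hi⟩ := o.exists_ord_of_inc (T := {a, b, c}) (a := b) (b := a)
      (by rw [o.inc_swap hT, h1, neg_neg])
    obtain ⟨j, hj⟩ := o.exists_ord_of_inc (T := {a, b, c'}) (a := b) (b := a)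
      (by rw [o.inc_swap hT', h2, neg_neg])
    exact absurd ⟨hi.1.trans hj.1.symm, hi.2.trans hj.2.symm⟩ (o.compat _ hT _ hT' hne i j)

end Orientation

/-- The triangles that contain the simplex `e`. -/
noncomputable def star (K : SurfaceMesh) (e : Finset E3) : Finset (Finset E3) :=
  K.triangles.filter (fun T => e ⊆ T)

theorem mem_star {e : Finset E3} : T ∈ K.star e ↔ T ∈ K.triangles ∧ e ⊆ T := Finset.mem_filter

theorem pair_mem_faces_iff : {a, b} ∈ K.faces ↔ (K.star {a, b}).Nonempty := by
  constructor
  · intro h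
    obtain ⟨T, hT, hs⟩ := exists_triangle h
    exact ⟨T, mem_star.2 ⟨hT, hs⟩⟩
  · rintro ⟨T, hT⟩
    obtain ⟨hT, hs⟩ := mem_star.1 hT
    exact K.down_closed (mem_triangles.1 hT).1 hs (by simp)

theorem card_star_le (hab : a ≠ b) : (K.star {a, b}).card ≤ 2 := by
  by_cases h : {a, b} ∈ K.faces
  · have := K.edge_le_two _ h (Finset.card_pair hab)
    rwa [show {T | T ∈ K.faces ∧ T.card = 3 ∧ {a, b} ⊆ T} = (K.star {a, b} : Set (Finset E3)) by
      ext T; simp [star, mem_triangles, and_assoc], ncard_coe_finset] at this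
  · rw [pair_mem_faces_iff, Finset.not_nonempty_iff_eq_empty] at h
    simp [h]

theorem onBoundary_pair_iff (hab : a ≠ b) : K.OnBoundary {a, b} ↔ (K.star {a, b}).card = 1 := by
  constructor
  · rintro ⟨e, he, hc, hs, h⟩
    have : {a, b} = e := Finset.eq_of_subset_of_card_le hs (by rw [hc, Finset.card_pair hab])
    rw [this]; exact h
  · intro h
    refine ⟨{a, b}, ?_, Finset.card_pair hab, subset_rfl, h⟩
    rw [pair_mem_faces_iff, ← Finset.card_pos, h]; norm_num

/-- Such a pair lies in no triangle, or in two that induce opposite directions. -/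
theorem sum_inc_eq_zero (hab : a ≠ b) (h : ¬ K.OnBoundary {a, b}) :
    ∑ T ∈ K.triangles, o.inc T a b = 0 := by
  have h1 : ∑ T ∈ K.triangles, o.inc T a b = ∑ T ∈ K.star {a, b}, o.inc T a b := by
    refine (Finset.sum_subset (Finset.filter_subset _ _) fun T hT hn => ?_).symm
    refine o.inc_of_notMem hT fun hm => hn (mem_star.2 ⟨hT, ?_⟩)
    intro x hx
    simp only [Finset.mem_insert, Finset.mem_singleton] at hx
    rcases hx with rfl | rfl
    exacts [hm.1, hm.2]
  rw [h1]
  rw [onBoundary_pair_iff hab] at h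
  have h2 := card_star_le (K := K) hab
  have : (K.star {a, b}).card = 0 ∨ (K.star {a, b}).card = 2 := by omega
  rcases this with h0 | h0
  · rw [Finset.card_eq_zero.1 h0, Finset.sum_empty]
  · obtain ⟨T, T', hne, hs⟩ := Finset.card_eq_two.1 h0
    have hT := mem_star.1 (show T ∈ K.star {a, b} by simp [hs])
    have hT' := mem_star.1 (show T' ∈ K.star {a, b} by simp [hs])
    rw [hs, Finset.sum_pair hne, o.inc_compat hT.1 hT'.1 hne (hT.2 (by simp)) (hT.2 (by simp))
      (hT'.2 (by simp)) (hT'.2 (by simp)), add_neg_cancel]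

/-- The nodes of the mesh. -/
noncomputable def nodes (K : SurfaceMesh) : Finset E3 := K.triangles.biUnion id

theorem mem_nodes_of_mem (hT : T ∈ K.triangles) (ha : a ∈ T) : a ∈ K.nodes :=
  Finset.mem_biUnion.2 ⟨T, hT, ha⟩

/-- Summation over all ordered pairs of nodes no longer depends on the triangle, so it can be
exchanged with a sum over triangles. Every edge occurs in both directions, hence the factor. -/
theorem sum_ord_eq (hT : T ∈ K.triangles) {g : E3 → E3 → ℝ} (hg : ∀ a b, g b a = - g a b) :
    ∑ i, g (o.ord T i) (o.ord T (i + 1)) =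
      2⁻¹ * ∑ a ∈ K.nodes, ∑ b ∈ K.nodes, o.inc T a b * g a b := by
  have hsub : T ⊆ K.nodes := fun a ha => mem_nodes_of_mem hT ha
  have h1 : ∑ a ∈ K.nodes, ∑ b ∈ K.nodes, o.inc T a b * g a b =
      ∑ a ∈ T, ∑ b ∈ T, o.inc T a b * g a b := by
    rw [← Finset.sum_subset hsub]
    · refine Finset.sum_congr rfl fun a _ => (Finset.sum_subset hsub fun b _ hb => ?_).symm
      rw [o.inc_of_notMem hT (fun h => hb h.2), zero_mul]
    · intro a _ ha
      exact Finset.sum_eq_zero fun b _ => by rw [o.inc_of_notMem hT (fun h => ha h.1), zero_mul]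
  have h2 : ∀ f : E3 → ℝ, ∑ a ∈ T, f a = ∑ i, f (o.ord T i) := by
    intro f
    conv_lhs => rw [← o.image_ord T hT]
    exact Finset.sum_image fun i _ j _ h => o.ord_injective hT h
  rw [h1, h2]
  simp only [h2, Fin.sum_univ_three]
  have n0 := o.inc_next hT 0
  have n1 := o.inc_next hT 1
  have n2 := o.inc_next hT 2
  have p0 := o.inc_prev hT 0
  have p1 := o.inc_prev hT 1
  have p2 := o.inc_prev hT 2
  rw [show (0 : Fin 3) + 1 = 1 from rfl] at *
  rw [show (1 : Fin 3) + 1 = 2 from rfl] at *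
  rw [show (2 : Fin 3) + 1 = 0 from rfl] at *
  rw [n0, n1, n2, p0, p1, p2, o.inc_self hT, o.inc_self hT, o.inc_self hT,
    hg (o.ord T 0) (o.ord T 1), hg (o.ord T 1) (o.ord T 2), hg (o.ord T 2) (o.ord T 0)]
  ring

/-- Contributions of interior edges cancel. -/
theorem sum_sum_ord_eq_zero {g : E3 → E3 → ℝ} (hg : ∀ a b, g b a = - g a b)
    (h0 : ∀ a b, a ≠ b → K.OnBoundary {a, b} → g a b = 0) :
    ∑ T ∈ K.triangles, ∑ i, g (o.ord T i) (o.ord T (i + 1)) = 0 := by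
  rw [Finset.sum_congr rfl fun T hT => sum_ord_eq o hT hg, ← Finset.mul_sum, Finset.sum_comm]
  rw [Finset.sum_eq_zero, mul_zero]
  intro a _
  rw [Finset.sum_comm]
  refine Finset.sum_eq_zero fun b _ => ?_
  rw [← Finset.sum_mul]
  by_cases hab : a = b
  · rw [Finset.sum_eq_zero fun T hT => by rw [hab, o.inc_self hT], zero_mul]
  by_cases hb : K.OnBoundary {a, b}
  · rw [h0 a b hab hb, mul_zero]
  · rw [sum_inc_eq_zero o hab hb, zero_mul]

end SurfaceMesh

end Oriented

/-! ### Stokes' theorem on the surface for two triangulations -/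

section Stokes

open Set

theorem IsTriangulation.continuousOn_hat {F : Finset (Finset E3)} {S : Set E3}
    (hF : IsTriangulation F S) (a : E3) : ContinuousOn (hat F a) S := by
  have h2 := LocallyFinite.continuousOn_iUnion (X := E3) (g := hat F a)
    (locallyFinite_of_finite (fun s : {s // s ∈ F} => convexHull ℝ (s.1 : Set E3)))
    (fun s => isClosed_convexHull_finset s.1) (fun s => by
      have : ContinuousOn (fun x => if a ∈ s.1 then baryCoord s.1 a x else 0)
          (convexHull ℝ (s.1 : Set E3)) := by
        split_ifs
        · exact (continuous_baryCoord _ _).continuousOn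
        · exact continuousOn_const
      exact this.congr fun x hx => hF.hat_eq s.2 hx a)
  refine h2.mono fun x hx => ?_
  obtain ⟨s, hs, hxs⟩ := hF.cover x hx
  exact mem_iUnion.2 ⟨⟨s, hs⟩, hxs⟩

theorem edgeInt_param (f w : E3 → ℝ) (v : Fin 3 → E3) (p q : ℝ × ℝ) :
    edgeInt (fun p => f (param v p)) (fun p => w (param v p)) p q =
      edgeInt f w (param v p) (param v q) := by
  have h : ∀ t : ℝ, param v (p + t • (q - p)) = param v p + t • (param v q - param v p) := by
    intro t
    simp only [param, Prod.fst_add, Prod.snd_add, Prod.smul_fst, Prod.smul_snd, Prod.fst_sub,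
      Prod.snd_sub, smul_eq_mul]
    module
  simp only [edgeInt, h]

theorem circulation_param (f w : E3 → ℝ) (v : Fin 3 → E3) :
    circulation (fun p => f (param v p)) (fun p => w (param v p)) =
      ∑ i, edgeInt f w (v i) (v (i + 1)) := by
  have h0 : param v (0, 0) = v 0 := by simp [param]
  have h1 : param v (1, 0) = v 1 := by simp [param]
  have h2 : param v (0, 1) = v 2 := by simp [param]
  rw [circulation, edgeInt_param, edgeInt_param, edgeInt_param, h0, h1, h2, Fin.sum_univ_three]
  rfl

theorem lipschitzOn_mul {f g : ℝ × ℝ → ℝ} {C D : ℝ≥0} (hf : LipschitzOnWith C f refTriangle)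
    (hg : LipschitzOnWith D g refTriangle) :
    ∃ E, LipschitzOnWith E (fun p => f p * g p) refTriangle := by
  obtain ⟨f', hf', hff⟩ := exists_bddLip_extend hf isCompact_refTriangle
  obtain ⟨g', hg', hgg⟩ := exists_bddLip_extend hg isCompact_refTriangle
  obtain ⟨⟨E, hE⟩, -⟩ := hf'.mul hg'
  refine ⟨E, fun p hp q hq => ?_⟩
  simp only
  rw [hff hp, hff hq, hgg hp, hgg hq]
  exact hE p q

theorem integrableOn_jac_of_lipschitzOn {f g : ℝ × ℝ → ℝ} {C D : ℝ≥0}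
    (hf : LipschitzOnWith C f refTriangle) (hg : LipschitzOnWith D g refTriangle) :
    IntegrableOn (jac f g) refTriangle := by
  obtain ⟨f', ⟨⟨C', hf'⟩, -⟩, hff⟩ := exists_bddLip_extend hf isCompact_refTriangle
  obtain ⟨g', ⟨⟨D', hg'⟩, -⟩, hgg⟩ := exists_bddLip_extend hg isCompact_refTriangle
  refine (integrableOn_jac hf' hg').congr ?_
  filter_upwards [ae_mem_refInterior] with p hp
  have hn := isOpen_refInterior.mem_nhds hp
  refine jac_congr ?_ ?_ <;> filter_upwards [hn] with q hq
  · exact (hff (refInterior_subset hq)).symm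
  · exact (hgg (refInterior_subset hq)).symm

variable {K : SurfaceMesh} (o : K.Orientation) {F G : Finset (Finset E3)} {a b c : E3}

theorem SurfaceMesh.Orientation.convexHull_ord_subset {T : Finset E3} (hT : T ∈ K.triangles) :
    convexHull ℝ (Finset.univ.image (o.ord T) : Set E3) ⊆ K.space := by
  rw [o.image_ord T hT]
  exact K.isTriangulation.subset T hT

/-- Stokes' theorem on the interface. -/
theorem stokes (hF : IsTriangulation F K.space) (hG : IsTriangulation G K.space)
    (h0 : ∀ p q, p ≠ q → K.OnBoundary {p, q} → (∀ x ∈ segment ℝ p q, hat F a x = 0) ∨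
      ∀ x ∈ segment ℝ p q, hat G b x * hat G c x = 0) :
    ∑ T ∈ K.triangles, ∫ p in refTriangle,
      (2 * hat F a (param (o.ord T) p) * jac (fun p => hat G b (param (o.ord T) p))
          (fun p => hat G c (param (o.ord T) p)) p +
        hat G b (param (o.ord T) p) * jac (fun p => hat F a (param (o.ord T) p))
          (fun p => hat G c (param (o.ord T) p)) p -
        hat G c (param (o.ord T) p) * jac (fun p => hat F a (param (o.ord T) p))
          (fun p => hat G b (param (o.ord T) p)) p) = 0 := by
  -- The integrand is the derivative of the hat function of `a` times the Whitney form of `b`, `c`;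
  -- the edge function `g` is the circulation of this product. On boundary edges it vanishes by
  -- `h0`.
  rw [← SurfaceMesh.sum_sum_ord_eq_zero o (g := fun p q =>
    edgeInt (fun x => hat F a x * hat G b x) (hat G c) p q -
      edgeInt (fun x => hat F a x * hat G c x) (hat G b) p q)]
  · refine Finset.sum_congr rfl fun T hT => ?_
    have hS := o.convexHull_ord_subset hT
    obtain ⟨Ca, la⟩ := hF.lipschitzOn_hat_param hS a
    obtain ⟨Cb, lb⟩ := hG.lipschitzOn_hat_param hS b
    obtain ⟨Cc, lc⟩ := hG.lipschitzOn_hat_param hS c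
    obtain ⟨Cab, lab⟩ := lipschitzOn_mul la lb
    obtain ⟨Cac, lac⟩ := lipschitzOn_mul la lc
    rw [Finset.sum_sub_distrib, ← circulation_param, ← circulation_param,
      ← integral_jac_refTriangle lab lc, ← integral_jac_refTriangle lac lb, ← integral_sub]
    · refine integral_congr_ae ?_
      filter_upwards [hF.ae_mem (o.ord_affineIndependent hT) hS,
        hG.ae_mem (o.ord_affineIndependent hT) hS] with p ⟨s, hs, hp⟩ ⟨t, ht, hp'⟩
      have da := (hF.hasFDerivAt_hat hs hp a).differentiableAt
      have db := (hG.hasFDerivAt_hat ht hp' b).differentiableAt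
      have dc := (hG.hasFDerivAt_hat ht hp' c).differentiableAt
      simp only [jac]
      rw [fderiv_fun_mul da db, fderiv_fun_mul da dc]
      simp only [_root_.add_apply, _root_.smul_apply, smul_eq_mul]
      ring
    · exact integrableOn_jac_of_lipschitzOn lab lc
    · exact integrableOn_jac_of_lipschitzOn lac lb
  · intro p q
    rw [edgeInt_symm _ _ p q, edgeInt_symm _ _ p q]; ring
  · intro p q hpq hb
    have hseg : segment ℝ p q ⊆ K.space := by
      obtain ⟨e, he, -, hs, -⟩ := hb
      refine Subset.trans ?_ (Geometry.SimplicialComplex.convexHull_subset_space he)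
      rw [← convexHull_pair]
      exact convexHull_mono (by
        have := Finset.coe_subset.2 hs
        simpa using this)
    have hcont : ∀ d, ContinuousOn (fun t : ℝ => hat G d (p + t • (q - p))) (Icc 0 1) := fun d => by
      refine (hG.continuousOn_hat d).comp (by fun_prop) fun t ht => hseg ?_
      rw [segment_eq_image']; exact ⟨t, ht, rfl⟩
    rw [edgeInt_eq_zero (h0 p q hpq hb) (hcont b), edgeInt_eq_zero _ (hcont c), sub_zero]
    refine (h0 p q hpq hb).imp_right fun h x hx => ?_
    rw [mul_comm]; exact h x hx

end Stokes

/-! ### The Whitney spaces form a complex -/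

section Derivative

open Finset

variable {F : Finset (Finset E3)} {S : Set E3} {s : Finset E3} {x : E3}

theorem whitneyLocal_two_apply (s : Finset E3) (w : Fin 3 → E3) (x : E3) (u : Fin 2 → E3) :
    whitneyLocal s w x u = 2 *
      (baryCoord s (w 0) x * (baryDiff s (w 1) (u 0) * baryDiff s (w 2) (u 1) -
          baryDiff s (w 1) (u 1) * baryDiff s (w 2) (u 0)) -
        baryCoord s (w 1) x * (baryDiff s (w 0) (u 0) * baryDiff s (w 2) (u 1) -
          baryDiff s (w 0) (u 1) * baryDiff s (w 2) (u 0)) +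
        baryCoord s (w 2) x * (baryDiff s (w 0) (u 0) * baryDiff s (w 1) (u 1) -
          baryDiff s (w 0) (u 1) * baryDiff s (w 1) (u 0))) := by
  simp [whitneyLocal, wedgeOneForms_two, Fin.sum_univ_three, Fin.succAbove, Fin.lt_def]
  ring

/-- Eliminating the third node by means of the sum of the coordinates and of their differentials
shows that the form is constant on the triangle. -/
theorem whitneyLocal_two_eq (hs : AffineIndependent ℝ ((↑) : s → E3)) (hc : s.card = 3)
    {w : Fin 3 → E3} (hw : Function.Injective w) (hws : univ.image w = s)
    (hx : x ∈ convexHull ℝ (s : Set E3)) (u : Fin 2 → E3) :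
    whitneyLocal s w x u = 2 * (baryDiff s (w 0) (u 0) * baryDiff s (w 1) (u 1) -
      baryDiff s (w 0) (u 1) * baryDiff s (w 1) (u 0)) := by
  have e : ∀ {M : Type} [AddCommMonoid M] (f : E3 → M), ∑ a ∈ s, f a = f (w 0) + f (w 1) + f (w 2) := by
    intro M _ f
    rw [← hws, sum_image (fun i _ j _ h => hw h), Fin.sum_univ_three]
  have h1 := sum_baryCoord hs hx
  have h2 : ∀ v, baryDiff s (w 0) v + baryDiff s (w 1) v + baryDiff s (w 2) v = 0 := fun v => by
    have := congrArg (fun l => l v) (sum_baryDiff hs hc)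
    simpa [e] using this
  rw [e] at h1
  rw [whitneyLocal_two_apply]
  have a0 : baryDiff s (w 2) (u 0) = - baryDiff s (w 0) (u 0) - baryDiff s (w 1) (u 0) := by
    linarith [h2 (u 0)]
  have a1 : baryDiff s (w 2) (u 1) = - baryDiff s (w 0) (u 1) - baryDiff s (w 1) (u 1) := by
    linarith [h2 (u 1)]
  rw [a0, a1, show baryCoord s (w 2) x = 1 - baryCoord s (w 0) x - baryCoord s (w 1) x by linarith]
  ring

theorem whitney_of_notMem (h : ∀ s ∈ F, x ∉ openTriangle s) {r : ℕ} (w : Fin (r + 1) → E3) :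
    whitney F w x = 0 :=
  sum_eq_zero fun s hs => Set.indicator_of_notMem (h s (mem_filter.1 hs).1) _

theorem surfaceD_of_notMem (h : ∀ s ∈ F, x ∉ openTriangle s) {r : ℕ} (ω : Form r) :
    surfaceD F ω x = 0 :=
  sum_eq_zero fun s hs => Set.indicator_of_notMem (h s hs) _

theorem whitney_eq_zero {r : ℕ} {w : Fin (r + 1) → E3}
    (h : ∀ s ∈ F, ¬ univ.image w ⊆ s) : whitney F w = 0 := by
  ext1 x
  rw [whitney, filter_eq_empty_iff.2 (fun s hs => h s hs), sum_empty]; rfl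

/-- Multiply the differential of the hat function of `a` by the sum of all hat functions, which is
one, and subtract the hat function of `a` times the sum of all differentials, which is zero. Nodes
that share no triangle with `a` contribute zero forms. -/
theorem IsTriangulation.surfaceD_whitney_zero (hF : IsTriangulation F S) (a : E3) :
    surfaceD F (whitney F ![a]) = ∑ b ∈ (F.biUnion id).erase a, whitney F ![b, a] := by
  ext1 x
  rw [Finset.sum_apply]
  by_cases hx : ∃ s ∈ F, x ∈ openTriangle s
  · obtain ⟨s, hs, hx⟩ := hx
    have is := hF.indep s hs
    rw [hF.surfaceD_whitney hs hx]
    have him : univ.image ![a] ⊆ s ↔ a ∈ s := by simp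
    simp only [him]
    ext u
    rw [ContinuousAlternatingMap.sum_apply]
    simp only [hF.whitney_eq hs hx, image_two_subset]
    split_ifs with ha
    · have hsub : s.erase a ⊆ (F.biUnion id).erase a :=
        erase_subset_erase a (subset_biUnion_of_mem id hs)
      rw [extDeriv_whitneyLocal_zero, ← sum_subset hsub]
      · have h1 := add_sum_erase s (fun b => baryCoord s b x) ha
        have h2 := add_sum_erase s (fun b => baryDiff s b (u 0)) ha
        rw [sum_baryCoord is hx.1] at h1
        have h3 : ∑ b ∈ s, baryDiff s b (u 0) = 0 := by
          have := congrArg (fun l => l (u 0)) (sum_baryDiff is (hF.card_eq s hs))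
          simpa using this
        rw [h3] at h2
        have h4 : ∀ b ∈ s.erase a, (if (![b, a] : Fin (1 + 1) → E3) 0 ∈ s ∧
            (![b, a] : Fin (1 + 1) → E3) 1 ∈ s then
            whitneyLocal s ![b, a] x else 0) u = baryCoord s b x * baryDiff s a (u 0) -
              baryCoord s a x * baryDiff s b (u 0) := by
          intro b hb
          have hb := mem_of_mem_erase hb
          rw [if_pos ⟨hb, ha⟩, whitneyLocal_one_apply]; rfl
        rw [sum_congr rfl h4, sum_sub_distrib, ← sum_mul, ← mul_sum]
        simp only [Matrix.cons_val_zero]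
        rw [show ∑ b ∈ s.erase a, baryCoord s b x = 1 - baryCoord s a x by linarith,
          show ∑ b ∈ s.erase a, baryDiff s b (u 0) = - baryDiff s a (u 0) by linarith]
        ring
      · intro b hb hbs
        rw [if_neg]
        · rfl
        · exact fun h => hbs (mem_erase.2 ⟨(mem_erase.1 hb).1, h.1⟩)
    · symm
      refine sum_eq_zero fun b _ => ?_
      rw [if_neg]
      · rfl
      · exact fun h => ha h.2
  · push Not at hx
    rw [surfaceD_of_notMem hx]
    symm
    exact sum_eq_zero fun b _ => whitney_of_notMem hx _

/-- On a triangle that contains `a` and `b` only its third node contributes, with twice the exterior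
product of the differentials at `a` and `b`. -/
theorem IsTriangulation.surfaceD_whitney_pair (hF : IsTriangulation F S) {a b : E3} (hab : a ≠ b) :
    surfaceD F (whitney F ![a, b]) =
      ∑ c ∈ ((F.biUnion id).erase a).erase b, whitney F ![a, b, c] := by
  ext1 x
  rw [Finset.sum_apply]
  by_cases hx : ∃ s ∈ F, x ∈ openTriangle s
  · obtain ⟨s, hs, hx⟩ := hx
    have is := hF.indep s hs
    rw [hF.surfaceD_whitney hs hx]
    ext u
    rw [ContinuousAlternatingMap.sum_apply]
    have him : ∀ c, univ.image ![a, b, c] ⊆ s ↔ a ∈ s ∧ b ∈ s ∧ c ∈ s := by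
      intro c
      rw [image_subset_iff]
      simp [Fin.forall_fin_succ]
    simp only [hF.whitney_eq hs hx, image_two_subset, him]
    change (if a ∈ s ∧ b ∈ s then extDeriv (whitneyLocal s ![a, b]) x else 0) u = _
    by_cases h : a ∈ s ∧ b ∈ s
    · rw [if_pos h, extDeriv_whitneyLocal_one]
      have hc : ((s.erase a).erase b).card = 1 := by
        rw [card_erase_of_mem (mem_erase.2 ⟨hab.symm, h.2⟩),
          card_erase_of_mem h.1, hF.card_eq s hs]
      obtain ⟨c, hc⟩ := card_eq_one.1 hc
      have hcm : c ∈ (s.erase a).erase b := by simp [hc]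
      have hcs : c ∈ s := mem_of_mem_erase (mem_of_mem_erase hcm)
      have hcb : c ≠ b := ne_of_mem_erase hcm
      have hca : c ≠ a := ne_of_mem_erase (mem_of_mem_erase hcm)
      rw [sum_eq_single c]
      · rw [if_pos ⟨h.1, h.2, hcs⟩]
        have hinj : Function.Injective ![a, b, c] := by
          intro i j hij
          fin_cases i <;> fin_cases j <;> simp_all
        rw [whitneyLocal_two_eq is (hF.card_eq s hs) hinj ?_ hx.1]
        · rfl
        · refine eq_of_subset_of_card_le ((him c).2 ⟨h.1, h.2, hcs⟩) ?_
          rw [card_image_of_injective _ hinj, hF.card_eq s hs]; simp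
      · intro d hd hdc
        rw [if_neg]
        · rfl
        · rintro ⟨-, -, hds⟩
          have : d ∈ (s.erase a).erase b := by
            simp only [mem_erase] at hd ⊢
            exact ⟨hd.1, hd.2.1, hds⟩
          rw [hc, mem_singleton] at this
          exact hdc this
      · intro hn
        exact absurd (mem_erase.2 ⟨hcb, mem_erase.2 ⟨hca,
          mem_biUnion.2 ⟨s, hs, hcs⟩⟩⟩) hn
    · rw [if_neg h]
      symm
      refine sum_eq_zero fun c _ => ?_
      rw [if_neg]
      · rfl
      · exact fun h' => h ⟨h'.1, h'.2.1⟩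
  · push Not at hx
    rw [surfaceD_of_notMem hx]
    symm
    exact sum_eq_zero fun b _ => whitney_of_notMem hx _

/-- The forms that are differentiable in the interiors of the triangles. -/
def smoothForms (F : Finset (Finset E3)) (r : ℕ) : Submodule ℝ (Form r) where
  carrier := {ω | ∀ s ∈ F, ∀ x ∈ openTriangle s, DifferentiableAt ℝ (fun y => ω (planeProj s y)) x}
  add_mem' := fun h1 h2 s hs x hx => (h1 s hs x hx).add (h2 s hs x hx)
  zero_mem' := fun _ _ _ _ => differentiableAt_const _
  smul_mem' := fun c _ h s hs x hx => (h s hs x hx).const_smul c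

/-- The exterior derivative as a linear map. -/
noncomputable def surfaceDMap (F : Finset (Finset E3)) (r : ℕ) :
    smoothForms F r →ₗ[ℝ] Form (r + 1) where
  toFun ω := surfaceD F (ω : Form r)
  map_add' := by
    intro ω η
    ext1 x
    simp only [surfaceD, Pi.add_apply, ← sum_add_distrib]
    refine sum_congr rfl fun s hs => ?_
    by_cases hx : x ∈ openTriangle s
    · simp only [Set.indicator_of_mem hx]
      exact extDeriv_fun_add (ω.2 s hs x hx) (η.2 s hs x hx)
    · simp only [Set.indicator_of_notMem hx, add_zero]
  map_smul' := by
    intro c ω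
    ext1 x
    simp only [surfaceD, Pi.smul_apply, smul_sum, RingHom.id_apply]
    refine sum_congr rfl fun s hs => ?_
    by_cases hx : x ∈ openTriangle s
    · simp only [Set.indicator_of_mem hx]
      exact extDeriv_smul c (fun y => (ω : Form r) (planeProj s y))
    · simp only [Set.indicator_of_notMem hx, smul_zero]

theorem IsTriangulation.whitney_mem_smoothForms (hF : IsTriangulation F S) {r : ℕ}
    (w : Fin (r + 1) → E3) : whitney F w ∈ smoothForms F r :=
  fun _ hs _ hx => hF.differentiableAt_whitney hs hx w

theorem whitneySpace_le_smoothForms (K : SurfaceMesh) (tr : ZeroTrace) (r : ℕ) :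
    whitneySpace K tr r ≤ smoothForms K.triangles r := by
  refine Submodule.span_le.2 ?_
  rintro _ ⟨w, -, -, rfl⟩
  exact K.isTriangulation.whitney_mem_smoothForms w

/-- Linear statements about the exterior derivative hold on the Whitney space if they hold for the
basis forms. -/
theorem whitneySpace_induction {K : SurfaceMesh} {tr : ZeroTrace} {r : ℕ}
    (P : Form r → Form (r + 1) → Prop)
    (hP : ∀ w : Fin (r + 1) → E3, Function.Injective w → K.IsDof tr (univ.image w) →
      P (whitney K.triangles w) (surfaceD K.triangles (whitney K.triangles w)))
    (h0 : P 0 0) (hadd : ∀ ω η dω dη, ω ∈ whitneySpace K tr r → η ∈ whitneySpace K tr r →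
      P ω dω → P η dη → P (ω + η) (dω + dη))
    (hsmul : ∀ (c : ℝ) ω dω, ω ∈ whitneySpace K tr r → P ω dω → P (c • ω) (c • dω))
    {ω : Form r} (hω : ω ∈ whitneySpace K tr r) : P ω (surfaceD K.triangles ω) := by
  induction hω using Submodule.span_induction with
  | mem ω h =>
    obtain ⟨w, hw, hd, rfl⟩ := h
    exact hP w hw hd
  | zero =>
    have := (surfaceDMap K.triangles r).map_zero
    change surfaceD K.triangles 0 = 0 at this
    rwa [this]
  | add ω η hω hη h1 h2 =>
    have := (surfaceDMap K.triangles r).map_add ⟨ω, whitneySpace_le_smoothForms K tr r hω⟩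
      ⟨η, whitneySpace_le_smoothForms K tr r hη⟩
    change surfaceD K.triangles (ω + η) = surfaceD K.triangles ω + surfaceD K.triangles η at this
    rw [this]
    exact hadd _ _ _ _ hω hη h1 h2
  | smul c ω hω h =>
    have := (surfaceDMap K.triangles r).map_smul c ⟨ω, whitneySpace_le_smoothForms K tr r hω⟩
    change surfaceD K.triangles (c • ω) = c • surfaceD K.triangles ω at this
    rw [this]
    exact hsmul _ _ _ hω h

theorem SurfaceMesh.OnBoundary.mono {K : SurfaceMesh} {s t : Finset E3} (h : K.OnBoundary t)
    (hst : s ⊆ t) : K.OnBoundary s := by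
  obtain ⟨e, he, hc, hs, h1⟩ := h
  exact ⟨e, he, hc, hst.trans hs, h1⟩

theorem SurfaceMesh.IsDof.mono {K : SurfaceMesh} {tr : ZeroTrace} {s t : Finset E3}
    (h : K.IsDof tr s) (hst : s ⊆ t) (ht : t ∈ K.faces) : K.IsDof tr t :=
  ⟨ht, fun htr hb => h.2 htr (hb.mono hst)⟩

/-- Faces of boundary simplices are on the boundary, so a simplex with an active face is active; a
tuple that spans no simplex of the mesh has zero form. -/
theorem whitney_mem_whitneySpace {K : SurfaceMesh} {tr : ZeroTrace} {r : ℕ} {w : Fin (r + 1) → E3}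
    (hw : Function.Injective w) {s : Finset E3} (hs : K.IsDof tr s)
    (hsw : s ⊆ univ.image w) : whitney K.triangles w ∈ whitneySpace K tr r := by
  by_cases h : ∃ T ∈ K.triangles, univ.image w ⊆ T
  · obtain ⟨T, hT, hwT⟩ := h
    refine Submodule.subset_span ⟨w, hw, hs.mono hsw ?_, rfl⟩
    exact K.down_closed (SurfaceMesh.mem_triangles.1 hT).1 hwT
      ⟨w 0, mem_image_of_mem w (mem_univ 0)⟩
  · push Not at h
    rw [whitney_eq_zero h]
    exact Submodule.zero_mem _

theorem surfaceD_mem_whitneySpace {K : SurfaceMesh} {tr : ZeroTrace} {r : ℕ} (hr : r < 2)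
    {ω : Form r} (hω : ω ∈ whitneySpace K tr r) :
    surfaceD K.triangles ω ∈ whitneySpace K tr (r + 1) := by
  refine whitneySpace_induction (fun _ dω => dω ∈ whitneySpace K tr (r + 1)) ?_
    (Submodule.zero_mem _) (fun _ _ _ _ _ _ h1 h2 => Submodule.add_mem _ h1 h2)
    (fun c _ _ _ h => Submodule.smul_mem _ c h) hω
  intro w hw hd
  interval_cases r
  · obtain ⟨a, rfl⟩ : ∃ a, w = ![a] := ⟨w 0, by ext i : 1; fin_cases i; rfl⟩
    rw [K.isTriangulation.surfaceD_whitney_zero]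
    refine Submodule.sum_mem _ fun b hb => ?_
    refine whitney_mem_whitneySpace ?_ hd ?_
    · have := ne_of_mem_erase hb
      intro i j hij
      fin_cases i <;> fin_cases j <;> simp_all
    · intro x; simp; rintro rfl; simp
  · obtain ⟨a, b, rfl⟩ : ∃ a b, w = ![a, b] := ⟨w 0, w 1, by ext i : 1; fin_cases i <;> rfl⟩
    have hne : a ≠ b := fun h => absurd (@hw 0 1 h) (by simp)
    rw [K.isTriangulation.surfaceD_whitney_pair hne]
    refine Submodule.sum_mem _ fun b hb => ?_
    refine whitney_mem_whitneySpace ?_ hd ?_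
    · have h1 := ne_of_mem_erase hb
      have h2 := ne_of_mem_erase (mem_of_mem_erase hb)
      intro i j hij
      fin_cases i <;> fin_cases j <;> simp_all
    · rw [image_subset_iff]
      intro i _
      fin_cases i
      · exact mem_image.2 ⟨0, by simp, rfl⟩
      · exact mem_image.2 ⟨1, by simp, rfl⟩

end Derivative

/-! ### Forms on the barycentric refinement and their derivatives -/

section Subdivision

open Finset

namespace SurfaceMesh

variable {K : SurfaceMesh} {a b c : E3} {x : E3}

theorem sdNodes_subset_iff {p q : ℕ} {w : Fin (p + 1) → Finset E3} {z : Fin (q + 1) → Finset E3}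
    (hw : w ∈ K.flags p) (hz : z ∈ K.flags q) : sdNodes w ⊆ sdNodes z ↔ IsSubflag w z := by
  rw [sdNodes, image_subset_iff, IsSubflag, Set.range_subset_iff]
  constructor
  · intro h i
    obtain ⟨j, -, hj⟩ := mem_image.1 (h i (mem_univ i))
    exact ⟨j, center_injective ((mem_flags.1 hz).1 j) ((mem_flags.1 hw).1 i) hj⟩
  · intro h i _
    obtain ⟨j, hj⟩ := h i
    exact mem_image.2 ⟨j, mem_univ j, by rw [hj]⟩

/-- The form with given coefficients with respect to the Whitney basis of the barycentric
refinement. -/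
noncomputable def sdForm (K : SurfaceMesh) {q : ℕ} (R : (Fin (q + 1) → Finset E3) → ℝ) : Form q :=
  ∑ w ∈ K.flags q, R w • whitney K.sdTriangles (fun i => center (w i))

theorem Tri.sdForm_apply (h : K.Tri a b c) (hx : x ∈ openTriangle (sdNodes (flag a b c))) {q : ℕ}
    (R : (Fin (q + 1) → Finset E3) → ℝ) :
    K.sdForm R x = ∑ w ∈ (K.flags q).filter (fun w => IsSubflag (q := 2) w (flag a b c)),
      R w • whitneyLocal (sdNodes (flag a b c)) (fun i => center (w i)) x := by
  have hs : sdNodes (flag a b c) ∈ K.sdTriangles := mem_sdTriangles.2 ⟨a, b, c, h, rfl⟩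
  rw [sdForm, Finset.sum_apply, sum_filter]
  refine sum_congr rfl fun w hw => ?_
  rw [Pi.smul_apply, K.isTriangulation_sd.whitney_eq hs hx]
  have : univ.image (fun i => center (w i)) ⊆ sdNodes (flag a b c) ↔
      IsSubflag (q := 2) w (flag a b c) := sdNodes_subset_iff hw h.flag_mem
  simp only [this]
  split_ifs <;> simp

theorem sum_subflags_zero {M : Type*} [AddCommMonoid M] {z : Fin 3 → Finset E3}
    (hz : z ∈ K.flags 2) (g : (Fin 1 → Finset E3) → M) :
    ∑ w ∈ (K.flags 0).filter (fun w => IsSubflag (p := 0) (q := 2) w z), g w =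
      g ![z 0] + g ![z 1] + g ![z 2] := by
  have hm := (mem_flags.1 hz).2
  have : (K.flags 0).filter (fun w => IsSubflag (p := 0) (q := 2) w z) =
      univ.image (fun i : Fin 3 => (![z i] : Fin (0 + 1) → Finset E3)) := by
    ext w
    rw [mem_filter, mem_flags_zero, mem_image]
    constructor
    · rintro ⟨-, hs⟩
      obtain ⟨i, hi⟩ := hs ⟨0, rfl⟩
      exact ⟨i, mem_univ i, by ext j : 1; fin_cases j; exact hi⟩
    · rintro ⟨i, -, rfl⟩
      refine ⟨(mem_flags.1 hz).1 i, ?_⟩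
      rintro _ ⟨j, rfl⟩
      fin_cases j
      exact ⟨i, rfl⟩
  rw [this, sum_image, Fin.sum_univ_three]
  intro i _ j _ hij
  exact hm.injective (congrFun hij 0)

theorem sum_subflags_one {M : Type*} [AddCommMonoid M] {z : Fin 3 → Finset E3}
    (hz : z ∈ K.flags 2) (g : (Fin 2 → Finset E3) → M) :
    ∑ w ∈ (K.flags 1).filter (fun w => IsSubflag (p := 1) (q := 2) w z), g w =
      g ![z 0, z 1] + g ![z 0, z 2] + g ![z 1, z 2] := by
  obtain ⟨hf, hm⟩ := mem_flags.1 hz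
  have h01 : z 0 ⊂ z 1 := hm (by decide)
  have h12 : z 1 ⊂ z 2 := hm (by decide)
  have h02 : z 0 ⊂ z 2 := h01.trans h12
  have : (K.flags 1).filter (fun w => IsSubflag (p := 1) (q := 2) w z) =
      ({![z 0, z 1], ![z 0, z 2], ![z 1, z 2]} : Finset (Fin (1 + 1) → Finset E3)) := by
    ext w
    rw [mem_filter, mem_flags_one]
    simp only [mem_insert, mem_singleton]
    constructor
    · rintro ⟨⟨-, -, hw⟩, hs⟩
      obtain ⟨i, hi⟩ := hs ⟨0, rfl⟩
      obtain ⟨j, hj⟩ := hs ⟨1, rfl⟩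
      have hij : i < j := by
        by_contra hn
        have h1 := hm.monotone (not_lt.1 hn)
        rw [hi, hj] at h1
        exact hw.2 h1
      have hw' : w = ![z i, z j] := by ext k : 1; fin_cases k; exacts [hi.symm, hj.symm]
      rw [hw']
      revert hij
      fin_cases i <;> fin_cases j <;> simp
    · have hsub : ∀ i j, IsSubflag (p := 1) (q := 2) ![z i, z j] z := by
        rintro i j _ ⟨k, rfl⟩
        fin_cases k
        exacts [⟨i, rfl⟩, ⟨j, rfl⟩]
      rintro (rfl | rfl | rfl)
      · exact ⟨⟨hf 0, hf 1, h01⟩, hsub 0 1⟩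
      · exact ⟨⟨hf 0, hf 2, h02⟩, hsub 0 2⟩
      · exact ⟨⟨hf 1, hf 2, h12⟩, hsub 1 2⟩
  rw [this, sum_insert, sum_insert, sum_singleton, add_assoc]
  · rw [mem_singleton]
    intro h; exact h01.ne (congrFun h 0)
  · rw [mem_insert, mem_singleton]
    rintro (h | h)
    · exact h12.ne (congrFun h 1)
    · exact h01.ne (congrFun h 0)

theorem sum_subflags_two {M : Type*} [AddCommMonoid M] {z : Fin 3 → Finset E3}
    (hz : z ∈ K.flags 2) (g : (Fin 3 → Finset E3) → M) :
    ∑ w ∈ (K.flags 2).filter (fun w => IsSubflag (p := 2) (q := 2) w z), g w = g z := by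
  have : (K.flags 2).filter (fun w => IsSubflag (p := 2) (q := 2) w z) = {z} := by
    ext w
    rw [mem_filter, mem_singleton]
    constructor
    · rintro ⟨hw, hs⟩
      have hw' := (mem_flags.1 hw).2
      have hz' := (mem_flags.1 hz).2
      refine (StrictMono.range_inj hw' hz').1 (Set.eq_of_subset_of_ncard_le hs ?_ (Set.finite_range _))
      rw [Set.ncard_range_of_injective hw'.injective, Set.ncard_range_of_injective hz'.injective]
    · rintro rfl
      exact ⟨hz, subset_rfl⟩
  rw [this, sum_singleton]

theorem coboundary_one (R : (Fin 2 → Finset E3) → ℝ) (z : Fin 3 → Finset E3) :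
    coboundary R z = R ![z 1, z 2] - R ![z 0, z 2] + R ![z 0, z 1] := by
  have e0 : (fun i : Fin 2 => z ((0 : Fin 3).succAbove i)) = ![z 1, z 2] := by
    ext i : 1; fin_cases i <;> rfl
  have e1 : (fun i : Fin 2 => z ((1 : Fin 3).succAbove i)) = ![z 0, z 2] := by
    ext i : 1; fin_cases i <;> rfl
  have e2 : (fun i : Fin 2 => z ((2 : Fin 3).succAbove i)) = ![z 0, z 1] := by
    ext i : 1; fin_cases i <;> rfl
  rw [coboundary, Fin.sum_univ_three]
  change _ * R (fun i : Fin 2 => z ((0 : Fin 3).succAbove i)) +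
    _ * R (fun i : Fin 2 => z ((1 : Fin 3).succAbove i)) +
    _ * R (fun i : Fin 2 => z ((2 : Fin 3).succAbove i)) = _
  rw [e0, e1, e2]
  simp
  ring

theorem coboundary_zero (R : (Fin 1 → Finset E3) → ℝ) (z : Fin 2 → Finset E3) :
    coboundary R z = R ![z 1] - R ![z 0] := by
  have e0 : (fun i : Fin 1 => z ((0 : Fin 2).succAbove i)) = ![z 1] := by
    ext i : 1; fin_cases i; rfl
  have e1 : (fun i : Fin 1 => z ((1 : Fin 2).succAbove i)) = ![z 0] := by
    ext i : 1; fin_cases i; rfl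
  rw [coboundary, Fin.sum_univ_two]
  change _ * R (fun i : Fin 1 => z ((0 : Fin 2).succAbove i)) +
    _ * R (fun i : Fin 1 => z ((1 : Fin 2).succAbove i)) = _
  rw [e0, e1]
  simp
  ring

theorem smul_add_three_apply {n : ℕ} (A B C : E3 [⋀^Fin n]→L[ℝ] ℝ) (r s t : ℝ) (u : Fin n → E3) :
    (r • A + s • B + t • C) u = r * A u + s * B u + t * C u := rfl

theorem Tri.sdForm_zero_apply (h : K.Tri a b c) (hx : x ∈ openTriangle (sdNodes (flag a b c)))
    (R : (Fin 1 → Finset E3) → ℝ) (u : Fin 0 → E3) :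
    K.sdForm R x u = R ![{a}] * baryCoord (sdNodes (flag a b c)) (center {a}) x +
      R ![{a, b}] * baryCoord (sdNodes (flag a b c)) (center {a, b}) x +
      R ![{a, b, c}] * baryCoord (sdNodes (flag a b c)) (center {a, b, c}) x := by
  rw [h.sdForm_apply hx, sum_subflags_zero h.flag_mem]
  refine (smul_add_three_apply _ _ _ _ _ _ _).trans ?_
  rw [whitneyLocal_zero_apply, whitneyLocal_zero_apply, whitneyLocal_zero_apply]
  rfl

theorem Tri.sdForm_one_apply (h : K.Tri a b c) (hx : x ∈ openTriangle (sdNodes (flag a b c)))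
    (R : (Fin 2 → Finset E3) → ℝ) (u : Fin 1 → E3) :
    let l := fun s : Finset E3 => baryCoord (sdNodes (flag a b c)) (center s) x
    let d := fun s : Finset E3 => baryDiff (sdNodes (flag a b c)) (center s) (u 0)
    K.sdForm R x u = R ![{a}, {a, b}] * (l {a} * d {a, b} - l {a, b} * d {a}) +
      R ![{a}, {a, b, c}] * (l {a} * d {a, b, c} - l {a, b, c} * d {a}) +
      R ![{a, b}, {a, b, c}] * (l {a, b} * d {a, b, c} - l {a, b, c} * d {a, b}) := by
  intro l d
  rw [h.sdForm_apply hx, sum_subflags_one h.flag_mem]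
  refine (smul_add_three_apply _ _ _ _ _ _ _).trans ?_
  rw [whitneyLocal_one_apply, whitneyLocal_one_apply, whitneyLocal_one_apply]
  rfl

theorem Tri.sdForm_two_apply (h : K.Tri a b c) (hx : x ∈ openTriangle (sdNodes (flag a b c)))
    (R : (Fin 3 → Finset E3) → ℝ) (u : Fin 2 → E3) :
    let d := fun (s : Finset E3) v => baryDiff (sdNodes (flag a b c)) (center s) v
    K.sdForm R x u = R (flag a b c) * (2 * (d {a} (u 0) * d {a, b} (u 1) -
      d {a} (u 1) * d {a, b} (u 0))) := by
  intro d
  have hs : sdNodes (flag a b c) ∈ K.sdTriangles := mem_sdTriangles.2 ⟨a, b, c, h, rfl⟩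
  rw [h.sdForm_apply hx, sum_subflags_two h.flag_mem]
  rw [ContinuousAlternatingMap.smul_apply, smul_eq_mul, whitneyLocal_two_eq (K.isTriangulation_sd.indep _ hs)
    (K.isTriangulation_sd.card_eq _ hs) (flag_center_affineIndependent h).injective rfl hx.1]
  rfl

/-- The derivatives of the basis `q`-forms, combined with the coefficients `R`. -/
noncomputable def sdDerivForm (K : SurfaceMesh) {q : ℕ} (R : (Fin (q + 1) → Finset E3) → ℝ) :
    Form (q + 1) :=
  ∑ w ∈ K.flags q, R w • surfaceD K.sdTriangles (whitney K.sdTriangles (fun i => center (w i)))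

theorem Tri.sdDerivForm_apply (h : K.Tri a b c) (hx : x ∈ openTriangle (sdNodes (flag a b c)))
    {q : ℕ} (R : (Fin (q + 1) → Finset E3) → ℝ) :
    K.sdDerivForm R x = ∑ w ∈ (K.flags q).filter (fun w => IsSubflag (q := 2) w (flag a b c)),
      R w • extDeriv (whitneyLocal (sdNodes (flag a b c)) (fun i => center (w i))) x := by
  have hs : sdNodes (flag a b c) ∈ K.sdTriangles := mem_sdTriangles.2 ⟨a, b, c, h, rfl⟩
  rw [sdDerivForm, Finset.sum_apply, sum_filter]
  refine sum_congr rfl fun w hw => ?_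
  rw [Pi.smul_apply, K.isTriangulation_sd.surfaceD_whitney hs hx]
  have : univ.image (fun i => center (w i)) ⊆ sdNodes (flag a b c) ↔
      IsSubflag (q := 2) w (flag a b c) := sdNodes_subset_iff hw h.flag_mem
  simp only [this]
  split_ifs <;> simp

theorem sdForm_of_notMem (hx : ∀ s ∈ K.sdTriangles, x ∉ openTriangle s) {q : ℕ}
    (R : (Fin (q + 1) → Finset E3) → ℝ) : K.sdForm R x = 0 := by
  rw [sdForm, Finset.sum_apply]
  exact sum_eq_zero fun w _ => by rw [Pi.smul_apply, whitney_of_notMem hx, smul_zero]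

theorem sdDerivForm_of_notMem (hx : ∀ s ∈ K.sdTriangles, x ∉ openTriangle s) {q : ℕ}
    (R : (Fin (q + 1) → Finset E3) → ℝ) : K.sdDerivForm R x = 0 := by
  rw [sdDerivForm, Finset.sum_apply]
  exact sum_eq_zero fun w _ => by rw [Pi.smul_apply, surfaceD_of_notMem hx, smul_zero]

theorem Tri.sum_three (h : K.Tri a b c) (hx : x ∈ openTriangle (sdNodes (flag a b c))) :
    (baryCoord (sdNodes (flag a b c)) (center {a}) x +
      baryCoord (sdNodes (flag a b c)) (center {a, b}) x +
      baryCoord (sdNodes (flag a b c)) (center {a, b, c}) x = 1) ∧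
    ∀ u, baryDiff (sdNodes (flag a b c)) (center {a}) u +
      baryDiff (sdNodes (flag a b c)) (center {a, b}) u +
      baryDiff (sdNodes (flag a b c)) (center {a, b, c}) u = 0 := by
  have hs : sdNodes (flag a b c) ∈ K.sdTriangles := mem_sdTriangles.2 ⟨a, b, c, h, rfl⟩
  have is := K.isTriangulation_sd.indep _ hs
  have hi := flag_center_affineIndependent h
  constructor
  · have := (sum_baryCoord_corners hi hx.1).1
    rwa [Fin.sum_univ_three] at this
  · intro u
    have := congrArg (fun l => l u) (sum_baryDiff is (K.isTriangulation_sd.card_eq _ hs))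
    simp only [_root_.sum_apply, _root_.zero_apply] at this
    rw [sdNodes, sum_image (fun i _ j _ h => hi.injective h), Fin.sum_univ_three] at this
    exact this

/-- Compared on each small triangle after eliminating one barycentric coordinate. Since
`sdDerivForm` is differentiated term by term, linearity of `surfaceD` is not involved. -/
theorem sdDerivForm_zero (R : (Fin 1 → Finset E3) → ℝ) :
    K.sdDerivForm R = K.sdForm (coboundary R) := by
  ext1 x
  by_cases hx : ∃ s ∈ K.sdTriangles, x ∈ openTriangle s
  · obtain ⟨s, hs, hx⟩ := hx
    obtain ⟨a, b, c, h, rfl⟩ := mem_sdTriangles.1 hs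
    ext u
    obtain ⟨e1, e2⟩ := h.sum_three hx
    have e2 := e2 (u 0)
    rw [h.sdForm_one_apply hx, h.sdDerivForm_apply hx, sum_subflags_zero h.flag_mem]
    refine (smul_add_three_apply _ _ _ _ _ _ _).trans ?_
    rw [extDeriv_whitneyLocal_zero, extDeriv_whitneyLocal_zero, extDeriv_whitneyLocal_zero,
      coboundary_zero, coboundary_zero, coboundary_zero]
    change R ![{a}] * baryDiff (sdNodes (flag a b c)) (center {a}) (u 0) +
      R ![{a, b}] * baryDiff (sdNodes (flag a b c)) (center {a, b}) (u 0) +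
      R ![{a, b, c}] * baryDiff (sdNodes (flag a b c)) (center {a, b, c}) (u 0) =
      (R ![{a, b}] - R ![{a}]) * _ + (R ![{a, b, c}] - R ![{a}]) * _ +
      (R ![{a, b, c}] - R ![{a, b}]) * _
    beta_reduce
    rw [show baryDiff (sdNodes (flag a b c)) (center {a, b, c}) (u 0) =
        - baryDiff (sdNodes (flag a b c)) (center {a}) (u 0) -
        baryDiff (sdNodes (flag a b c)) (center {a, b}) (u 0) by linarith,
      show baryCoord (sdNodes (flag a b c)) (center {a, b, c}) x =
        1 - baryCoord (sdNodes (flag a b c)) (center {a}) x -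
        baryCoord (sdNodes (flag a b c)) (center {a, b}) x by linarith]
    ring
  · push Not at hx
    rw [sdForm_of_notMem hx, sdDerivForm_of_notMem hx]

theorem sdDerivForm_one (R : (Fin 2 → Finset E3) → ℝ) :
    K.sdDerivForm R = K.sdForm (coboundary R) := by
  ext1 x
  by_cases hx : ∃ s ∈ K.sdTriangles, x ∈ openTriangle s
  · obtain ⟨s, hs, hx⟩ := hx
    obtain ⟨a, b, c, h, rfl⟩ := mem_sdTriangles.1 hs
    ext u
    have e2 := (h.sum_three hx).2
    have f0 := e2 (u 0)
    have f1 := e2 (u 1)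
    rw [h.sdForm_two_apply hx, h.sdDerivForm_apply hx, sum_subflags_one h.flag_mem]
    refine (smul_add_three_apply _ _ _ _ _ _ _).trans ?_
    rw [extDeriv_whitneyLocal_one, extDeriv_whitneyLocal_one, extDeriv_whitneyLocal_one,
      coboundary_one]
    set d := fun (s : Finset E3) v => baryDiff (sdNodes (flag a b c)) (center s) v with hd
    change R ![{a}, {a, b}] * (2 * (d {a} (u 0) * d {a, b} (u 1) - d {a} (u 1) * d {a, b} (u 0))) +
      R ![{a}, {a, b, c}] * (2 * (d {a} (u 0) * d {a, b, c} (u 1) -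
        d {a} (u 1) * d {a, b, c} (u 0))) +
      R ![{a, b}, {a, b, c}] * (2 * (d {a, b} (u 0) * d {a, b, c} (u 1) -
        d {a, b} (u 1) * d {a, b, c} (u 0))) =
      (R ![{a, b}, {a, b, c}] - R ![{a}, {a, b, c}] + R ![{a}, {a, b}]) *
        (2 * (d {a} (u 0) * d {a, b} (u 1) - d {a} (u 1) * d {a, b} (u 0)))
    rw [show d {a, b, c} (u 0) = - d {a} (u 0) - d {a, b} (u 0) by simp only [hd]; linarith,
      show d {a, b, c} (u 1) = - d {a} (u 1) - d {a, b} (u 1) by simp only [hd]; linarith]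
    ring
  · push Not at hx
    rw [sdForm_of_notMem hx, sdDerivForm_of_notMem hx]

theorem hat_eq_zero_of_notMem {e : Finset E3} (he : e ∈ K.faces) {q : E3} (hq : q ∉ e)
    (hx : x ∈ convexHull ℝ (e : Set E3)) : hat K.triangles q x = 0 := by
  obtain ⟨T, hT, heT⟩ := exists_triangle he
  rw [K.isTriangulation.hat_eq hT (convexHull_mono (coe_subset.2 heT) hx)]
  split_ifs with hqT
  · rw [baryCoord_of_mem_convexHull_subset (K.isTriangulation.indep T hT) (K.indep he) heT hx
      hqT, if_neg hq]
  · rfl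

/-- If the refined hat function did not vanish at `x`, then `t` would be a superlevel set of the
coarse hat functions at `x`; but those of nodes outside `e` vanish on `e`. -/
theorem hat_sd_eq_zero {e t : Finset E3} (he : e ∈ K.faces) (ht : t ∈ K.faces) (hte : ¬ t ⊆ e)
    (hx : x ∈ convexHull ℝ (e : Set E3)) : hat K.sdTriangles (center t) x = 0 := by
  obtain ⟨T, hT, heT⟩ := exists_triangle he
  have hxT := convexHull_mono (coe_subset.2 heT) hx
  obtain ⟨s, hs, hxs⟩ := K.isTriangulation_sd.cover x (K.isTriangulation.subset T hT hxT)
  rw [K.isTriangulation_sd.hat_eq hs hxs]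
  split_ifs with hts
  · obtain ⟨a, b, c, h, rfl⟩ := mem_sdTriangles.1 hs
    obtain ⟨i, -, hi⟩ := mem_image.1 hts
    have hit := center_injective ((mem_flags.1 h.flag_mem).1 i) ht hi
    by_contra hne
    rw [← hi] at hne
    obtain ⟨τ, hτ, hl⟩ := h.exists_superlevel hxs i hne
    rw [hit] at hl
    apply hte
    intro q hq
    have : q ∈ {q | τ ≤ hat K.triangles q x} := by rw [hl]; exact hq
    by_contra hqe
    have h0 := hat_eq_zero_of_notMem he hqe hx
    have this : τ ≤ hat K.triangles q x := this
    linarith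
  · rfl

end SurfaceMesh

end Subdivision

/-! ### Two meshes of one surface have the same boundary -/

section Boundary

open Finset

/-- A short tangential step can leave the simplex only through a coordinate that is already zero, so
signs matter only there. -/
theorem eventually_mem_convexHull {s : Finset E3} (hs : AffineIndependent ℝ ((↑) : s → E3))
    {x v : E3} (hx : x ∈ convexHull ℝ (s : Set E3)) (hv : v ∈ vectorSpan ℝ (s : Set E3))
    (h : ∀ r ∈ s, baryCoord s r x = 0 → 0 ≤ baryDiff s r v) :
    ∀ᶠ ε : ℝ in 𝓝[>] 0, x + ε • v ∈ convexHull ℝ (s : Set E3) := by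
  have h1 : ∀ᶠ ε : ℝ in 𝓝[>] 0, ∀ r ∈ s, 0 ≤ baryCoord s r (x + ε • v) := by
    rw [Finset.eventually_all]
    intro r hr
    simp only [baryCoord_add, map_smul, smul_eq_mul]
    rcases (baryCoord_nonneg hs hx hr).eq_or_lt with h0 | h0
    · filter_upwards [self_mem_nhdsWithin] with ε hε
      rw [← h0, zero_add]
      exact mul_nonneg (le_of_lt hε) (h r hr h0.symm)
    · have : ContinuousAt (fun ε : ℝ => baryCoord s r x + ε * baryDiff s r v) 0 := by fun_prop
      have h2 := this.eventually (lt_mem_nhds (a := 0) (by simpa using h0))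
      exact (h2.filter_mono nhdsWithin_le_nhds).mono fun ε hε => hε.le
  filter_upwards [h1] with ε hε
  refine mem_convexHull_of_mem_affineSpan hs ?_ hε
  rw [add_comm]
  refine AffineSubspace.vadd_mem_of_mem_direction ?_ (convexHull_subset_affineSpan _ hx)
  rw [direction_affineSpan]
  exact Submodule.smul_mem _ _ hv

namespace SurfaceMesh

variable {K K' : SurfaceMesh} {a b c p q r x : E3}

theorem Tri.not_collinear (h : K.Tri p q r) {x d : E3} {α β γ : ℝ} (hp : p - x = α • d)
    (hq : q - x = β • d) (hr : r - x = γ • d) : False := by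
  have hi := K.isTriangulation.indep _ h.2.2.2
  have hinj : Function.Injective ![p, q, r] := by
    obtain ⟨h1, h2, h3, -⟩ := h
    intro i j hij
    fin_cases i <;> fin_cases j <;> simp_all
  have him : univ.image ![p, q, r] = {p, q, r} := by
    ext y; simp [Fin.exists_fin_succ, eq_comm]
  rw [← him] at hi
  have h3 := affineIndependent_of_image hi hinj
  rw [affineIndependent_iff_not_collinear_set] at h3
  apply h3
  rw [collinear_iff_exists_forall_eq_smul_vadd]
  refine ⟨x, d, ?_⟩
  simp only [Set.mem_insert_iff, Set.mem_singleton_iff, vadd_eq_add]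
  rintro y (rfl | rfl | rfl)
  · exact ⟨α, by rw [← hp]; abel⟩
  · exact ⟨β, by rw [← hq]; abel⟩
  · exact ⟨γ, by rw [← hr]; abel⟩

theorem Tri.coeff_eq_zero (h : K.Tri a b c) {α β : ℝ} (h0 : α • (b - a) + β • (c - a) = 0) :
    β = 0 := by
  by_contra hβ
  refine h.not_collinear (x := a) (d := b - a) (α := 0) (β := 1) (γ := -(β⁻¹ * α)) (by simp)
    (by simp) ?_
  have : β • (c - a) = -(α • (b - a)) := by rw [eq_neg_iff_add_eq_zero, add_comm]; exact h0
  rw [neg_smul, mul_smul, ← smul_neg, ← this, smul_smul, inv_mul_cancel₀ hβ, one_smul]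

/-- The directions in which one can leave a point of a boundary edge. -/
theorem exists_coeff_of_boundary (h : K.Tri a b c) (hb : K.OnBoundary {a, b})
    (hx : x ∈ openSegment ℝ a b) {u : E3} (hu : ∀ᶠ ε : ℝ in 𝓝[>] 0, x + ε • u ∈ K.space) :
    ∃ α β : ℝ, u = α • (b - a) + β • (c - a) ∧ 0 ≤ β := by
  have hT := h.2.2.2
  have iT := K.isTriangulation.indep _ hT
  obtain ⟨s, t, hs, ht, hst, rfl⟩ := hx
  have hab : a ∉ ({b, c} : Finset E3) := by simp [h.1, h.2.1]
  have hbc : b ∉ ({c} : Finset E3) := by simp [h.2.2.1]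
  have hxT : s • a + t • b ∈ convexHull ℝ (({a, b, c} : Finset E3) : Set E3) := by
    refine (convex_convexHull ℝ _) ?_ ?_ hs.le ht.le hst <;> apply subset_convexHull <;> simp
  have hca : baryCoord {a, b, c} a (s • a + t • b) = s := by
    have := baryCoord_sum_smul {a, b, c} a univ ![s, t] ![a, b] (by simpa using hst)
    simp only [Fin.sum_univ_two, Matrix.cons_val_zero, Matrix.cons_val_one] at this
    rw [this, baryCoord_self, baryCoord_of_ne iT (by simp) (by simp) h.1.symm]; ring
  have hcb : baryCoord {a, b, c} b (s • a + t • b) = t := by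
    have := baryCoord_sum_smul {a, b, c} b univ ![s, t] ![a, b] (by simpa using hst)
    simp only [Fin.sum_univ_two, Matrix.cons_val_zero, Matrix.cons_val_one] at this
    rw [this, baryCoord_self, baryCoord_of_ne iT (by simp) (by simp) h.1]; ring
  -- The coordinates at `a` and `b` are positive, so a triangle through the point contains the whole
  -- edge, and a boundary edge has only one triangle.
  have huniq : ∀ S ∈ K.triangles, s • a + t • b ∈ convexHull ℝ (S : Set E3) → S = {a, b, c} := by
    intro S hS hxS
    have key : ∀ y ∈ ({a, b, c} : Finset E3), 0 < baryCoord {a, b, c} y (s • a + t • b) → y ∈ S := by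
      intro y hy hpos
      have h1 := K.isTriangulation.hat_eq hT hxT y
      rw [K.isTriangulation.hat_eq hS hxS y, if_pos hy] at h1
      by_contra hyS
      rw [if_neg hyS] at h1
      linarith
    have ha := key a (by simp) (by rw [hca]; exact hs)
    have hb' := key b (by simp) (by rw [hcb]; exact ht)
    rw [onBoundary_pair_iff h.1, card_eq_one] at hb
    obtain ⟨U, hU⟩ := hb
    have e1 : S ∈ K.star {a, b} := mem_star.2 ⟨hS, by
      intro y hy; simp only [mem_insert, mem_singleton] at hy
      rcases hy with rfl | rfl <;> assumption⟩
    have e2 : {a, b, c} ∈ K.star {a, b} := mem_star.2 ⟨hT, by intro y; simp; tauto⟩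
    rw [hU, mem_singleton] at e1 e2
    rw [e1, e2]
  -- The remaining triangles are closed and miss the point; a short step within the surface thus
  -- stays in `{a, b, c}`.
  have hev : ∀ᶠ ε : ℝ in 𝓝[>] 0, ∀ S ∈ K.triangles, S ≠ {a, b, c} →
      (s • a + t • b) + ε • u ∉ convexHull ℝ (S : Set E3) := by
    rw [Finset.eventually_all]
    intro S hS
    by_cases hSe : S = {a, b, c}
    · exact Eventually.of_forall fun ε hne => absurd hSe hne
    have hn : (s • a + t • b) ∈ (convexHull ℝ (S : Set E3))ᶜ := fun hm => hSe (huniq S hS hm)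
    have hc : ContinuousAt (fun ε : ℝ => (s • a + t • b) + ε • u) 0 := by fun_prop
    have := hc.eventually ((isClosed_convexHull_finset S).isOpen_compl.mem_nhds (by simpa using hn))
    exact (this.filter_mono nhdsWithin_le_nhds).mono fun ε hε _ => hε
  obtain ⟨ε, ⟨h1, h2⟩, hε⟩ := ((hu.and hev).and self_mem_nhdsWithin).exists
  have hε : 0 < ε := hε
  obtain ⟨S, hS, hxS⟩ := K.isTriangulation.cover _ h1
  have hSe : S = {a, b, c} := by
    by_contra hne
    exact h2 S hS hne hxS
  rw [hSe] at hxS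
  have hc0 := baryCoord_nonneg iT hxS (a := c) (by simp)
  have e1 := sum_baryCoord iT hxS
  have e2 := sum_baryCoord_smul iT hxS
  rw [sum_insert hab, sum_insert hbc, sum_singleton] at e1 e2
  set la := baryCoord {a, b, c} a (s • a + t • b + ε • u)
  set lb := baryCoord {a, b, c} b (s • a + t • b + ε • u)
  set lc := baryCoord {a, b, c} c (s • a + t • b + ε • u)
  refine ⟨ε⁻¹ * (lb - t), ε⁻¹ * lc, ?_, by positivity⟩
  have h3 : ε • u = (lb - t) • (b - a) + lc • (c - a) := by
    have : ε • u = la • a + (lb • b + lc • c) - (s • a + t • b) := by rw [e2]; abel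
    rw [this, show la = 1 - lb - lc by linarith, show s = 1 - t by linarith]
    module
  rw [mul_smul, mul_smul, ← smul_add, ← h3, smul_smul, inv_mul_cancel₀ hε.ne', one_smul]

/-- Near `x` the surface lies in a half plane bounded by the line through `a` and `b`. Directions
available in both senses are parallel to this line, which forces `x` onto an edge of `K'` along it.
A second triangle at that edge would lie on the same side as the first and overlap it. -/
theorem exists_boundary_edge_of_generic (hΓ : K'.space = K.space) (hab : a ≠ b)
    (hb : K.OnBoundary {a, b}) (hx : x ∈ openSegment ℝ a b) (hn : x ∉ K'.nodes) :
    ∃ e ∈ K'.faces, e.card = 2 ∧ (K'.star e).card = 1 ∧ x ∈ convexHull ℝ (e : Set E3) := by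
  obtain ⟨c, h⟩ : ∃ c, K.Tri a b c := by
    have h1 := hb
    rw [onBoundary_pair_iff hab] at h1
    obtain ⟨T, hT⟩ := Finset.card_pos.1 (h1 ▸ Nat.one_pos)
    obtain ⟨hT, hs⟩ := mem_star.1 hT
    obtain ⟨c, h, -⟩ := exists_tri_edge hT (hs (by simp)) (hs (by simp)) hab
    exact ⟨c, h⟩
  have dir : ∀ {u : E3}, (∀ᶠ ε : ℝ in 𝓝[>] 0, x + ε • u ∈ K'.space) →
      ∃ α β : ℝ, u = α • (b - a) + β • (c - a) ∧ 0 ≤ β := fun hu =>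
    exists_coeff_of_boundary h hb hx (hΓ ▸ hu)
  have dir0 : ∀ {u : E3}, (∀ᶠ ε : ℝ in 𝓝[>] 0, x + ε • u ∈ K'.space) →
      (∀ᶠ ε : ℝ in 𝓝[>] 0, x + ε • (-u) ∈ K'.space) → ∃ α : ℝ, u = α • (b - a) := by
    intro u h1 h2
    obtain ⟨α, β, e1, hβ⟩ := dir h1
    obtain ⟨α', β', e2, hβ'⟩ := dir h2
    have := h.coeff_eq_zero (α := α + α') (β := β + β') (by
      rw [add_smul, add_smul, add_add_add_comm, ← e1, ← e2, add_neg_cancel])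
    have hβ0 : β = 0 := by linarith
    exact ⟨α, by rw [e1, hβ0, zero_smul, add_zero]⟩
  have hxS : x ∈ K'.space := by
    rw [hΓ]
    refine K.isTriangulation.subset _ h.2.2.2 ?_
    refine (convex_convexHull ℝ _).openSegment_subset ?_ ?_ hx <;> apply subset_convexHull <;> simp
  obtain ⟨T', hT', hxT'⟩ := K'.isTriangulation.cover x hxS
  obtain ⟨p, q, r, h', rfl, hqp, hrq⟩ := exists_tri_sorted hT' (fun y => baryCoord T' y x)
  have iT' := K'.isTriangulation.indep _ hT'
  have hr0 := baryCoord_nonneg iT' hxT' (a := r) (by simp)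
  have hsum := sum_baryCoord iT' hxT'
  have hsmul := sum_baryCoord_smul iT' hxT'
  have hpq : p ∉ ({q, r} : Finset E3) := by simp [h'.1, h'.2.1]
  have hqr : q ∉ ({r} : Finset E3) := by simp [h'.2.2.1]
  rw [sum_insert hpq, sum_insert hqr, sum_singleton] at hsum hsmul
  -- Otherwise both smaller coordinates vanish and `x` is the node `p`.
  have hq : 0 < baryCoord {p, q, r} q x := by
    by_contra hle
    have hq0 : baryCoord {p, q, r} q x = 0 := le_antisymm (not_lt.1 hle) (hr0.trans hrq)
    have hr0' : baryCoord {p, q, r} r x = 0 := le_antisymm (hrq.trans hq0.le) hr0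
    rw [hq0, hr0'] at hsum hsmul
    have : baryCoord {p, q, r} p x = 1 := by linarith
    rw [this] at hsmul
    simp only [one_smul, zero_smul, add_zero] at hsmul
    exact hn (hsmul ▸ mem_nodes_of_mem hT' (by simp))
  have hp : 0 < baryCoord {p, q, r} p x := hq.trans_le hqp
  have hV : ∀ y ∈ ({p, q, r} : Finset E3), y - x ∈ vectorSpan ℝ (({p, q, r} : Finset E3) : Set E3) := by
    intro y hy
    rw [← direction_affineSpan]
    exact AffineSubspace.vsub_mem_direction (subset_affineSpan ℝ _ (mem_coe.2 hy))
      (convexHull_subset_affineSpan _ hxT')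
  have fpos : ∀ y ∈ ({p, q, r} : Finset E3), ∀ᶠ ε : ℝ in 𝓝[>] 0, x + ε • (y - x) ∈ K'.space := by
    intro y hy
    refine (eventually_mem_convexHull iT' hxT' (hV y hy) fun z hz h0 => ?_).mono
      fun ε hε => K'.isTriangulation.subset _ hT' hε
    rw [← baryCoord_sub, h0, sub_zero]
    exact baryCoord_nonneg iT' (subset_convexHull ℝ _ (mem_coe.2 hy)) hz
  have fneg : ∀ y ∈ ({p, q, r} : Finset E3), 0 < baryCoord {p, q, r} y x →
      ∀ᶠ ε : ℝ in 𝓝[>] 0, x + ε • (-(y - x)) ∈ K'.space := by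
    intro y hy hpos
    refine (eventually_mem_convexHull iT' hxT' (Submodule.neg_mem _ (hV y hy)) fun z hz h0 => ?_).mono
      fun ε hε => K'.isTriangulation.subset _ hT' hε
    have hzy : y ≠ z := by rintro rfl; exact hpos.ne' h0
    rw [map_neg, ← baryCoord_sub, h0, baryCoord_of_ne iT' hz hy hzy, sub_zero, neg_zero]
  obtain ⟨αp, ep⟩ := dir0 (fpos p (by simp)) (fneg p (by simp) hp)
  obtain ⟨αq, eq⟩ := dir0 (fpos q (by simp)) (fneg q (by simp) hq)
  have hr : baryCoord {p, q, r} r x = 0 := by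
    by_contra hne
    obtain ⟨αr, er⟩ := dir0 (fpos r (by simp)) (fneg r (by simp) (lt_of_le_of_ne hr0 (Ne.symm hne)))
    exact h'.not_collinear ep eq er
  have hxe : x ∈ convexHull ℝ (({p, q} : Finset E3) : Set E3) := by
    refine mem_convexHull_of_baryCoord iT' (by intro y; simp; tauto) hxT' fun y hy hy' => ?_
    obtain rfl : y = r := by
      simp only [mem_insert, mem_singleton] at hy hy'; tauto
    exact hr
  have hpqf : {p, q} ∈ K'.faces := h'.mem_faces (by intro y; simp; tauto) (by simp)
  refine ⟨{p, q}, hpqf, card_pair h'.1, ?_, hxe⟩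
  · by_contra hcard
    obtain ⟨T₂, hT₂, hne⟩ : ∃ T₂ ∈ K'.star {p, q}, T₂ ≠ {p, q, r} := by
      by_contra hcon
      push Not at hcon
      apply hcard
      rw [card_eq_one]
      refine ⟨{p, q, r}, eq_singleton_iff_unique_mem.2 ⟨mem_star.2 ⟨hT', ?_⟩, hcon⟩⟩
      intro y; simp; tauto
    obtain ⟨hT₂, hs₂⟩ := mem_star.1 hT₂
    obtain ⟨r₂, h₂, rfl⟩ := exists_tri_edge hT₂ (hs₂ (by simp)) (hs₂ (by simp)) h'.1
    have iT₂ := K'.isTriangulation.indep _ hT₂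
    have hxT₂ : x ∈ convexHull ℝ (({p, q, r₂} : Finset E3) : Set E3) :=
      convexHull_mono (coe_subset.2 hs₂) hxe
    have ray : ∀ ε ∈ Set.Ioo (0 : ℝ) 1, x + ε • (r₂ - x) ∈
        convexHull ℝ (({p, q, r₂} : Finset E3) : Set E3) := fun ε hε =>
      (convex_convexHull ℝ _).add_smul_sub_mem hxT₂ (subset_convexHull ℝ _ (by simp)) ⟨hε.1.le, hε.2.le⟩
    obtain ⟨α₁, β₁, e₁, hβ₁⟩ := dir (fpos r (by simp))
    obtain ⟨α₂, β₂, e₂, hβ₂⟩ := dir (u := r₂ - x) (by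
      filter_upwards [Ioo_mem_nhdsGT (zero_lt_one' ℝ)] with ε hε
      exact K'.isTriangulation.subset _ hT₂ (ray ε hε))
    have hβ₁0 : 0 < β₁ := by
      refine lt_of_le_of_ne hβ₁ fun h0 => ?_
      rw [← h0, zero_smul, add_zero] at e₁
      exact h'.not_collinear ep eq e₁
    have hβ₂0 : 0 < β₂ := by
      refine lt_of_le_of_ne hβ₂ fun h0 => ?_
      rw [← h0, zero_smul, add_zero] at e₂
      exact h₂.not_collinear ep eq e₂
    have hαne : αp - αq ≠ 0 := by
      intro h0
      apply h'.1
      have h1 : p - x = q - x := by rw [ep, eq, sub_eq_zero.1 h0]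
      exact sub_left_injective h1
    have hd : (αp - αq) • (b - a) = p - q := by
      rw [sub_smul, ← ep, ← eq]; abel
    have hd' : b - a = (αp - αq)⁻¹ • (p - q) := by
      rw [← hd, smul_smul, inv_mul_cancel₀ hαne, one_smul]
    -- Modulo the direction of the edge, `r₂ - x` is a positive multiple of `r - x`, because both
    -- point into the half plane.
    have hv : r₂ - x = (β₂ / β₁) • (r - x) + ((α₂ - β₂ / β₁ * α₁) * (αp - αq)⁻¹) • (p - q) := by
      rw [mul_smul, ← hd', e₂, e₁, smul_add, smul_smul, smul_smul, div_mul_cancel₀ _ hβ₁0.ne']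
      module
    have hdr : baryDiff {p, q, r} r (r₂ - x) = β₂ / β₁ := by
      rw [hv, map_add, map_smul, map_smul, ← baryCoord_sub, ← baryCoord_sub, baryCoord_self, hr,
        baryCoord_of_ne iT' (by simp) (by simp) h'.2.1, baryCoord_of_ne iT' (by simp) (by simp) h'.2.2.1]
      simp
    have hmem := eventually_mem_convexHull iT' hxT' (v := r₂ - x) (by
      rw [hv]
      refine Submodule.add_mem _ (Submodule.smul_mem _ _ (hV r (by simp))) (Submodule.smul_mem _ _ ?_)
      rw [show p - q = (p - x) - (q - x) by abel]
      exact Submodule.sub_mem _ (hV p (by simp)) (hV q (by simp))) (by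
      intro y hy h0
      have : y = r := by
        simp only [mem_insert, mem_singleton] at hy
        rcases hy with rfl | rfl | rfl
        · exact absurd h0 hp.ne'
        · exact absurd h0 hq.ne'
        · rfl
      rw [this, hdr]; positivity)
    obtain ⟨ε, hε1, hε2⟩ := (hmem.and (Ioo_mem_nhdsGT (zero_lt_one' ℝ))).exists
    -- The hat function of `r` is evaluated at one point through both triangles: positive in the
    -- first, and zero in the second, which does not contain `r`.
    have h1 := K'.isTriangulation.hat_eq hT' hε1 r
    have h2 := K'.isTriangulation.hat_eq hT₂ (ray ε hε2) r
    have hrn : r ∉ ({p, q, r₂} : Finset E3) := by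
      intro hm
      simp only [mem_insert, mem_singleton] at hm
      rcases hm with hm | hm | hm
      · exact h'.2.1 hm.symm
      · exact h'.2.2.1 hm.symm
      · exact hne (by rw [hm])
    rw [h2, if_neg hrn, if_pos (by simp), baryCoord_add, hr, map_smul, hdr, smul_eq_mul,
      zero_add] at h1
    have : 0 < ε * (β₂ / β₁) := mul_pos hε2.1 (div_pos hβ₂0 hβ₁0)
    linarith

/-- Two meshes of the same surface have the same boundary. -/
theorem exists_boundary_edge (hΓ : K'.space = K.space) (hab : a ≠ b)
    (hb : K.OnBoundary {a, b}) (hx : x ∈ segment ℝ a b) :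
    ∃ e ∈ K'.faces, e.card = 2 ∧ (K'.star e).card = 1 ∧ x ∈ convexHull ℝ (e : Set E3) := by
  set B : Set E3 := ⋃ e ∈ K'.faceFinset.filter (fun e => e.card = 2 ∧ (K'.star e).card = 1),
    convexHull ℝ (e : Set E3) with hB
  have hBc : IsClosed B := by
    refine Set.Finite.isClosed_biUnion (finite_toSet _) fun e _ => ?_
    exact isClosed_convexHull_finset e
  set f : ℝ → E3 := fun t => a + t • (b - a) with hf
  have hfc : Continuous f := by rw [hf]; fun_prop
  have hinj : Function.Injective f := by
    intro s t hst
    have : s • (b - a) = t • (b - a) := add_left_cancel hst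
    exact smul_left_injective ℝ (sub_ne_zero.2 hab.symm) this
  have hfin : (f ⁻¹' (K'.nodes : Set E3)).Finite := (finite_toSet _).preimage hinj.injOn
  -- Only finitely many points of the edge are nodes of `K'`, so the generic case holds on a dense
  -- set of parameters, and the union `B` of the boundary edges of `K'` is closed.
  have hdense : Dense (f ⁻¹' (K'.nodes : Set E3))ᶜ := hfin.countable.dense_compl ℝ
  have h1 : Set.Ioo (0 : ℝ) 1 ∩ (f ⁻¹' (K'.nodes : Set E3))ᶜ ⊆ f ⁻¹' B := by
    rintro t ⟨ht, hn⟩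
    have hx : f t ∈ openSegment ℝ a b := by
      rw [openSegment_eq_image']; exact ⟨t, ht, rfl⟩
    obtain ⟨e, he, h2, h3, hxe⟩ := exists_boundary_edge_of_generic hΓ hab hb hx hn
    exact Set.mem_biUnion (mem_coe.2 (mem_filter.2 ⟨mem_faceFinset.2 he, h2, h3⟩)) hxe
  have h2 : Set.Icc (0 : ℝ) 1 ⊆ f ⁻¹' B := by
    rw [← closure_Ioo (zero_ne_one' ℝ)]
    refine closure_minimal ?_ (hBc.preimage hfc)
    exact (hdense.open_subset_closure_inter isOpen_Ioo).trans
      (closure_minimal h1 (hBc.preimage hfc))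
  rw [segment_eq_image'] at hx
  obtain ⟨t, ht, rfl⟩ := hx
  obtain ⟨e, he, hxe⟩ := Set.mem_iUnion₂.1 (h2 ht)
  obtain ⟨he, h3⟩ := mem_filter.1 he
  exact ⟨e, mem_faceFinset.1 he, h3.1, h3.2, hxe⟩

theorem hat_eq_zero_on_boundary (hΓ : K'.space = K.space) (hab : a ≠ b) (hb : K.OnBoundary {a, b})
    (hp : ¬ K'.OnBoundary {p}) (hx : x ∈ segment ℝ a b) : hat K'.triangles p x = 0 := by
  obtain ⟨e, he, h2, h3, hxe⟩ := exists_boundary_edge hΓ hab hb hx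
  exact hat_eq_zero_of_notMem he (fun h => hp ⟨e, he, h2, by simpa using h, h3⟩) hxe

theorem hat_mul_hat_eq_zero_on_boundary (hΓ : K'.space = K.space) (hab : a ≠ b)
    (hb : K.OnBoundary {a, b}) (hp : ¬ K'.OnBoundary {p, q}) (hx : x ∈ segment ℝ a b) :
    hat K'.triangles p x * hat K'.triangles q x = 0 := by
  obtain ⟨e, he, h2, h3, hxe⟩ := exists_boundary_edge hΓ hab hb hx
  by_cases h : p ∈ e
  · rw [hat_eq_zero_of_notMem he (q := q) (fun h' => hp ⟨e, he, h2, ?_, h3⟩) hxe, mul_zero]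
    intro y hy
    simp only [mem_insert, mem_singleton] at hy
    rcases hy with rfl | rfl <;> assumption
  · rw [hat_eq_zero_of_notMem he h hxe, zero_mul]

end SurfaceMesh

end Boundary

/-! ### Integration by parts in the pairing -/

section Adjoint

open Finset

variable {K : SurfaceMesh} (o : K.Orientation) {F G : Finset (Finset E3)} {a b c : E3}

theorem IsTriangulation.surfaceD_whitney_zero_mem {S : Set E3} (hF : IsTriangulation F S) (a : E3) :
    surfaceD F (whitney F ![a]) ∈ regularForms 1 := by
  rw [hF.surfaceD_whitney_zero]
  exact Submodule.sum_mem _ fun _ _ => whitney_mem_regularForms _ _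

theorem IsTriangulation.surfaceD_whitney_pair_mem {S : Set E3} (hF : IsTriangulation F S)
    (hab : a ≠ b) : surfaceD F (whitney F ![a, b]) ∈ regularForms 2 := by
  rw [hF.surfaceD_whitney_pair hab]
  exact Submodule.sum_mem _ fun _ _ => whitney_mem_regularForms _ _

/-- The product rule for a function times a 1-form, integrated by `stokes`. Its minus sign is
absorbed by exchanging the two 1-forms in the exterior product. -/
theorem pairing_surfaceD_zero (hF : IsTriangulation F K.space) (hG : IsTriangulation G K.space)
    (hbc : b ≠ c)
    (h0 : ∀ p q, p ≠ q → K.OnBoundary {p, q} → (∀ x ∈ segment ℝ p q, hat F a x = 0) ∨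
      ∀ x ∈ segment ℝ p q, hat G b x * hat G c x = 0) (h11 : 1 + 1 = 2) (h20 : 2 + 0 = 2) :
    pairing o h11 (whitney G ![b, c]) (surfaceD F (whitney F ![a])) =
      pairing o h20 (surfaceD G (whitney G ![b, c])) (whitney F ![a]) := by
  have key := stokes o hF hG h0
  symm
  rw [← sub_eq_zero, ← key, pairing_eq, pairing_eq, ← sum_sub_distrib]
  refine sum_congr rfl fun T hT => ?_
  have hS := o.convexHull_ord_subset hT
  rw [← integral_sub
    (integrable_integrand h20 (hG.surfaceD_whitney_pair_mem hbc) (whitney_mem_regularForms _ _) _)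
    (integrable_integrand h11 (whitney_mem_regularForms _ _) (hF.surfaceD_whitney_zero_mem a) _)]
  refine integral_congr_ae ?_
  filter_upwards [hF.ae_mem (o.ord_affineIndependent hT) hS,
    hG.ae_mem (o.ord_affineIndependent hT) hS] with p ⟨s, hs, hp⟩ ⟨t, ht, hp'⟩
  simp only [integrand]
  rw [wedge_one_one, wedge_two_zero, hG.surfaceD_whitney_one ht hp', hF.whitney_zero_apply hs hp.1,
    hG.whitney_one_fst ht hp', hG.whitney_one_snd ht hp', hF.surfaceD_whitney_zero_fst hs hp,
    hF.surfaceD_whitney_zero_snd hs hp]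
  simp only [jac, Matrix.cons_val_zero, Matrix.cons_val_one]
  ring

/-- The same product rule; here the factors already stand in the order of the rule, so the minus
sign remains. -/
theorem pairing_surfaceD_one (hF : IsTriangulation F K.space) (hG : IsTriangulation G K.space)
    (hbc : b ≠ c)
    (h0 : ∀ p q, p ≠ q → K.OnBoundary {p, q} → (∀ x ∈ segment ℝ p q, hat F a x = 0) ∨
      ∀ x ∈ segment ℝ p q, hat G b x * hat G c x = 0) (h02 : 0 + 2 = 2) (h11 : 1 + 1 = 2) :
    pairing o h02 (whitney F ![a]) (surfaceD G (whitney G ![b, c])) =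
      - pairing o h11 (surfaceD F (whitney F ![a])) (whitney G ![b, c]) := by
  have key := stokes o hF hG h0
  rw [← sub_eq_zero, sub_neg_eq_add, ← key, pairing_eq, pairing_eq, ← sum_add_distrib]
  refine sum_congr rfl fun T hT => ?_
  have hS := o.convexHull_ord_subset hT
  rw [← integral_add
    (integrable_integrand h02 (whitney_mem_regularForms _ _) (hG.surfaceD_whitney_pair_mem hbc) _)
    (integrable_integrand h11 (hF.surfaceD_whitney_zero_mem a) (whitney_mem_regularForms _ _) _)]
  refine integral_congr_ae ?_
  filter_upwards [hF.ae_mem (o.ord_affineIndependent hT) hS,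
    hG.ae_mem (o.ord_affineIndependent hT) hS] with p ⟨s, hs, hp⟩ ⟨t, ht, hp'⟩
  simp only [integrand]
  rw [wedge_one_one, wedge_zero_two, hG.surfaceD_whitney_one ht hp', hF.whitney_zero_apply hs hp.1,
    hG.whitney_one_fst ht hp', hG.whitney_one_snd ht hp', hF.surfaceD_whitney_zero_fst hs hp,
    hF.surfaceD_whitney_zero_snd hs hp]
  simp only [jac, Matrix.cons_val_zero, Matrix.cons_val_one]
  ring

section Linear

variable {q r : ℕ} (h : q + r = 2)

theorem pairing_sum_left {ι : Type*} (s : Finset ι) (R : ι → ℝ) {β : ι → Form q} {ω : Form r}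
    (hβ : ∀ i ∈ s, β i ∈ regularForms q) (hω : ω ∈ regularForms r) :
    pairing o h (∑ i ∈ s, R i • β i) ω = ∑ i ∈ s, R i * pairing o h (β i) ω := by
  have := map_sum ((pairingMap o h).flip ⟨ω, hω⟩) (fun i : s => R i • ⟨β i, hβ i i.2⟩) univ
  simp only [map_smul, smul_eq_mul] at this
  rw [← sum_coe_sort, ← sum_coe_sort s (fun i => R i * pairing o h (β i) ω)]
  refine Eq.trans ?_ this
  change _ = pairing o h (((∑ i : s, R i • ⟨β i, hβ i i.2⟩ : regularForms q)) : Form q) ω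
  congr 1
  simp

theorem pairing_add_right {β : Form q} {ω η : Form r} (hβ : β ∈ regularForms q)
    (hω : ω ∈ regularForms r) (hη : η ∈ regularForms r) :
    pairing o h β (ω + η) = pairing o h β ω + pairing o h β η :=
  (pairingMap o h ⟨β, hβ⟩).map_add ⟨ω, hω⟩ ⟨η, hη⟩

theorem pairing_smul_right {β : Form q} {ω : Form r} (hβ : β ∈ regularForms q)
    (hω : ω ∈ regularForms r) (c : ℝ) : pairing o h β (c • ω) = c * pairing o h β ω :=
  (pairingMap o h ⟨β, hβ⟩).map_smul c ⟨ω, hω⟩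

theorem pairing_zero_right {β : Form q} (hβ : β ∈ regularForms q) : pairing o h β 0 = 0 :=
  (pairingMap o h (r := r) ⟨β, hβ⟩).map_zero

end Linear

theorem sdForm_mem_regularForms {q : ℕ} (R : (Fin (q + 1) → Finset E3) → ℝ) :
    K.sdForm R ∈ regularForms q :=
  Submodule.sum_mem _ fun w _ => Submodule.smul_mem _ _ (whitney_mem_regularForms _ _)

variable {K' : SurfaceMesh} {tr : ZeroTrace}

theorem eq_pair_of_center (w : Fin 2 → Finset E3) :
    (fun i : Fin 2 => center (w i)) = ![center (w 0), center (w 1)] := by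
  ext i : 1; fin_cases i <;> rfl

/-- Integration by parts for 0-forms. -/
theorem pairing_surfaceD_of_zero (hΓ : K'.space = K.space) {R : (Fin 2 → Finset E3) → ℝ}
    (hR : tr = ZeroTrace.buffaChristiansen → ∀ a b, a ≠ b → K.OnBoundary {a, b} →
      R ![{a}, {a, b}] = 0)
    {ω : Form 0} (hω : ω ∈ whitneySpace K' tr 0) (h11 : 1 + 1 = 2) (h20 : 2 + 0 = 2) :
    pairing o h11 (K.sdForm R) (surfaceD K'.triangles ω) =
      pairing o h20 (K.sdForm (coboundary R)) ω := by
  refine whitneySpace_induction (tr := tr) (fun ω dω => dω ∈ regularForms 1 ∧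
    pairing o h11 (K.sdForm R) dω = pairing o h20 (K.sdForm (coboundary R)) ω) ?_ ?_ ?_ ?_ hω |>.2
  · intro w hw hd
    obtain ⟨a, rfl⟩ : ∃ a, w = ![a] := ⟨w 0, by ext i : 1; fin_cases i; rfl⟩
    have tK' : IsTriangulation K'.triangles K.space := hΓ ▸ K'.isTriangulation
    refine ⟨tK'.surfaceD_whitney_zero_mem a, ?_⟩
    rw [← SurfaceMesh.sdDerivForm_one, SurfaceMesh.sdForm, SurfaceMesh.sdDerivForm,
      pairing_sum_left o h11 _ _ (fun _ _ => whitney_mem_regularForms _ _)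
        (tK'.surfaceD_whitney_zero_mem a)]
    have hne : ∀ w ∈ K.flags 1, center (w 0) ≠ center (w 1) := fun w hw he => by
      obtain ⟨h0, h1, h01⟩ := SurfaceMesh.mem_flags_one.1 hw
      exact h01.ne (SurfaceMesh.center_injective h0 h1 he)
    rw [pairing_sum_left o h20 _ _ (fun w hw => ?_) (whitney_mem_regularForms _ _)]
    · refine sum_congr rfl fun w hw => ?_
      by_cases hRw : R w = 0
      · rw [hRw, zero_mul, zero_mul]
      congr 1
      have e := eq_pair_of_center w
      change pairing o h11 (whitney _ (fun i : Fin 2 => center (w i))) _ =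
        pairing o h20 (surfaceD _ (whitney _ (fun i : Fin 2 => center (w i)))) _
      rw [e]
      refine pairing_surfaceD_zero o tK' K.isTriangulation_sd (hne w hw) ?_ h11 h20
      intro p q hpq hb
      have him : univ.image ![a] = {a} := by simp
      -- In either case one factor vanishes on the boundary. With zero Whitney traces it is the hat
      -- function of an interior node of the other mesh, as both meshes have the same boundary.
      -- Otherwise it is the refined Whitney form, except for halves of boundary edges, whose
      -- coefficients vanish by `hR`.
      cases htr : tr with
      | whitney =>
        left
        intro x hx
        exact SurfaceMesh.hat_eq_zero_on_boundary hΓ hpq hb (him ▸ hd.2 htr) hx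
      | buffaChristiansen =>
        right
        intro x hx
        obtain ⟨h0, h1, h01⟩ := SurfaceMesh.mem_flags_one.1 hw
        have hpqf : {p, q} ∈ K.faces := by
          obtain ⟨e, he, -, hs, -⟩ := hb
          exact K.down_closed he hs (by simp)
        have hxc : x ∈ convexHull ℝ (({p, q} : Finset E3) : Set E3) := by
          rw [coe_pair, convexHull_pair]; exact hx
        by_cases hs1 : w 1 ⊆ {p, q}
        · exfalso
          apply hRw
          have hc1 := card_lt_card h01
          have hc0 := SurfaceMesh.card_pos h0
          have hc2 := card_le_card hs1
          rw [card_pair hpq] at hc2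
          have hw1 : w 1 = {p, q} :=
            eq_of_subset_of_card_le hs1 (by rw [card_pair hpq]; omega)
          obtain ⟨v, hv⟩ := card_eq_one.1 (show (w 0).card = 1 by omega)
          have hvm : v ∈ ({p, q} : Finset E3) := by rw [← hw1]; exact h01.1 (by simp [hv])
          have hweq : w = ![w 0, w 1] := by ext i : 1; fin_cases i <;> rfl
          rw [hweq, hv, hw1]
          simp only [mem_insert, mem_singleton] at hvm
          rcases hvm with rfl | rfl
          · exact hR htr _ _ hpq hb
          · rw [pair_comm]
            exact hR htr _ _ hpq.symm (by rwa [pair_comm])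
        · rw [SurfaceMesh.hat_sd_eq_zero hpqf h1 hs1 hxc, mul_zero]
    · have e := eq_pair_of_center w
      change surfaceD _ (whitney _ (fun i : Fin 2 => center (w i))) ∈ _
      rw [e]
      exact K.isTriangulation_sd.surfaceD_whitney_pair_mem (hne w hw)
  · refine ⟨Submodule.zero_mem _, ?_⟩
    rw [pairing_zero_right o h11 (sdForm_mem_regularForms R),
      pairing_zero_right o h20 (sdForm_mem_regularForms _)]
  · intro ω η dω dη hω hη h1 h2
    refine ⟨Submodule.add_mem _ h1.1 h2.1, ?_⟩
    rw [pairing_add_right o h11 (sdForm_mem_regularForms R) h1.1 h2.1,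
      pairing_add_right o h20 (sdForm_mem_regularForms _) (whitneySpace_le _ _ _ hω)
        (whitneySpace_le _ _ _ hη), h1.2, h2.2]
  · intro c ω dω hω h1
    refine ⟨Submodule.smul_mem _ c h1.1, ?_⟩
    rw [pairing_smul_right o h11 (sdForm_mem_regularForms R) h1.1,
      pairing_smul_right o h20 (sdForm_mem_regularForms _) (whitneySpace_le _ _ _ hω), h1.2]

/-- Integration by parts for 1-forms. -/
theorem pairing_surfaceD_of_one (hΓ : K'.space = K.space) {R : (Fin 1 → Finset E3) → ℝ}
    (hR : tr = ZeroTrace.buffaChristiansen → ∀ s ∈ K.faces, K.OnBoundary s → R ![s] = 0)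
    {ω : Form 1} (hω : ω ∈ whitneySpace K' tr 1) (h02 : 0 + 2 = 2) (h11 : 1 + 1 = 2) :
    pairing o h02 (K.sdForm R) (surfaceD K'.triangles ω) =
      - pairing o h11 (K.sdForm (coboundary R)) ω := by
  refine whitneySpace_induction (tr := tr) (fun ω dω => dω ∈ regularForms 2 ∧
    pairing o h02 (K.sdForm R) dω = - pairing o h11 (K.sdForm (coboundary R)) ω) ?_ ?_ ?_ ?_ hω |>.2
  · intro w hw hd
    obtain ⟨b, c, rfl⟩ : ∃ b c, w = ![b, c] := ⟨w 0, w 1, by ext i : 1; fin_cases i <;> rfl⟩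
    have hbc : b ≠ c := fun h => absurd (@hw 0 1 h) (by simp)
    have tK' : IsTriangulation K'.triangles K.space := hΓ ▸ K'.isTriangulation
    refine ⟨tK'.surfaceD_whitney_pair_mem hbc, ?_⟩
    have e1 : ∀ w : Fin 1 → Finset E3, (fun i => center (w i)) = ![center (w 0)] := fun w => by
      ext i : 1; fin_cases i; rfl
    rw [← SurfaceMesh.sdDerivForm_zero, SurfaceMesh.sdForm, SurfaceMesh.sdDerivForm,
      pairing_sum_left o h02 _ _ (fun _ _ => whitney_mem_regularForms _ _)
        (tK'.surfaceD_whitney_pair_mem hbc)]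
    rw [pairing_sum_left o h11 _ _ (fun w hw => ?_) (whitney_mem_regularForms _ _),
      ← sum_neg_distrib]
    · refine sum_congr rfl fun w hw => ?_
      by_cases hRw : R w = 0
      · rw [hRw, zero_mul, zero_mul, neg_zero]
      rw [← mul_neg]
      congr 1
      change pairing o h02 (whitney _ (fun i : Fin 1 => center (w i))) _ =
        - pairing o h11 (surfaceD _ (whitney _ (fun i : Fin 1 => center (w i)))) _
      rw [e1]
      refine pairing_surfaceD_one o K.isTriangulation_sd tK' hbc ?_ h02 h11
      intro p q hpq hb
      have him : univ.image ![b, c] = {b, c} := by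
        ext y; simp [Fin.exists_fin_succ, eq_comm]
      cases htr : tr with
      | whitney =>
        right
        intro x hx
        exact SurfaceMesh.hat_mul_hat_eq_zero_on_boundary hΓ hpq hb (him ▸ hd.2 htr) hx
      | buffaChristiansen =>
        left
        intro x hx
        have h0 := SurfaceMesh.mem_flags_zero.1 hw
        have hpqf : {p, q} ∈ K.faces := by
          obtain ⟨e, he, -, hs, -⟩ := hb
          exact K.down_closed he hs (by simp)
        have hxc : x ∈ convexHull ℝ (({p, q} : Finset E3) : Set E3) := by
          rw [coe_pair, convexHull_pair]; exact hx
        refine SurfaceMesh.hat_sd_eq_zero hpqf h0 (fun hs => hRw ?_) hxc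
        have hweq : w = ![w 0] := by ext i : 1; fin_cases i; rfl
        rw [hweq]
        exact hR htr _ h0 (hb.mono hs)
    · change surfaceD _ (whitney _ (fun i : Fin 1 => center (w i))) ∈ _
      rw [e1]
      exact K.isTriangulation_sd.surfaceD_whitney_zero_mem _
  · refine ⟨Submodule.zero_mem _, ?_⟩
    rw [pairing_zero_right o h02 (sdForm_mem_regularForms R),
      pairing_zero_right o h11 (sdForm_mem_regularForms _), neg_zero]
  · intro ω η dω dη hω hη h1 h2
    refine ⟨Submodule.add_mem _ h1.1 h2.1, ?_⟩
    rw [pairing_add_right o h02 (sdForm_mem_regularForms R) h1.1 h2.1,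
      pairing_add_right o h11 (sdForm_mem_regularForms _) (whitneySpace_le _ _ _ hω)
        (whitneySpace_le _ _ _ hη), h1.2, h2.2, neg_add]
  · intro c ω dω hω h1
    refine ⟨Submodule.smul_mem _ c h1.1, ?_⟩
    rw [pairing_smul_right o h02 (sdForm_mem_regularForms R) h1.1,
      pairing_smul_right o h11 (sdForm_mem_regularForms _) (whitneySpace_le _ _ _ hω), h1.2,
      mul_neg]

end Adjoint

/-! ### Splitting the pairing into small triangles -/

section Frame

open Finset

theorem map_pair_add_left (β : E3 [⋀^Fin 2]→L[ℝ] ℝ) (x y z : E3) :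
    β ![x + y, z] = β ![x, z] + β ![y, z] := by
  have := β.map_update_add ![x, z] 0 x y
  have e : ∀ t, Function.update ![x, z] 0 t = ![t, z] := fun t => by
    ext i : 1; fin_cases i <;> simp
  rwa [e, e, e] at this

theorem map_pair_smul_left (β : E3 [⋀^Fin 2]→L[ℝ] ℝ) (c : ℝ) (x z : E3) :
    β ![c • x, z] = c * β ![x, z] := by
  have := β.map_update_smul ![x, z] 0 c x
  have e : ∀ t, Function.update ![x, z] 0 t = ![t, z] := fun t => by
    ext i : 1; fin_cases i <;> simp
  rwa [e, e] at this

theorem map_pair_swap (β : E3 [⋀^Fin 2]→L[ℝ] ℝ) (x y : E3) : β ![x, y] = - β ![y, x] := by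
  have := β.map_swap ![y, x] (show (0 : Fin 2) ≠ 1 by decide)
  have e : ![y, x] ∘ (Equiv.swap (0 : Fin 2) 1) = ![x, y] := by
    ext i : 1; fin_cases i <;> rfl
  rw [e] at this
  exact this

theorem map_pair_self (β : E3 [⋀^Fin 2]→L[ℝ] ℝ) (x : E3) : β ![x, x] = 0 := by
  have := map_pair_swap β x x
  linarith

theorem map_pair_frame (β : E3 [⋀^Fin 2]→L[ℝ] ℝ) (x y x' y' : ℝ) (e₁ e₂ : E3) :
    β ![x • e₁ + y • e₂, x' • e₁ + y' • e₂] = (x * y' - y * x') * β ![e₁, e₂] := by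
  rw [map_pair_add_left, map_pair_smul_left, map_pair_smul_left, map_pair_swap β e₁ (_ + _),
    map_pair_swap β e₂ (_ + _), map_pair_add_left, map_pair_add_left, map_pair_smul_left,
    map_pair_smul_left, map_pair_smul_left, map_pair_smul_left, map_pair_self, map_pair_self,
    map_pair_swap β e₂ e₁]
  ring

theorem map_single_frame (β : E3 [⋀^Fin 1]→L[ℝ] ℝ) (x y : ℝ) (e₁ e₂ : E3) :
    β ![x • e₁ + y • e₂] = x * β ![e₁] + y * β ![e₂] := by
  have e : ∀ t s : E3, Function.update ![s] 0 t = ![t] := fun t s => by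
    ext i : 1; fin_cases i; simp
  have h1 := β.map_update_add ![e₁] 0 (x • e₁) (y • e₂)
  have h2 := β.map_update_smul ![e₁] 0 x e₁
  have h3 := β.map_update_smul ![e₁] 0 y e₂
  simp only [e, smul_eq_mul] at h1 h2 h3
  rw [h1, h2, h3]

/-- An alternating 2-form on the span of `e₁` and `e₂` changes by the determinant of the frame; the
three splittings of the degree are checked separately. -/
theorem wedge_frame {q r : ℕ} (h : q + r = 2) (β : E3 [⋀^Fin q]→L[ℝ] ℝ) (ω : E3 [⋀^Fin r]→L[ℝ] ℝ)
    (x y x' y' : ℝ) (e₁ e₂ : E3) :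
    wedge β ω (fun k => ![x • e₁ + y • e₂, x' • e₁ + y' • e₂] (Fin.cast h k)) =
      (x * y' - y * x') * wedge β ω (fun k => ![e₁, e₂] (Fin.cast h k)) := by
  have hq : q = 0 ∨ q = 1 ∨ q = 2 := by omega
  rcases hq with rfl | rfl | rfl
  · obtain rfl : r = 2 := by omega
    rw [wedge_zero_two, wedge_zero_two, map_pair_frame]; ring
  · obtain rfl : r = 1 := by omega
    rw [wedge_one_one, wedge_one_one]
    simp only [map_single_frame]
    ring
  · obtain rfl : r = 0 := by omega
    rw [wedge_two_zero, wedge_two_zero, map_pair_frame]; ring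

/-- The barycentric coordinates on the reference triangle. -/
def refCoord (i : Fin 3) (p : ℝ × ℝ) : ℝ := ![1 - p.1 - p.2, p.1, p.2] i

/-- The corners of the reference triangle. -/
def refNode (i : Fin 3) : ℝ × ℝ := ![(0, 0), (1, 0), (0, 1)] i

/-- The part of the reference triangle with a given order of the barycentric coordinates. -/
def refSector (i j k : Fin 3) : Set (ℝ × ℝ) :=
  {p | 0 ≤ refCoord k p ∧ refCoord k p ≤ refCoord j p ∧ refCoord j p ≤ refCoord i p}

/-- The affine map from the reference triangle to one of its sectors. -/
noncomputable def refMap (i j k : Fin 3) (p : ℝ × ℝ) : ℝ × ℝ :=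
  refNode i + p.1 • ((2 : ℝ)⁻¹ • (refNode j - refNode i)) +
    p.2 • ((3 : ℝ)⁻¹ • (refNode j + refNode k - (2 : ℝ) • refNode i))

theorem image_refMap {i j k : Fin 3} (hij : i ≠ j) (hik : i ≠ k) (hjk : j ≠ k) :
    refMap i j k '' refTriangle = refSector i j k := by
  ext ⟨x, y⟩
  simp only [Set.mem_image, Prod.exists, refTriangle, refSector, Set.mem_ofPred_eq]
  constructor
  · rintro ⟨s, t, ⟨h1, h2, h3⟩, he⟩
    revert he hij hik hjk
    fin_cases i <;> fin_cases j <;> fin_cases k <;>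
      simp [refMap, refNode, refCoord] <;> rintro rfl rfl <;> refine ⟨?_, ?_, ?_⟩ <;> linarith
  · rintro ⟨h1, h2, h3⟩
    refine ⟨2 * (refCoord j (x, y) - refCoord k (x, y)), 3 * refCoord k (x, y),
      ⟨by linarith, by linarith, ?_⟩, ?_⟩
    · revert h1 h2 h3 hij hik hjk
      fin_cases i <;> fin_cases j <;> fin_cases k <;>
        simp [refCoord] <;> intros <;> linarith
    · revert hij hik hjk
      fin_cases i <;> fin_cases j <;> fin_cases k <;>
        simp [refMap, refNode, refCoord] <;> constructor <;> ring

theorem refMap_det {i j k : Fin 3} (hij : i ≠ j) (hik : i ≠ k) (hjk : j ≠ k) :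
    |((2 : ℝ)⁻¹ • (refNode j - refNode i)).1 *
        ((3 : ℝ)⁻¹ • (refNode j + refNode k - (2 : ℝ) • refNode i)).2 -
      ((2 : ℝ)⁻¹ • (refNode j - refNode i)).2 *
        ((3 : ℝ)⁻¹ • (refNode j + refNode k - (2 : ℝ) • refNode i)).1| = 1 / 6 := by
  revert hij hik hjk
  fin_cases i <;> fin_cases j <;> fin_cases k <;> simp [refNode] <;> norm_num [abs_of_pos, abs_of_neg]

theorem refSector_subset {i j k : Fin 3} (hij : i ≠ j) (hik : i ≠ k) (hjk : j ≠ k) :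
    refSector i j k ⊆ refTriangle := by
  rintro p ⟨h1, h2, h3⟩
  revert h1 h2 h3 hij hik hjk
  fin_cases i <;> fin_cases j <;> fin_cases k <;> simp [refCoord, refTriangle] <;> intros <;>
    refine ⟨?_, ?_, ?_⟩ <;> linarith

theorem measurableSet_refSector (i j k : Fin 3) : MeasurableSet (refSector i j k) := by
  have hc : ∀ l, Continuous (refCoord l) := by
    intro l; unfold refCoord; fin_cases l <;> simp <;> fun_prop
  exact ((isClosed_le continuous_const (hc k)).inter ((isClosed_le (hc k) (hc j)).inter
    (isClosed_le (hc j) (hc i)))).measurableSet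

/-- The six sectors overlap only along the three medians, which are null. -/
theorem integral_refTriangle_eq_sum {g : ℝ × ℝ → ℝ} (hg : IntegrableOn g refTriangle) :
    ∫ p in refTriangle, g p = ∑ i : Fin 3, ((∫ p in refSector i (i + 1) (i + 2), g p) +
      ∫ p in refSector i (i + 2) (i + 1), g p) := by
  have n1 : ∀ i : Fin 3, i ≠ i + 1 := by decide
  have n2 : ∀ i : Fin 3, i ≠ i + 2 := by decide
  have n3 : ∀ i : Fin 3, i + 1 ≠ i + 2 := by decide
  have hi1 : ∀ i : Fin 3, Integrable ((refSector i (i + 1) (i + 2)).indicator g) := fun i =>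
    (integrable_indicator_iff (measurableSet_refSector _ _ _)).2
      (hg.mono_set (refSector_subset (n1 i) (n2 i) (n3 i)))
  have hi2 : ∀ i : Fin 3, Integrable ((refSector i (i + 2) (i + 1)).indicator g) := fun i =>
    (integrable_indicator_iff (measurableSet_refSector _ _ _)).2
      (hg.mono_set (refSector_subset (n2 i) (n1 i) (n3 i).symm))
  simp only [← integral_indicator (measurableSet_refSector _ _ _),
    ← integral_indicator isClosed_refTriangle.measurableSet]
  rw [sum_congr rfl fun i _ => (integral_add (hi1 i) (hi2 i)).symm,
    ← integral_finsetSum univ (f := fun (i : Fin 3) a =>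
      (refSector i (i + 1) (i + 2)).indicator g a + (refSector i (i + 2) (i + 1)).indicator g a)
      fun i _ => (hi1 i).add (hi2 i)]
  refine integral_congr_ae ?_
  filter_upwards [ae_line_ne (a := 1) (b := -1) 0 (Or.inl one_ne_zero),
    ae_line_ne (a := 2) (b := 1) 1 (Or.inr one_ne_zero),
    ae_line_ne (a := 1) (b := 2) 1 (Or.inl one_ne_zero)] with p h1 h2 h3
  rw [Fin.sum_univ_three]
  by_cases hp : p ∈ refTriangle
  · rw [Set.indicator_of_mem hp]
    obtain ⟨p1, p2, p3⟩ := hp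
    simp only [Set.indicator, refSector, Set.mem_ofPred_eq]
    simp [refCoord]
    grind
  · have hz : ∀ i j k : Fin 3, i ≠ j → i ≠ k → j ≠ k → (refSector i j k).indicator g p = 0 :=
      fun i j k hij hik hjk => Set.indicator_of_notMem (fun h => hp (refSector_subset hij hik hjk h)) _
    rw [Set.indicator_of_notMem hp, hz _ _ _ (n1 0) (n2 0) (n3 0), hz _ _ _ (n1 1) (n2 1) (n3 1),
      hz _ _ _ (n1 2) (n2 2) (n3 2), hz _ _ _ (n2 0) (n1 0) (n3 0).symm,
      hz _ _ _ (n2 1) (n1 1) (n3 1).symm, hz _ _ _ (n2 2) (n1 2) (n3 2).symm]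
    simp

theorem corner_eq (v : Fin 3 → E3) (j : Fin 3) :
    v j = v 0 + (refNode j).1 • (v 1 - v 0) + (refNode j).2 • (v 2 - v 0) := by
  fin_cases j <;> simp [refNode]

theorem center_pair {a b : E3} (hab : a ≠ b) : center {a, b} = (2 : ℝ)⁻¹ • (a + b) := by
  rw [center_eq (by simp), card_pair hab, sum_pair hab, smul_add]; simp

theorem center_singleton (a : E3) : center {a} = a := by
  rw [center_eq (by simp)]; simp

theorem center_triple {a b c : E3} (hab : a ≠ b) (hac : a ≠ c) (hbc : b ≠ c) :
    center {a, b, c} = (3 : ℝ)⁻¹ • (a + b + c) := by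
  have h1 : a ∉ ({b, c} : Finset E3) := by simp [hab, hac]
  have h2 : b ∉ ({c} : Finset E3) := by simp [hbc]
  rw [center_eq (by simp), card_insert_of_notMem h1, card_pair hbc,
    sum_insert h1, sum_insert h2, sum_singleton, smul_add, smul_add]
  norm_num [add_assoc]

/-- The determinant of the map onto a sector is `1 / 6` or `-1 / 6`. It enters once in modulus, by
the change of variables, and once with sign, by the change of frame; the factor in front is thus
only the orientation sign of the small triangle. -/
theorem setIntegral_refSector {q r : ℕ} (h : q + r = 2) (β : Form q) (ω : Form r) {v : Fin 3 → E3}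
    (hv : Function.Injective v) {i j k : Fin 3} (hij : i ≠ j) (hik : i ≠ k) (hjk : j ≠ k) :
    ∫ p in refSector i j k, integrand h β ω v p =
      6 * (((2 : ℝ)⁻¹ • (refNode j - refNode i)).1 *
          ((3 : ℝ)⁻¹ • (refNode j + refNode k - (2 : ℝ) • refNode i)).2 -
        ((2 : ℝ)⁻¹ • (refNode j - refNode i)).2 *
          ((3 : ℝ)⁻¹ • (refNode j + refNode k - (2 : ℝ) • refNode i)).1) *
      ∫ p in refTriangle, integrand h β ω
        (fun l => center (SurfaceMesh.flag (v i) (v j) (v k) l)) p := by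
  have hdet := refMap_det hij hik hjk
  set U := (2 : ℝ)⁻¹ • (refNode j - refNode i) with hU
  set V := (3 : ℝ)⁻¹ • (refNode j + refNode k - (2 : ℝ) • refNode i) with hV
  have hne : U.1 * V.2 - U.2 * V.1 ≠ 0 := fun h0 => by rw [h0] at hdet; norm_num at hdet
  have e1 := setIntegral_affine (refNode i) U V hne isClosed_refTriangle.measurableSet
    (integrand h β ω v)
  have e2 : (fun p : ℝ × ℝ => refNode i + p.1 • U + p.2 • V) '' refTriangle = refSector i j k :=
    image_refMap hij hik hjk
  rw [e2, hdet] at e1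
  have hc0 : center (SurfaceMesh.flag (v i) (v j) (v k) 0) = v i := center_singleton _
  have hc1 : center (SurfaceMesh.flag (v i) (v j) (v k) 1) = (2 : ℝ)⁻¹ • (v i + v j) :=
    center_pair (hv.ne hij)
  have hc2 : center (SurfaceMesh.flag (v i) (v j) (v k) 2) = (3 : ℝ)⁻¹ • (v i + v j + v k) :=
    center_triple (hv.ne hij) (hv.ne hik) (hv.ne hjk)
  have f1 : (2 : ℝ)⁻¹ • (v i + v j) - v i = U.1 • (v 1 - v 0) + U.2 • (v 2 - v 0) := by
    rw [corner_eq v i, corner_eq v j]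
    simp only [hU, Prod.smul_fst, Prod.smul_snd, Prod.fst_sub, Prod.snd_sub, smul_eq_mul]
    module
  have f2 : (3 : ℝ)⁻¹ • (v i + v j + v k) - v i = V.1 • (v 1 - v 0) + V.2 • (v 2 - v 0) := by
    rw [corner_eq v i, corner_eq v j, corner_eq v k]
    simp only [hV, Prod.smul_fst, Prod.smul_snd, Prod.fst_sub, Prod.snd_sub, Prod.fst_add,
      Prod.snd_add, smul_eq_mul]
    module
  have e3 : ∀ p : ℝ × ℝ, integrand h β ω
      (fun l => center (SurfaceMesh.flag (v i) (v j) (v k) l)) p =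
      (U.1 * V.2 - U.2 * V.1) * integrand h β ω v (refNode i + p.1 • U + p.2 • V) := by
    intro p
    have hp : param (fun l => center (SurfaceMesh.flag (v i) (v j) (v k) l)) p =
        param v (refNode i + p.1 • U + p.2 • V) := by
      simp only [param, hc0, hc1, hc2, f1, f2]
      rw [corner_eq v i]
      simp only [Prod.smul_fst, Prod.smul_snd, Prod.fst_add, Prod.snd_add, smul_eq_mul]
      module
    simp only [integrand, hp, hc0, hc1, hc2, f1, f2]
    rw [wedge_frame]
  simp only [e3]
  rw [integral_const_mul, e1, ← mul_assoc, mul_assoc 6, ← sq, ← sq_abs, hdet]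
  norm_num

namespace SurfaceMesh

variable {K : SurfaceMesh} (o : K.Orientation)

theorem sum_inc_mul {T : Finset E3} (hT : T ∈ K.triangles) (g : E3 → E3 → ℝ) :
    ∑ a ∈ K.nodes, ∑ b ∈ K.nodes, o.inc T a b * g a b =
      ∑ i, (g (o.ord T i) (o.ord T (i + 1)) - g (o.ord T (i + 1)) (o.ord T i)) := by
  have := sum_ord_eq o hT (g := fun a b => g a b - g b a) (fun a b => by ring)
  rw [this]
  have e : ∑ a ∈ K.nodes, ∑ b ∈ K.nodes, o.inc T a b * g b a =
      - ∑ a ∈ K.nodes, ∑ b ∈ K.nodes, o.inc T a b * g a b := by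
    rw [sum_comm, ← sum_neg_distrib]
    refine sum_congr rfl fun a _ => ?_
    rw [← sum_neg_distrib]
    refine sum_congr rfl fun b _ => ?_
    rw [o.inc_swap hT]; ring
  simp only [mul_sub, sum_sub_distrib, e]
  ring

/-- The small triangle at the node `a`, the edge `a b` and the triangle `T`. -/
noncomputable def smallTriangle (a b : E3) (T : Finset E3) : Fin 3 → Finset E3 :=
  ![{a}, {a, b}, T]

/-- The pairing as a sum over the triangles of the barycentric refinement. -/
theorem pairing_eq_sum {q r : ℕ} (h : q + r = 2) {β : Form q} {ω : Form r}
    (hβ : β ∈ regularForms q) (hω : ω ∈ regularForms r) :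
    pairing o h β ω = ∑ T ∈ K.triangles, ∑ a ∈ K.nodes, ∑ b ∈ K.nodes, o.inc T a b *
      ∫ p in refTriangle, integrand h β ω (fun l => center (smallTriangle a b T l)) p := by
  rw [pairing_eq]
  refine sum_congr rfl fun T hT => ?_
  rw [sum_inc_mul o hT, integral_refTriangle_eq_sum (integrable_integrand h hβ hω _)]
  have n1 : ∀ i : Fin 3, i ≠ i + 1 := by decide
  have n2 : ∀ i : Fin 3, i ≠ i + 2 := by decide
  have n3 : ∀ i : Fin 3, i + 1 ≠ i + 2 := by decide
  have hinj := o.ord_injective hT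
  have hfl : ∀ i j k : Fin 3, i ≠ j → i ≠ k → j ≠ k →
      flag (o.ord T i) (o.ord T j) (o.ord T k) = smallTriangle (o.ord T i) (o.ord T j) T := by
    intro i j k hij hik hjk
    have : ({o.ord T i, o.ord T j, o.ord T k} : Finset E3) = T := by
      conv_rhs => rw [← o.image_ord T hT]
      have hu : (univ : Finset (Fin 3)) = {i, j, k} := by
        revert hij hik hjk; revert i j k; decide
      rw [hu]; simp [image_insert]
    simp only [flag, smallTriangle, this]
  -- Sectors whose first two corners follow the cyclic order are positive and the others negative;
  -- these signs agree with the incidence numbers.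
  have s1 : ∀ i, ∫ p in refSector i (i + 1) (i + 2), integrand h β ω (o.ord T) p =
      ∫ p in refTriangle, integrand h β ω
        (fun l => center (smallTriangle (o.ord T i) (o.ord T (i + 1)) T l)) p := by
    intro i
    rw [setIntegral_refSector h β ω hinj (n1 i) (n2 i) (n3 i), hfl _ _ _ (n1 i) (n2 i) (n3 i)]
    refine (congrArg (· * _) ?_).trans (one_mul _)
    fin_cases i <;> simp [refNode] <;> norm_num
  have s2 : ∀ i, ∫ p in refSector i (i + 2) (i + 1), integrand h β ω (o.ord T) p =
      - ∫ p in refTriangle, integrand h β ω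
        (fun l => center (smallTriangle (o.ord T i) (o.ord T (i + 2)) T l)) p := by
    intro i
    rw [setIntegral_refSector h β ω hinj (n2 i) (n1 i) (n3 i).symm,
      hfl _ _ _ (n2 i) (n1 i) (n3 i).symm]
    refine (congrArg (· * _) ?_).trans (neg_one_mul _)
    fin_cases i <;> simp [refNode] <;> norm_num
  simp only [s1, s2, Fin.sum_univ_three]
  simp only [show (0 : Fin 3) + 1 = 1 from rfl, show (1 : Fin 3) + 1 = 2 from rfl,
    show (2 : Fin 3) + 1 = 0 from rfl, show (0 : Fin 3) + 2 = 2 from rfl,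
    show (1 : Fin 3) + 2 = 0 from rfl, show (2 : Fin 3) + 2 = 1 from rfl]
  ring

end SurfaceMesh

end Frame

/-! ### Integrals over the reference triangle and averages over nodes -/

section Averages

open Set

theorem integral_refTriangle_one : ∫ _ in refTriangle, (1 : ℝ) = 1 / 2 := by
  have e : refTriangle =ᵐ[volume] regionBetween (fun _ : ℝ => (0 : ℝ)) (fun x => 1 - x) (Ioc 0 1) := by
    filter_upwards [ae_line_ne (a := 1) (b := 0) 0 (Or.inl one_ne_zero),
      ae_line_ne (a := 0) (b := 1) 0 (Or.inr one_ne_zero),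
      ae_line_ne (a := 1) (b := 1) 1 (Or.inl one_ne_zero)] with p h1 h2 h3
    refine propext (show p ∈ refTriangle ↔
      p ∈ regionBetween (fun _ : ℝ => (0 : ℝ)) (fun x => 1 - x) (Ioc 0 1) from ?_)
    simp only [refTriangle, regionBetween, mem_ofPred_eq, mem_Ioc, mem_Ioo]
    simp only [one_mul, zero_mul, add_zero, zero_add] at h1 h2 h3
    constructor
    · rintro ⟨k1, k2, k3⟩
      have := lt_of_le_of_ne k1 (Ne.symm h1)
      have := lt_of_le_of_ne k2 (Ne.symm h2)
      have := lt_of_le_of_ne k3 h3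
      exact ⟨⟨by linarith, by linarith⟩, by linarith, by linarith⟩
    · rintro ⟨⟨k1, k2⟩, k3, k4⟩
      exact ⟨k1.le, k3.le, by linarith⟩
  rw [setIntegral_congr_set e, setIntegral_const, smul_eq_mul, mul_one, Measure.real,
    Measure.volume_eq_prod, volume_regionBetween_eq_integral (μ := volume)
      ((continuous_const.integrableOn_Icc).mono_set Ioc_subset_Icc_self)
      (((by fun_prop : Continuous fun x : ℝ => 1 - x).integrableOn_Icc).mono_set Ioc_subset_Icc_self)
      measurableSet_Ioc (fun x hx => by linarith [hx.2])]
  rw [ENNReal.toReal_ofReal (setIntegral_nonneg measurableSet_Ioc fun x hx => by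
      simp only [Pi.sub_apply]; linarith [hx.2]), ← intervalIntegral.integral_of_le zero_le_one]
  simp only [Pi.sub_apply, sub_zero]
  rw [intervalIntegral.integral_sub (by simp) (by simp)]
  simp; norm_num

theorem integral_refTriangle_rotate (g : ℝ × ℝ → ℝ) :
    ∫ p in refTriangle, g p = ∫ p in refTriangle, g (p.2, 1 - p.1 - p.2) := by
  have h := setIntegral_affine (0, 1) (0, -1) (1, -1) (by norm_num)
    isClosed_refTriangle.measurableSet g
  have e : (fun p : ℝ × ℝ => ((0 : ℝ), (1 : ℝ)) + p.1 • ((0 : ℝ), (-1 : ℝ)) + p.2 • ((1 : ℝ), (-1 : ℝ)))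
      = fun p => (p.2, 1 - p.1 - p.2) := by
    ext p <;> simp; ring
  have e' := fun p => congrFun e p
  simp only [e'] at h
  rw [show (fun p : ℝ × ℝ => (p.2, 1 - p.1 - p.2)) '' refTriangle = refTriangle from ?_] at h
  · simpa using h
  · ext ⟨x, y⟩
    simp only [mem_image, Prod.exists, refTriangle, mem_ofPred_eq]
    constructor
    · rintro ⟨s, t, ⟨h1, h2, h3⟩, he⟩
      simp only [Prod.mk.injEq] at he
      obtain ⟨rfl, rfl⟩ := he
      exact ⟨h2, by linarith, by linarith⟩
    · rintro ⟨h1, h2, h3⟩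
      exact ⟨1 - x - y, x, ⟨by linarith, h1, by linarith⟩, Prod.ext rfl (by simp; ring)⟩

theorem integrableOn_refTriangle {g : ℝ × ℝ → ℝ} (hg : Continuous g) : IntegrableOn g refTriangle :=
  hg.continuousOn.integrableOn_compact isCompact_refTriangle

/-- The affine rotation of the reference triangle permutes the coordinates, so their integrals are
equal; they add up to the area `1 / 2`. -/
theorem integral_refCoord (i : Fin 3) : ∫ p in refTriangle, refCoord i p = 1 / 6 := by
  have h1 : ∫ p in refTriangle, p.1 = ∫ p in refTriangle, p.2 := integral_refTriangle_rotate _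
  have h2 : ∫ p in refTriangle, p.2 = ∫ p in refTriangle, (1 - p.1 - p.2) :=
    integral_refTriangle_rotate _
  have h3 : ∫ p in refTriangle, (1 - p.1 - p.2) = 1 / 2 - (∫ p in refTriangle, p.1) -
      ∫ p in refTriangle, p.2 := by
    rw [integral_sub, integral_sub, integral_refTriangle_one] <;>
      exact integrableOn_refTriangle (by fun_prop)
  fin_cases i
  · change ∫ p in refTriangle, (1 - p.1 - p.2) = _; linarith
  · change ∫ p in refTriangle, p.1 = _; linarith
  · change ∫ p in refTriangle, p.2 = _; linarith

theorem continuous_refCoord (i : Fin 3) : Continuous (refCoord i) := by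
  unfold refCoord; fin_cases i <;> simp <;> fun_prop

theorem integral_sum_refCoord (m : Fin 3 → ℝ) :
    ∫ p in refTriangle, ∑ i, refCoord i p * m i = (∑ i, m i) / 6 := by
  rw [integral_finsetSum Finset.univ (f := fun i p => refCoord i p * m i) fun i _ =>
    integrableOn_refTriangle ((continuous_refCoord i).mul continuous_const), Finset.sum_div]
  refine Finset.sum_congr rfl fun i _ => ?_
  rw [integral_mul_const, integral_refCoord]; ring

theorem refCoord_pos {p : ℝ × ℝ} (hp : p ∈ refInterior) (i : Fin 3) : 0 < refCoord i p := by
  obtain ⟨h1, h2, h3⟩ := hp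
  fin_cases i
  · change 0 < 1 - p.1 - p.2; linarith
  · exact h1
  · exact h2

theorem sum_refCoord (p : ℝ × ℝ) : ∑ i, refCoord i p = 1 := by
  simp [Fin.sum_univ_three, refCoord]; ring

theorem param_eq_sum (v : Fin 3 → E3) (p : ℝ × ℝ) : param v p = ∑ i, refCoord i p • v i := by
  rw [param_eq]; simp [Fin.sum_univ_three, refCoord]

/-- The average of a function on the nodes of a simplex. -/
noncomputable def nodeAverage (x : E3 → ℝ) (s : Finset E3) : ℝ := (s.card : ℝ)⁻¹ * ∑ p ∈ s, x p

theorem nodeAverage_singleton (x : E3 → ℝ) (a : E3) : nodeAverage x {a} = x a := by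
  simp [nodeAverage]

theorem nodeAverage_pair (x : E3 → ℝ) {a b : E3} (hab : a ≠ b) :
    nodeAverage x {a, b} = (x a + x b) / 2 := by
  rw [nodeAverage, Finset.card_pair hab, Finset.sum_pair hab]; push_cast; ring

namespace SurfaceMesh

variable {K : SurfaceMesh} {a b c : E3} {p : ℝ × ℝ}

theorem Tri.nodeAverage (h : K.Tri a b c) (x : E3 → ℝ) :
    nodeAverage x {a, b, c} = (x a + x b + x c) / 3 := by
  have h1 : a ∉ ({b, c} : Finset E3) := by simp [h.1, h.2.1]
  have h2 : b ∉ ({c} : Finset E3) := by simp [h.2.2.1]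
  rw [MeshCoupling.nodeAverage, (mem_triangles.1 h.2.2.2).2, Finset.sum_insert h1,
    Finset.sum_insert h2, Finset.sum_singleton]
  push_cast; ring

/-- The corners of a small triangle. -/
noncomputable def corners (a b c : E3) (i : Fin 3) : E3 := center (flag a b c i)

theorem Tri.param_mem_sd (h : K.Tri a b c) (hp : p ∈ refInterior) :
    param (corners a b c) p ∈ openTriangle (sdNodes (flag a b c)) := by
  have hi := flag_center_affineIndependent h
  refine ⟨param_mem (refInterior_subset hp), fun q hq => ?_⟩
  obtain ⟨i, -, rfl⟩ := Finset.mem_image.1 hq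
  rw [param_eq_sum]
  refine (refCoord_pos hp i).trans_le (baryCoord_corners hi (sum_refCoord p) i).ge

theorem Tri.baryCoord_corner (h : K.Tri a b c) (p : ℝ × ℝ) (i : Fin 3) :
    baryCoord (sdNodes (flag a b c)) (corners a b c i) (param (corners a b c) p) = refCoord i p := by
  rw [param_eq_sum]
  exact baryCoord_corners (flag_center_affineIndependent h) (sum_refCoord p) i

theorem Tri.baryDiff_corner (h : K.Tri a b c) (i j k : Fin 3) :
    baryDiff (sdNodes (flag a b c)) (corners a b c i) (corners a b c j - corners a b c k) =
      (if i = j then 1 else 0) - if i = k then 1 else 0 := by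
  have hi := flag_center_affineIndependent h
  have key : ∀ l, baryCoord (sdNodes (flag a b c)) (corners a b c i) (corners a b c l) =
      if i = l then 1 else 0 := by
    intro l
    have := baryCoord_corners hi (w := fun m => if m = l then 1 else 0) (by simp) i
    simp only [ite_smul, one_smul, zero_smul, Finset.sum_ite_eq', Finset.mem_univ, if_true] at this
    exact this
  rw [← baryCoord_sub, key, key]

theorem Tri.hat_corner (h : K.Tri a b c) (q : E3) (i : Fin 3) :
    hat K.triangles q (corners a b c i) =
      if q ∈ flag a b c i then ((flag a b c i).card : ℝ)⁻¹ else 0 :=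
  hat_center ((mem_flags.1 h.flag_mem).1 i) q

theorem flag_subset (a b c : E3) (i : Fin 3) : flag a b c i ⊆ {a, b, c} := by
  fin_cases i <;> intro x <;> simp [flag] <;> tauto

theorem Tri.corner_mem (h : K.Tri a b c) (i : Fin 3) :
    corners a b c i ∈ convexHull ℝ (({a, b, c} : Finset E3) : Set E3) :=
  convexHull_mono (Finset.coe_subset.2 (flag_subset a b c i))
    (center_mem (K.nonempty_of_mem_faces ((mem_flags.1 h.flag_mem).1 i)))

theorem Tri.param_mem_convexHull (h : K.Tri a b c) (hp : p ∈ refInterior) :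
    param (corners a b c) p ∈ convexHull ℝ (({a, b, c} : Finset E3) : Set E3) := by
  rw [param_eq_sum]
  exact (convex_convexHull ℝ _).sum_mem (fun i _ => (refCoord_pos hp i).le) (sum_refCoord p)
    fun i _ => h.corner_mem i

theorem Tri.param_mem (h : K.Tri a b c) (hp : p ∈ refInterior) :
    param (corners a b c) p ∈ openTriangle {a, b, c} := by
  have hm := h.param_mem_convexHull hp
  refine ⟨hm, fun q hq => ?_⟩
  have h1 := K.isTriangulation.hat_eq h.2.2.2 hm q
  rw [if_pos hq] at h1
  have r0 := refCoord_pos hp 0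
  have r1 := refCoord_pos hp 1
  have r2 := refCoord_pos hp 2
  have h2 := h.hat_flag (w := fun i => refCoord i p) (fun i => (refCoord_pos hp i).le)
    (sum_refCoord p) q
  rw [← h1, param_eq_sum]
  refine lt_of_lt_of_eq ?_ h2.symm
  simp only [Finset.mem_insert, Finset.mem_singleton] at hq
  split_ifs <;> first | positivity | (exfalso; tauto)

theorem Tri.sum_mul_baryCoord (h : K.Tri a b c) (x : E3 → ℝ) {y : E3}
    (hy : y ∈ convexHull ℝ (({a, b, c} : Finset E3) : Set E3)) :
    ∑ q ∈ K.nodes, x q * hat K.triangles q y =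
      ∑ q ∈ {a, b, c}, x q * baryCoord {a, b, c} q y := by
  have hsub : ({a, b, c} : Finset E3) ⊆ K.nodes := fun q hq => mem_nodes_of_mem h.2.2.2 hq
  rw [← Finset.sum_subset hsub]
  · exact Finset.sum_congr rfl fun q hq => by
      rw [K.isTriangulation.hat_eq h.2.2.2 hy, if_pos hq]
  · intro q _ hq
    rw [K.isTriangulation.hat_eq h.2.2.2 hy, if_neg hq, mul_zero]

theorem Tri.sum_mul_hat_corner (h : K.Tri a b c) (x : E3 → ℝ) (i : Fin 3) :
    ∑ q ∈ K.nodes, x q * hat K.triangles q (corners a b c i) =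
      MeshCoupling.nodeAverage x (flag a b c i) := by
  have hsub : flag a b c i ⊆ K.nodes := fun q hq =>
    mem_nodes_of_mem h.2.2.2 (flag_subset a b c i hq)
  rw [← Finset.sum_subset hsub, MeshCoupling.nodeAverage, Finset.mul_sum]
  · exact Finset.sum_congr rfl fun q hq => by rw [h.hat_corner, if_pos hq, mul_comm]
  · intro q _ hq
    rw [h.hat_corner, if_neg hq, mul_zero]

/-- A piecewise linear function on the mesh is affine on a small triangle, and its values at the
corners are averages over the nodes of the flag members. -/
theorem Tri.sum_mul_hat_param (h : K.Tri a b c) (x : E3 → ℝ) (hp : p ∈ refInterior) :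
    ∑ q ∈ K.nodes, x q * hat K.triangles q (param (corners a b c) p) =
      ∑ i, refCoord i p * MeshCoupling.nodeAverage x (flag a b c i) := by
  have e : ∀ q, hat K.triangles q (param (corners a b c) p) =
      ∑ i, refCoord i p * hat K.triangles q (corners a b c i) := fun q => by
    rw [param_eq_sum]
    exact h.hat_flag_sum (fun i => (refCoord_pos hp i).le) (sum_refCoord p) q
  simp only [e, Finset.mul_sum, ← h.sum_mul_hat_corner]
  rw [Finset.sum_comm]
  refine Finset.sum_congr rfl fun i _ => Finset.sum_congr rfl fun q _ => by ring

theorem Tri.sum_mul_baryDiff (h : K.Tri a b c) (x : E3 → ℝ) (i j : Fin 3) :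
    ∑ q ∈ {a, b, c}, x q * baryDiff {a, b, c} q (corners a b c i - corners a b c j) =
      MeshCoupling.nodeAverage x (flag a b c i) - MeshCoupling.nodeAverage x (flag a b c j) := by
  simp only [← baryCoord_sub, mul_sub, Finset.sum_sub_distrib]
  rw [← h.sum_mul_baryCoord x (h.corner_mem i), ← h.sum_mul_baryCoord x (h.corner_mem j),
    h.sum_mul_hat_corner, h.sum_mul_hat_corner]

end SurfaceMesh

end Averages

/-! ### The pairing on a single small triangle -/

section LocalPairing

open Finset

/-- The piecewise linear function with given values at the nodes. -/
noncomputable def nodeForm (K : SurfaceMesh) (x : E3 → ℝ) : Form 0 :=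
  ∑ p ∈ K.nodes, x p • whitney K.triangles ![p]

/-- The Whitney 1-form with given coefficients; each edge occurs in both directions. -/
noncomputable def edgeForm (K : SurfaceMesh) (x : E3 → E3 → ℝ) : Form 1 :=
  ∑ p ∈ K.nodes, ∑ q ∈ K.nodes, (x p q / 2) • whitney K.triangles ![p, q]

/-- The Whitney 2-form with given coefficients. -/
noncomputable def faceForm {K : SurfaceMesh} (o : K.Orientation) (y : Finset E3 → ℝ) : Form 2 :=
  ∑ T ∈ K.triangles, y T • whitney K.triangles (o.ord T)

theorem nodeForm_mem_regularForms (K : SurfaceMesh) (x : E3 → ℝ) :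
    nodeForm K x ∈ regularForms 0 :=
  Submodule.sum_mem _ fun _ _ => Submodule.smul_mem _ _ (whitney_mem_regularForms _ _)

theorem edgeForm_mem_regularForms (K : SurfaceMesh) (x : E3 → E3 → ℝ) :
    edgeForm K x ∈ regularForms 1 :=
  Submodule.sum_mem _ fun _ _ => Submodule.sum_mem _ fun _ _ =>
    Submodule.smul_mem _ _ (whitney_mem_regularForms _ _)

variable {K : SurfaceMesh} (o : K.Orientation) {a b c : E3} {y : E3} {p : ℝ × ℝ}

theorem faceForm_mem_regularForms (y : Finset E3 → ℝ) : faceForm o y ∈ regularForms 2 :=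
  Submodule.sum_mem _ fun _ _ => Submodule.smul_mem _ _ (whitney_mem_regularForms _ _)

theorem nodeForm_apply {T : Finset E3} (hT : T ∈ K.triangles) (hy : y ∈ openTriangle T)
    (x : E3 → ℝ) (u : Fin 0 → E3) :
    nodeForm K x y u = ∑ q ∈ K.nodes, x q * hat K.triangles q y := by
  rw [nodeForm, Finset.sum_apply, ContinuousAlternatingMap.sum_apply]
  refine sum_congr rfl fun q _ => ?_
  change x q * whitney K.triangles ![q] y u = _
  rw [K.isTriangulation.whitney_zero_apply hT hy]
  rfl

theorem edgeForm_apply {T : Finset E3} (hT : T ∈ K.triangles) (hy : y ∈ openTriangle T)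
    (x : E3 → E3 → ℝ) (u : Fin 1 → E3) :
    edgeForm K x y u = ∑ p ∈ T, ∑ q ∈ T, x p q / 2 *
      (baryCoord T p y * baryDiff T q (u 0) - baryCoord T q y * baryDiff T p (u 0)) := by
  have hsub : T ⊆ K.nodes := fun q hq => SurfaceMesh.mem_nodes_of_mem hT hq
  have key : ∀ p q, whitney K.triangles ![p, q] y u = if p ∈ T ∧ q ∈ T then
      baryCoord T p y * baryDiff T q (u 0) - baryCoord T q y * baryDiff T p (u 0) else 0 := by
    intro p q
    have h2 : univ.image ![p, q] ⊆ T ↔ p ∈ T ∧ q ∈ T := image_two_subset _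
    rw [K.isTriangulation.whitney_eq hT hy]
    simp only [h2]
    split_ifs
    · rw [whitneyLocal_one_apply]; rfl
    · rfl
  have e : edgeForm K x y u = ∑ p ∈ K.nodes, ∑ q ∈ K.nodes,
      x p q / 2 * whitney K.triangles ![p, q] y u := by
    simp only [edgeForm, Finset.sum_apply, ContinuousAlternatingMap.sum_apply]
    rfl
  simp only [e, key]
  rw [← sum_subset hsub fun p _ hp => sum_eq_zero fun q _ => by simp [hp]]
  refine sum_congr rfl fun p hp => ?_
  rw [← sum_subset hsub fun q _ hq => by simp [hq]]
  exact sum_congr rfl fun q hq => by rw [if_pos ⟨hp, hq⟩]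

/-- A closed Whitney 1-form is the differential of a linear function on each triangle. -/
theorem edgeForm_apply_of_potential {T : Finset E3} (hT : T ∈ K.triangles)
    (hy : y ∈ openTriangle T) {x : E3 → E3 → ℝ} {η : E3 → ℝ}
    (hx : ∀ p ∈ T, ∀ q ∈ T, x p q = η q - η p) (u : Fin 1 → E3) :
    edgeForm K x y u = ∑ q ∈ T, η q * baryDiff T q (u 0) := by
  have h1 := sum_baryCoord (K.isTriangulation.indep T hT) hy.1
  have h2 : ∑ q ∈ T, baryDiff T q (u 0) = 0 := by
    have := congrArg (fun f : E3 →L[ℝ] ℝ => f (u 0)) (sum_baryDiff (K.isTriangulation.indep T hT)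
      (K.isTriangulation.card_eq T hT))
    simpa [_root_.sum_apply] using this
  rw [edgeForm_apply hT hy]
  set l := fun p => baryCoord T p y
  set d := fun p => baryDiff T p (u 0)
  have e : ∀ p ∈ T, ∑ q ∈ T, x p q / 2 * (l p * d q - l q * d p) =
      l p * (∑ q ∈ T, η q * d q) / 2 - l p * η p * (∑ q ∈ T, d q) / 2 -
        (∑ q ∈ T, η q * l q) * d p / 2 + η p * d p * (∑ q ∈ T, l q) / 2 := by
    intro p hp
    simp only [mul_sum, sum_mul, sum_div, ← sum_sub_distrib,
      ← sum_add_distrib]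
    exact sum_congr rfl fun q hq => by rw [hx p hp q hq]; ring
  rw [sum_congr rfl e]
  simp only [show ∑ q ∈ T, l q = 1 from h1, show ∑ q ∈ T, d q = 0 from h2]
  simp only [mul_zero, zero_div, sub_zero, mul_one, sum_add_distrib, sum_sub_distrib,
    ← sum_div, ← sum_mul, ← mul_sum]
  simp only [show ∑ q ∈ T, l q = 1 from h1, show ∑ q ∈ T, d q = 0 from h2]
  ring

theorem faceForm_apply {T : Finset E3} (hT : T ∈ K.triangles) (hy : y ∈ openTriangle T)
    (z : Finset E3 → ℝ) (u : Fin 2 → E3) :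
    faceForm o z y u = z T * (2 * (baryDiff T (o.ord T 0) (u 0) * baryDiff T (o.ord T 1) (u 1) -
      baryDiff T (o.ord T 0) (u 1) * baryDiff T (o.ord T 1) (u 0))) := by
  rw [faceForm, Finset.sum_apply, ContinuousAlternatingMap.sum_apply, sum_eq_single T]
  · change z T * whitney K.triangles (o.ord T) y u = _
    have hi : univ.image (o.ord T) ⊆ T := (o.image_ord T hT).le
    rw [K.isTriangulation.whitney_eq hT hy, if_pos hi,
      whitneyLocal_two_eq (K.isTriangulation.indep T hT) (K.isTriangulation.card_eq T hT)
        (o.ord_injective hT) (o.image_ord T hT) hy.1]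
  · intro S hS hne
    change z S * whitney K.triangles (o.ord S) y u = 0
    have hi : ¬ univ.image (o.ord S) ⊆ T := by
      rw [o.image_ord S hS]
      exact fun h => hne (eq_of_subset_of_card_le h
        ((K.isTriangulation.card_eq T hT).trans (K.isTriangulation.card_eq S hS).symm).le)
    rw [K.isTriangulation.whitney_eq hT hy, if_neg hi]
    exact mul_zero _
  · exact fun h => absurd hT h

namespace SurfaceMesh

/-- The refined 2-form is constant, and the mean of an affine function over a triangle is the mean
of its corner values. -/
theorem Tri.integral_two_zero (h : K.Tri a b c) (R : (Fin 3 → Finset E3) → ℝ) (x : E3 → ℝ)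
    (h20 : 2 + 0 = 2) :
    ∫ p in refTriangle, integrand h20 (K.sdForm R) (nodeForm K x) (corners a b c) p =
      R (flag a b c) * (∑ i, MeshCoupling.nodeAverage x (flag a b c i)) / 3 := by
  have e : ∀ᵐ p ∂(volume.restrict refTriangle),
      integrand h20 (K.sdForm R) (nodeForm K x) (corners a b c) p =
      2 * R (flag a b c) * ∑ i, refCoord i p * MeshCoupling.nodeAverage x (flag a b c i) := by
    filter_upwards [ae_mem_refInterior] with p hp
    rw [integrand, wedge_two_zero, h.sdForm_two_apply (h.param_mem_sd hp),
      nodeForm_apply h.2.2.2 (h.param_mem hp), h.sum_mul_hat_param x hp]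
    have d := h.baryDiff_corner
    change R (flag a b c) * (2 * (
        baryDiff (sdNodes (flag a b c)) (corners a b c 0) (corners a b c 1 - corners a b c 0) *
        baryDiff (sdNodes (flag a b c)) (corners a b c 1) (corners a b c 2 - corners a b c 0) -
        baryDiff (sdNodes (flag a b c)) (corners a b c 0) (corners a b c 2 - corners a b c 0) *
        baryDiff (sdNodes (flag a b c)) (corners a b c 1) (corners a b c 1 - corners a b c 0))) *
        _ = _
    rw [d, d, d, d]
    simp
    left; ring
  rw [integral_congr_ae e, integral_const_mul, integral_sum_refCoord]
  ring

/-- The result is Stokes' formula for the potential times the 1-form: an area term with the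
derivative of the 1-form, minus a circulation. On an edge the Whitney form is constant and the
potential affine, so the means of the end values appear. The proof compares coefficients directly.
-/
theorem Tri.integral_one_one (h : K.Tri a b c) (R : (Fin 2 → Finset E3) → ℝ) {x : E3 → E3 → ℝ}
    {η : E3 → ℝ} (hx : ∀ p ∈ ({a, b, c} : Finset E3), ∀ q ∈ ({a, b, c} : Finset E3),
      x p q = η q - η p) (h11 : 1 + 1 = 2) :
    ∫ p in refTriangle, integrand h11 (K.sdForm R) (edgeForm K x) (corners a b c) p =
      coboundary R (flag a b c) * (∑ i, MeshCoupling.nodeAverage η (flag a b c i)) / 3 -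
      (R ![{a}, {a, b}] * (MeshCoupling.nodeAverage η {a} + MeshCoupling.nodeAverage η {a, b}) / 2 +
        R ![{a, b}, {a, b, c}] *
          (MeshCoupling.nodeAverage η {a, b} + MeshCoupling.nodeAverage η {a, b, c}) / 2 -
        R ![{a}, {a, b, c}] *
          (MeshCoupling.nodeAverage η {a} + MeshCoupling.nodeAverage η {a, b, c}) / 2) := by
  set m : Fin 3 → ℝ := fun i => MeshCoupling.nodeAverage η (flag a b c i) with hm
  set A := R ![{a}, {a, b}]
  set B := R ![{a, b}, {a, b, c}]
  set C := R ![{a}, {a, b, c}]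
  have e : ∀ᵐ p ∂(volume.restrict refTriangle),
      integrand h11 (K.sdForm R) (edgeForm K x) (corners a b c) p =
      ∑ i, refCoord i p * ![A * (m 2 - m 0) - C * (m 1 - m 0),
        A * (m 2 - m 0) - (A + B) * (m 1 - m 0), (C - B) * (m 2 - m 0) - C * (m 1 - m 0)] i := by
    filter_upwards [ae_mem_refInterior] with p hp
    have l := h.baryCoord_corner p
    have d := h.baryDiff_corner
    have w : ∀ i, edgeForm K x (param (corners a b c) p) ![corners a b c i - corners a b c 0] =
        m i - m 0 := fun i => by
      rw [edgeForm_apply_of_potential h.2.2.2 (h.param_mem hp) hx]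
      exact h.sum_mul_baryDiff η i 0
    have β : ∀ i, K.sdForm R (param (corners a b c) p) ![corners a b c i - corners a b c 0] =
        A * (refCoord 0 p * baryDiff (sdNodes (flag a b c)) (corners a b c 1)
          (corners a b c i - corners a b c 0) - refCoord 1 p * baryDiff (sdNodes (flag a b c))
          (corners a b c 0) (corners a b c i - corners a b c 0)) +
        C * (refCoord 0 p * baryDiff (sdNodes (flag a b c)) (corners a b c 2)
          (corners a b c i - corners a b c 0) - refCoord 2 p * baryDiff (sdNodes (flag a b c))
          (corners a b c 0) (corners a b c i - corners a b c 0)) +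
        B * (refCoord 1 p * baryDiff (sdNodes (flag a b c)) (corners a b c 2)
          (corners a b c i - corners a b c 0) - refCoord 2 p * baryDiff (sdNodes (flag a b c))
          (corners a b c 1) (corners a b c i - corners a b c 0)) := fun i => by
      rw [h.sdForm_one_apply (h.param_mem_sd hp), ← l 0, ← l 1, ← l 2]
      rfl
    rw [integrand, wedge_one_one, w, w, β, β]
    simp only [d]
    simp [Fin.sum_univ_three]; ring
  rw [integral_congr_ae e, integral_sum_refCoord, coboundary_one]
  simp only [Fin.sum_univ_three]
  change _ = (B - C + A) * (m 0 + m 1 + m 2) / 3 - (A * (m 0 + m 1) / 2 + B * (m 1 + m 2) / 2 -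
    C * (m 0 + m 2) / 2)
  simp; ring

theorem Tri.integral_zero_two (h : K.Tri a b c) (R : (Fin 1 → Finset E3) → ℝ) (y : Finset E3 → ℝ)
    (h02 : 0 + 2 = 2) :
    ∫ p in refTriangle, integrand h02 (K.sdForm R) (faceForm o y) (corners a b c) p =
      o.inc {a, b, c} a b * y {a, b, c} *
        (R ![{a}] + R ![{a, b}] + R ![{a, b, c}]) / 18 := by
  set T : Finset E3 := {a, b, c} with hTdef
  have d : ∀ q ∈ T, ∀ i, baryDiff T q (corners a b c i - corners a b c 0) =
      MeshCoupling.nodeAverage (fun r => if r = q then 1 else 0) (flag a b c i) -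
      MeshCoupling.nodeAverage (fun r => if r = q then 1 else 0) (flag a b c 0) := by
    intro q hq i
    rw [← h.sum_mul_baryDiff]
    simp [hq, ← hTdef]
  have d1 : ∀ q ∈ T, baryDiff T q (corners a b c 1 - corners a b c 0) =
      ((if a = q then 1 else 0) + (if b = q then 1 else 0)) / 2 - if a = q then 1 else 0 := by
    intro q hq
    rw [d q hq, flag_one, flag_zero, nodeAverage_pair _ h.1, nodeAverage_singleton]
  have d2 : ∀ q ∈ T, baryDiff T q (corners a b c 2 - corners a b c 0) =
      ((if a = q then 1 else 0) + (if b = q then 1 else 0) + if c = q then 1 else 0) / 3 -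
        if a = q then 1 else 0 := by
    intro q hq
    rw [d q hq, flag_two, flag_zero, h.nodeAverage, nodeAverage_singleton]
  have e : ∀ᵐ p ∂(volume.restrict refTriangle),
      integrand h02 (K.sdForm R) (faceForm o y) (corners a b c) p =
      (o.inc T a b * y T / 3) * ∑ i, refCoord i p * ![R ![{a}], R ![{a, b}], R ![T]] i := by
    filter_upwards [ae_mem_refInterior] with p hp
    rw [integrand, wedge_zero_two, h.sdForm_zero_apply (h.param_mem_sd hp),
      faceForm_apply o h.2.2.2 (h.param_mem hp)]
    have l := h.baryCoord_corner p
    change (R ![{a}] * baryCoord (sdNodes (flag a b c)) (corners a b c 0) _ +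
      R ![{a, b}] * baryCoord (sdNodes (flag a b c)) (corners a b c 1) _ +
      R ![T] * baryCoord (sdNodes (flag a b c)) (corners a b c 2) _) *
      (y T * (2 * (baryDiff T (o.ord T 0) (corners a b c 1 - corners a b c 0) *
        baryDiff T (o.ord T 1) (corners a b c 2 - corners a b c 0) -
        baryDiff T (o.ord T 0) (corners a b c 2 - corners a b c 0) *
        baryDiff T (o.ord T 1) (corners a b c 1 - corners a b c 0)))) = _
    rw [l, l, l]
    -- Twice the ratio `1 / 6` of the areas, with the orientation sign of the small triangle.
    have det : 2 * (baryDiff T (o.ord T 0) (corners a b c 1 - corners a b c 0) *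
        baryDiff T (o.ord T 1) (corners a b c 2 - corners a b c 0) -
        baryDiff T (o.ord T 0) (corners a b c 2 - corners a b c 0) *
        baryDiff T (o.ord T 1) (corners a b c 1 - corners a b c 0)) = o.inc T a b / 3 := by
      rw [d1 _ (o.ord_mem h.2.2.2 _), d1 _ (o.ord_mem h.2.2.2 _), d2 _ (o.ord_mem h.2.2.2 _),
        d2 _ (o.ord_mem h.2.2.2 _)]
      obtain ⟨n1, n2, n3, hT⟩ := h
      rcases o.ord_cases ⟨n1, n2, n3, hT⟩ with ⟨i, h0, h1, h2⟩ | ⟨i, h0, h1, h2⟩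
      · have hinc := o.inc_next hT i
        rw [h0, h1] at hinc
        rw [hTdef, hinc]
        fin_cases i <;> simp at h0 h1 h2 <;>
          simp [h0, h1, h2, n1, n2, n3, n1.symm, n2.symm, n3.symm] <;> norm_num
      · have hinc := o.inc_prev hT i
        rw [h0, h1] at hinc
        rw [hTdef, hinc]
        fin_cases i <;> simp at h0 h1 h2 <;>
          simp [h0, h1, h2, n1, n2, n3, n1.symm, n2.symm, n3.symm] <;> norm_num
    rw [det]
    simp [Fin.sum_univ_three]; ring
  rw [integral_congr_ae e, integral_const_mul, integral_sum_refCoord]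
  simp [Fin.sum_univ_three]; ring

end SurfaceMesh

end LocalPairing

/-! ### The pairing by coefficients; nondegeneracy for 0-forms -/

section GlobalPairing

open Finset

namespace SurfaceMesh

variable {K : SurfaceMesh} (o : K.Orientation) {a b c : E3} {T : Finset E3}

theorem exists_tri_of_inc_ne_zero (hT : T ∈ K.triangles) (h : o.inc T a b ≠ 0) :
    ∃ c, K.Tri a b c ∧ T = {a, b, c} := by
  have hab : a ∈ T ∧ b ∈ T := by
    by_contra hn; exact h (o.inc_of_notMem hT hn)
  refine exists_tri_edge hT hab.1 hab.2 ?_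
  rintro rfl
  exact h (o.inc_self hT)

/-- Where the incidence number is zero nothing has to be compared; all other index triples are small
triangles. -/
theorem sum_inc_congr {f g : Finset E3 → E3 → E3 → ℝ}
    (hfg : ∀ a b c, K.Tri a b c → f {a, b, c} a b = g {a, b, c} a b) :
    ∑ T ∈ K.triangles, ∑ a ∈ K.nodes, ∑ b ∈ K.nodes, o.inc T a b * f T a b =
      ∑ T ∈ K.triangles, ∑ a ∈ K.nodes, ∑ b ∈ K.nodes, o.inc T a b * g T a b := by
  refine sum_congr rfl fun T hT => sum_congr rfl fun a _ =>
    sum_congr rfl fun b _ => ?_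
  by_cases h : o.inc T a b = 0
  · rw [h, zero_mul, zero_mul]
  · obtain ⟨c, hc, rfl⟩ := exists_tri_of_inc_ne_zero o hT h
    rw [hfg a b c hc]

theorem Tri.inc_mul_inc (h : K.Tri a b c) : o.inc {a, b, c} a b * o.inc {a, b, c} a b = 1 := by
  rcases o.inc_eq_or h with h | h <;> rw [h] <;> norm_num

theorem pairing_two_zero (R : (Fin 3 → Finset E3) → ℝ) (x : E3 → ℝ) (h20 : 2 + 0 = 2) :
    pairing o h20 (K.sdForm R) (nodeForm K x) =
      ∑ T ∈ K.triangles, ∑ a ∈ K.nodes, ∑ b ∈ K.nodes, o.inc T a b *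
        (R (smallTriangle a b T) * (x a + (x a + x b) / 2 + nodeAverage x T) / 3) := by
  rw [pairing_eq_sum o h20 (sdForm_mem_regularForms R) (nodeForm_mem_regularForms K x)]
  refine sum_inc_congr o fun a b c h => (h.integral_two_zero R x h20).trans ?_
  rw [Fin.sum_univ_three, flag_zero, flag_one, flag_two, nodeAverage_singleton,
    nodeAverage_pair _ h.1]
  rfl

/-- Within `T`, the barycenter is a corner of six small triangles, each midpoint and each node of
two; every corner has weight `1 / 18`. -/
theorem pairing_zero_two (R : (Fin 1 → Finset E3) → ℝ) (y : Finset E3 → ℝ) (h02 : 0 + 2 = 2) :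
    pairing o h02 (K.sdForm R) (faceForm o y) =
      ∑ T ∈ K.triangles, y T *
        (6 * R ![T] + ∑ i, (2 * R ![{o.ord T i, o.ord T (i + 1)}] + 2 * R ![{o.ord T i}])) / 18 := by
  rw [pairing_eq_sum o h02 (sdForm_mem_regularForms R) (faceForm_mem_regularForms o y)]
  rw [sum_inc_congr o (g := fun T a b => o.inc T a b * y T *
    (R ![{a}] + R ![{a, b}] + R ![T]) / 18) fun a b c h => h.integral_zero_two o R y h02]
  refine sum_congr rfl fun T hT => ?_
  rw [sum_inc_mul o hT]
  simp only [o.inc_next hT, o.inc_prev hT]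
  have e : ∀ i, ({o.ord T (i + 1), o.ord T i} : Finset E3) = {o.ord T i, o.ord T (i + 1)} :=
    fun i => pair_comm _ _
  simp only [e, Fin.sum_univ_three]
  simp only [show (0 : Fin 3) + 1 = 1 from rfl, show (1 : Fin 3) + 1 = 2 from rfl,
    show (2 : Fin 3) + 1 = 0 from rfl]
  ring

/-- On every small triangle the potential `x a`, which is zero at the node of that small triangle,
is used. This choice makes the terms of adjacent small triangles at the same node comparable and
lets them cancel later. -/
theorem pairing_one_one (R : (Fin 2 → Finset E3) → ℝ) {x : E3 → E3 → ℝ}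
    (ha : ∀ a b, x b a = - x a b) (hx : ∀ a b c, K.Tri a b c → x a b + x b c + x c a = 0)
    (h11 : 1 + 1 = 2) :
    pairing o h11 (K.sdForm R) (edgeForm K x) =
      ∑ T ∈ K.triangles, ∑ a ∈ K.nodes, ∑ b ∈ K.nodes, o.inc T a b *
        (coboundary R (smallTriangle a b T) * (x a b / 2 + nodeAverage (x a) T) / 3 -
          (R ![{a}, {a, b}] * (x a b / 2) / 2 +
            R ![{a, b}, T] * (x a b / 2 + nodeAverage (x a) T) / 2 -
            R ![{a}, T] * nodeAverage (x a) T / 2)) := by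
  have h0 : ∀ a, x a a = 0 := fun a => by linarith [ha a a]
  rw [pairing_eq_sum o h11 (sdForm_mem_regularForms R) (edgeForm_mem_regularForms K x)]
  refine sum_inc_congr o fun a b c h => (h.integral_one_one R (η := x a) ?_ h11).trans ?_
  · have h1 := hx a b c h
    have := ha a b; have := ha b c; have := ha a c
    have := h0 a; have := h0 b; have := h0 c
    intro p hp q hq
    simp only [mem_insert, mem_singleton] at hp hq
    rcases hp with rfl | rfl | rfl <;> rcases hq with rfl | rfl | rfl <;> linarith
  · rw [Fin.sum_univ_three, flag_zero, flag_one, flag_two, nodeAverage_singleton,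
      nodeAverage_pair _ h.1, h0]
    change coboundary R (smallTriangle a b {a, b, c}) * _ / 3 - _ = _
    ring

/-- The number of small triangles at a node. -/
noncomputable def valence (K : SurfaceMesh) (a : E3) : ℝ :=
  ((K.flags 2).filter (fun z => z 0 = {a})).card

theorem Tri.valence_pos (h : K.Tri a b c) : 0 < K.valence a := by
  refine Nat.cast_pos.2 (Finset.card_pos.2 ⟨flag a b c, ?_⟩)
  exact mem_filter.2 ⟨h.flag_mem, rfl⟩

theorem Tri.coeff2_eq (h : K.Tri a b c) (p : E3) :
    K.coeff2 o p (smallTriangle a b {a, b, c}) =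
      if a = p then o.inc {a, b, c} a b / K.valence a else 0 := by
  have hm : smallTriangle a b {a, b, c} ∈ K.flags 2 := h.flag_mem
  have h0 : smallTriangle a b {a, b, c} 0 = {a} := rfl
  have h1 : smallTriangle a b {a, b, c} 1 = {a, b} := rfl
  have h2 : smallTriangle a b {a, b, c} 2 = {a, b, c} := rfl
  rw [coeff2, h0, h1, h2]
  by_cases e : a = p
  · subst e
    rw [if_pos ⟨hm, rfl⟩, if_pos rfl, sum_pair h.1, o.inc_self h.2.2.2, zero_add]
    rfl
  · rw [if_neg (fun hh => e (singleton_inj.1 hh.2)), if_neg e]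

theorem exists_tri_of_mem_nodes (ha : a ∈ K.nodes) : ∃ b c, K.Tri a b c := by
  obtain ⟨T, hT, haT⟩ := mem_biUnion.1 ha
  obtain ⟨b, c, h, -⟩ := exists_tri hT haT
  exact ⟨b, c, h⟩

theorem singleton_mem_faces_iff : {a} ∈ K.faces ↔ a ∈ K.nodes := by
  constructor
  · intro h
    obtain ⟨T, hT, haT⟩ := exists_triangle h
    exact mem_nodes_of_mem hT (haT (mem_singleton_self a))
  · intro h
    obtain ⟨b, c, h⟩ := exists_tri_of_mem_nodes h
    exact h.mem_faces (by simp) (by simp)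

/-- The pairing of a Whitney 0-form with the basis 2-form of the dual cell of `p`. -/
theorem pairing_coeff2 (x : E3 → ℝ) {p : E3} (hp : p ∈ K.nodes) (h20 : 2 + 0 = 2) :
    K.valence p * pairing o h20 (K.sdForm (K.coeff2 o p)) (nodeForm K x) =
      ∑ T ∈ K.triangles, ∑ b ∈ K.nodes, o.inc T p b * (o.inc T p b *
        ((x p + (x p + x b) / 2 + nodeAverage x T) / 3)) := by
  obtain ⟨b, c, h⟩ := exists_tri_of_mem_nodes hp
  have hv := h.valence_pos
  rw [pairing_two_zero, sum_inc_congr o (g := fun T a b => if a = p then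
    o.inc T a b / K.valence p * (x a + (x a + x b) / 2 + nodeAverage x T) / 3 else 0)]
  · rw [mul_sum]
    refine sum_congr rfl fun T _ => ?_
    rw [sum_eq_single p]
    · rw [mul_sum]
      refine sum_congr rfl fun b _ => ?_
      rw [if_pos rfl]
      field_simp
    · intro a _ hap
      exact sum_eq_zero fun b _ => by rw [if_neg hap, mul_zero]
    · exact fun hn => absurd hp hn
  · intro a b c h
    rw [h.coeff2_eq]
    split_ifs with e
    · rw [e]
    · ring

/-- Discrete maximum principle. In every small triangle at a node `p` with maximal modulus, `x p`
has weight 11/18, the other two nodes 5/18 and 2/18, so the moment over the dual cell of `p` cannot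
vanish unless `x p` does. -/
theorem nodeForm_eq_zero_of_pairing {x : E3 → ℝ} {tr : ZeroTrace}
    (hx : ∀ p, ¬ K.IsDof tr {p} → x p = 0) (h20 : 2 + 0 = 2)
    (h : ∀ p, K.IsDof tr {p} → pairing o h20 (K.sdForm (K.coeff2 o p)) (nodeForm K x) = 0) :
    x = 0 := by
  by_contra hne
  obtain ⟨p₀, hp₀⟩ := Function.ne_iff.1 hne
  have hmem : ∀ p, x p ≠ 0 → p ∈ K.nodes := fun p hp =>
    singleton_mem_faces_iff.1 (not_not.1 (mt (hx p) hp)).1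
  obtain ⟨p, hp, hmax⟩ := K.nodes.exists_max_image (fun p => |x p|) ⟨p₀, hmem p₀ hp₀⟩
  have hpos : 0 < |x p| := (abs_pos.2 hp₀).trans_le (hmax p₀ (hmem p₀ hp₀))
  have hle : ∀ q, |x q| ≤ |x p| := fun q => by
    by_cases hq : x q = 0
    · rw [hq, abs_zero]; exact hpos.le
    · exact hmax q (hmem q hq)
  have hdof : K.IsDof tr {p} := not_not.1 (mt (hx p) (abs_pos.1 hpos))
  have key := pairing_coeff2 o x hp h20
  rw [h p hdof, mul_zero] at key
  -- Multiplication by `x p` avoids a distinction of its sign.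
  have hterm : ∀ b c, K.Tri p b c → 0 <
      (x p + (x p + x b) / 2 + nodeAverage x {p, b, c}) / 3 * x p := by
    intro b c ht
    rw [ht.nodeAverage]
    have h1 : |x p| * |x p| = x p * x p := abs_mul_abs_self _
    have h2 : ∀ q, - (x p * x p) ≤ x q * x p := fun q => by
      rw [← h1]
      have h3 : |x q * x p| ≤ |x p| * |x p| := by
        rw [abs_mul]; exact mul_le_mul_of_nonneg_right (hle q) (abs_nonneg _)
      linarith [neg_abs_le (x q * x p)]
    have h4 : 0 < x p * x p := by rw [← h1]; positivity
    nlinarith [h2 b, h2 c]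
  have hnn : ∀ T ∈ K.triangles, ∀ b, 0 ≤ o.inc T p b * (o.inc T p b *
      ((x p + (x p + x b) / 2 + nodeAverage x T) / 3)) * x p := by
    intro T hT b
    by_cases h0 : o.inc T p b = 0
    · rw [h0]; simp
    · obtain ⟨c, hc, rfl⟩ := exists_tri_of_inc_ne_zero o hT h0
      rw [← mul_assoc, hc.inc_mul_inc, one_mul]
      exact (hterm b c hc).le
  obtain ⟨b, c, ht⟩ := exists_tri_of_mem_nodes hp
  have hsum : 0 < ∑ T ∈ K.triangles, ∑ b ∈ K.nodes, o.inc T p b * (o.inc T p b *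
      ((x p + (x p + x b) / 2 + nodeAverage x T) / 3)) * x p := by
    refine sum_pos' (fun T hT => sum_nonneg fun b _ => hnn T hT b)
      ⟨_, ht.2.2.2, sum_pos' (fun b _ => hnn _ ht.2.2.2 b)
        ⟨b, mem_nodes_of_mem ht.2.2.2 (by simp), ?_⟩⟩
    rw [← mul_assoc, ht.inc_mul_inc, one_mul]
    exact hterm b c ht
  simp only [← sum_mul, ← key, zero_mul, lt_irrefl] at hsum

end SurfaceMesh

end GlobalPairing

/-! ### Supports of the basis forms and their boundaries -/

section Regions

open Finset

namespace SurfaceMesh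

variable {K : SurfaceMesh} {tr : ZeroTrace} {a b c p q : E3} {s t u T : Finset E3}
  {z : Fin 3 → Finset E3}

theorem isSubflag_zero_iff : IsSubflag (p := 0) (q := 2) ![s] z ↔ ∃ i, z i = s := by
  rw [IsSubflag, Set.range_subset_iff]
  exact ⟨fun h => h 0, fun h i => by fin_cases i; exact h⟩

theorem isSubflag_one_iff :
    IsSubflag (p := 1) (q := 2) ![s, t] z ↔ (∃ i, z i = s) ∧ ∃ i, z i = t := by
  rw [IsSubflag, Set.range_subset_iff]
  exact ⟨fun h => ⟨h 0, h 1⟩, fun h i => by fin_cases i; exacts [h.1, h.2]⟩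

theorem Tri.pair_mem (h : K.Tri a b c) : {a, b} ∈ K.faces :=
  h.mem_faces (by intro x; simp; tauto) (by simp)

theorem Tri.singleton_mem (h : K.Tri a b c) : {a} ∈ K.faces := h.mem_faces (by simp) (by simp)

theorem Tri.card_pair (h : K.Tri a b c) : ({a, b} : Finset E3).card = 2 := Finset.card_pair h.1

theorem Tri.card_triangle (h : K.Tri a b c) : ({a, b, c} : Finset E3).card = 3 :=
  (mem_triangles.1 h.2.2.2).2

theorem mem_flags_node_edge (hab : a ≠ b) (h : {a, b} ∈ K.faces) : ![{a}, {a, b}] ∈ K.flags 1 := by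
  refine mem_flags_one.2 ⟨K.down_closed h (by simp) (by simp), h, ?_⟩
  exact ssubset_iff_of_subset (by simp) |>.2 ⟨b, by simp, by simp [hab.symm]⟩

theorem mem_flags_node_triangle (hT : T ∈ K.triangles) (ha : a ∈ T) : ![{a}, T] ∈ K.flags 1 := by
  obtain ⟨hf, hc⟩ := mem_triangles.1 hT
  refine mem_flags_one.2 ⟨K.down_closed hf (by simpa using ha) (by simp), hf, ?_⟩
  refine Finset.ssubset_iff_subset_ne.2 ⟨by simpa using ha, fun h => ?_⟩
  change {a} = T at h
  rw [← h] at hc; simp at hc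

theorem mem_flags_edge_triangle (hab : a ≠ b) (hT : T ∈ K.triangles) (ha : a ∈ T) (hb : b ∈ T) :
    ![{a, b}, T] ∈ K.flags 1 := by
  obtain ⟨hf, hc⟩ := mem_triangles.1 hT
  have hs : {a, b} ⊆ T := by
    intro x hx; simp only [mem_insert, mem_singleton] at hx
    rcases hx with rfl | rfl <;> assumption
  refine mem_flags_one.2 ⟨K.down_closed hf hs (by simp), hf, ?_⟩
  refine Finset.ssubset_iff_subset_ne.2 ⟨hs, fun h => ?_⟩
  change {a, b} = T at h
  rw [← h, Finset.card_pair hab] at hc; simp at hc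

/-- The small edges are of three kinds. -/
theorem flags_one_cases {w : Fin 2 → Finset E3} (hw : w ∈ K.flags 1) :
    (∃ a b, a ≠ b ∧ {a, b} ∈ K.faces ∧ w = ![{a}, {a, b}]) ∨
    (∃ a T, T ∈ K.triangles ∧ a ∈ T ∧ w = ![{a}, T]) ∨
    ∃ a b c, K.Tri a b c ∧ w = ![{a, b}, {a, b, c}] := by
  obtain ⟨h0, h1, h2⟩ := mem_flags_one.1 hw
  have hw' : w = ![w 0, w 1] := by ext i : 1; fin_cases i <;> rfl
  have c0 := card_pos h0
  have c1 := card_le h1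
  have c2 := card_lt_card h2
  have e0 : (w 0).card = 1 ∨ (w 0).card = 2 := by omega
  rcases e0 with e0 | e0
  · obtain ⟨a, ha⟩ := card_eq_one.1 e0
    have ha1 : a ∈ w 1 := h2.1 (by simp [ha])
    rw [e0] at c2
    have e1 : (w 1).card = 2 ∨ (w 1).card = 3 := by omega
    rcases e1 with e1 | e1
    · obtain ⟨b, hb⟩ := card_eq_one.1 (show ((w 1).erase a).card = 1 by
        rw [card_erase_of_mem ha1]; omega)
      have hz1 : w 1 = {a, b} := by rw [← hb, insert_erase ha1]
      have hba : b ≠ a := by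
        have : b ∈ (w 1).erase a := by simp [hb]
        exact (mem_erase.1 this).1
      exact Or.inl ⟨a, b, hba.symm, hz1 ▸ h1, by rw [hw', ha, hz1]⟩
    · exact Or.inr (Or.inl ⟨a, w 1, mem_triangles.2 ⟨h1, e1⟩, ha1, by rw [← ha]; exact hw'⟩)
  · obtain ⟨a, b, hab, he⟩ := card_eq_two.1 e0
    have hT : w 1 ∈ K.triangles := mem_triangles.2 ⟨h1, by omega⟩
    obtain ⟨c, hc, hT'⟩ := exists_tri_edge hT (h2.1 (by simp [he])) (h2.1 (by simp [he])) hab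
    exact Or.inr (Or.inr ⟨a, b, c, hc, by rw [← he, ← hT']; exact hw'⟩)

theorem inRegion_iff {q : ℕ} {w : Fin (q + 1) → Finset E3} :
    K.InRegion t w ↔ ∃ a b c, K.Tri a b c ∧ a ∈ t ∧ IsSubflag (q := 2) w (flag a b c) := by
  simp only [InRegion, region, mem_filter]
  constructor
  · rintro ⟨z, ⟨hz, hzt⟩, hw⟩
    obtain ⟨a, b, c, h, rfl⟩ := mem_flags_two.1 hz
    exact ⟨a, b, c, h, by simpa using hzt, hw⟩
  · rintro ⟨a, b, c, h, ha, hw⟩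
    exact ⟨_, ⟨h.flag_mem, by simpa using ha⟩, hw⟩

theorem flag_eq_singleton_iff (h : K.Tri a b c) {i : Fin 3} : flag a b c i = {p} ↔ i = 0 ∧ a = p := by
  constructor
  · intro e
    have hc := congrArg card e
    fin_cases i
    · exact ⟨rfl, singleton_inj.1 e⟩
    · simp [h.card_pair] at hc
    · simp [h.card_triangle] at hc
  · rintro ⟨rfl, rfl⟩; rfl

theorem flag_eq_pair_iff (h : K.Tri a b c) (hpq : p ≠ q) {i : Fin 3} :
    flag a b c i = {p, q} ↔ i = 1 ∧ ({a, b} : Finset E3) = {p, q} := by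
  have hpc := Finset.card_pair hpq
  constructor
  · intro e
    have hc := congrArg card e
    rw [hpc] at hc
    fin_cases i
    · simp at hc
    · exact ⟨rfl, e⟩
    · simp [h.card_triangle] at hc
  · rintro ⟨rfl, e⟩; exact e

theorem flag_eq_triangle_iff (h : K.Tri a b c) (hT : T ∈ K.triangles) {i : Fin 3} :
    flag a b c i = T ↔ i = 2 ∧ {a, b, c} = T := by
  constructor
  · intro e
    have hc := congrArg card e
    rw [(mem_triangles.1 hT).2] at hc
    fin_cases i
    · simp at hc
    · simp [h.card_pair] at hc
    · exact ⟨rfl, e⟩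
  · rintro ⟨rfl, e⟩; exact e

theorem finset_pair_eq_pair_iff {a b a' b' : E3} : ({a, b} : Finset E3) = {a', b'} ↔
    (a = a' ∧ b = b') ∨ (a = b' ∧ b = a') := by
  rw [← coe_inj]; push_cast; exact Set.pair_eq_pair_iff

theorem star_pair_eq (hab : a ≠ b) (h : {a, b} ∈ K.faces) :
    (K.flags 2).filter (fun z => IsSubflag (p := 1) (q := 2) ![{a}, {a, b}] z) =
      (K.star {a, b}).image fun T => ![{a}, {a, b}, T] := by
  ext z
  rw [mem_filter, mem_image]
  constructor
  · rintro ⟨hz, hs⟩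
    obtain ⟨p, q, r, ht, rfl⟩ := mem_flags_two.1 hz
    obtain ⟨⟨i, hi⟩, ⟨j, hj⟩⟩ := isSubflag_one_iff.1 hs
    obtain ⟨-, rfl⟩ := (flag_eq_singleton_iff ht).1 hi
    obtain ⟨-, he⟩ := (flag_eq_pair_iff ht hab).1 hj
    refine ⟨{p, q, r}, mem_star.2 ⟨ht.2.2.2, ?_⟩, by rw [flag, he]⟩
    rw [← he]; intro x; simp; tauto
  · rintro ⟨T, hT, rfl⟩
    obtain ⟨hT, hs⟩ := mem_star.1 hT
    obtain ⟨c, hc, rfl⟩ := exists_tri_edge hT (hs (by simp)) (hs (by simp)) hab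
    exact ⟨hc.flag_mem, isSubflag_one_iff.2 ⟨⟨0, rfl⟩, ⟨1, rfl⟩⟩⟩

theorem card_flags_node_edge (hab : a ≠ b) (h : {a, b} ∈ K.faces) :
    ((K.flags 2).filter (fun z => IsSubflag (p := 1) (q := 2) ![{a}, {a, b}] z)).card =
      (K.star {a, b}).card := by
  rw [star_pair_eq hab h, card_image_of_injective]
  exact fun T T' h => congrFun h 2

theorem flags_node_triangle_eq (h : K.Tri a b c) :
    (K.flags 2).filter (fun z => IsSubflag (p := 1) (q := 2) ![{a}, {a, b, c}] z) =
      {flag a b c, flag a c b} := by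
  ext z
  rw [mem_filter, mem_insert, mem_singleton]
  constructor
  · rintro ⟨hz, hs⟩
    obtain ⟨p, q, r, ht, rfl⟩ := mem_flags_two.1 hz
    obtain ⟨⟨i, hi⟩, ⟨j, hj⟩⟩ := isSubflag_one_iff.1 hs
    obtain ⟨-, rfl⟩ := (flag_eq_singleton_iff ht).1 hi
    obtain ⟨-, he⟩ := (flag_eq_triangle_iff ht h.2.2.2).1 hj
    have hq : q ∈ ({p, b, c} : Finset E3) := he ▸ by simp
    simp only [mem_insert, mem_singleton] at hq
    rcases hq with rfl | rfl | rfl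
    · exact absurd rfl ht.1
    · left; rw [flag, flag, he]
    · right; rw [flag, flag, he, pair_comm b q]
  · rintro (rfl | rfl)
    · exact ⟨h.flag_mem, isSubflag_one_iff.2 ⟨⟨0, rfl⟩, ⟨2, rfl⟩⟩⟩
    · exact ⟨h.swap.flag_mem, isSubflag_one_iff.2 ⟨⟨0, rfl⟩, ⟨2, by
        rw [flag_two, pair_comm]⟩⟩⟩

theorem flag_ne_flag_swap (h : K.Tri a b c) : flag a b c ≠ flag a c b := by
  intro e
  have h1 := congrFun e 1
  simp only [flag_one, finset_pair_eq_pair_iff] at h1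
  rcases h1 with h1 | h1
  · exact h.2.2.1 h1.2
  · exact h.1 h1.2.symm

theorem flags_edge_triangle_eq (h : K.Tri a b c) :
    (K.flags 2).filter (fun z => IsSubflag (p := 1) (q := 2) ![{a, b}, {a, b, c}] z) =
      {flag a b c, flag b a c} := by
  ext z
  rw [mem_filter, mem_insert, mem_singleton]
  constructor
  · rintro ⟨hz, hs⟩
    obtain ⟨p, q, r, ht, rfl⟩ := mem_flags_two.1 hz
    obtain ⟨⟨i, hi⟩, ⟨j, hj⟩⟩ := isSubflag_one_iff.1 hs
    obtain ⟨-, he⟩ := (flag_eq_pair_iff ht h.1).1 hi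
    obtain ⟨-, hT⟩ := (flag_eq_triangle_iff ht h.2.2.2).1 hj
    rcases finset_pair_eq_pair_iff.1 he with ⟨rfl, rfl⟩ | ⟨rfl, rfl⟩
    · left; rw [flag, flag, hT]
    · right; rw [flag, flag, hT, insert_comm]
  · rintro (rfl | rfl)
    · exact ⟨h.flag_mem, isSubflag_one_iff.2 ⟨⟨1, rfl⟩, ⟨2, rfl⟩⟩⟩
    · exact ⟨h.swap_left.flag_mem, isSubflag_one_iff.2 ⟨⟨1, by rw [flag_one, pair_comm]⟩,
        ⟨2, by rw [flag_two, insert_comm]⟩⟩⟩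

theorem flag_ne_flag_swap_left (h : K.Tri a b c) : flag a b c ≠ flag b a c := fun e =>
  h.1 (singleton_inj.1 (congrFun e 0))

theorem filter_region (t : Finset E3) (f : Fin 2 → Finset E3) :
    (K.region t).filter (fun z => IsSubflag (p := 1) (q := 2) f z) =
      ((K.flags 2).filter (fun z => IsSubflag (p := 1) (q := 2) f z)).filter fun z => z 0 ⊆ t := by
  rw [region, filter_comm]

/-- A segment from a node to the barycenter of a triangle lies in two small triangles at the same
node, hence never in the boundary of `U`. A segment from a midpoint to a barycenter separates the
dual cells of the two end nodes of the edge, so it counts if exactly one of them is in `t`. A half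
of an edge counts only on the boundary of the interface, if that part is not left out. -/
theorem inRegionBoundary_iff {q : ℕ} {w : Fin (q + 1) → Finset E3} :
    K.InRegionBoundary tr t w ↔
      (tr = ZeroTrace.buffaChristiansen ∧
        ∃ a b, a ≠ b ∧ a ∈ t ∧ K.OnBoundary {a, b} ∧ IsSubflag (q := 1) w ![{a}, {a, b}]) ∨
      ∃ a b c, K.Tri a b c ∧ a ∈ t ∧ b ∉ t ∧ IsSubflag (q := 1) w ![{a, b}, {a, b, c}] := by
  have hE : ∀ a b c, K.Tri a b c → ¬ K.SdBoundaryEdge ![{a, b}, {a, b, c}] := by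
    intro a b c h h1
    rw [SdBoundaryEdge, flags_edge_triangle_eq h,
      Finset.card_pair (flag_ne_flag_swap_left h)] at h1
    exact absurd h1 (by norm_num)
  constructor
  · rintro ⟨f, hf, hs, h1, h2⟩
    rw [filter_region] at h1
    rcases flags_one_cases hf with ⟨a, b, hab, he, rfl⟩ | ⟨a, T, hT, ha, rfl⟩ | ⟨a, b, c, h, rfl⟩
    · rw [star_pair_eq hab he] at h1
      have hat : a ∈ t := by
        obtain ⟨z, hz⟩ := Finset.card_pos.1 (h1 ▸ Nat.one_pos)
        obtain ⟨hz, hzt⟩ := mem_filter.1 hz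
        obtain ⟨T, -, rfl⟩ := mem_image.1 hz
        exact hzt (mem_singleton_self a)
      rw [filter_true_of_mem, card_image_of_injective] at h1
      · left
        refine ⟨?_, a, b, hab, hat, (onBoundary_pair_iff hab).2 h1, hs⟩
        cases tr with
        | buffaChristiansen => rfl
        | whitney => exact absurd ((card_flags_node_edge hab he).trans h1) (h2 rfl)
      · exact fun T T' h => congrFun h 2
      · intro z hz
        obtain ⟨T, -, rfl⟩ := mem_image.1 hz
        simpa using hat
    · obtain ⟨b, c, h, rfl⟩ := exists_tri hT ha
      rw [flags_node_triangle_eq h] at h1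
      by_cases hat : a ∈ t
      · rw [filter_true_of_mem (by simp [hat]),
          Finset.card_pair (flag_ne_flag_swap h)] at h1
        exact absurd h1 (by norm_num)
      · rw [filter_false_of_mem (by simp [hat])] at h1
        simp at h1
    · right
      rw [flags_edge_triangle_eq h] at h1
      by_cases hat : a ∈ t <;> by_cases hbt : b ∈ t
      · rw [filter_true_of_mem (by simp [hat, hbt]),
          Finset.card_pair (flag_ne_flag_swap_left h)] at h1
        exact absurd h1 (by norm_num)
      · exact ⟨a, b, c, h, hat, hbt, hs⟩
      · exact ⟨b, a, c, h.swap_left, hbt, hat, by rwa [pair_comm b a, insert_comm b a]⟩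
      · rw [filter_false_of_mem (by simp [hat, hbt])] at h1
        simp at h1
  · rintro (⟨htr, a, b, hab, ha, hb, hs⟩ | ⟨a, b, c, h, ha, hb, hs⟩)
    · have h1 := (onBoundary_pair_iff hab).1 hb
      have he : {a, b} ∈ K.faces := pair_mem_faces_iff.2 (Finset.card_pos.1 (h1 ▸ Nat.one_pos))
      refine ⟨_, mem_flags_node_edge hab he, hs, ?_, fun h => by rw [htr] at h; cases h⟩
      rw [filter_region, star_pair_eq hab he, filter_true_of_mem,
        card_image_of_injective, h1]
      · exact fun T T' h => congrFun h 2
      · intro z hz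
        obtain ⟨T, -, rfl⟩ := mem_image.1 hz
        simpa using ha
    · refine ⟨_, mem_flags_edge_triangle h.1 h.2.2.2 (by simp) (by simp), hs, ?_,
        fun _ => hE a b c h⟩
      rw [filter_region, flags_edge_triangle_eq h, filter_insert, filter_singleton]
      simp [ha, hb]

/-! Flags with few entries as subflags of an edge of the refinement -/

theorem isSubflag_zero_one_iff {f : Fin 2 → Finset E3} :
    IsSubflag (p := 0) (q := 1) ![s] f ↔ f 0 = s ∨ f 1 = s := by
  rw [IsSubflag, Set.range_subset_iff]
  constructor
  · intro h
    obtain ⟨i, hi⟩ := h 0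
    fin_cases i
    exacts [Or.inl hi, Or.inr hi]
  · rintro (h | h) i <;> fin_cases i
    exacts [⟨0, h⟩, ⟨1, h⟩]

theorem isSubflag_one_one_iff {w f : Fin 2 → Finset E3} (hw : w ∈ K.flags 1) (hf : f ∈ K.flags 1) :
    IsSubflag (p := 1) (q := 1) w f ↔ w = f := by
  constructor
  · intro hs
    have hw' := (mem_flags.1 hw).2
    have hf' := (mem_flags.1 hf).2
    refine (StrictMono.range_inj hw' hf').1 (Set.eq_of_subset_of_ncard_le hs ?_ (Set.finite_range _))
    rw [Set.ncard_range_of_injective hw'.injective, Set.ncard_range_of_injective hf'.injective]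
  · rintro rfl; exact subset_rfl

theorem inRegion_node_iff {t u : Finset E3} (h : ![{p}, u] ∈ K.flags 1) :
    K.InRegion t (q := 1) ![{p}, u] ↔ p ∈ t := by
  rw [inRegion_iff]
  constructor
  · rintro ⟨a, b, c, ht, ha, hs⟩
    obtain ⟨⟨i, hi⟩, -⟩ := isSubflag_one_iff.1 hs
    obtain ⟨-, rfl⟩ := (flag_eq_singleton_iff ht).1 hi
    exact ha
  · intro hp
    rcases flags_one_cases h with ⟨a, b, hab, he, e⟩ | ⟨a, T, hT, ha, e⟩ | ⟨a, b, c, h', e⟩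
    · obtain ⟨e0, e1⟩ : ({p} : Finset E3) = {a} ∧ u = {a, b} := ⟨congrFun e 0, congrFun e 1⟩
      obtain rfl := singleton_inj.1 e0
      subst e1
      obtain ⟨T, hT, hs⟩ := exists_triangle he
      obtain ⟨c, hc, rfl⟩ := exists_tri_edge hT (hs (by simp)) (hs (by simp)) hab
      exact ⟨_, _, _, hc, hp, isSubflag_one_iff.2 ⟨⟨0, rfl⟩, ⟨1, rfl⟩⟩⟩
    · obtain ⟨e0, e1⟩ : ({p} : Finset E3) = {a} ∧ u = T := ⟨congrFun e 0, congrFun e 1⟩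
      obtain rfl := singleton_inj.1 e0
      subst e1
      obtain ⟨b, c, hc, rfl⟩ := exists_tri hT ha
      exact ⟨_, _, _, hc, hp, isSubflag_one_iff.2 ⟨⟨0, rfl⟩, ⟨2, rfl⟩⟩⟩
    · have e0 : ({p} : Finset E3) = {a, b} := congrFun e 0
      have := congrArg card e0
      rw [h'.card_pair] at this; simp at this

theorem Tri.inRegion_edge_iff (h : K.Tri a b c) :
    K.InRegion t (q := 1) ![{a, b}, {a, b, c}] ↔ a ∈ t ∨ b ∈ t := by
  rw [inRegion_iff]
  constructor
  · rintro ⟨p, q, r, ht, hp, hs⟩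
    obtain ⟨⟨i, hi⟩, -⟩ := isSubflag_one_iff.1 hs
    obtain ⟨-, he⟩ := (flag_eq_pair_iff ht h.1).1 hi
    rcases finset_pair_eq_pair_iff.1 he with ⟨rfl, rfl⟩ | ⟨rfl, rfl⟩
    exacts [Or.inl hp, Or.inr hp]
  · rintro (ha | hb)
    · exact ⟨_, _, _, h, ha, isSubflag_one_iff.2 ⟨⟨1, rfl⟩, ⟨2, rfl⟩⟩⟩
    · exact ⟨_, _, _, h.swap_left, hb, isSubflag_one_iff.2 ⟨⟨1, pair_comm _ _⟩,
        ⟨2, insert_comm _ _ _⟩⟩⟩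

theorem inRegion_zero (hs : s ∈ K.faces) : K.InRegion t (q := 0) ![s] ↔ ∃ a ∈ s, a ∈ t := by
  rw [inRegion_iff]
  constructor
  · rintro ⟨a, b, c, ht, ha, hw⟩
    obtain ⟨i, hi⟩ := isSubflag_zero_iff.1 hw
    refine ⟨a, ?_, ha⟩
    rw [← hi]; fin_cases i <;> simp [flag]
  · rintro ⟨a, has, hat⟩
    obtain ⟨T, hT, hsT⟩ := exists_triangle hs
    have hc := card_le hs
    have hp := card_pos hs
    have hcT := (mem_triangles.1 hT).2
    have : s.card = 1 ∨ s.card = 2 ∨ s.card = 3 := by omega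
    rcases this with e | e | e
    · obtain ⟨b, hb⟩ := card_eq_one.1 e
      subst hb
      obtain rfl := mem_singleton.1 has
      obtain ⟨b, c, h, -⟩ := exists_tri hT (hsT has)
      exact ⟨a, b, c, h, hat, isSubflag_zero_iff.2 ⟨0, rfl⟩⟩
    · obtain ⟨b, hb⟩ := card_eq_one.1 (show (s.erase a).card = 1 by
        rw [card_erase_of_mem has]; omega)
      have hs' : s = {a, b} := by rw [← hb, insert_erase has]
      have hba : b ≠ a := by
        have : b ∈ s.erase a := by simp [hb]
        exact (mem_erase.1 this).1
      obtain ⟨c, h, -⟩ := exists_tri_edge hT (hsT has) (hsT (by simp [hs'])) hba.symm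
      exact ⟨_, _, _, h, hat, isSubflag_zero_iff.2 ⟨1, hs'.symm⟩⟩
    · obtain rfl := eq_of_subset_of_card_le hsT (by omega)
      obtain ⟨b, c, h, e⟩ := exists_tri hT has
      exact ⟨_, _, _, h, hat, isSubflag_zero_iff.2 ⟨2, e.symm⟩⟩

end SurfaceMesh

end Regions

/-! ### Values of the basis forms forced by the axioms -/

section BCFacts

open Finset SurfaceMesh

variable {K : SurfaceMesh} {o : K.Orientation} {tr : ZeroTrace} (μ : BCBasis K o tr)
  {a b c p q : E3} {s t u T S : Finset E3}

namespace SurfaceMesh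

theorem card_flags_edge (hab : a ≠ b) :
    ((K.flags 1).filter (fun w => w 0 = {a, b})).card = (K.star {a, b}).card := by
  have : (K.flags 1).filter (fun w => w 0 = {a, b}) = (K.star {a, b}).image fun T => ![{a, b}, T] := by
    ext w
    rw [mem_filter, mem_image]
    constructor
    · rintro ⟨hw, h0⟩
      rcases flags_one_cases hw with ⟨p, q, -, -, rfl⟩ | ⟨p, T, -, -, rfl⟩ | ⟨p, q, r, h, rfl⟩
      · have := congrArg card h0
        rw [card_pair hab] at this; simp at this
      · have := congrArg card h0
        rw [card_pair hab] at this; simp at this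
      · change ({p, q} : Finset E3) = {a, b} at h0
        refine ⟨{p, q, r}, mem_star.2 ⟨h.2.2.2, ?_⟩, by rw [h0]⟩
        rw [← h0]; intro x; simp; tauto
    · rintro ⟨T, hT, rfl⟩
      obtain ⟨hT, hs⟩ := mem_star.1 hT
      exact ⟨mem_flags_edge_triangle hab hT (hs (by simp)) (hs (by simp)), rfl⟩
  rw [this, card_image_of_injective]
  exact fun T T' h => congrFun h 1

theorem fin_three_ne : ∀ i : Fin 3, i ≠ i + 1 := by decide

theorem IsDof.pair_comm (h : K.IsDof tr {a, b}) : K.IsDof tr {b, a} := by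
  rwa [Finset.pair_comm]

theorem Tri.flags_node_edge (h : K.Tri a b c) : ![{a}, {a, b}] ∈ K.flags 1 :=
  mem_flags_node_edge h.1 h.pair_mem

theorem Tri.flags_node_triangle (h : K.Tri a b c) : ![{a}, {a, b, c}] ∈ K.flags 1 :=
  mem_flags_node_triangle h.2.2.2 (by simp)

theorem Tri.flags_edge_triangle (h : K.Tri a b c) : ![{a, b}, {a, b, c}] ∈ K.flags 1 :=
  mem_flags_edge_triangle h.1 h.2.2.2 (by simp) (by simp)

theorem coboundary_flag (R : (Fin 2 → Finset E3) → ℝ) (a b c : E3) :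
    coboundary R (flag a b c) =
      R ![{a, b}, {a, b, c}] - R ![{a}, {a, b, c}] + R ![{a}, {a, b}] := by
  rw [coboundary_one]; rfl

theorem isDof_of_not_onBoundary (hs : s ∈ K.faces) (h : ¬ K.OnBoundary s) : K.IsDof tr s :=
  ⟨hs, fun _ => h⟩

end SurfaceMesh

namespace BCBasis

theorem R1_of_notMem (hab : a ≠ b) (hd : K.IsDof tr {a, b}) {u : Finset E3} (h : ![{p}, u] ∈ K.flags 1) (hp : p ≠ a ∧ p ≠ b) :
    μ.R1 a b ![{p}, u] = 0 := by
  refine μ.support1 a b hab hd _ h (Or.inl ?_)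
  rw [inRegion_node_iff h]
  simp [hp]

/-- If the edges share one node, the segment lies in the boundary of the support; if they share
none, it lies outside. -/
theorem R1_edge_of_ne (hab : a ≠ b) (hd : K.IsDof tr {a, b}) (h : K.Tri p q c) (hne : ({p, q} : Finset E3) ≠ {a, b}) :
    μ.R1 a b ![{p, q}, {p, q, c}] = 0 := by
  refine μ.support1 a b hab hd _ h.flags_edge_triangle ?_
  by_cases hp : p ∈ ({a, b} : Finset E3)
  · by_cases hq : q ∈ ({a, b} : Finset E3)
    · exact absurd (eq_of_subset_of_card_le
        (by intro x hx; simp only [mem_insert, mem_singleton] at hx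
            rcases hx with rfl | rfl <;> assumption)
        (by rw [card_pair hab, h.card_pair])) hne
    · exact Or.inr (inRegionBoundary_iff.2 (Or.inr ⟨p, q, c, h, hp, hq, subset_rfl⟩))
  · by_cases hq : q ∈ ({a, b} : Finset E3)
    · refine Or.inr (inRegionBoundary_iff.2 (Or.inr ⟨q, p, c, h.swap_left, hq, hp, ?_⟩))
      rw [Finset.pair_comm q p, insert_comm q p]; exact subset_rfl
    · refine Or.inl ?_
      rw [h.inRegion_edge_iff]
      tauto

theorem R1_edge (hab : a ≠ b) (hd : K.IsDof tr {a, b}) (hT : T ∈ K.triangles) (ha : a ∈ T) (hb : b ∈ T) :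
    μ.R1 a b ![{a, b}, T] = - o.inc T a b / (K.star {a, b}).card := by
  rw [μ.same1 a b hab hd _ (mem_flags_edge_triangle hab hT ha hb) rfl, card_flags_edge hab]
  rfl

theorem R1_boundary (hab : a ≠ b) (hd : K.IsDof tr {a, b}) (htr : tr = ZeroTrace.buffaChristiansen) (hpq : p ≠ q)
    (hb : K.OnBoundary {p, q}) : μ.R1 a b ![{p}, {p, q}] = 0 := by
  have h1 := (onBoundary_pair_iff hpq).1 hb
  have he : {p, q} ∈ K.faces := pair_mem_faces_iff.2 (card_pos.1 (h1 ▸ Nat.one_pos))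
  have hf := mem_flags_node_edge hpq he
  refine μ.support1 a b hab hd _ hf ?_
  rw [inRegion_node_iff hf]
  by_cases hp : p ∈ ({a, b} : Finset E3)
  · exact Or.inr (inRegionBoundary_iff.2 (Or.inl ⟨htr, p, q, hpq, hp, hb, subset_rfl⟩))
  · exact Or.inl hp

/-- Outside the support both sides vanish, so the restriction in `deriv1` can be dropped. -/
theorem coboundary_R1 (hab : a ≠ b) (hd : K.IsDof tr {a, b}) {z : Fin 3 → Finset E3} (hz : z ∈ K.flags 2) :
    coboundary (μ.R1 a b) z =
      (if K.IsDof tr {b} then K.coeff2 o b z else 0) -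
        (if K.IsDof tr {a} then K.coeff2 o a z else 0) := by
  obtain ⟨p, q, r, h, rfl⟩ := mem_flags_two.1 hz
  by_cases hp : p ∈ ({a, b} : Finset E3)
  · refine μ.deriv1 a b hab hd _ hz ?_
    exact inRegion_iff.2 ⟨p, q, r, h, hp, subset_rfl⟩
  · have hp' : p ≠ a ∧ p ≠ b := by simpa using hp
    have c0 : ∀ x, p ≠ x → K.coeff2 o x (flag p q r) = 0 := fun x hx => by
      have := h.coeff2_eq o x
      rwa [if_neg hx] at this
    rw [coboundary_flag, μ.R1_of_notMem hab hd h.flags_node_triangle hp',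
      μ.R1_of_notMem hab hd h.flags_node_edge hp', μ.R1_edge_of_ne hab hd h, c0 a hp'.1,
      c0 b hp'.2]
    · simp
    · intro e
      exact hp (e ▸ by simp)

/-- If `s` has nodes inside and outside `T`, its barycenter is an end of a segment that separates
two such dual cells, so it lies in the boundary of `U`; if it has none inside, the barycenter is
outside `U`. -/
theorem R0_of_not_subset (hT : T ∈ K.triangles) (hs : s ∈ K.faces) (h : ¬ s ⊆ T) :
    μ.R0 T ![s] = 0 := by
  refine μ.support0 T hT _ (mem_flags_zero.2 hs) ?_
  rw [inRegion_zero hs]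
  by_cases hst : ∃ a ∈ s, a ∈ T
  · obtain ⟨q, hqs, hqT⟩ := hst
    obtain ⟨p, hps, hpT⟩ := not_subset.1 h
    have hqp : q ≠ p := fun e => hpT (e ▸ hqT)
    obtain ⟨S, hS, hsS⟩ := exists_triangle hs
    obtain ⟨r, hr, hS'⟩ := exists_tri_edge hS (hsS hqs) (hsS hps) hqp
    refine Or.inr (inRegionBoundary_iff.2 (Or.inr ⟨q, p, r, hr, hqT, hpT, ?_⟩))
    rw [isSubflag_zero_one_iff]
    have h2 : ({q, p} : Finset E3) ⊆ s := by
      intro x hx; simp only [mem_insert, mem_singleton] at hx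
      rcases hx with rfl | rfl <;> assumption
    have c2 := card_le_card h2
    rw [hr.card_pair] at c2
    have c3 := card_le hs
    have : s.card = 2 ∨ s.card = 3 := by omega
    rcases this with e | e
    · exact Or.inl (eq_of_subset_of_card_le h2 (e.trans hr.card_pair.symm).le)
    · exact Or.inr ((hS'.symm).trans
        (eq_of_subset_of_card_le hsS (by rw [e, (mem_triangles.1 hS).2])).symm)
  · exact Or.inl hst

theorem R0_self (hT : T ∈ K.triangles) : μ.R0 T ![T] = 1 :=
  μ.same0 T hT _ (mem_flags_zero.2 (mem_triangles.1 hT).1) rfl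

theorem R0_triangle (hT : T ∈ K.triangles) (hS : S ∈ K.triangles) :
    μ.R0 T ![S] = if S = T then 1 else 0 := by
  split_ifs with h
  · rw [h]; exact μ.R0_self hT
  · refine μ.R0_of_not_subset hT (mem_triangles.1 hS).1 fun hs => h ?_
    exact eq_of_subset_of_card_le hs
      (by rw [(mem_triangles.1 hT).2, (mem_triangles.1 hS).2])

theorem R0_boundary (htr : tr = ZeroTrace.buffaChristiansen) (hT : T ∈ K.triangles)
    (hs : K.OnBoundary s) (hne : s.Nonempty) : μ.R0 T ![s] = 0 := by
  obtain ⟨e, he, hc, hse, h1⟩ := hs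
  have hsf := K.down_closed he hse hne
  by_cases hsT : s ⊆ T
  · obtain ⟨a, ha⟩ := hne
    obtain ⟨b, hb⟩ := card_eq_one.1 (show (e.erase a).card = 1 by
      rw [card_erase_of_mem (hse ha)]; omega)
    have he' : e = {a, b} := by rw [← hb, insert_erase (hse ha)]
    have hba : b ≠ a := by
      have : b ∈ e.erase a := by simp [hb]
      exact (mem_erase.1 this).1
    refine μ.support0 T hT _ (mem_flags_zero.2 hsf) (Or.inr (inRegionBoundary_iff.2 (Or.inl
      ⟨htr, a, b, hba.symm, hsT ha, ⟨e, he, hc, he'.ge, h1⟩, ?_⟩)))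
    rw [isSubflag_zero_one_iff]
    by_cases hbs : b ∈ s
    · right
      refine (he'.symm.trans ?_)
      refine (eq_of_subset_of_card_le hse ?_).symm
      rw [hc, ← card_pair hba.symm]
      refine card_le_card ?_
      intro x hx; simp only [mem_insert, mem_singleton] at hx
      rcases hx with rfl | rfl <;> assumption
    · left
      refine (Finset.Subset.antisymm (by simpa using ha) fun x hx => ?_)
      have := hse hx
      rw [he', mem_insert, mem_singleton] at this
      rcases this with rfl | rfl
      · simp
      · exact absurd hx hbs
  · exact μ.R0_of_not_subset hT hsf hsT

theorem coboundary_R0 (hT : T ∈ K.triangles) {z : Fin 2 → Finset E3} (hz : z ∈ K.flags 1) :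
    coboundary (μ.R0 T) z = - ∑ i : Fin 3,
      if K.IsDof tr {o.ord T i, o.ord T (i + 1)} then μ.R1 (o.ord T i) (o.ord T (i + 1)) z else 0 := by
  by_cases hr : K.InRegion T (q := 1) z
  · exact μ.deriv0 T hT z hz hr
  obtain ⟨h0, h1, h01⟩ := mem_flags_one.1 hz
  have hz0 : ¬ z 0 ⊆ T := by
    intro hs
    apply hr
    rcases flags_one_cases hz with ⟨p, q, -, -, rfl⟩ | ⟨p, T, -, -, rfl⟩ | ⟨p, q, r, h, rfl⟩
    · exact (inRegion_node_iff hz).2 (hs (mem_singleton_self p))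
    · exact (inRegion_node_iff hz).2 (hs (mem_singleton_self p))
    · exact h.inRegion_edge_iff.2 (Or.inl (hs (show p ∈ ({p, q} : Finset E3) by simp)))
  rw [coboundary_zero, μ.R0_of_not_subset hT h0 hz0,
    μ.R0_of_not_subset hT h1 fun h => hz0 (h01.1.trans h), sub_zero, eq_comm, neg_eq_zero]
  refine sum_eq_zero fun i _ => ?_
  split_ifs with hd
  · refine μ.support1 _ _ ((o.ord_injective hT).ne (fin_three_ne i)) hd z hz
      (Or.inl fun h => hr ?_)
    obtain ⟨p, q, r, hpqr, hp, hs⟩ := inRegion_iff.1 h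
    refine inRegion_iff.2 ⟨p, q, r, hpqr, ?_, hs⟩
    simp only [mem_insert, mem_singleton] at hp
    rcases hp with rfl | rfl <;> exact o.ord_mem hT _
  · rfl

/-- The derivative along the segment from the midpoint to the barycenter of `T` involves only the
basis form of this edge, whose coefficient there is fixed by `same1`; the value at the barycenter is
one. -/
theorem R0_edge (hT : T ∈ K.triangles) (hab : a ≠ b) (ha : a ∈ T) (hb : b ∈ T) :
    μ.R0 T ![{a, b}] = 1 - if K.IsDof tr {a, b} then ((K.star {a, b}).card : ℝ)⁻¹ else 0 := by
  have key : ∀ j : Fin 3, μ.R0 T ![{o.ord T j, o.ord T (j + 1)}] =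
      1 - if K.IsDof tr {o.ord T j, o.ord T (j + 1)} then
        ((K.star {o.ord T j, o.ord T (j + 1)}).card : ℝ)⁻¹ else 0 := by
    intro j
    have hinj := o.ord_injective hT
    have hne : ∀ j : Fin 3, o.ord T j ≠ o.ord T (j + 1) := fun j => hinj.ne (fin_three_ne j)
    have h := μ.coboundary_R0 hT (mem_flags_edge_triangle (hne j) hT (o.ord_mem hT j)
      (o.ord_mem hT (j + 1)))
    rw [coboundary_zero, sum_eq_single j] at h
    · have h' : μ.R0 T ![T] - μ.R0 T ![{o.ord T j, o.ord T (j + 1)}] = _ := h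
      rw [μ.R0_self hT] at h'
      split_ifs at h' ⊢ with hd
      · rw [μ.R1_edge (hne j) hd hT (o.ord_mem hT j) (o.ord_mem hT (j + 1)), o.inc_next hT] at h'
        rw [inv_eq_one_div]; linarith [neg_div ((K.star {o.ord T j, o.ord T (j + 1)}).card : ℝ) 1]
      · linarith
    · intro i _ hij
      split_ifs with hd
      · obtain ⟨r, hr, hT'⟩ := exists_tri_edge hT (o.ord_mem hT j) (o.ord_mem hT (j + 1)) (hne j)
        have := μ.R1_edge_of_ne (hne i) hd hr ?_
        · rwa [← hT'] at this
        · rw [Ne, finset_pair_eq_pair_iff, hinj.eq_iff, hinj.eq_iff, hinj.eq_iff, hinj.eq_iff]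
          exact (by decide : ∀ i j : Fin 3, i ≠ j →
            ¬ (j = i ∧ j + 1 = i + 1 ∨ j = i + 1 ∧ j + 1 = i)) i j hij
      · rfl
    · exact fun hn => absurd (mem_univ j) hn
  obtain ⟨c, h, rfl⟩ := exists_tri_edge hT ha hb hab
  rcases o.ord_cases h with ⟨i, h0, h1, -⟩ | ⟨i, h0, h1, -⟩
  · have := key i
    rwa [h0, h1] at this
  · have := key i
    rwa [h0, h1, Finset.pair_comm b a] at this

/-- Along a segment from `a` to a barycenter, the derivative of the sum of all basis 0-forms
collects each interior edge twice with opposite signs, and boundary edges contribute nothing. So the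
sum is constant there, and it is one at the barycenter. -/
theorem sum_R0_node (ha : a ∈ K.nodes)
    (h : tr = ZeroTrace.buffaChristiansen → ¬ K.OnBoundary {a}) :
    ∑ T ∈ K.triangles, μ.R0 T ![{a}] = 1 := by
  obtain ⟨b, c, ht⟩ := exists_tri_of_mem_nodes ha
  have hz := ht.flags_node_triangle
  have h1 : ∑ T ∈ K.triangles, coboundary (μ.R0 T) ![{a}, {a, b, c}] =
      1 - ∑ T ∈ K.triangles, μ.R0 T ![{a}] := by
    simp only [coboundary_zero, sum_sub_distrib]
    congr 1
    change ∑ T ∈ K.triangles, μ.R0 T ![{a, b, c}] = 1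
    rw [sum_congr rfl fun T hT => μ.R0_triangle hT ht.2.2.2]
    simp [ht.2.2.2]
  have h2 := sum_sum_ord_eq_zero o (g := fun p q => if K.IsDof tr {p, q} then
    μ.R1 p q ![{a}, {a, b, c}] else 0) ?_ ?_
  · rw [sum_congr rfl fun T hT => μ.coboundary_R0 hT hz, sum_neg_distrib, h2] at h1
    linarith
  · intro p q
    beta_reduce
    rw [Finset.pair_comm q p, μ.antisymm p q]
    split_ifs <;> simp
  · intro p q hpq hb
    beta_reduce
    split_ifs with hd
    · cases tr with
      | whitney => exact absurd hb (hd.2 rfl)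
      | buffaChristiansen =>
        refine μ.R1_of_notMem hpq hd hz ⟨?_, ?_⟩
        · rintro rfl; exact h rfl (hb.mono (by simp))
        · rintro rfl; exact h rfl (hb.mono (by simp))
    · rfl

/-- At an interior node, the basis 0-form has the same value for all triangles. -/
theorem R0_interior (hT : T ∈ K.triangles) (haT : a ∈ T) (ha : ¬ K.OnBoundary {a}) :
    μ.R0 T ![{a}] = 2 / K.valence a := by
  obtain ⟨i, hi⟩ := o.exists_ord hT haT
  have hinj := o.ord_injective hT
  have n1 : ∀ i : Fin 3, i ≠ i + 1 := by decide
  have n2 : ∀ i : Fin 3, i ≠ i + 2 := by decide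
  have n3 : ∀ i : Fin 3, i + 1 ≠ i + 2 := by decide
  have m1 : ∀ i : Fin 3, i + 2 + 1 = i := by decide
  have m2 : ∀ i : Fin 3, i + 1 + 1 = i + 2 := by decide
  have m3 : ∀ i j : Fin 3, j ≠ i + 2 → j = i ∨ j = i + 1 := by decide
  set b := o.ord T (i + 1) with hb
  set c := o.ord T (i + 2) with hc
  have hab : a ≠ b := hi ▸ hinj.ne (n1 i)
  have hac : a ≠ c := hi ▸ hinj.ne (n2 i)
  have hbc : b ≠ c := hinj.ne (n3 i)
  have hTe : ({a, b, c} : Finset E3) = T := by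
    refine eq_of_subset_of_card_le ?_ ?_
    · intro x hx; simp only [mem_insert, mem_singleton] at hx
      rcases hx with rfl | rfl | rfl
      exacts [haT, o.ord_mem hT _, o.ord_mem hT _]
    · rw [(mem_triangles.1 hT).2, card_insert_of_notMem (by simp [hab, hac]),
        card_pair hbc]
  have h : K.Tri a b c := ⟨hab, hac, hbc, hTe ▸ hT⟩
  have hNB : ∀ x, ¬ K.OnBoundary {a, x} := fun x hx => ha (hx.mono (by simp))
  have hdab : K.IsDof tr {a, b} := isDof_of_not_onBoundary h.pair_mem (hNB b)
  have hdca : K.IsDof tr {c, a} :=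
    (isDof_of_not_onBoundary h.swap.pair_mem (hNB c)).pair_comm
  have hda : K.IsDof tr {a} := isDof_of_not_onBoundary h.singleton_mem ha
  have card2 : ∀ x, K.Tri a x b ∨ K.Tri a x c → ((K.star {a, x}).card : ℝ) = 2 := by
    intro x hx
    obtain ⟨y, hy⟩ : ∃ y, K.Tri a x y := by rcases hx with hx | hx <;> exact ⟨_, hx⟩
    have h1 : (K.star {a, x}).card ≠ 1 := fun e => hNB x ((onBoundary_pair_iff hy.1).2 e)
    have h2 := card_star_le (K := K) hy.1
    have h3 := card_pos.2 (pair_mem_faces_iff.1 hy.pair_mem)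
    exact_mod_cast (by omega : (K.star {a, x}).card = 2)
  have hinc : o.inc T a b = 1 := by
    have := o.inc_next hT i
    rwa [hi] at this
  have hincca : o.inc T c a = 1 := by
    have := o.inc_next hT (i + 2)
    rw [m1 i, hi] at this
    exact this
  have hincac : o.inc T a c = -1 := by rw [o.inc_swap hT c a, hincca]
  -- the derivative of the basis 0-form along the half of the edge
  have e1 : μ.R0 T ![{a}] = 1 / 2 + μ.R1 c a ![{a}, {a, b}] := by
    have hz := h.flags_node_edge
    have hs := μ.coboundary_R0 hT hz
    rw [coboundary_zero] at hs
    have hs' : μ.R0 T ![{a, b}] - μ.R0 T ![{a}] = _ := hs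
    rw [μ.R0_edge hT hab haT (o.ord_mem hT _), if_pos hdab, card2 b (Or.inr h)] at hs'
    have hsum : ∑ j : Fin 3, (if K.IsDof tr {o.ord T j, o.ord T (j + 1)} then
        μ.R1 (o.ord T j) (o.ord T (j + 1)) ![{a}, {a, b}] else 0) = μ.R1 c a ![{a}, {a, b}] := by
      rw [sum_eq_single (i + 2)]
      · rw [m1 i, hi, ← hc, if_pos hdca]
      · intro j _ hj
        rcases m3 i j hj with rfl | rfl
        · rw [hi, ← hb, if_pos hdab]
          exact μ.stable a b hab hdab _ hz rfl ha
        · rw [m2 i, ← hb, ← hc]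
          split_ifs with hd
          · exact μ.R1_of_notMem hbc hd hz ⟨hab, hac⟩
          · rfl
      · exact fun hn => absurd (mem_univ _) hn
    rw [hsum] at hs'
    linarith
  -- Turning around `a` inside `T` crosses two small triangles, each contributing `1 / K.valence a`
  -- by `deriv1`. The half of the edge to `c` carries nothing, by `stable`, and the coefficient of
  -- the dual edge cancels the value `1 / 2` at the midpoint.
  have e2 : μ.R1 c a ![{a}, {a, b}] = 1 / K.valence a + μ.R1 c a ![{a}, T] := by
    have hs := μ.coboundary_R1 hac.symm hdca h.flag_mem
    rw [coboundary_flag, μ.R1_edge_of_ne hac.symm hdca h, if_pos hda, hTe] at hs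
    · have k1 : K.coeff2 o a (flag a b c) = _ := h.coeff2_eq o a
      have k2 : K.coeff2 o c (flag a b c) = _ := h.coeff2_eq o c
      rw [k1, k2, if_pos rfl, if_neg hac, hTe, hinc] at hs
      simp only [ite_self] at hs
      linarith
    · rw [Ne, finset_pair_eq_pair_iff]
      rintro (⟨h1, -⟩ | ⟨-, h1⟩)
      exacts [hac h1, hbc h1]
  have e3 : μ.R1 c a ![{a}, T] = -(1 / 2) + 1 / K.valence a := by
    have hs := μ.coboundary_R1 hac.symm hdca h.swap.flag_mem
    have hTe' : ({a, c, b} : Finset E3) = T := by rw [Finset.pair_comm c b, hTe]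
    have k0 : μ.R1 c a ![{a}, {a, c}] = 0 :=
      μ.stable c a hac.symm hdca _ h.swap.flags_node_edge (Finset.pair_comm a c) ha
    have k3 := μ.R1_edge hac.symm hdca hT (o.ord_mem hT _) haT
    rw [Finset.pair_comm c a, hincca, card2 c (Or.inl h.swap)] at k3
    have k1 : K.coeff2 o a (flag a c b) = _ := h.swap.coeff2_eq o a
    have k2 : K.coeff2 o c (flag a c b) = _ := h.swap.coeff2_eq o c
    rw [coboundary_flag, if_pos hda, k1, k2, if_pos rfl, if_neg hac, hTe', k0, k3, hincac] at hs
    simp only [ite_self, neg_div] at hs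
    linarith
  rw [e1, e2, e3]; ring

/-- Interior nodes have an explicit value; boundary nodes are covered by the zero trace or by the
axiom `nonneg`. The sign is needed for the maximum principle. -/
theorem R0_nonneg (hT : T ∈ K.triangles) (ha : a ∈ K.nodes) : 0 ≤ μ.R0 T ![{a}] := by
  have hf := singleton_mem_faces_iff.2 ha
  by_cases haT : a ∈ T
  · by_cases hb : K.OnBoundary {a}
    · cases tr with
      | whitney => exact μ.nonneg rfl T hT _ (mem_flags_zero.2 hf) hb (card_singleton a)
      | buffaChristiansen => exact (μ.R0_boundary rfl hT hb (by simp)).ge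
    · rw [μ.R0_interior hT haT hb]
      exact div_nonneg zero_le_two (Nat.cast_nonneg _)
  · exact (μ.R0_of_not_subset hT hf (by simpa using haT)).ge

end BCBasis

end BCFacts

/-! ### Nondegeneracy for 2-forms by a maximum principle -/

section FaceForms

open Finset SurfaceMesh

variable {K : SurfaceMesh} {o : K.Orientation} {tr : ZeroTrace} (μ : BCBasis K o tr)
  {a b c p q : E3} {s t u T S : Finset E3}

namespace BCBasis

/-- The value of a combination of the basis 0-forms at the barycenter of a simplex. -/
noncomputable def value (y : Finset E3 → ℝ) (s : Finset E3) : ℝ :=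
  ∑ T ∈ K.triangles, y T * μ.R0 T ![s]

theorem value_neg (y : Finset E3 → ℝ) (s : Finset E3) : μ.value (-y) s = - μ.value y s := by
  simp [value, sum_neg_distrib]

theorem value_triangle (y : Finset E3 → ℝ) (hS : S ∈ K.triangles) : μ.value y S = y S := by
  rw [value, sum_congr rfl fun T hT => by rw [μ.R0_triangle hT hS]]
  simp [hS]

theorem value_edge (y : Finset E3 → ℝ) (hab : a ≠ b) (hf : {a, b} ∈ K.faces) :
    μ.value y {a, b} = (1 - if K.IsDof tr {a, b} then ((K.star {a, b}).card : ℝ)⁻¹ else 0) *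
      ∑ T ∈ K.star {a, b}, y T := by
  have hsum : ∑ T ∈ K.star {a, b}, y T = ∑ T ∈ K.triangles, if {a, b} ⊆ T then y T else 0 :=
    sum_filter _ _
  rw [value, hsum, mul_sum]
  refine sum_congr rfl fun T hT => ?_
  by_cases hs : {a, b} ⊆ T
  · rw [μ.R0_edge hT hab (hs (by simp)) (hs (by simp)), if_pos hs]; ring
  · rw [μ.R0_of_not_subset hT hf hs, if_neg hs]; ring

variable {y : Finset E3 → ℝ} {M : ℝ}

/-- The values at the node are a partition of unity, unless they all vanish by the zero trace. So
the distance of the combination to `-M` is a sum of nonnegative terms. If it vanishes, then so does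
the term of `S`, which forces `μ.R0 S` to be zero at the node; this is impossible at interior nodes.
-/
theorem value_node_ge (hM : 0 < M) (hy : ∀ T ∈ K.triangles, -M ≤ y T) (hS : S ∈ K.triangles)
    (hyS : y S = M) (ha : a ∈ S) : -M ≤ μ.value y {a} ∧
    (μ.value y {a} = -M → tr = ZeroTrace.whitney ∧ K.OnBoundary {a}) := by
  have han := mem_nodes_of_mem hS ha
  by_cases hb : tr = ZeroTrace.buffaChristiansen ∧ K.OnBoundary {a}
  · have h0 : μ.value y {a} = 0 := sum_eq_zero fun T hT => by
      rw [μ.R0_boundary hb.1 hT hb.2 (by simp), mul_zero]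
    rw [h0]
    exact ⟨by linarith, fun h => by linarith⟩
  · have h1 : μ.value y {a} + M = ∑ T ∈ K.triangles, (y T + M) * μ.R0 T ![{a}] := by
      have := μ.sum_R0_node han (fun htr hB => hb ⟨htr, hB⟩)
      simp only [add_mul, sum_add_distrib, ← mul_sum, this, value]
      ring
    have hnn : ∀ T ∈ K.triangles, 0 ≤ (y T + M) * μ.R0 T ![{a}] := fun T hT =>
      mul_nonneg (by linarith [hy T hT]) (μ.R0_nonneg hT han)
    refine ⟨by linarith [sum_nonneg hnn], fun he => ?_⟩
    rw [he, neg_add_cancel] at h1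
    have h2 := (sum_eq_zero_iff_of_nonneg hnn).1 h1.symm S hS
    rw [hyS] at h2
    have h3 : μ.R0 S ![{a}] = 0 := by
      rcases mul_eq_zero.1 h2 with h | h
      · linarith
      · exact h
    have hB : K.OnBoundary {a} := by
      by_contra hB
      rw [μ.R0_interior hS ha hB] at h3
      obtain ⟨b, c, ht⟩ := exists_tri_of_mem_nodes han
      have := ht.valence_pos
      have : 0 < 2 / K.valence a := by positivity
      linarith
    refine ⟨?_, hB⟩
    cases tr with
    | whitney => rfl
    | buffaChristiansen => exact absurd ⟨rfl, hB⟩ hb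

/-- At the midpoint of an interior edge the value is the mean of the coefficients of the two
neighbours, one of which is `M`. On a boundary edge it is `0` or `M`, depending on which traces
vanish. -/
theorem value_edge_nonneg (hM : 0 < M) (hy : ∀ T ∈ K.triangles, -M ≤ y T) (hS : S ∈ K.triangles)
    (hyS : y S = M) (hab : a ≠ b) (ha : a ∈ S) (hb : b ∈ S) : 0 ≤ μ.value y {a, b} ∧
    (tr = ZeroTrace.whitney → μ.value y {a, b} = 0 → ¬ K.OnBoundary {a, b} ∧
      ∀ T ∈ K.star {a, b}, T ≠ S → y T = -M) := by
  obtain ⟨c, h, rfl⟩ := exists_tri_edge hS ha hb hab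
  have hSs : {a, b, c} ∈ K.star {a, b} :=
    mem_star.2 ⟨hS, by intro x; simp only [mem_insert, mem_singleton]; tauto⟩
  rw [μ.value_edge y hab h.pair_mem]
  have hle := card_star_le (K := K) hab
  have hpos := card_pos.2 ⟨_, hSs⟩
  have : (K.star {a, b}).card = 1 ∨ (K.star {a, b}).card = 2 := by omega
  rcases this with e | e
  · have hB := (onBoundary_pair_iff hab).2 e
    obtain ⟨T, hT⟩ := card_eq_one.1 e
    have hTS : {a, b, c} = T := by rw [hT] at hSs; exact mem_singleton.1 hSs
    rw [hT, sum_singleton, ← hTS, hyS, card_singleton]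
    split_ifs with hd
    · refine ⟨by simp, fun htr => ?_⟩
      exact absurd hB (hd.2 htr)
    · refine ⟨by linarith, fun _ h0 => ?_⟩
      linarith
  · have hB : ¬ K.OnBoundary {a, b} := fun hB => by
      rw [(onBoundary_pair_iff hab).1 hB] at e; omega
    have hd : K.IsDof tr {a, b} := isDof_of_not_onBoundary h.pair_mem hB
    obtain ⟨T, hT⟩ := card_eq_one.1 (show ((K.star {a, b}).erase {a, b, c}).card = 1 by
      rw [card_erase_of_mem hSs, e])
    have hTm : T ∈ (K.star {a, b}).erase {a, b, c} := by rw [hT]; simp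
    have hyT := hy T (mem_star.1 (mem_erase.1 hTm).2).1
    rw [if_pos hd, e, ← add_sum_erase _ _ hSs, hT, sum_singleton, hyS]
    push_cast
    refine ⟨by nlinarith, fun _ h0 => ⟨hB, fun T' hT' hne => ?_⟩⟩
    have : T' ∈ (K.star {a, b}).erase {a, b, c} := mem_erase.2 ⟨hne, hT'⟩
    rw [hT, mem_singleton] at this
    rw [this]; linarith

/-- Where the modulus is maximal, all nodes are on the boundary, no edge is, and the modulus is
maximal also on the neighbours. -/
theorem maximal_triangle (hM : 0 < M) (hy : ∀ T ∈ K.triangles, |y T| ≤ M) (hS : S ∈ K.triangles)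
    (hyS : |y S| = M)
    (h0 : 6 * μ.value y S + ∑ i, (2 * μ.value y {o.ord S i, o.ord S (i + 1)} +
      2 * μ.value y {o.ord S i}) = 0) :
    (∀ i, K.OnBoundary {o.ord S i}) ∧ ∀ i, ¬ K.OnBoundary {o.ord S i, o.ord S (i + 1)} ∧
      ∀ T ∈ K.star {o.ord S i, o.ord S (i + 1)}, |y T| = M := by
  wlog hpos : y S = M generalizing y with H
  · have hneg : y S = -M := by
      rcases abs_choice (y S) with h | h
      · exact absurd (h ▸ hyS) hpos
      · linarith
    have := H (y := -y) (by simpa using hy) (by simpa using hyS) ?_ (by simp [hneg])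
    · simpa using this
    · simp only [value_neg]
      simp only [Fin.sum_univ_three] at h0 ⊢
      linarith
  have hy' : ∀ T ∈ K.triangles, -M ≤ y T := fun T hT => neg_le_of_abs_le (hy T hT)
  have hne : ∀ i, o.ord S i ≠ o.ord S (i + 1) := fun i => (o.ord_injective hS).ne (fin_three_ne i)
  have hN := fun i => μ.value_node_ge hM hy' hS hpos (o.ord_mem hS i)
  have hE := fun i => μ.value_edge_nonneg hM hy' hS hpos (hne i) (o.ord_mem hS i)
    (o.ord_mem hS (i + 1))
  -- The barycenter contributes `6 * M`, the edges at least zero and each node at least `-2 * M`.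
  -- The sum can vanish only if all these bounds are attained.
  rw [μ.value_triangle y hS, hpos, Fin.sum_univ_three] at h0
  have hN' : ∀ i, μ.value y {o.ord S i} = -M := by
    have := (hN 0).1; have := (hN 1).1; have := (hN 2).1
    have := (hE 0).1; have := (hE 1).1; have := (hE 2).1
    intro i; fin_cases i <;> simp only [Fin.zero_eta, Fin.mk_one, Fin.reduceFinMk] <;> linarith
  have hE' : ∀ i, μ.value y {o.ord S i, o.ord S (i + 1)} = 0 := by
    have := (hN 0).1; have := (hN 1).1; have := (hN 2).1
    have := (hE 0).1; have := (hE 1).1; have := (hE 2).1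
    intro i; fin_cases i <;> simp only [Fin.zero_eta, Fin.mk_one, Fin.reduceFinMk] <;> linarith
  refine ⟨fun i => ((hN i).2 (hN' i)).2, fun i => ?_⟩
  obtain ⟨h1, h2⟩ := (hE i).2 ((hN i).2 (hN' i)).1 (hE' i)
  refine ⟨h1, fun T hT => ?_⟩
  by_cases hTS : T = S
  · rw [hTS, hyS]
  · rw [h2 T hT hTS, abs_neg, abs_of_pos hM]

/-- By `maximal_triangle` the maximal modulus passes to all neighbours, hence around any node of a
maximal triangle. Such a node is on the boundary, so going around it one meets a triangle with a
boundary edge, whereas maximal triangles have none. -/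
theorem eq_zero_of_values
    (h0 : ∀ S ∈ K.triangles, 6 * μ.value y S +
      ∑ i, (2 * μ.value y {o.ord S i, o.ord S (i + 1)} + 2 * μ.value y {o.ord S i}) = 0)
    (hT : T ∈ K.triangles) : y T = 0 := by
  by_contra hne
  obtain ⟨S, hS, hmax⟩ := K.triangles.exists_max_image (fun T => |y T|) ⟨T, hT⟩
  have hM : 0 < |y S| := (abs_pos.2 hne).trans_le (hmax T hT)
  have key := fun S' hS' e => μ.maximal_triangle hM hmax (S := S') hS' e (h0 S' hS')
  set a := o.ord S 0 with ha
  obtain ⟨e, he, hc, hae, h1⟩ := (key S hS rfl).1 0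
  obtain ⟨T₀, hT₀, heT⟩ : ∃ T₀ ∈ K.triangles, e ⊆ T₀ := by
    obtain ⟨T₀, h⟩ := card_pos.1 (h1 ▸ Nat.one_pos : 0 < (K.star e).card)
    exact ⟨T₀, mem_star.1 h⟩
  have hedge : ∀ S' ∈ K.triangles, |y S'| = |y S| → ∀ p q, p ≠ q → p ∈ S' → q ∈ S' →
      ¬ K.OnBoundary {p, q} ∧ ∀ T ∈ K.star {p, q}, |y T| = |y S| := by
    intro S' hS' hyS' p q hpq hp hq
    obtain ⟨r, h, rfl⟩ := exists_tri_edge hS' hp hq hpq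
    rcases o.ord_cases h with ⟨i, i0, i1, -⟩ | ⟨i, i0, i1, -⟩
    · have := (key _ hS' hyS').2 i
      rwa [i0, i1] at this
    · have := (key _ hS' hyS').2 i
      rwa [i0, i1, pair_comm] at this
  have hconn := K.star_connected a S (mem_triangles.1 hS).1 T₀ (mem_triangles.1 hT₀).1
    (mem_triangles.1 hS).2 (mem_triangles.1 hT₀).2 (o.ord_mem hS 0) (heT (hae (mem_singleton_self a)))
  have hall : |y T₀| = |y S| := by
    clear h1 heT hT₀
    induction hconn with
    | refl => rfl
    | @tail A B hAB hstep ih =>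
      obtain ⟨hA, hB, cA, cB, -, -, hcard⟩ := hstep
      obtain ⟨p, q, hpq, hpair⟩ := Set.ncard_eq_two.1 hcard
      have hp : p ∈ {x | x ∈ A ∧ x ∈ B} := hpair ▸ by simp
      have hq : q ∈ {x | x ∈ A ∧ x ∈ B} := hpair ▸ by simp
      have hA' : A ∈ K.triangles := mem_triangles.2 ⟨hA, cA⟩
      have hB' : B ∈ K.triangles := mem_triangles.2 ⟨hB, cB⟩
      refine (hedge A hA' ih p q hpq hp.1 hq.1).2 B (mem_star.2 ⟨hB', ?_⟩)
      intro x hx; simp only [mem_insert, mem_singleton] at hx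
      rcases hx with rfl | rfl
      exacts [hp.2, hq.2]
  obtain ⟨p, q, hpq, rfl⟩ := card_eq_two.1 hc
  exact (hedge T₀ hT₀ hall p q hpq (heT (by simp)) (heT (by simp))).1
    ((onBoundary_pair_iff hpq).2 h1)

/-- The maximum principle controls combinations of the basis 0-forms, not of the Whitney forms, so
it makes the transposed matrix injective. The matrix is square, which suffices. -/
theorem faceForm_eq_zero_of_pairing (hy : ∀ T, T ∉ K.triangles → y T = 0) (h02 : 0 + 2 = 2)
    (h : ∀ T ∈ K.triangles, pairing o h02 (K.sdForm (μ.R0 T)) (faceForm o y) = 0) : y = 0 := by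
  set A : Matrix K.triangles K.triangles ℝ := fun T S => (6 * μ.R0 T ![(S : Finset E3)] +
    ∑ i, (2 * μ.R0 T ![{o.ord S i, o.ord S (i + 1)}] + 2 * μ.R0 T ![{o.ord S i}])) with hA
  have hdet : A.det ≠ 0 := by
    intro h0
    obtain ⟨x, hx, hxA⟩ := Matrix.exists_vecMul_eq_zero_iff.2 h0
    apply hx
    ext T
    set z : Finset E3 → ℝ := fun T => if h : T ∈ K.triangles then x ⟨T, h⟩ else 0 with hz
    have hzT : ∀ T : K.triangles, z T = x T := fun T => by simp [hz]
    rw [← hzT]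
    refine μ.eq_zero_of_values (fun S hS => ?_) T.2
    have hS' := congrFun hxA ⟨S, hS⟩
    rw [Matrix.vecMul, dotProduct, Pi.zero_apply] at hS'
    simp only [← hzT, hA] at hS'
    rw [sum_coe_sort K.triangles (fun T => z T * (6 * μ.R0 T ![S] +
      ∑ i, (2 * μ.R0 T ![{o.ord S i, o.ord S (i + 1)}] + 2 * μ.R0 T ![{o.ord S i}])))] at hS'
    rw [← hS']
    simp only [value, Fin.sum_univ_three, mul_sum, ← sum_add_distrib]
    exact sum_congr rfl fun T _ => by ring
  have hmul : A.mulVec (fun T => y T) = 0 := by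
    ext T
    have hT := h T T.2
    rw [pairing_zero_two, ← sum_div, div_eq_zero_iff] at hT
    replace hT := hT.resolve_right (by norm_num)
    rw [Matrix.mulVec, dotProduct, Pi.zero_apply, ← hT]
    rw [← sum_coe_sort K.triangles]
    exact sum_congr rfl fun S _ => mul_comm _ _
  have hzero := Matrix.eq_zero_of_mulVec_eq_zero hdet hmul
  ext T
  by_cases hT : T ∈ K.triangles
  · exact congrFun hzero ⟨T, hT⟩
  · exact hy T hT

end BCBasis

end FaceForms

/-! ### Whitney forms and their coefficients -/

section Representation

open Finset SurfaceMesh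

variable {K : SurfaceMesh} (o : K.Orientation) {tr : ZeroTrace} {a b c p q : E3}
  {s t u T S : Finset E3}

theorem nodeForm_add (x y : E3 → ℝ) : nodeForm K (x + y) = nodeForm K x + nodeForm K y := by
  simp only [nodeForm, Pi.add_apply, add_smul, sum_add_distrib]

theorem nodeForm_smul (r : ℝ) (x : E3 → ℝ) : nodeForm K (r • x) = r • nodeForm K x := by
  simp only [nodeForm, Pi.smul_apply, smul_eq_mul, mul_smul, smul_sum]

theorem edgeForm_add (x y : E3 → E3 → ℝ) : edgeForm K (x + y) = edgeForm K x + edgeForm K y := by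
  simp only [edgeForm, Pi.add_apply, add_div, add_smul, sum_add_distrib]

theorem edgeForm_smul (r : ℝ) (x : E3 → E3 → ℝ) : edgeForm K (r • x) = r • edgeForm K x := by
  simp only [edgeForm, Pi.smul_apply, smul_eq_mul, mul_smul, smul_sum, mul_div_assoc]

theorem faceForm_add (x y : Finset E3 → ℝ) : faceForm o (x + y) = faceForm o x + faceForm o y := by
  simp only [faceForm, Pi.add_apply, add_smul, sum_add_distrib]

theorem faceForm_smul (r : ℝ) (x : Finset E3 → ℝ) : faceForm o (r • x) = r • faceForm o x := by
  simp only [faceForm, Pi.smul_apply, smul_eq_mul, mul_smul, smul_sum]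

/-- The functions on the nodes that carry degrees of freedom. -/
def nodeCoeffs (K : SurfaceMesh) (tr : ZeroTrace) : Submodule ℝ (E3 → ℝ) where
  carrier := {x | ∀ p, ¬ K.IsDof tr {p} → x p = 0}
  add_mem' := fun hx hy p hp => by rw [Pi.add_apply, hx p hp, hy p hp, add_zero]
  zero_mem' := fun _ _ => rfl
  smul_mem' := fun r x hx p hp => by rw [Pi.smul_apply, hx p hp, smul_zero]

/-- The antisymmetric functions on the edges that carry degrees of freedom. -/
def edgeCoeffs (K : SurfaceMesh) (tr : ZeroTrace) : Submodule ℝ (E3 → E3 → ℝ) where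
  carrier := {x | (∀ p q, x q p = - x p q) ∧ ∀ p q, ¬ (p ≠ q ∧ K.IsDof tr {p, q}) → x p q = 0}
  add_mem' := fun hx hy => ⟨fun p q => by
    simp only [Pi.add_apply, hx.1 p q, hy.1 p q]; ring, fun p q h => by
    simp only [Pi.add_apply, hx.2 p q h, hy.2 p q h, add_zero]⟩
  zero_mem' := ⟨fun _ _ => by simp, fun _ _ _ => rfl⟩
  smul_mem' := fun r x hx => ⟨fun p q => by
    simp only [Pi.smul_apply, hx.1 p q, smul_neg], fun p q h => by
    simp only [Pi.smul_apply, hx.2 p q h, smul_zero]⟩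

/-- The functions on the triangles. -/
def faceCoeffs (K : SurfaceMesh) : Submodule ℝ (Finset E3 → ℝ) where
  carrier := {y | ∀ T, T ∉ K.triangles → y T = 0}
  add_mem' := fun hx hy p hp => by rw [Pi.add_apply, hx p hp, hy p hp, add_zero]
  zero_mem' := fun _ _ => rfl
  smul_mem' := fun r x hx p hp => by rw [Pi.smul_apply, hx p hp, smul_zero]

theorem nodeForm_mem {x : E3 → ℝ} (hx : x ∈ nodeCoeffs K tr) :
    nodeForm K x ∈ whitneySpace K tr 0 := by
  refine Submodule.sum_mem _ fun p _ => ?_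
  by_cases h : K.IsDof tr {p}
  · refine Submodule.smul_mem _ _ (Submodule.subset_span
      ⟨![p], fun i j _ => Subsingleton.elim (α := Fin 1) i j, ?_, rfl⟩)
    simpa using h
  · rw [hx p h, zero_smul]; exact Submodule.zero_mem _

theorem image_pair (p q : E3) : univ.image ![p, q] = {p, q} := by
  ext x; simp [Fin.exists_fin_two, eq_comm]

theorem injective_pair (h : p ≠ q) : Function.Injective ![p, q] := by
  intro i j hij
  fin_cases i <;> fin_cases j <;> simp_all [eq_comm]

theorem edgeForm_mem {x : E3 → E3 → ℝ} (hx : x ∈ edgeCoeffs K tr) :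
    edgeForm K x ∈ whitneySpace K tr 1 := by
  refine Submodule.sum_mem _ fun p _ => Submodule.sum_mem _ fun q _ => ?_
  by_cases h : p ≠ q ∧ K.IsDof tr {p, q}
  · refine Submodule.smul_mem _ _ (Submodule.subset_span ⟨![p, q], injective_pair h.1, ?_, rfl⟩)
    rw [image_pair]; exact h.2
  · rw [hx.2 p q h, zero_div, zero_smul]; exact Submodule.zero_mem _

theorem isDof_triangle (hT : T ∈ K.triangles) : K.IsDof tr T := by
  refine ⟨(mem_triangles.1 hT).1, fun _ => ?_⟩
  rintro ⟨e, -, hc, hs, -⟩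
  have := card_le_card hs
  rw [(mem_triangles.1 hT).2, hc] at this
  omega

theorem faceForm_mem (y : Finset E3 → ℝ) : faceForm o y ∈ whitneySpace K tr 2 := by
  refine Submodule.sum_mem _ fun T hT => Submodule.smul_mem _ _ (Submodule.subset_span
    ⟨o.ord T, o.ord_injective hT, ?_, rfl⟩)
  rw [o.image_ord T hT]; exact isDof_triangle hT

theorem exists_nodeForm_eq {ω : Form 0} (hω : ω ∈ whitneySpace K tr 0) :
    ∃ x ∈ nodeCoeffs K tr, nodeForm K x = ω := by
  induction hω using Submodule.span_induction with
  | mem ω h =>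
    obtain ⟨v, -, hd, rfl⟩ := h
    have hv : v = ![v 0] := by ext i : 1; fin_cases i; rfl
    have him : univ.image v = {v 0} := by ext x; simp
    rw [him] at hd
    have hn := singleton_mem_faces_iff.1 hd.1
    refine ⟨Pi.single (v 0) 1, fun p hp => Pi.single_eq_of_ne (fun e : p = v 0 => hp (by rw [e]; exact hd)) _, ?_⟩
    rw [nodeForm, sum_eq_single (v 0)]
    · rw [Pi.single_eq_same, one_smul, ← hv]
    · intro p _ hp; rw [Pi.single_eq_of_ne hp, zero_smul]
    · exact fun h => absurd hn h
  | zero => exact ⟨0, Submodule.zero_mem _, by simp [nodeForm]⟩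
  | add ω η _ _ h1 h2 =>
    obtain ⟨x, hx, rfl⟩ := h1
    obtain ⟨y, hy, rfl⟩ := h2
    exact ⟨x + y, Submodule.add_mem _ hx hy, nodeForm_add x y⟩
  | smul r ω _ h =>
    obtain ⟨x, hx, rfl⟩ := h
    exact ⟨r • x, Submodule.smul_mem _ _ hx, nodeForm_smul r x⟩

theorem whitney_pair_swap (F : Finset (Finset E3)) (p q : E3) :
    whitney F ![q, p] = - whitney F ![p, q] := by
  ext x u
  have e : (univ.image ![q, p] : Finset E3) = univ.image ![p, q] := by
    rw [image_pair, image_pair, pair_comm]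
  have h' : ∀ s, whitneyLocal s ![q, p] = - whitneyLocal s ![p, q] := by
    intro s; ext y w
    change whitneyLocal s ![q, p] y w = - whitneyLocal s ![p, q] y w
    rw [whitneyLocal_one_apply, whitneyLocal_one_apply]; simp
  rw [Pi.neg_apply]
  congr 1
  simp only [whitney, e, h', Set.indicator_neg', Pi.neg_apply, sum_neg_distrib]

theorem exists_edgeForm_eq {ω : Form 1} (hω : ω ∈ whitneySpace K tr 1) :
    ∃ x ∈ edgeCoeffs K tr, edgeForm K x = ω := by
  induction hω using Submodule.span_induction with
  | mem ω h =>
    obtain ⟨v, hi, hd, rfl⟩ := h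
    obtain ⟨p, hp⟩ : ∃ p, p = v 0 := ⟨_, rfl⟩
    obtain ⟨q, hq⟩ : ∃ q, q = v 1 := ⟨_, rfl⟩
    have hpq : p ≠ q := by rw [hp, hq]; exact hi.ne (by decide)
    have hv : v = ![p, q] := by ext i : 1; fin_cases i <;> simp [hp, hq]
    rw [hv, image_pair] at hd
    obtain ⟨T, hT, hs⟩ := exists_triangle hd.1
    have hpn : p ∈ K.nodes := mem_nodes_of_mem hT (hs (by simp))
    have hqn : q ∈ K.nodes := mem_nodes_of_mem hT (hs (by simp))
    refine ⟨fun r s => (if r = p ∧ s = q then 1 else 0) - if r = q ∧ s = p then 1 else 0,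
      ⟨fun r s => ?_, fun r s hrs => ?_⟩, ?_⟩
    · have e1 : (s = p ∧ r = q) = (r = q ∧ s = p) := propext and_comm
      have e2 : (s = q ∧ r = p) = (r = p ∧ s = q) := propext and_comm
      simp only [e1, e2]; ring
    · have h1 : ¬ (r = p ∧ s = q) := by rintro ⟨rfl, rfl⟩; exact hrs ⟨hpq, hd⟩
      have h2 : ¬ (r = q ∧ s = p) := by
        rintro ⟨rfl, rfl⟩; exact hrs ⟨hpq.symm, hd.pair_comm⟩
      simp only [if_neg h1, if_neg h2, sub_zero]
    · rw [edgeForm, sum_eq_add p q hpq, sum_eq_single q, sum_eq_single p, hv]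
      · rw [whitney_pair_swap _ p q]
        simp [hpq, hpq.symm, neg_div]
        rw [← add_smul]; norm_num
      · intro s _ hs'; simp [hs', hpq.symm]
      · exact fun h => absurd hpn h
      · intro s _ hs'; simp [hs', hpq]
      · exact fun h => absurd hqn h
      · intro r _ hr
        exact sum_eq_zero fun s _ => by simp [hr.1, hr.2]
      · exact fun h => absurd hpn h
      · exact fun h => absurd hqn h
  | zero => exact ⟨0, Submodule.zero_mem _, by simp [edgeForm]⟩
  | add ω η _ _ h1 h2 =>
    obtain ⟨x, hx, rfl⟩ := h1
    obtain ⟨y, hy, rfl⟩ := h2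
    exact ⟨x + y, Submodule.add_mem _ hx hy, edgeForm_add x y⟩
  | smul r ω _ h =>
    obtain ⟨x, hx, rfl⟩ := h
    exact ⟨r • x, Submodule.smul_mem _ _ hx, edgeForm_smul r x⟩

/-- Both are constant 2-forms on the same triangle; writing the differential at `c` as minus the
other two leaves only the orientation sign. -/
theorem whitney_triangle (h : K.Tri a b c) :
    whitney K.triangles ![a, b, c] =
      o.inc {a, b, c} a b • whitney K.triangles (o.ord {a, b, c}) := by
  have him : univ.image ![a, b, c] = {a, b, c} := by
    ext x; simp [Fin.exists_fin_succ, eq_comm]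
  have hT := h.2.2.2
  have hinj : Function.Injective ![a, b, c] := by
    obtain ⟨h1, h2, h3, -⟩ := h
    intro i j hij
    fin_cases i <;> fin_cases j <;> simp_all [eq_comm]
  ext y u
  rw [Pi.smul_apply, ContinuousAlternatingMap.smul_apply, smul_eq_mul]
  by_cases hy : ∃ s ∈ K.triangles, y ∈ openTriangle s
  · obtain ⟨s, hs, hy⟩ := hy
    rw [K.isTriangulation.whitney_eq hs hy, K.isTriangulation.whitney_eq hs hy,
      o.image_ord _ hT, him]
    by_cases hsub : ({a, b, c} : Finset E3) ⊆ s
    · obtain rfl := eq_of_subset_of_card_le hsub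
        ((mem_triangles.1 hs).2.trans h.card_triangle.symm).le
      have iT := K.isTriangulation.indep _ hT
      rw [if_pos hsub, if_pos hsub, whitneyLocal_two_eq iT h.card_triangle hinj him hy.1,
        whitneyLocal_two_eq iT h.card_triangle (o.ord_injective hT) (o.image_ord _ hT) hy.1]
      have hsum : ∀ w, baryDiff {a, b, c} a w + baryDiff {a, b, c} b w +
          baryDiff {a, b, c} c w = 0 := fun w => by
        have := congrArg (fun f : E3 →L[ℝ] ℝ => f w) (sum_baryDiff iT h.card_triangle)
        rw [sum_insert (by simp [h.1, h.2.1]), sum_pair h.2.2.1] at this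
        rw [add_assoc]; exact this
      have s0 := hsum (u 0)
      have s1 := hsum (u 1)
      set d := fun q w => baryDiff {a, b, c} q w with hd
      have e0 : d c (u 0) = - d a (u 0) - d b (u 0) := by simp only [hd]; linarith
      have e1 : d c (u 1) = - d a (u 1) - d b (u 1) := by simp only [hd]; linarith
      change 2 * (d a (u 0) * d b (u 1) - d a (u 1) * d b (u 0)) = o.inc {a, b, c} a b *
        (2 * (d (o.ord {a, b, c} 0) (u 0) * d (o.ord {a, b, c} 1) (u 1) -
          d (o.ord {a, b, c} 0) (u 1) * d (o.ord {a, b, c} 1) (u 0)))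
      rcases o.ord_cases h with ⟨i, h0, h1, h2⟩ | ⟨i, h0, h1, h2⟩
      · have hinc := o.inc_next hT i
        rw [h0, h1] at hinc
        rw [hinc]
        fin_cases i <;> simp at h0 h1 h2 <;> simp only [h0, h1, h2, e0, e1] <;> ring
      · have hinc := o.inc_prev hT i
        rw [h0, h1] at hinc
        rw [hinc]
        fin_cases i <;> simp at h0 h1 h2 <;> simp only [h0, h1, h2, e0, e1] <;> ring
    · rw [if_neg hsub, if_neg hsub]; simp
  · push Not at hy
    rw [whitney_of_notMem hy, whitney_of_notMem hy]; simp

theorem exists_faceForm_eq {ω : Form 2} (hω : ω ∈ whitneySpace K tr 2) :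
    ∃ y ∈ faceCoeffs K, faceForm o y = ω := by
  induction hω using Submodule.span_induction with
  | mem ω h =>
    obtain ⟨v, hi, hd, rfl⟩ := h
    have hv : v = ![v 0, v 1, v 2] := by ext i : 1; fin_cases i <;> rfl
    have him : univ.image v = {v 0, v 1, v 2} := by
      ext x; simp [Fin.exists_fin_succ, eq_comm]
    have hc : (univ.image v).card = 3 := by
      rw [card_image_of_injective _ hi]; simp
    have h : K.Tri (v 0) (v 1) (v 2) := ⟨hi.ne (by decide), hi.ne (by decide), hi.ne (by decide),
      him ▸ mem_triangles.2 ⟨hd.1, hc⟩⟩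
    refine ⟨Pi.single {v 0, v 1, v 2} (o.inc {v 0, v 1, v 2} (v 0) (v 1)), fun T hT =>
      Pi.single_eq_of_ne (fun e : T = _ => hT (by rw [e]; exact h.2.2.2)) _, ?_⟩
    have := whitney_triangle o h
    rw [← hv] at this
    rw [this, faceForm, sum_eq_single {v 0, v 1, v 2}]
    · rw [Pi.single_eq_same]
    · intro p _ hp; rw [Pi.single_eq_of_ne hp, zero_smul]
    · exact fun hn => absurd h.2.2.2 hn
  | zero => exact ⟨0, Submodule.zero_mem _, by simp [faceForm]⟩
  | add ω η _ _ h1 h2 =>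
    obtain ⟨x, hx, rfl⟩ := h1
    obtain ⟨y, hy, rfl⟩ := h2
    exact ⟨x + y, Submodule.add_mem _ hx hy, faceForm_add o x y⟩
  | smul r ω _ h =>
    obtain ⟨x, hx, rfl⟩ := h
    exact ⟨r • x, Submodule.smul_mem _ _ hx, faceForm_smul o r x⟩

theorem baryDiff_sub (h : K.Tri a b c) {r s : E3} (hp : p ∈ ({a, b, c} : Finset E3))
    (hr : r ∈ ({a, b, c} : Finset E3)) (hs : s ∈ ({a, b, c} : Finset E3)) :
    baryDiff {a, b, c} p (r - s) = (if r = p then 1 else 0) - if s = p then 1 else 0 := by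
  have key : ∀ t ∈ ({a, b, c} : Finset E3), baryCoord {a, b, c} p t = if t = p then 1 else 0 := by
    intro t ht
    split_ifs with e
    · rw [e, baryCoord_self]
    · exact baryCoord_of_ne (K.isTriangulation.indep _ h.2.2.2) hp ht e
  rw [← baryCoord_sub, key r hr, key s hs]

/-- The coefficients of a closed Whitney 1-form add up to zero around each triangle. -/
theorem sum_eq_zero_of_surfaceD {x : E3 → E3 → ℝ} (ha : ∀ p q, x q p = - x p q)
    (hx : surfaceD K.triangles (edgeForm K x) = 0) (h : K.Tri a b c) :
    x a b + x b c + x c a = 0 := by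
  have hT := h.2.2.2
  set T : Finset E3 := {a, b, c} with hTdef
  -- One interior point is enough, because the derivative is constant on the triangle.
  have hy := h.param_mem (p := (1 / 3, 1 / 3)) ⟨by norm_num, by norm_num, by norm_num⟩
  set y := param (corners a b c) (1 / 3, 1 / 3)
  have hlin : surfaceD K.triangles (edgeForm K x) = ∑ p ∈ K.nodes, ∑ q ∈ K.nodes,
      (x p q / 2) • surfaceD K.triangles (whitney K.triangles ![p, q]) := by
    set W : E3 → E3 → smoothForms K.triangles 1 := fun p q =>
      ⟨whitney K.triangles ![p, q], K.isTriangulation.whitney_mem_smoothForms _⟩ with hW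
    have h1 : surfaceDMap K.triangles 1 (∑ p ∈ K.nodes, ∑ q ∈ K.nodes, (x p q / 2) • W p q) =
        ∑ p ∈ K.nodes, ∑ q ∈ K.nodes, (x p q / 2) • surfaceDMap K.triangles 1 (W p q) := by
      simp only [map_sum, map_smul]
    have h2 : (smoothForms K.triangles 1).subtype
        (∑ p ∈ K.nodes, ∑ q ∈ K.nodes, (x p q / 2) • W p q) = edgeForm K x := by
      simp only [map_sum, map_smul]; rfl
    rw [← h2]; exact h1
  have hsub : T ⊆ K.nodes := fun q hq => mem_nodes_of_mem hT hq
  have hw : ∀ p q, surfaceD K.triangles (whitney K.triangles ![p, q]) y ![b - a, c - a] =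
      if p ∈ T ∧ q ∈ T then 2 * (baryDiff T p (b - a) * baryDiff T q (c - a) -
        baryDiff T p (c - a) * baryDiff T q (b - a)) else 0 := by
    intro p q
    have h2 : univ.image ![p, q] ⊆ T ↔ p ∈ T ∧ q ∈ T := image_two_subset _
    rw [K.isTriangulation.surfaceD_whitney hT hy]
    simp only [h2]
    split_ifs
    · rw [extDeriv_whitneyLocal_one]; rfl
    · rfl
  have key : ∑ p ∈ K.nodes, ∑ q ∈ K.nodes,
      (x p q / 2) * surfaceD K.triangles (whitney K.triangles ![p, q]) y ![b - a, c - a] = 0 := by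
    have h0 : surfaceD K.triangles (edgeForm K x) y ![b - a, c - a] = 0 := by rw [hx]; rfl
    rw [← h0, hlin]
    simp only [Finset.sum_apply, ContinuousAlternatingMap.sum_apply]
    rfl
  simp only [hw] at key
  rw [← sum_subset hsub fun p _ hp => sum_eq_zero fun q _ => by simp [hp]] at key
  rw [sum_congr rfl fun p hp => (sum_subset hsub fun q _ hq => by simp [hq]).symm]
    at key
  obtain ⟨n1, n2, n3, -⟩ := h
  have ea : a ∈ T := by simp [hTdef]
  have eb : b ∈ T := by simp [hTdef]
  have ec : c ∈ T := by simp [hTdef]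
  have hd : ∀ p ∈ T, baryDiff T p (b - a) = (if b = p then 1 else 0) - if a = p then 1 else 0 :=
    fun p hp => baryDiff_sub ⟨n1, n2, n3, hT⟩ hp eb ea
  have hd' : ∀ p ∈ T, baryDiff T p (c - a) = (if c = p then 1 else 0) - if a = p then 1 else 0 :=
    fun p hp => baryDiff_sub ⟨n1, n2, n3, hT⟩ hp ec ea
  have hex : ∀ g : E3 → ℝ, ∑ p ∈ T, g p = g a + g b + g c := fun g => by
    rw [hTdef, sum_insert (by simp [n1, n2]), sum_pair n3, add_assoc]
  simp only [hex, ea, eb, ec, and_self, if_true, hd _ ea, hd _ eb, hd _ ec, hd' _ ea, hd' _ eb,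
    hd' _ ec, n1, n2, n3, n1.symm, n2.symm, n3.symm, if_false] at key
  linarith [ha a b, ha b c, ha a c, ha a a, ha b b, ha c c]

/-- A small triangle at `a` is the same as a pair of a triangle and a node with nonzero incidence
number, and the squares of these numbers count such pairs. -/
theorem valence_eq (o : K.Orientation) (a : E3) :
    K.valence a = ∑ T ∈ K.triangles, ∑ b ∈ K.nodes, o.inc T a b * o.inc T a b := by
  have h1 : ∀ T ∈ K.triangles, ∀ b, o.inc T a b * o.inc T a b =
      if o.inc T a b ≠ 0 then 1 else 0 := by
    intro T hT b
    split_ifs with h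
    · obtain ⟨c, hc, rfl⟩ := exists_tri_of_inc_ne_zero o hT h
      exact hc.inc_mul_inc o
    · rw [not_not.1 h, zero_mul]
  rw [sum_congr rfl fun T hT => sum_congr rfl fun b _ => h1 T hT b,
    ← sum_product' (f := fun T b => if o.inc T a b ≠ 0 then (1 : ℝ) else 0),
    sum_boole, valence]
  congr 1
  rw [← card_image_of_injOn (f := fun z : Finset E3 × E3 => smallTriangle a z.2 z.1)]
  · congr 1
    ext z
    rw [mem_filter, mem_image]
    constructor
    · rintro ⟨hz, h0⟩
      obtain ⟨p, q, r, h, rfl⟩ := mem_flags_two.1 hz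
      obtain rfl := singleton_inj.1 h0
      refine ⟨({p, q, r}, q), mem_filter.2 ⟨mem_product.2
        ⟨h.2.2.2, mem_nodes_of_mem h.2.2.2 (by simp)⟩, ?_⟩, rfl⟩
      rcases o.inc_eq_or h with e | e <;> simp only [e] <;> norm_num
    · rintro ⟨⟨T, q⟩, hm, rfl⟩
      obtain ⟨hm, hne⟩ := mem_filter.1 hm
      obtain ⟨r, hr, e⟩ := exists_tri_of_inc_ne_zero o (mem_product.1 hm).1 hne
      have e' : T = {a, q, r} := e
      subst e'
      exact ⟨hr.flag_mem, rfl⟩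
  · rintro ⟨T, q⟩ hz ⟨T', q'⟩ hz' e
    obtain ⟨hm, hne⟩ := mem_filter.1 (mem_coe.1 hz)
    obtain ⟨r, hr, -⟩ := exists_tri_of_inc_ne_zero o (mem_product.1 hm).1 hne
    have e2 : T = T' := congrFun e 2
    have e1 : ({a, q} : Finset E3) = {a, q'} := congrFun e 1
    rcases finset_pair_eq_pair_iff.1 e1 with h | h
    · rw [e2, h.2]
    · exact absurd h.2.symm hr.1

end Representation

/-! ### Nondegeneracy for 1-forms -/

section EdgeForms

open Finset SurfaceMesh

variable {K K' : SurfaceMesh} {o : K.Orientation} {tr : ZeroTrace} (μ : BCBasis K o tr)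
  {a b c p q : E3} {s t u T S : Finset E3}

theorem pairing_sdForm {k r : ℕ} (h : k + r = 2) (R : (Fin (k + 1) → Finset E3) → ℝ)
    {ω : Form r} (hω : ω ∈ regularForms r) : pairing o h (K.sdForm R) ω =
      ∑ w ∈ K.flags k, R w * pairing o h (whitney K.sdTriangles (fun i => center (w i))) ω :=
  pairing_sum_left o h _ R (fun _ _ => whitney_mem_regularForms _ _) hω

/-- The boundary of the triangle enters `a` along one edge and leaves it along the other. -/
theorem SurfaceMesh.sum_inc_right (hT : T ∈ K.triangles) (a : E3) :
    ∑ b ∈ K.nodes, o.inc T a b = 0 := by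
  by_cases ha : a ∈ T
  · obtain ⟨b, c, h, rfl⟩ := exists_tri hT ha
    rw [sum_eq_add b c h.2.2.1]
    · rw [o.inc_third h]; ring
    · intro q _ hq
      by_cases hqa : q = a
      · rw [hqa, o.inc_self hT]
      · exact o.inc_of_notMem hT (by simp [hq.1, hq.2, hqa])
    · exact fun hn => absurd (mem_nodes_of_mem hT (by simp)) hn
    · exact fun hn => absurd (mem_nodes_of_mem hT (by simp)) hn
  · exact sum_eq_zero fun b _ => o.inc_of_notMem hT fun h => ha h.1

namespace BCBasis

/-- The sign in the integration by parts cancels that in `deriv0`. With `K' = K` this serves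
nondegeneracy, with the other mesh the commuting property. -/
theorem pairing_surfaceD_R0 (hΓ : K'.space = K.space) (hT : T ∈ K.triangles) {ω : Form 1}
    (hω : ω ∈ whitneySpace K' tr 1) (h02 : 0 + 2 = 2) (h11 : 1 + 1 = 2) :
    pairing o h02 (K.sdForm (μ.R0 T)) (surfaceD K'.triangles ω) =
      ∑ i, if K.IsDof tr {o.ord T i, o.ord T (i + 1)} then
        pairing o h11 (K.sdForm (μ.R1 (o.ord T i) (o.ord T (i + 1)))) ω else 0 := by
  have hω' := whitneySpace_le K' tr 1 hω
  rw [pairing_surfaceD_of_one o hΓ (fun htr s hs hB =>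
      μ.R0_boundary htr hT hB (K.nonempty_of_mem_faces hs)) hω h02 h11, pairing_sdForm h11 _ hω',
    sum_congr rfl fun w hw => by rw [μ.coboundary_R0 hT hw]]
  simp only [pairing_sdForm h11 _ hω', neg_mul, sum_neg_distrib, neg_neg, sum_mul]
  rw [sum_comm]
  refine sum_congr rfl fun i _ => ?_
  split_ifs <;> simp

/-- Integration by parts turns the derivative of the Whitney form into the coboundary of the
coefficients, which `coboundary_R1` expresses by the two end nodes. -/
theorem pairing_surfaceD_R1 (hΓ : K'.space = K.space) (hab : a ≠ b) (hd : K.IsDof tr {a, b})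
    {ω : Form 0} (hω : ω ∈ whitneySpace K' tr 0) (h11 : 1 + 1 = 2) (h20 : 2 + 0 = 2) :
    pairing o h11 (K.sdForm (μ.R1 a b)) (surfaceD K'.triangles ω) =
      (if K.IsDof tr {b} then pairing o h20 (K.sdForm (K.coeff2 o b)) ω else 0) -
        (if K.IsDof tr {a} then pairing o h20 (K.sdForm (K.coeff2 o a)) ω else 0) := by
  have hω' := whitneySpace_le K' tr 0 hω
  rw [pairing_surfaceD_of_zero o hΓ (fun htr p q hpq hB => μ.R1_boundary hab hd htr hpq hB) hω h11
    h20, pairing_sdForm h20 _ hω', pairing_sdForm h20 _ hω', pairing_sdForm h20 _ hω',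
    sum_congr rfl fun w hw => by rw [μ.coboundary_R1 hab hd hw]]
  simp only [sub_mul, ite_mul, zero_mul, sum_sub_distrib]
  split_ifs <;> simp

/-- The average of a potential over the dual cell of its base node. -/
noncomputable def dualAverage (o : K.Orientation) (x : E3 → E3 → ℝ) (p : E3) : ℝ :=
  (∑ T ∈ K.triangles, ∑ q ∈ K.nodes, o.inc T p q * (o.inc T p q *
    ((x p q / 2 + nodeAverage (x p) T) / 3))) / K.valence p

/-- The potential is zero at the base node, and the other two nodes of a small triangle have weights
5/18 and 2/18. -/
theorem abs_dualAverage_le {x : E3 → E3 → ℝ} {M : ℝ} (hM : 0 ≤ M) (hx : ∀ p q, |x p q| ≤ M)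
    (h0 : x p p = 0) : |dualAverage o x p| ≤ 7 / 18 * M := by
  rw [dualAverage, abs_div, abs_of_nonneg (show 0 ≤ K.valence p from Nat.cast_nonneg _)]
  refine div_le_of_le_mul₀ (Nat.cast_nonneg _) (by positivity) ?_
  rw [valence_eq o, mul_sum]
  refine (abs_sum_le_sum_abs _ _).trans (sum_le_sum fun T hT => ?_)
  rw [mul_sum]
  refine (abs_sum_le_sum_abs _ _).trans (sum_le_sum fun q _ => ?_)
  by_cases hi : o.inc T p q = 0
  · rw [hi]; simp
  obtain ⟨r, hr, rfl⟩ := exists_tri_of_inc_ne_zero o hT hi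
  rw [← mul_assoc, hr.inc_mul_inc, one_mul, mul_one, hr.nodeAverage, h0]
  have h1 := abs_le.1 (hx p q)
  have h2 := abs_le.1 (hx p r)
  rw [abs_le]
  constructor <;> linarith [h1.1, h1.2, h2.1, h2.2]

/-- Stokes on each small triangle with the potential based at its node. The area terms are averages
over the dual cells of the end nodes. In the circulation, halves of edges and segments from nodes to
barycenters cancel, because the potential is the same on both sides, or vanish on the boundary by
the trace condition. Across the dual edge the potential jumps by `x a b`. -/
theorem pairing_R1 (hab : a ≠ b) (hd : K.IsDof tr {a, b}) {x : E3 → E3 → ℝ}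
    (hx : x ∈ edgeCoeffs K tr) (hc : ∀ a b c, K.Tri a b c → x a b + x b c + x c a = 0)
    (h11 : 1 + 1 = 2) :
    pairing o h11 (K.sdForm (μ.R1 a b)) (edgeForm K x) = x a b +
      ((if K.IsDof tr {b} then dualAverage o x b else 0) -
        if K.IsDof tr {a} then dualAverage o x a else 0) := by
  obtain ⟨hanti, hsupp⟩ := hx
  obtain ⟨T₀, hT₀, hs₀⟩ := exists_triangle hd.1
  have ha : a ∈ K.nodes := mem_nodes_of_mem hT₀ (hs₀ (by simp))
  have hb : b ∈ K.nodes := mem_nodes_of_mem hT₀ (hs₀ (by simp))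
  rw [pairing_one_one o _ hanti hc]
  have split : ∀ i A B C D : ℝ, i * (A - (B + C - D)) = i * A - (i * B + i * C - i * D) :=
    fun i A B C D => by ring
  simp only [split, sum_sub_distrib, sum_add_distrib]
  -- the derivative of the basis form
  have s1 : ∑ T ∈ K.triangles, ∑ p ∈ K.nodes, ∑ q ∈ K.nodes, o.inc T p q *
      (coboundary (μ.R1 a b) (smallTriangle p q T) * (x p q / 2 + nodeAverage (x p) T) / 3) =
      (if K.IsDof tr {b} then dualAverage o x b else 0) -
        if K.IsDof tr {a} then dualAverage o x a else 0 := by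
    have single : ∀ d ∈ K.nodes, ∑ T ∈ K.triangles, ∑ p ∈ K.nodes, ∑ q ∈ K.nodes, o.inc T p q *
        (K.coeff2 o d (smallTriangle p q T) * (x p q / 2 + nodeAverage (x p) T) / 3) =
        dualAverage o x d := by
      intro d hd
      rw [sum_inc_congr o (g := fun T p q => if p = d then o.inc T p q *
        ((x p q / 2 + nodeAverage (x p) T) / 3) / K.valence p else 0), dualAverage, sum_div]
      · refine sum_congr rfl fun T _ => ?_
        rw [sum_eq_single d, sum_div]
        · refine sum_congr rfl fun q _ => ?_
          rw [if_pos rfl]; ring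
        · intro p _ hp
          exact sum_eq_zero fun q _ => by rw [if_neg hp, mul_zero]
        · exact fun hn => absurd hd hn
      · intro p q r h
        rw [h.coeff2_eq]
        split_ifs <;> ring
    rw [sum_inc_congr o (g := fun T p q =>
      (if K.IsDof tr {b} then K.coeff2 o b (smallTriangle p q T) *
        (x p q / 2 + nodeAverage (x p) T) / 3 else 0) -
      (if K.IsDof tr {a} then K.coeff2 o a (smallTriangle p q T) *
        (x p q / 2 + nodeAverage (x p) T) / 3 else 0))]
    · simp only [mul_sub, sum_sub_distrib]
      congr 1 <;> split_ifs
      · exact single b hb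
      · simp
      · exact single a ha
      · simp
    · intro p q r h
      rw [μ.coboundary_R1 hab hd (show smallTriangle p q {p, q, r} ∈ K.flags 2 from h.flag_mem)]
      split_ifs <;> ring
  -- the halves of the edges
  have s2 : ∑ T ∈ K.triangles, ∑ p ∈ K.nodes, ∑ q ∈ K.nodes, o.inc T p q *
      (μ.R1 a b ![{p}, {p, q}] * (x p q / 2) / 2) = 0 := by
    rw [sum_comm]
    refine sum_eq_zero fun p _ => ?_
    rw [sum_comm]
    refine sum_eq_zero fun q _ => ?_
    rw [← sum_mul]
    by_cases hpq : p = q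
    · rw [hpq, sum_eq_zero fun T hT => o.inc_self hT, zero_mul]
    by_cases hB : K.OnBoundary {p, q}
    · have htr : tr = ZeroTrace.buffaChristiansen ∨ tr = ZeroTrace.whitney := by
        cases tr <;> simp
      rcases htr with htr | htr
      · rw [μ.R1_boundary hab hd htr hpq hB]; simp
      · rw [hsupp p q fun h => h.2.2 htr hB]; simp
    · rw [sum_inc_eq_zero o hpq hB, zero_mul]
  -- the segments from the nodes to the barycenters
  have s3 : ∑ T ∈ K.triangles, ∑ p ∈ K.nodes, ∑ q ∈ K.nodes, o.inc T p q *
      (μ.R1 a b ![{p}, T] * nodeAverage (x p) T / 2) = 0 := by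
    refine sum_eq_zero fun T hT => sum_eq_zero fun p _ => ?_
    rw [← sum_mul, sum_inc_right hT, zero_mul]
  -- the dual edge
  have s4 : ∑ T ∈ K.triangles, ∑ p ∈ K.nodes, ∑ q ∈ K.nodes, o.inc T p q *
      (μ.R1 a b ![{p, q}, T] * (x p q / 2 + nodeAverage (x p) T) / 2) = - x a b := by
    have hT4 : ∀ T ∈ K.triangles, ∑ p ∈ K.nodes, ∑ q ∈ K.nodes, o.inc T p q *
        (μ.R1 a b ![{p, q}, T] * (x p q / 2 + nodeAverage (x p) T) / 2) =
        if {a, b} ⊆ T then - x a b / (K.star {a, b}).card else 0 := by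
      intro T hT
      have hz : ∀ p q, ({p, q} : Finset E3) ≠ {a, b} → o.inc T p q *
          (μ.R1 a b ![{p, q}, T] * (x p q / 2 + nodeAverage (x p) T) / 2) = 0 := by
        intro p q hne
        by_cases hi : o.inc T p q = 0
        · rw [hi, zero_mul]
        · obtain ⟨r, hr, rfl⟩ := exists_tri_of_inc_ne_zero o hT hi
          rw [μ.R1_edge_of_ne hab hd hr hne]; ring
      have hsum : ∑ p ∈ K.nodes, ∑ q ∈ K.nodes, o.inc T p q *
          (μ.R1 a b ![{p, q}, T] * (x p q / 2 + nodeAverage (x p) T) / 2) =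
          o.inc T a b * (μ.R1 a b ![{a, b}, T] * (x a b / 2 + nodeAverage (x a) T) / 2) +
          o.inc T b a * (μ.R1 a b ![{b, a}, T] * (x b a / 2 + nodeAverage (x b) T) / 2) := by
        rw [sum_eq_add a b hab, sum_eq_single b, sum_eq_single a]
        · intro q _ hq
          refine hz b q fun e => ?_
          rcases finset_pair_eq_pair_iff.1 e with h | h
          exacts [hab h.1.symm, hq h.2]
        · exact fun hn => absurd ha hn
        · intro q _ hq
          refine hz a q fun e => ?_
          rcases finset_pair_eq_pair_iff.1 e with h | h
          exacts [hq h.2, hab h.1]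
        · exact fun hn => absurd hb hn
        · intro p _ hp
          refine sum_eq_zero fun q _ => hz p q fun e => ?_
          rcases finset_pair_eq_pair_iff.1 e with h | h
          exacts [hp.1 h.1, hp.2 h.1]
        · exact fun hn => absurd ha hn
        · exact fun hn => absurd hb hn
      rw [hsum]
      split_ifs with hsT
      · obtain ⟨r, hr, rfl⟩ := exists_tri_edge hT (hsT (by simp)) (hsT (by simp)) hab
        rw [pair_comm b a, μ.R1_edge hab hd hT (by simp) (by simp), o.inc_swap hT a b,
          hr.nodeAverage, hr.nodeAverage]
        have hi := hr.inc_mul_inc o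
        have k1 : x a a = 0 := by linarith [hanti a a]
        have k2 : x b b = 0 := by linarith [hanti b b]
        have k3 := hanti a b
        have k4 := hc a b r hr
        have k5 := hanti a r
        have k6 : x b r = x a r - x a b := by linarith
        rw [k1, k2, k3, k6]
        generalize ((K.star {a, b}).card : ℝ) = n
        linear_combination (- (x a b) / n) * hi
      · have : o.inc T a b = 0 := o.inc_of_notMem hT fun h => hsT (by
          intro y hy; simp only [mem_insert, mem_singleton] at hy
          rcases hy with rfl | rfl
          exacts [h.1, h.2])
        rw [o.inc_swap hT a b, this]; ring
    have hst : ∑ T ∈ K.triangles, (if {a, b} ⊆ T then - x a b / (K.star {a, b}).card else 0) =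
        ∑ T ∈ K.star {a, b}, (- x a b / (K.star {a, b}).card) := (sum_filter _ _).symm
    rw [sum_congr rfl hT4, hst, sum_const, nsmul_eq_mul]
    have : ((K.star {a, b}).card : ℝ) ≠ 0 := by
      exact_mod_cast (card_pos.2 (pair_mem_faces_iff.1 hd.1)).ne'
    field_simp
  rw [s1, s2, s3, s4]
  ring

/-- Orthogonality to the basis 1-forms makes the derivative orthogonal to the basis 0-forms, so the
form is closed by the case of 2-forms. By `pairing_R1` a maximal coefficient is then a difference of
two averages, each at most 7/18 of it, and twice 7/18 is less than one. -/
theorem edgeForm_eq_zero_of_pairing {x : E3 → E3 → ℝ} (hx : x ∈ edgeCoeffs K tr)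
    (h11 : 1 + 1 = 2)
    (h : ∀ a b, a ≠ b → K.IsDof tr {a, b} →
      pairing o h11 (K.sdForm (μ.R1 a b)) (edgeForm K x) = 0) : x = 0 := by
  have hω : edgeForm K x ∈ whitneySpace K tr 1 := edgeForm_mem hx
  -- the form is closed
  have hclosed : surfaceD K.triangles (edgeForm K x) = 0 := by
    obtain ⟨y, hy, hyd⟩ := exists_faceForm_eq o (surfaceD_mem_whitneySpace (by norm_num) hω)
    have hy0 : y = 0 := by
      refine μ.faceForm_eq_zero_of_pairing hy (zero_add 2) fun T hT => ?_
      rw [hyd, μ.pairing_surfaceD_R0 rfl hT hω (zero_add 2) h11]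
      refine sum_eq_zero fun i _ => ?_
      split_ifs with hd
      · exact h _ _ ((o.ord_injective hT).ne (fin_three_ne i)) hd
      · rfl
    rw [← hyd, hy0]; simp [faceForm]
  have hc : ∀ a b c, K.Tri a b c → x a b + x b c + x c a = 0 := fun a b c ht =>
    sum_eq_zero_of_surfaceD hx.1 hclosed ht
  by_contra hne
  have hmem : ∀ p q, x p q ≠ 0 → (p, q) ∈ K.nodes ×ˢ K.nodes := by
    intro p q hpq
    have hd := (not_not.1 (mt (hx.2 p q) hpq)).2
    obtain ⟨T, hT, hs⟩ := exists_triangle hd.1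
    exact mem_product.2 ⟨mem_nodes_of_mem hT (hs (by simp)),
      mem_nodes_of_mem hT (hs (by simp))⟩
  obtain ⟨p₀, q₀, h₀⟩ : ∃ p q, x p q ≠ 0 := by
    by_contra hn
    push Not at hn
    exact hne (funext fun p => funext fun q => hn p q)
  obtain ⟨⟨p, q⟩, -, hmax⟩ := (K.nodes ×ˢ K.nodes).exists_max_image (fun z => |x z.1 z.2|)
    ⟨_, hmem p₀ q₀ h₀⟩
  have hpos : 0 < |x p q| := (abs_pos.2 h₀).trans_le (hmax _ (hmem p₀ q₀ h₀))
  have hle : ∀ r s, |x r s| ≤ |x p q| := fun r s => by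
    by_cases hrs : x r s = 0
    · rw [hrs, abs_zero]; exact hpos.le
    · exact hmax _ (hmem r s hrs)
  obtain ⟨hpq, hd⟩ := not_not.1 (mt (hx.2 p q) (abs_pos.1 hpos))
  have key := μ.pairing_R1 hpq hd hx hc h11
  rw [h p q hpq hd] at key
  have hself : ∀ r, x r r = 0 := fun r => by linarith [hx.1 r r]
  have hb : ∀ r, |if K.IsDof tr {r} then dualAverage o x r else 0| ≤ 7 / 18 * |x p q| := by
    intro r
    split_ifs
    · exact abs_dualAverage_le hpos.le hle (hself r)
    · rw [abs_zero]; positivity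
  have b1 := hb p
  have b2 := hb q
  have : |x p q| ≤ 7 / 18 * |x p q| + 7 / 18 * |x p q| := by
    have e : x p q = (if K.IsDof tr {p} then dualAverage o x p else 0) -
        (if K.IsDof tr {q} then dualAverage o x q else 0) := by linarith
    calc |x p q| = |(if K.IsDof tr {p} then dualAverage o x p else 0) -
        (if K.IsDof tr {q} then dualAverage o x q else 0)| := by rw [← e]
      _ ≤ _ := (abs_sub _ _).trans (add_le_add b1 b2)
  linarith

end BCBasis

end EdgeForms

/-! ### Existence of the coupling operators -/

section Coupling

open Set
open SurfaceMesh

/-- The moments take values in the same space `X` that parametrizes `W`, so parametrization followed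
by moments is an endomorphism of a finite-dimensional space; being injective, it is invertible. No
dimensions have to be counted. -/
theorem exists_comp_eq {U V W Y : Type*} [AddCommGroup V] [Module ℝ V] [AddCommGroup W]
    [Module ℝ W] [AddCommGroup Y] [Module ℝ Y] [AddCommGroup U] [Module ℝ U]
    [FiniteDimensional ℝ W] {X : Submodule ℝ Y} (A : X →ₗ[ℝ] W) (i : W →ₗ[ℝ] U) (j : V →ₗ[ℝ] U)
    (D : U →ₗ[ℝ] Y) (hD : ∀ u, D u ∈ X) (hinj : ∀ x, D (i (A x)) = 0 → x = 0) :
    ∃ Q : V →ₗ[ℝ] W, ∀ v, D (i (Q v)) = D (j v) := by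
  have hA : Function.Injective A := (injective_iff_map_eq_zero A).2 fun x hx =>
    hinj x (by rw [hx, map_zero, map_zero])
  have : FiniteDimensional ℝ X := FiniteDimensional.of_injective A hA
  have hM : Function.Injective (D.codRestrict X hD ∘ₗ i ∘ₗ A) :=
    (injective_iff_map_eq_zero _).2 fun x hx => hinj x (congrArg Subtype.val hx)
  set e := LinearEquiv.ofInjectiveEndo _ hM
  refine ⟨A ∘ₗ e.symm.toLinearMap ∘ₗ D.codRestrict X hD ∘ₗ j, fun v => ?_⟩
  exact congrArg Subtype.val (e.apply_symm_apply (D.codRestrict X hD (j v)))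

instance (K : SurfaceMesh) (tr : ZeroTrace) (r : ℕ) : FiniteDimensional ℝ (whitneySpace K tr r) := by
  refine FiniteDimensional.span_of_finite ℝ (Set.Finite.subset (s := (fun v : Fin (r + 1) → E3 =>
    whitney K.triangles v) '' Set.pi Set.univ fun _ => (K.nodes : Set E3)) ?_ ?_)
  · exact (Set.Finite.pi fun _ => K.nodes.finite_toSet).image _
  · rintro _ ⟨v, -, hd, rfl⟩
    obtain ⟨T, hT, hs⟩ := exists_triangle hd.1
    exact ⟨v, fun i _ => mem_nodes_of_mem hT (hs (Finset.mem_image_of_mem v (Finset.mem_univ i))), rfl⟩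

variable {K K' : SurfaceMesh} {o : K.Orientation} {tr : ZeroTrace} (μ : BCBasis K o tr)
  {q r : ℕ} (h : q + r = 2)

theorem pairing_sub_right (o : K.Orientation) {β : Form q} {ω η : Form r}
    (hβ : β ∈ regularForms q) (hω : ω ∈ regularForms r) (hη : η ∈ regularForms r) :
    pairing o h β (ω - η) = pairing o h β ω - pairing o h β η :=
  map_sub (pairingMap o h (⟨β, hβ⟩ : regularForms q)) (⟨ω, hω⟩ : regularForms r) ⟨η, hη⟩

namespace BCBasis

theorem forall_pairing_eq_zero_iff {ω : Form r} (hω : ω ∈ regularForms r) :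
    (∀ β ∈ μ.space q, pairing o h β ω = 0) ↔
      ∀ R ∈ μ.coeffs q, pairing o h (K.sdForm R) ω = 0 := by
  refine ⟨fun H R hR => H _ (Submodule.subset_span ⟨R, hR, rfl⟩), fun H β hβ => ?_⟩
  have : μ.space q ≤
      (LinearMap.ker ((pairingMap o h).flip ⟨ω, hω⟩)).map (regularForms q).subtype := by
    refine Submodule.span_le.2 ?_
    rintro _ ⟨R, hR, rfl⟩
    exact ⟨⟨K.sdForm R, sdForm_mem_regularForms R⟩, H R hR, rfl⟩
  obtain ⟨β', h0, rfl⟩ := this hβ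
  exact h0

/-- The part common to all degrees: `A` builds a Whitney form from its coefficients, `D` collects
the moments against the basis forms, indexed in the same way. -/
theorem nondegenerate_and_exists_of_moments {Y : Type*} [AddCommGroup Y] [Module ℝ Y]
    {X : Submodule ℝ Y} (A : X →ₗ[ℝ] whitneySpace K tr r) (D : regularForms r →ₗ[ℝ] Y)
    (hA : Function.Surjective A) (hD : ∀ ω, D ω ∈ X)
    (hD0 : ∀ ω, D ω = 0 ↔ ∀ R ∈ μ.coeffs q, pairing o h (K.sdForm R) ω = 0)
    (hinj : ∀ x, D (Submodule.inclusion (whitneySpace_le K tr r) (A x)) = 0 → x = 0) :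
    (∀ ω ∈ whitneySpace K tr r, (∀ β ∈ μ.space q, pairing o h β ω = 0) → ω = 0) ∧
      ∀ K', ∃ Q, IsCouplingOperator K' μ h Q := by
  constructor
  · intro ω hω H
    obtain ⟨x, hx⟩ := hA ⟨ω, hω⟩
    have := hinj x ((hD0 _).2 fun R hR => by
      rw [hx]; exact (μ.forall_pairing_eq_zero_iff h (whitneySpace_le K tr r hω)).1 H R hR)
    rw [this, map_zero] at hx
    exact (congrArg Subtype.val hx).symm
  · intro K'
    obtain ⟨Q, hQ⟩ := exists_comp_eq (V := whitneySpace K' tr r) (W := whitneySpace K tr r)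
      (U := regularForms r) A (Submodule.inclusion (whitneySpace_le K tr r))
      (Submodule.inclusion (whitneySpace_le K' tr r)) D hD hinj
    refine ⟨Q, fun ω β hβ => ?_⟩
    have h0 := sub_eq_zero.2 (hQ ω)
    rw [← map_sub, hD0, ← μ.forall_pairing_eq_zero_iff h (Subtype.property _)] at h0
    exact sub_eq_zero.1 ((pairing_sub_right h o (μ.space_le q hβ) (whitneySpace_le _ _ _ (Q ω).2)
      (whitneySpace_le _ _ _ ω.2)).symm.trans (h0 β hβ))

/-- Setting the moments to zero off the active simplices places them in the space of coefficients;
in degree one their antisymmetry comes from that of the basis forms. -/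
theorem nondegenerate_and_exists :
    (∀ ω ∈ whitneySpace K tr r, (∀ β ∈ μ.space q, pairing o h β ω = 0) → ω = 0) ∧
      ∀ K', ∃ Q, IsCouplingOperator K' μ h Q := by
  set P : ((Fin (q + 1) → Finset E3) → ℝ) → regularForms r →ₗ[ℝ] ℝ := fun R =>
    pairingMap o h ⟨K.sdForm R, sdForm_mem_regularForms R⟩ with hP
  obtain ⟨rfl, rfl⟩ | ⟨rfl, rfl⟩ | ⟨rfl, rfl⟩ : q = 2 ∧ r = 0 ∨ q = 1 ∧ r = 1 ∨ q = 0 ∧ r = 2 := by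
    omega
  · have hval : ∀ ω p, LinearMap.pi (fun p => if K.IsDof tr {p} then P (K.coeff2 o p) else 0) ω p =
        if K.IsDof tr {p} then pairing o h (K.sdForm (K.coeff2 o p)) ω else 0 := by
      intro ω p; rw [LinearMap.pi_apply]; split_ifs <;> rfl
    refine μ.nondegenerate_and_exists_of_moments h (X := nodeCoeffs K tr)
      ⟨⟨fun x => ⟨nodeForm K x, nodeForm_mem x.2⟩, fun x y => Subtype.ext (nodeForm_add _ _)⟩,
        fun c x => Subtype.ext (nodeForm_smul _ _)⟩
      (LinearMap.pi fun p => if K.IsDof tr {p} then P (K.coeff2 o p) else 0) ?_ ?_ ?_ ?_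
    · rintro ⟨ω, hω⟩
      obtain ⟨x, hx, rfl⟩ := exists_nodeForm_eq hω
      exact ⟨⟨x, hx⟩, rfl⟩
    · exact fun ω p hp => by rw [hval, if_neg hp]
    · refine fun ω => ⟨?_, fun H => funext fun p => ?_⟩
      · rintro H _ ⟨p, hp, rfl⟩
        have := congrFun H p
        rwa [hval, if_pos hp] at this
      · rw [hval]
        split_ifs with hp
        · exact H _ ⟨p, hp, rfl⟩
        · rfl
    · refine fun x H => Subtype.ext (nodeForm_eq_zero_of_pairing o x.2 h fun p hp => ?_)
      have := congrFun H p
      rwa [hval, if_pos hp] at this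
  · have hval : ∀ ω a b, LinearMap.pi (fun a => LinearMap.pi fun b =>
          if a ≠ b ∧ K.IsDof tr {a, b} then P (μ.R1 a b) else 0) ω a b =
        if a ≠ b ∧ K.IsDof tr {a, b} then pairing o h (K.sdForm (μ.R1 a b)) ω else 0 := by
      intro ω a b; rw [LinearMap.pi_apply, LinearMap.pi_apply]; split_ifs <;> rfl
    refine μ.nondegenerate_and_exists_of_moments h (X := edgeCoeffs K tr)
      ⟨⟨fun x => ⟨edgeForm K x, edgeForm_mem x.2⟩, fun x y => Subtype.ext (edgeForm_add _ _)⟩,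
        fun c x => Subtype.ext (edgeForm_smul _ _)⟩
      (LinearMap.pi fun a => LinearMap.pi fun b =>
        if a ≠ b ∧ K.IsDof tr {a, b} then P (μ.R1 a b) else 0) ?_ ?_ ?_ ?_
    · rintro ⟨ω, hω⟩
      obtain ⟨x, hx, rfl⟩ := exists_edgeForm_eq hω
      exact ⟨⟨x, hx⟩, rfl⟩
    · refine fun ω => ⟨fun a b => ?_, fun a b hab => by rw [hval, if_neg hab]⟩
      have e : (b ≠ a ∧ K.IsDof tr {b, a}) = (a ≠ b ∧ K.IsDof tr {a, b}) := by
        rw [Finset.pair_comm, ne_comm]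
      simp only [hval, e]
      split_ifs
      · rw [pairing_sdForm h _ ω.2, pairing_sdForm h _ ω.2, ← Finset.sum_neg_distrib]
        exact Finset.sum_congr rfl fun w _ => by rw [μ.antisymm a b, neg_mul]
      · rw [neg_zero]
    · refine fun ω => ⟨?_, fun H => funext fun a => funext fun b => ?_⟩
      · rintro H _ ⟨a, b, hab, hd, rfl⟩
        have := congrFun (congrFun H a) b
        rwa [hval, if_pos ⟨hab, hd⟩] at this
      · rw [hval]
        split_ifs with hp
        · exact H _ ⟨a, b, hp.1, hp.2, rfl⟩
        · rfl
    · refine fun x H => Subtype.ext (μ.edgeForm_eq_zero_of_pairing x.2 h fun a b hab hd => ?_)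
      have := congrFun (congrFun H a) b
      rwa [hval, if_pos ⟨hab, hd⟩] at this
  · have hval : ∀ ω T, LinearMap.pi (fun T => if T ∈ K.triangles then P (μ.R0 T) else 0) ω T =
        if T ∈ K.triangles then pairing o h (K.sdForm (μ.R0 T)) ω else 0 := by
      intro ω p; rw [LinearMap.pi_apply]; split_ifs <;> rfl
    refine μ.nondegenerate_and_exists_of_moments h (X := faceCoeffs K)
      ⟨⟨fun x => ⟨faceForm o x, faceForm_mem o x⟩, fun x y => Subtype.ext (faceForm_add o _ _)⟩,
        fun c x => Subtype.ext (faceForm_smul o _ _)⟩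
      (LinearMap.pi fun T => if T ∈ K.triangles then P (μ.R0 T) else 0) ?_ ?_ ?_ ?_
    · rintro ⟨ω, hω⟩
      obtain ⟨x, hx, rfl⟩ := exists_faceForm_eq o hω
      exact ⟨⟨x, hx⟩, rfl⟩
    · exact fun ω p hp => by rw [hval, if_neg hp]
    · refine fun ω => ⟨?_, fun H => funext fun p => ?_⟩
      · rintro H _ ⟨p, hp, rfl⟩
        have := congrFun H p
        rwa [hval, if_pos hp] at this
      · rw [hval]
        split_ifs with hp
        · exact H _ ⟨p, hp, rfl⟩
        · rfl
    · refine fun x H => Subtype.ext (μ.faceForm_eq_zero_of_pairing x.2 h fun p hp => ?_)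
      have := congrFun H p
      rwa [hval, if_pos hp] at this

end BCBasis

end Coupling

/-! ### The commuting property -/

section Commuting

open Set
open SurfaceMesh

variable {K K' : SurfaceMesh} {o : K.Orientation} {tr : ZeroTrace} (μ : BCBasis K o tr)
  {q r : ℕ}

/-- Almost every point of a triangle of `K` is interior to a triangle of `K` and to a triangle of
`K'`. -/
theorem pairing_eq_of_coincide (hΓ : K'.space = K.space) (h : q + r = 2) (β : Form q)
    {ω η : Form r} (H : Coincide K' K ω η) : pairing o h β η = pairing o h β ω := by
  rw [pairing_eq, pairing_eq]
  refine Finset.sum_congr rfl fun T hT => integral_congr_ae ?_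
  have hv := o.ord_affineIndependent hT
  filter_upwards [K.isTriangulation.ae_mem hv (o.convexHull_ord_subset hT),
    K'.isTriangulation.ae_mem hv (hΓ ▸ o.convexHull_ord_subset hT)] with p hp hp'
  obtain ⟨s, hs, hps, -⟩ := hp
  obtain ⟨s', hs', hps', -⟩ := hp'
  have := H s' hs' s hs _ ⟨hps', hps⟩
  simp only [integrand, this]

namespace BCBasis

theorem eq_of_pairing_eq (h : q + r = 2) {ω η : Form r} (hω : ω ∈ whitneySpace K tr r)
    (hη : η ∈ whitneySpace K tr r)
    (H : ∀ R ∈ μ.coeffs q, pairing o h (K.sdForm R) ω = pairing o h (K.sdForm R) η) : ω = η := by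
  have hs := Submodule.sub_mem _ hω hη
  refine sub_eq_zero.1 ((μ.nondegenerate_and_exists h).1 _ hs
    ((μ.forall_pairing_eq_zero_iff h (whitneySpace_le _ _ _ hs)).2 fun R hR => ?_))
  rw [pairing_sub_right h o (sdForm_mem_regularForms R) (whitneySpace_le _ _ _ hω)
    (whitneySpace_le _ _ _ hη), H R hR, sub_self]

theorem sdForm_mem_space {R : (Fin (q + 1) → Finset E3) → ℝ} (hR : R ∈ μ.coeffs q) :
    K.sdForm R ∈ μ.space q := Submodule.subset_span ⟨R, hR, rfl⟩

/-- Adjointness on `K` turns the moments of the derivative of `η` into moments of `η`, which are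
those of `ω`; adjointness between the meshes turns these into moments of the derivative of `ω`,
which are those of `ζ`. Nondegeneracy then identifies the two forms. -/
theorem surfaceD_coupling (hΓ : K'.space = K.space) (h : q + 1 + r = 2) (h' : q + (r + 1) = 2)
    {ω η : Form r} (hω : ω ∈ whitneySpace K' tr r) (hη : η ∈ whitneySpace K tr r) {ζ : Form (r + 1)}
    (hζ : ζ ∈ whitneySpace K tr (r + 1))
    (H : ∀ β ∈ μ.space (q + 1), pairing o h β η = pairing o h β ω)
    (H' : ∀ β ∈ μ.space q, pairing o h' β ζ = pairing o h' β (surfaceD K'.triangles ω)) :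
    surfaceD K.triangles η = ζ := by
  refine μ.eq_of_pairing_eq h' (surfaceD_mem_whitneySpace (by omega) hη) hζ fun R hR => ?_
  rw [H' _ (μ.sdForm_mem_space hR)]
  obtain ⟨rfl, rfl⟩ | ⟨rfl, rfl⟩ : q = 1 ∧ r = 0 ∨ q = 0 ∧ r = 1 := by omega
  · obtain ⟨a, b, hab, hd, rfl⟩ := hR
    rw [μ.pairing_surfaceD_R1 rfl hab hd hη h' h, μ.pairing_surfaceD_R1 hΓ hab hd hω h' h]
    congr 1 <;> split_ifs with hp
    · exact H _ (μ.sdForm_mem_space ⟨_, hp, rfl⟩)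
    · rfl
    · exact H _ (μ.sdForm_mem_space ⟨_, hp, rfl⟩)
    · rfl
  · obtain ⟨T, hT, rfl⟩ := hR
    rw [μ.pairing_surfaceD_R0 rfl hT hη h' h, μ.pairing_surfaceD_R0 hΓ hT hω h' h]
    refine Finset.sum_congr rfl fun i _ => ?_
    split_ifs with hp
    · exact H _ (μ.sdForm_mem_space ⟨_, _, (o.ord_injective hT).ne (fin_three_ne i), hp, rfl⟩)
    · rfl

end BCBasis

end Commuting

/-- Fredholm alternative: a vector outside the range is separated from it by a linear functional,
whose coefficients serve as `y`. -/
theorem exists_eq_of_orthogonal {ι V : Type*} [AddCommGroup V] [Module ℝ V] (S : Finset ι)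
    (L : V →ₗ[ℝ] ι → ℝ) (v : ι → ℝ)
    (h : ∀ y : ι → ℝ, (∀ g, ∑ i ∈ S, y i * L g i = 0) → ∑ i ∈ S, y i * v i = 0) :
    ∃ g, ∀ i ∈ S, L g i = v i := by
  classical
  by_contra hn
  set res : (ι → ℝ) →ₗ[ℝ] S → ℝ := LinearMap.funLeft ℝ ℝ ((↑) : S → ι)
  have hv : res v ∉ LinearMap.range (res ∘ₗ L) := by
    rintro ⟨g, hg⟩
    exact hn ⟨g, fun i hi => congrFun hg ⟨i, hi⟩⟩
  obtain ⟨f, hf, hk⟩ := Submodule.exists_le_ker_of_notMem hv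
  set y : ι → ℝ := fun i => if hi : i ∈ S then f (fun j => if (⟨i, hi⟩ : S) = j then 1 else 0) else 0
  have hy : ∀ x : ι → ℝ, ∑ i ∈ S, y i * x i = f (res x) := by
    intro x
    rw [LinearMap.pi_apply_eq_sum_univ f, ← Finset.sum_coe_sort]
    refine Finset.sum_congr rfl fun i _ => ?_
    simp only [y, dif_pos i.2, smul_eq_mul]
    rw [mul_comm]; rfl
  refine hf ((hy v).symm.trans (h y fun g => ?_))
  rw [hy]
  exact hk ⟨g, rfl⟩

/-! ### Solving for the basis 1-forms around a node -/

section EdgeWeights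

open SurfaceMesh Finset

variable {K : SurfaceMesh} (o : K.Orientation) {tr : ZeroTrace} {a b c p q : E3}
  {s t u T S : Finset E3}

namespace SurfaceMesh

theorem inc_ne_zero_iff (hT : T ∈ K.triangles) (hab : a ≠ b) :
    o.inc T a b ≠ 0 ↔ a ∈ T ∧ b ∈ T := by
  refine ⟨fun h => not_not.1 (mt (o.inc_of_notMem hT) h), fun h => ?_⟩
  obtain ⟨c, hc, rfl⟩ := exists_tri_edge hT h.1 h.2 hab
  rcases o.inc_eq_or hc with e | e <;> rw [e] <;> norm_num

theorem sum_inc_sq (hab : a ≠ b) :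
    ∑ T ∈ K.triangles, o.inc T a b * o.inc T a b = (K.star {a, b}).card := by
  rw [star, card_filter, Nat.cast_sum]
  refine sum_congr rfl fun T hT => ?_
  simp only [insert_subset_iff, singleton_subset_iff, Nat.cast_ite, Nat.cast_one,
    Nat.cast_zero]
  split_ifs with h
  · obtain ⟨c, hc, rfl⟩ := exists_tri_edge hT h.1 h.2 hab
    exact hc.inc_mul_inc o
  · rw [o.inc_of_notMem hT h, zero_mul]

/-- Multipliers that are balanced in the triangles around a node and at the edges between them are
constant. -/
theorem eq_of_balanced {y : Finset E3 → E3 → ℝ}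
    (hT : ∀ T ∈ K.triangles, ∑ q ∈ K.nodes, y T q * o.inc T a q = 0)
    (he : ∀ q, ¬ K.OnBoundary {a, q} → ∑ T ∈ K.triangles, y T q * o.inc T a q = 0)
    (hS : S ∈ K.triangles) (hp : o.inc S a p ≠ 0) (hS' : T ∈ K.triangles) (hq : o.inc T a q ≠ 0) :
    y S p = y T q := by
  have hne : ∀ {T q}, T ∈ K.triangles → o.inc T a q ≠ 0 → a ≠ q := by
    rintro T q h1 h2 rfl; exact h2 (o.inc_self h1)
  -- The two edges at `a` of one triangle have opposite incidence numbers, so balance equates their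
  -- multipliers; `h2` does the same for the two triangles at an interior edge, and connectedness of
  -- the star links all of them.
  have h1 : ∀ {T p q}, T ∈ K.triangles → o.inc T a p ≠ 0 → o.inc T a q ≠ 0 → y T p = y T q := by
    intro T p q h hp hq
    by_cases hpq : p = q
    · rw [hpq]
    obtain ⟨r, hr, rfl⟩ := exists_tri_of_inc_ne_zero o h hp
    have hqr : q = r := by
      have := ((inc_ne_zero_iff o h (hne h hq)).1 hq).2
      simp only [mem_insert, mem_singleton] at this
      rcases this with e | e | e
      · exact absurd e.symm (hne h hq)
      · exact absurd e.symm hpq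
      · exact e
    subst hqr
    have := hT _ h
    rw [sum_eq_add p q hpq, o.inc_third hr] at this
    · exact mul_right_cancel₀ hp (by linarith)
    · intro x _ hx
      by_cases hxa : x = a
      · rw [hxa, o.inc_self h, mul_zero]
      · rw [o.inc_of_notMem h (by simp [hx.1, hx.2, hxa]), mul_zero]
    · exact fun hn => absurd (mem_nodes_of_mem h (by simp)) hn
    · exact fun hn => absurd (mem_nodes_of_mem h (by simp)) hn
  have h2 : ∀ {T S q}, T ∈ K.triangles → S ∈ K.triangles → o.inc T a q ≠ 0 → o.inc S a q ≠ 0 →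
      y T q = y S q := by
    intro T S q hT hS h h'
    by_cases hTS : T = S
    · rw [hTS]
    have haq := hne hT h
    obtain ⟨t1, t2⟩ := (inc_ne_zero_iff o hT haq).1 h
    obtain ⟨s1, s2⟩ := (inc_ne_zero_iff o hS haq).1 h'
    have hstar : K.star {a, q} = {T, S} := by
      refine (eq_of_subset_of_card_le ?_ ?_).symm
      · intro X hX
        rcases mem_insert.1 hX with rfl | hX
        · exact mem_star.2 ⟨hT, by simp [insert_subset_iff, t1, t2]⟩
        · rw [mem_singleton.1 hX]
          exact mem_star.2 ⟨hS, by simp [insert_subset_iff, s1, s2]⟩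
      · rw [card_pair hTS]; exact card_star_le haq
    have := he q (by rw [onBoundary_pair_iff haq, hstar, card_pair hTS]; norm_num)
    rw [sum_eq_add T S hTS, o.inc_compat hT hS hTS t1 t2 s1 s2] at this
    · exact mul_right_cancel₀ h (by linarith)
    · intro X hX hne
      rw [o.inc_of_notMem hX, mul_zero]
      intro hm
      have : X ∈ K.star {a, q} := mem_star.2 ⟨hX, by simp [insert_subset_iff, hm]⟩
      rw [hstar, mem_insert, mem_singleton] at this
      exact this.elim hne.1 hne.2
    · exact fun hn => absurd hT hn
    · exact fun hn => absurd hS hn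
  obtain ⟨mS, cS⟩ := mem_triangles.1 hS
  obtain ⟨mT, cT⟩ := mem_triangles.1 hS'
  have hpath := K.star_connected a S mS T mT cS cT ((inc_ne_zero_iff o hS (hne hS hp)).1 hp).1
    ((inc_ne_zero_iff o hS' (hne hS' hq)).1 hq).1
  suffices ∀ q, o.inc T a q ≠ 0 → y S p = y T q from this q hq
  clear hq
  induction hpath with
  | refl => exact fun q hq => h1 hS hp hq
  | @tail X Z _ hXZ ih =>
    obtain ⟨mX, mZ, cX, cZ, aX, aZ, hc⟩ := hXZ
    have tX := mem_triangles.2 ⟨mX, cX⟩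
    have tZ := mem_triangles.2 ⟨mZ, cZ⟩
    obtain ⟨x, hx, hxa⟩ := Set.exists_ne_of_one_lt_ncard (by rw [hc]; norm_num) a
    have iX := (inc_ne_zero_iff o tX hxa.symm).2 ⟨aX, hx.1⟩
    have iZ := (inc_ne_zero_iff o tZ hxa.symm).2 ⟨aZ, hx.2⟩
    exact fun q hq => (ih tX mX cX x iX).trans ((h2 tX tZ iX iZ).trans (h1 tZ iZ hq))

/-- Up to sign, `g T` and `g {a, q}` are the coefficients of the basis 1-form of `a b` on the
segments from `a` to the barycenter of `T` and to the midpoint of `a q`, and each equation is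
`deriv1` in one small triangle. `P` marks the halves with zero trace, `act` tells whether `a` is
active. Annihilating multipliers are constant around `a`. At an active node the weighted right-hand
sides add up to `1 - 1`; at an inactive one, a boundary edge without trace condition forces the
constant to be zero. -/
theorem exists_edge_weights {P : E3 → Prop} {act : Prop} (hab : a ≠ b) (hf : {a, b} ∈ K.faces)
    (hP : ∀ q, P q → K.OnBoundary {a, q})
    (hact : ¬ act → ∃ q, a ≠ q ∧ K.OnBoundary {a, q} ∧ ¬ P q) :
    ∃ g : Finset E3 → ℝ, (∀ T ∈ K.triangles, ∀ q, o.inc T a q ≠ 0 → g T - g {a, q} = o.inc T a q *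
      ((if q = b then ((K.star {a, b}).card : ℝ)⁻¹ else 0) - if act then (K.valence a)⁻¹ else 0)) ∧
      ∀ q, P q → g {a, q} = 0 := by
  set w : E3 → ℝ := fun q =>
    (if q = b then ((K.star {a, b}).card : ℝ)⁻¹ else 0) - if act then (K.valence a)⁻¹ else 0 with hw
  have hTne : ∀ T ∈ K.triangles, ∀ q, T ≠ {a, q} := by
    rintro T hT q rfl
    have := (card_le_two (a := a) (b := q))
    rw [(mem_triangles.1 hT).2] at this; omega
  -- Unknowns on halves with zero trace are removed from the equations; they are set to zero at the
  -- end.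
  set u : E3 → ℝ := fun q => if P q then 0 else 1 with hu
  -- Each equation is multiplied by its incidence number, so the equations of pairs that do not
  -- belong to a small triangle at `a` become trivial.
  set L : (Finset E3 → ℝ) →ₗ[ℝ] Finset E3 × E3 → ℝ :=
    ⟨⟨fun g z => o.inc z.1 a z.2 * (g z.1 - u z.2 * g {a, z.2}), fun g g' => by
      ext z; simp only [Pi.add_apply]; ring⟩, fun c g => by
      ext z; simp only [Pi.smul_apply, smul_eq_mul, RingHom.id_apply]; ring⟩
  obtain ⟨g, hg⟩ := exists_eq_of_orthogonal (K.triangles ×ˢ K.nodes) L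
    (fun z => o.inc z.1 a z.2 * (o.inc z.1 a z.2 * w z.2)) (by
      intro y hy
      simp only [sum_product] at hy ⊢
      have hy' : ∀ g : Finset E3 → ℝ, ∑ T ∈ K.triangles, ∑ q ∈ K.nodes, y (T, q) * (o.inc T a q *
          (g T - u q * g {a, q})) = 0 := hy
      have e1 : ∀ T ∈ K.triangles, ∑ q ∈ K.nodes, y (T, q) * o.inc T a q = 0 := by
        intro T hT
        rw [← hy' (Pi.single T 1), sum_eq_single T]
        · refine sum_congr rfl fun q _ => ?_
          rw [Pi.single_eq_same, Pi.single_eq_of_ne (hTne T hT q).symm, mul_zero, sub_zero, mul_one]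
        · intro S hS hST
          refine sum_eq_zero fun q _ => ?_
          rw [Pi.single_eq_of_ne hST, Pi.single_eq_of_ne (hTne T hT q).symm, mul_zero, sub_zero,
            mul_zero, mul_zero]
        · exact fun hn => absurd hT hn
      have e2 : ∀ q, ¬ P q → ∑ T ∈ K.triangles, y (T, q) * o.inc T a q = 0 := by
        intro q hq
        rw [← neg_eq_zero, ← hy' (Pi.single {a, q} 1), ← sum_neg_distrib]
        refine sum_congr rfl fun T hT => ?_
        rw [sum_eq_single q]
        · rw [hu]; beta_reduce; rw [if_neg hq, Pi.single_eq_same, Pi.single_eq_of_ne (hTne T hT q)]; ring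
        · intro r _ hr
          have : ({a, r} : Finset E3) ≠ {a, q} := by
            rw [Ne, finset_pair_eq_pair_iff]
            rintro (⟨-, h⟩ | ⟨h1, h2⟩)
            exacts [hr h, hr (h2.trans h1)]
          rw [Pi.single_eq_of_ne this, mul_zero, Pi.single_eq_of_ne (hTne T hT q), sub_zero,
            mul_zero, mul_zero]
        · intro hn
          rw [o.inc_of_notMem hT fun hm => hn (mem_nodes_of_mem hT hm.2)]; simp
      have e3 := fun {S T : Finset E3} {p q : E3} => eq_of_balanced o (S := S) (T := T) (p := p)
        (q := q) (y := fun T q => y (T, q)) e1 (fun q hq => e2 q fun h => hq (hP q h))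
      obtain ⟨T₀, hT₀⟩ := pair_mem_faces_iff.1 hf
      have hT₀' := (mem_star.1 hT₀).1
      have i₀ : o.inc T₀ a b ≠ 0 := (inc_ne_zero_iff o hT₀' hab).2
        ⟨(mem_star.1 hT₀).2 (by simp), (mem_star.1 hT₀).2 (by simp)⟩
      have hsum : ∑ T ∈ K.triangles, ∑ q ∈ K.nodes, y (T, q) * (o.inc T a q * (o.inc T a q * w q)) =
          y (T₀, b) * ∑ T ∈ K.triangles, ∑ q ∈ K.nodes, o.inc T a q * o.inc T a q * w q := by
        simp only [mul_sum]
        refine sum_congr rfl fun T hT => sum_congr rfl fun q _ => ?_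
        by_cases hi : o.inc T a q = 0
        · rw [hi]; ring
        · rw [e3 hT hi hT₀' i₀]; ring
      -- The squares count small triangles: `(K.star {a, b}).card` of them touch the edge `a b`, and
      -- there are `K.valence a` in all.
      have hwsum : ∑ T ∈ K.triangles, ∑ q ∈ K.nodes, o.inc T a q * o.inc T a q * w q =
          1 - if act then 1 else 0 := by
        have hb : b ∈ K.nodes := mem_nodes_of_mem hT₀' ((mem_star.1 hT₀).2 (by simp))
        have hc : ((K.star {a, b}).card : ℝ) ≠ 0 :=
          Nat.cast_ne_zero.2 (Finset.card_pos.2 ⟨_, hT₀⟩).ne'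
        obtain ⟨c, hc', -⟩ := exists_tri_of_inc_ne_zero o hT₀' i₀
        have hv : ∑ T ∈ K.triangles, ∑ q ∈ K.nodes, o.inc T a q * o.inc T a q *
            (if act then (K.valence a)⁻¹ else 0) = if act then 1 else 0 := by
          simp only [← sum_mul, ← valence_eq o a]
          split_ifs
          exacts [mul_inv_cancel₀ hc'.valence_pos.ne', mul_zero _]
        simp only [hw, mul_sub, sum_sub_distrib, hv]
        simp only [mul_ite, mul_zero, sum_ite_eq', hb, if_true, ← sum_mul,
          sum_inc_sq o hab, mul_inv_cancel₀ hc]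
      rw [hsum, hwsum]
      by_cases ha : act
      · rw [if_pos ha, sub_self, mul_zero]
      · obtain ⟨q, haq, hB, hPq⟩ := hact ha
        obtain ⟨S, hS⟩ := card_eq_one.1 ((onBoundary_pair_iff haq).1 hB)
        have hSm := mem_star.1 (by rw [hS]; simp : S ∈ K.star {a, q})
        have iS : o.inc S a q ≠ 0 := (inc_ne_zero_iff o hSm.1 haq).2
          ⟨hSm.2 (by simp), hSm.2 (by simp)⟩
        have := e2 q hPq
        rw [sum_eq_single S] at this
        · rw [e3 hT₀' i₀ hSm.1 iS, (mul_eq_zero.1 this).resolve_right iS, zero_mul]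
        · intro X hX hXS
          rw [o.inc_of_notMem hX, mul_zero]
          intro hm
          have : X ∈ K.star {a, q} := mem_star.2 ⟨hX, by simp [insert_subset_iff, hm]⟩
          rw [hS] at this
          exact hXS (mem_singleton.1 this)
        · exact fun hn => absurd hSm.1 hn)
  refine ⟨fun s => if ∃ q, P q ∧ s = {a, q} then 0 else g s, fun T hT q hi => ?_, fun q hq =>
    if_pos ⟨q, hq, rfl⟩⟩
  have haq : a ≠ q := by rintro rfl; exact hi (o.inc_self hT)
  have := hg (T, q) (mem_product.2 ⟨hT, mem_nodes_of_mem hT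
    ((inc_ne_zero_iff o hT haq).1 hi).2⟩)
  have e : (∃ r, P r ∧ ({a, q} : Finset E3) = {a, r}) ↔ P q := by
    refine ⟨?_, fun h => ⟨q, h, rfl⟩⟩
    rintro ⟨r, hr, h⟩
    rcases finset_pair_eq_pair_iff.1 h with ⟨-, h⟩ | ⟨h, h'⟩
    · rwa [h]
    · exact absurd h'.symm haq
  have e' : ¬ ∃ r, P r ∧ T = {a, r} := fun ⟨r, _, h⟩ => hTne T hT r h
  simp only [e, e', if_false]
  refine mul_left_cancel₀ hi (Eq.trans ?_ this)
  change _ = o.inc T a q * (g T - u q * g {a, q})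
  simp only [hu]
  split_ifs <;> ring

end SurfaceMesh

end EdgeWeights

/-! ### Normalization and assembly of the basis 1-forms -/

section EdgeWeights

open SurfaceMesh Finset

variable {K : SurfaceMesh} (o : K.Orientation) {tr : ZeroTrace} {a b c p q r : E3}
  {s t u T S : Finset E3} {e : E3 → E3}

namespace SurfaceMesh

theorem exists_boundary_neighbour (h : K.OnBoundary {a}) : ∃ b, a ≠ b ∧ K.OnBoundary {a, b} := by
  obtain ⟨e, he, hc, hs, h1⟩ := h
  obtain ⟨x, y, hxy, rfl⟩ := card_eq_two.1 hc
  have ha : a = x ∨ a = y := by simpa using hs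
  rcases ha with rfl | rfl
  · exact ⟨y, hxy, _, he, hc, subset_rfl, h1⟩
  · exact ⟨x, hxy.symm, _, he, hc, by rw [pair_comm], h1⟩

/-- The equations do not change if a constant is added to `g`. At an interior node the constant is
used to annihilate the half of `a b` itself, as `stable` demands. At a boundary node without trace
condition it annihilates the half of the boundary edge to `e a`, the same one for all `b`, which
later gives `nonneg`. -/
theorem exists_normalized_edge_weights
    (he : ∀ a, K.OnBoundary {a} → a ≠ e a ∧ K.OnBoundary {a, e a}) (hab : a ≠ b)
    (hf : {a, b} ∈ K.faces) :
    ∃ g : Finset E3 → ℝ, (∀ T ∈ K.triangles, ∀ q, o.inc T a q ≠ 0 → g T - g {a, q} = o.inc T a q *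
      ((if q = b then ((K.star {a, b}).card : ℝ)⁻¹ else 0) -
        if K.IsDof tr {a} then (K.valence a)⁻¹ else 0)) ∧
      (tr = ZeroTrace.buffaChristiansen → ∀ q, a ≠ q → K.OnBoundary {a, q} → g {a, q} = 0) ∧
      (¬ K.OnBoundary {a} → g {a, b} = 0) ∧
      (tr = ZeroTrace.whitney → K.OnBoundary {a} → g {a, e a} = 0) := by
  have ha : {a} ∈ K.faces := K.down_closed hf (by simp) (by simp)
  have hbd : ∀ q, K.OnBoundary {a, q} → K.OnBoundary {a} := fun q h => h.mono (by simp)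
  obtain ⟨g, h1, h2⟩ := exists_edge_weights o
    (P := fun q => tr = ZeroTrace.buffaChristiansen ∧ K.OnBoundary {a, q})
    (act := K.IsDof tr {a}) hab hf (fun q h => h.2) (fun h => by
      have hB : K.OnBoundary {a} := by
        by_contra hn; exact h (isDof_of_not_onBoundary ha hn)
      refine ⟨e a, (he a hB).1, (he a hB).2, fun hP => h ⟨ha, fun hw => ?_⟩⟩
      rw [hw] at hP; cases hP.1)
  by_cases hB : K.OnBoundary {a}
  · have : tr = ZeroTrace.buffaChristiansen ∨ tr = ZeroTrace.whitney := by cases tr <;> simp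
    rcases this with htr | htr
    · exact ⟨g, h1, fun _ q _ hq => h2 q ⟨htr, hq⟩, fun hn => absurd hB hn,
        fun hw => by rw [htr] at hw; cases hw⟩
    · exact ⟨fun s => g s - g {a, e a}, fun T hT q hq => by rw [← h1 T hT q hq]; ring,
        fun hw => by rw [htr] at hw; (cases hw), fun hn => absurd hB hn, fun _ _ => sub_self _⟩
  · exact ⟨fun s => g s - g {a, b}, fun T hT q hq => by rw [← h1 T hT q hq]; ring,
      fun _ q _ hq => absurd (hbd q hq) hB, fun _ => sub_self _, fun _ h => absurd h hB⟩

/-- The weights at the two end nodes enter with opposite signs and the dual edge has its prescribed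
coefficients; at other nodes everything is zero. -/
theorem exists_edge_coeffs (tr : ZeroTrace)
    (he : ∀ a, K.OnBoundary {a} → a ≠ e a ∧ K.OnBoundary {a, e a}) :
    ∃ R : E3 → E3 → (Fin 2 → Finset E3) → ℝ, (∀ a b w, R b a w = - R a b w) ∧
      (∀ a b p u, p ≠ a → p ≠ b → R a b ![{p}, u] = 0) ∧
      (∀ a b p q T, a ≠ b → p ≠ q → T ∈ K.triangles → R a b ![{p, q}, T] =
        if {p, q} = ({a, b} : Finset E3) then - o.inc T a b / (K.star {a, b}).card else 0) ∧
      ∀ a b, a ≠ b → {a, b} ∈ K.faces →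
        (tr = ZeroTrace.buffaChristiansen → ∀ p q, p ≠ q → K.OnBoundary {p, q} →
          R a b ![{p}, {p, q}] = 0) ∧
        (¬ K.OnBoundary {a} → R a b ![{a}, {a, b}] = 0) ∧
        (tr = ZeroTrace.whitney → ∀ p, K.OnBoundary {p} → R a b ![{p}, {p, e p}] = 0) ∧
        ∀ z ∈ K.flags 2, coboundary (R a b) z = (if K.IsDof tr {b} then K.coeff2 o b z else 0) -
          if K.IsDof tr {a} then K.coeff2 o a z else 0 := by
  have hex : ∀ a b, ∃ g : Finset E3 → ℝ, a ≠ b → {a, b} ∈ K.faces → _ := fun a b =>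
    if h : a ≠ b ∧ {a, b} ∈ K.faces then
      (exists_normalized_edge_weights o (tr := tr) he h.1 h.2).imp fun g hg _ _ => hg
    else ⟨0, fun h1 h2 => absurd ⟨h1, h2⟩ h⟩
  choose g hg using hex
  set R : E3 → E3 → (Fin 2 → Finset E3) → ℝ := fun a b w => if a = b then 0 else
    (if w 0 = {b} then g b a (w 1) else 0) - (if w 0 = {a} then g a b (w 1) else 0) +
      if w 0 = {a, b} ∧ w 1 ∈ K.triangles then - o.inc (w 1) a b / (K.star {a, b}).card else 0
    with hR
  have hnode : ∀ a b p u, a ≠ b → R a b ![{p}, u] =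
      (if p = b then g b a u else 0) - if p = a then g a b u else 0 := by
    intro a b p u hab
    have e1 : ({p} : Finset E3) ≠ {a, b} := fun h => by
      have := card_pair hab
      rw [← h, card_singleton] at this; omega
    simp [hR, hab, e1]
  have hedge : ∀ a b p q T, a ≠ b → p ≠ q → T ∈ K.triangles → R a b ![{p, q}, T] =
      if {p, q} = ({a, b} : Finset E3) then - o.inc T a b / (K.star {a, b}).card else 0 := by
    intro a b p q T hab hpq hT
    have e1 : ∀ x, ({p, q} : Finset E3) ≠ {x} := fun x h => by
      have := card_pair hpq
      rw [h, card_singleton] at this; omega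
    simp [hR, hab, e1, hT]
  refine ⟨R, fun a b w => ?_, fun a b p u h1 h2 => ?_, hedge, fun a b hab hf => ?_⟩
  · simp only [hR, pair_comm b a]
    by_cases hab : a = b
    · simp [hab]
    · by_cases h : w 0 = {a, b} ∧ w 1 ∈ K.triangles
      · simp only [hab, Ne.symm hab, h, and_self, if_true, if_false, o.inc_swap h.2 a b]; ring
      · simp only [hab, Ne.symm hab, h, if_false]; ring
  · by_cases hab : a = b
    · simp [hR, hab]
    · rw [hnode a b p u hab, if_neg h1, if_neg h2, sub_zero]
  · have hf' : {b, a} ∈ K.faces := by rw [pair_comm]; exact hf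
    obtain ⟨a1, a2, a3, a4⟩ := hg a b hab hf
    obtain ⟨b1, b2, -, b4⟩ := hg b a hab.symm hf'
    refine ⟨fun htr p q hpq hB => ?_, fun hn => ?_, fun htr p hB => ?_, fun z hz => ?_⟩
    · rw [hnode _ _ _ _ hab]
      split_ifs with h1 h2 h2
      · exact absurd (h2.symm.trans h1) hab
      · subst h1; rw [b2 htr _ hpq hB, sub_zero]
      · subst h2; rw [a2 htr _ hpq hB, sub_zero]
      · rw [sub_zero]
    · rw [hnode _ _ _ _ hab, if_neg hab, if_pos rfl, a3 hn, sub_zero]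
    · rw [hnode _ _ _ _ hab]
      split_ifs with h1 h2 h2
      · exact absurd (h2.symm.trans h1) hab
      · subst h1; rw [b4 htr hB, sub_zero]
      · subst h2; rw [a4 htr hB, sub_zero]
      · rw [sub_zero]
    · obtain ⟨p, q, r, h, rfl⟩ := mem_flags_two.1 hz
      have hT := h.2.2.2
      have hi : o.inc {p, q, r} p q ≠ 0 := (inc_ne_zero_iff o hT h.1).2 ⟨by simp, by simp⟩
      have hcoeff : ∀ x, K.coeff2 o x (flag p q r) =
          if p = x then o.inc {p, q, r} p q / K.valence p else 0 := h.coeff2_eq o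
      rw [coboundary_flag, hnode _ _ _ _ hab, hnode _ _ _ _ hab, hedge _ _ _ _ _ hab h.1 hT,
        hcoeff, hcoeff]
      by_cases hpb : p = b
      · subst hpb
        have key := b1 _ hT q hi
        rw [pair_comm p a] at key
        have e1 : ({p, q} : Finset E3) = {a, p} ↔ q = a := by
          rw [finset_pair_eq_pair_iff]
          exact ⟨fun h => h.elim (fun h => absurd h.1.symm hab) fun h => h.2, fun h => .inr ⟨rfl, h⟩⟩
        simp only [e1, if_true, hab.symm, if_false, ite_self, sub_zero]
        by_cases hqa : q = a
        · subst hqa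
          rw [if_pos rfl] at key ⊢
          rw [o.inc_swap hT p q]
          split_ifs at key ⊢ <;> linear_combination -key
        · rw [if_neg hqa] at key ⊢
          split_ifs at key ⊢ <;> linear_combination -key
      · by_cases hpa : p = a
        · subst hpa
          have key := a1 _ hT q hi
          have e1 : ({p, q} : Finset E3) = {p, b} ↔ q = b := by
            rw [finset_pair_eq_pair_iff]
            exact ⟨fun h => h.elim (fun h => h.2) fun h => absurd h.1 hab, fun h => .inl ⟨rfl, h⟩⟩
          simp only [e1, if_true, hab, if_false, ite_self, zero_sub]
          by_cases hqa : q = b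
          · subst hqa
            rw [if_pos rfl] at key ⊢
            split_ifs at key ⊢ <;> linear_combination key
          · rw [if_neg hqa] at key ⊢
            split_ifs at key ⊢ <;> linear_combination key
        · have e1 : ({p, q} : Finset E3) ≠ {a, b} := by
            rw [Ne, finset_pair_eq_pair_iff]
            rintro (h | h)
            exacts [hpa h.1, hpb h.1]
          simp only [hpa, hpb, e1, if_false, ite_self, sub_self, add_zero]

end SurfaceMesh

end EdgeWeights

/-! ### Primitives of the basis 1-forms; existence of a basis -/

section Existence

open SurfaceMesh Finset

variable {K : SurfaceMesh} (o : K.Orientation) (tr : ZeroTrace) {a b c p q r : E3}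
  {s t u T S : Finset E3} {e : E3 → E3}

namespace SurfaceMesh

/-- The part of a family of edge coefficients that belongs to the edges of the triangle `T`. -/
noncomputable def boundarySum (R : E3 → E3 → (Fin 2 → Finset E3) → ℝ) (T : Finset E3)
    (z : Fin 2 → Finset E3) : ℝ :=
  ∑ i : Fin 3, if K.IsDof tr {o.ord T i, o.ord T (i + 1)} then
    R (o.ord T i) (o.ord T (i + 1)) z else 0

/-- The coefficients of the Buffa-Christiansen basis function of the triangle `T`, for given
coefficients of the 1-forms. -/
noncomputable def faceCoeff (R : E3 → E3 → (Fin 2 → Finset E3) → ℝ) (T : Finset E3)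
    (w : Fin 1 → Finset E3) : ℝ :=
  if w 0 = T then 1 else if w 0 ⊆ T then
    if (w 0).card = 2 then 1 - if K.IsDof tr (w 0) then ((K.star (w 0)).card : ℝ)⁻¹ else 0
    else 1 + boundarySum o tr R T ![w 0, T]
  else 0

variable {R : E3 → E3 → (Fin 2 → Finset E3) → ℝ} {tr}

theorem pair_ne_triangle (hT : T ∈ K.triangles) : ({p, q} : Finset E3) ≠ T := by
  rintro rfl
  have := card_le_two (a := p) (b := q)
  rw [(mem_triangles.1 hT).2] at this; omega

theorem faceCoeff_pair (hT : T ∈ K.triangles) (hpq : p ≠ q) : faceCoeff o tr R T ![{p, q}] =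
    if {p, q} ⊆ T then 1 - if K.IsDof tr {p, q} then ((K.star {p, q}).card : ℝ)⁻¹ else 0 else 0 := by
  simp [faceCoeff, pair_ne_triangle hT, card_pair hpq]

theorem faceCoeff_node (hT : T ∈ K.triangles) : faceCoeff o tr R T ![{p}] =
    if p ∈ T then 1 + boundarySum o tr R T ![{p}, T] else 0 := by
  have : ({p} : Finset E3) ≠ T := by rw [← pair_eq_singleton]; exact pair_ne_triangle hT
  simp [faceCoeff, this]

theorem faceCoeff_triangle (hT : T ∈ K.triangles) (hS : S ∈ K.triangles) :
    faceCoeff o tr R T ![S] = if S = T then 1 else 0 := by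
  have : S ⊆ T → S = T := fun h => eq_of_subset_of_card_le h
    (by rw [(mem_triangles.1 hT).2, (mem_triangles.1 hS).2])
  by_cases h : S = T
  · simp [faceCoeff, h]
  · simp [faceCoeff, h, mt this h]

/-- This is `deriv0` on a segment from a midpoint to a barycenter, where at most the edge `p q` of
`T` contributes. If the barycenter is that of another triangle, the edge is interior, the incidence
number is reversed, and both sides are `1 / 2`. -/
theorem boundarySum_edge (hR : ∀ a b p q T, a ≠ b → p ≠ q → T ∈ K.triangles → R a b ![{p, q}, T] =
      if {p, q} = ({a, b} : Finset E3) then - o.inc T a b / (K.star {a, b}).card else 0)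
    (hT : T ∈ K.triangles) (h : K.Tri p q r) :
    boundarySum o tr R T ![{p, q}, {p, q, r}] = faceCoeff o tr R T ![{p, q}] -
      faceCoeff o tr R T ![{p, q, r}] := by
  have hS := h.2.2.2
  have hinj := o.ord_injective hT
  have hne : ∀ j : Fin 3, o.ord T j ≠ o.ord T (j + 1) := fun j => hinj.ne (fin_three_ne j)
  rw [faceCoeff_pair o hT h.1, faceCoeff_triangle o hT hS, boundarySum,
    sum_congr rfl fun i _ => by rw [hR _ _ p q _ (hne i) h.1 hS]]
  by_cases hsub : {p, q} ⊆ T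
  · obtain ⟨i, hi⟩ : ∃ i, ({p, q} : Finset E3) = {o.ord T i, o.ord T (i + 1)} := by
      obtain ⟨c, hc, rfl⟩ := exists_tri_edge hT (hsub (by simp : p ∈ _)) (hsub (by simp : q ∈ _)) h.1
      rcases o.ord_cases hc with ⟨i, h0, h1, -⟩ | ⟨i, h0, h1, -⟩
      · exact ⟨i, by rw [h0, h1]⟩
      · exact ⟨i, by rw [h0, h1, pair_comm]⟩
    have hST : ({p, q} : Finset E3) ⊆ {p, q, r} := by intro x; simp; tauto
    rw [if_pos hsub, sum_eq_single i]
    · rw [← hi, if_pos rfl]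
      split_ifs with hd heq heq
      · rw [heq, o.inc_next hT, neg_div, one_div]; ring
      · have mp := hST (hi.ge (by simp : o.ord T i ∈ _))
        have mq := hST (hi.ge (by simp : o.ord T (i + 1) ∈ _))
        have hstar : (K.star {p, q}).card = 2 := by
          refine le_antisymm (card_star_le h.1) ?_
          rw [← card_pair heq]
          refine card_le_card fun X hX => ?_
          rcases mem_insert.1 hX with rfl | hX
          · exact mem_star.2 ⟨hS, hST⟩
          · rw [mem_singleton.1 hX]; exact mem_star.2 ⟨hT, hsub⟩
        rw [o.inc_compat hT hS (Ne.symm heq) (o.ord_mem hT _) (o.ord_mem hT _) mp mq,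
          o.inc_next hT, hstar]
        norm_num
      · simp
      · refine absurd (isDof_of_not_onBoundary h.pair_mem fun hB => ?_) hd
        obtain ⟨X, hX⟩ := card_eq_one.1 ((onBoundary_pair_iff h.1).1 hB)
        have m1 : ({p, q, r} : Finset E3) ∈ K.star {p, q} := mem_star.2 ⟨hS, hST⟩
        have m2 : T ∈ K.star {p, q} := mem_star.2 ⟨hT, hsub⟩
        rw [hX, mem_singleton] at m1 m2
        exact heq (m1.trans m2.symm)
    · intro j _ hj
      rw [hi, ite_eq_right_iff]
      refine fun _ => if_neg ?_
      rw [finset_pair_eq_pair_iff, hinj.eq_iff, hinj.eq_iff, hinj.eq_iff, hinj.eq_iff]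
      exact (by decide : ∀ j i : Fin 3, j ≠ i →
        ¬ (i = j ∧ i + 1 = j + 1 ∨ i = j + 1 ∧ i + 1 = j)) j i hj
    · exact fun hn => absurd (mem_univ i) hn
  · rw [if_neg hsub, if_neg (by rintro rfl; exact hsub (by intro x; simp; tauto)), sub_zero]
    refine sum_eq_zero fun i _ => ?_
    rw [ite_eq_right_iff]
    refine fun _ => if_neg fun hi => hsub ?_
    simp [hi, insert_subset_iff, o.ord_mem hT]

/-- The contributions of the nodes telescope around `T`. Inactive edges have only inactive nodes, so
leaving them out does no harm. -/
theorem boundarySum_coboundary (hR : ∀ a b, a ≠ b → {a, b} ∈ K.faces → ∀ z ∈ K.flags 2,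
      coboundary (R a b) z = (if K.IsDof tr {b} then K.coeff2 o b z else 0) -
        if K.IsDof tr {a} then K.coeff2 o a z else 0)
    (hT : T ∈ K.triangles) (h : K.Tri p q r) :
    boundarySum o tr R T ![{p, q}, {p, q, r}] - boundarySum o tr R T ![{p}, {p, q, r}] +
      boundarySum o tr R T ![{p}, {p, q}] = 0 := by
  simp only [boundarySum, ← sum_sub_distrib, ← sum_add_distrib]
  set F : Fin 3 → ℝ := fun i => if K.IsDof tr {o.ord T i} then K.coeff2 o (o.ord T i) (flag p q r) else 0
  have hsum : ∑ i, (F (i + 1) - F i) = 0 := by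
    rw [sum_sub_distrib, sub_eq_zero]
    exact Equiv.sum_comp (Equiv.addRight (1 : Fin 3)) F
  refine Eq.trans (sum_congr rfl fun i _ => ?_) hsum
  have hf : {o.ord T i, o.ord T (i + 1)} ∈ K.faces := K.down_closed (mem_triangles.1 hT).1
    (by simp [insert_subset_iff, o.ord_mem hT]) (by simp)
  have key := hR _ _ ((o.ord_injective hT).ne (fin_three_ne i)) hf _ h.flag_mem
  rw [coboundary_flag] at key
  split_ifs with hd
  · exact key
  · have hn : ∀ x ∈ ({o.ord T i, o.ord T (i + 1)} : Finset E3), ¬ K.IsDof tr {x} := fun x hx hx' =>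
      hd ⟨hf, fun htr hB => hx'.2 htr (hB.mono (by simpa using hx))⟩
    simp only [F]
    rw [if_neg (hn _ (by simp)), if_neg (hn _ (by simp))]; ring

/-- The defining property of the basis functions at the edges that start from a node. -/
theorem faceCoeff_add_boundarySum
    (hR : ∀ a b p q T, a ≠ b → p ≠ q → T ∈ K.triangles → R a b ![{p, q}, T] =
      if {p, q} = ({a, b} : Finset E3) then - o.inc T a b / (K.star {a, b}).card else 0)
    (hR' : ∀ a b, a ≠ b → {a, b} ∈ K.faces → ∀ z ∈ K.flags 2,
      coboundary (R a b) z = (if K.IsDof tr {b} then K.coeff2 o b z else 0) -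
        if K.IsDof tr {a} then K.coeff2 o a z else 0)
    (hT : T ∈ K.triangles) (hp : p ∈ T) (hu : ![{p}, u] ∈ K.flags 1) :
    faceCoeff o tr R T ![u] + boundarySum o tr R T ![{p}, u] = faceCoeff o tr R T ![{p}] := by
  -- `H u` is the value at `p` obtained by integrating from the barycenter of `u`. Closedness makes
  -- it constant within a small triangle, and the triangles around `p` are connected through edges
  -- at `p`.
  set H : Finset E3 → ℝ := fun u => faceCoeff o tr R T ![u] + boundarySum o tr R T ![{p}, u] with hH
  have step : ∀ q r, K.Tri p q r → H {p, q, r} = H {p, q} := fun q r h => by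
    have h1 := boundarySum_edge o (tr := tr) hR hT h
    have h2 := boundarySum_coboundary o hR' hT h
    simp only [hH]; linarith
  have htri : ∀ S ∈ K.triangles, p ∈ S → H S = H T := by
    intro S hS hpS
    obtain ⟨mS, cS⟩ := mem_triangles.1 hS
    obtain ⟨mT, cT⟩ := mem_triangles.1 hT
    have hpath := K.star_connected p T mT S mS cT cS hp hpS
    clear hS hpS mS cS
    induction hpath with
    | refl => rfl
    | @tail X Z _ hXZ ih =>
      obtain ⟨mX, mZ, cX, cZ, aX, aZ, hc⟩ := hXZ
      obtain ⟨x, hx, hxp⟩ := Set.exists_ne_of_one_lt_ncard (by rw [hc]; norm_num) p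
      obtain ⟨r, hr, e1⟩ := exists_tri_edge (mem_triangles.2 ⟨mX, cX⟩) aX hx.1 hxp.symm
      obtain ⟨r', hr', e2⟩ := exists_tri_edge (mem_triangles.2 ⟨mZ, cZ⟩) aZ hx.2 hxp.symm
      rw [← ih, e1, e2, step _ _ hr, step _ _ hr']
  have hT1 : H T = faceCoeff o tr R T ![{p}] := by
    rw [faceCoeff_node o hT, if_pos hp]
    simp only [hH]; rw [faceCoeff_triangle o hT hT, if_pos rfl]
  rw [← hT1]
  have hpu : p ∈ u := (mem_flags_one.1 hu).2.2.1 (mem_singleton_self p)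
  obtain ⟨S, hS, hs⟩ := exists_triangle (mem_flags_one.1 hu).2.1
  rcases flags_one_cases hu with ⟨x, y, hxy, -, e⟩ | ⟨x, X, hX, -, e⟩ | ⟨x, y, z, h, e⟩
  · obtain rfl := singleton_inj.1 (congrFun e 0)
    have e1 : u = {p, y} := congrFun e 1
    subst e1
    obtain ⟨r, hr, rfl⟩ := exists_tri_edge hS (hs (by simp : p ∈ _)) (hs (by simp : y ∈ _)) hxy
    exact (step _ _ hr).symm.trans (htri _ hS (by simp))
  · have e1 : u = X := congrFun e 1
    exact htri u (by rw [e1]; exact hX) hpu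
  · have := congrArg card (congrFun e 0 : {p} = {x, y})
    rw [card_singleton, h.card_pair] at this; omega

end SurfaceMesh

/-- The 0-forms are primitives of the 1-forms, normalized at the barycenters. At a boundary node `p`
without trace condition, all 1-forms vanish on the half of the edge to `e p`, so the value at `p`
equals the one at that midpoint, which is nonnegative by its explicit formula. -/
theorem exists_bcBasis (tr : ZeroTrace) : Nonempty (BCBasis K o tr) := by
  -- One boundary edge at every boundary node, fixed for all basis forms; the value at other nodes
  -- is irrelevant.
  choose e he using fun a => show ∃ b, K.OnBoundary {a} → a ≠ b ∧ K.OnBoundary {a, b} from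
    if h : K.OnBoundary {a} then (exists_boundary_neighbour h).imp fun _ h' _ => h'
    else ⟨a, fun h' => absurd h' h⟩
  obtain ⟨R, r1, r2, r3, r4⟩ := exists_edge_coeffs o tr he
  have hcob : ∀ a b, a ≠ b → {a, b} ∈ K.faces → ∀ z ∈ K.flags 2, _ := fun a b hab hf =>
    (r4 a b hab hf).2.2.2
  have hnode := fun {T u p} => faceCoeff_add_boundarySum o (T := T) (u := u) (p := p) r3 hcob
  have hcard : ∀ {p x y : E3}, x ≠ y → ({p} : Finset E3) ≠ {x, y} := fun hxy h => by
    have := card_pair hxy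
    rw [← h, card_singleton] at this; omega
  have hBf : ∀ {x y : E3}, K.OnBoundary {x, y} → {x, y} ∈ K.faces := by
    rintro x y ⟨e, he, -, hs, -⟩
    exact K.down_closed he hs (by simp)
  have hsum0 : ∀ {T z}, T ∈ K.triangles → (∀ a b, a ≠ b → {a, b} ∈ K.faces → R a b z = 0) →
      boundarySum o tr R T z = 0 := by
    intro T z hT h
    refine sum_eq_zero fun i _ => ?_
    split_ifs with hd
    · exact h _ _ ((o.ord_injective hT).ne (fin_three_ne i)) hd.1
    · rfl
  have hw1 : ∀ w : Fin 1 → Finset E3, w = ![w 0] := fun w => by ext i : 1; fin_cases i; rfl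
  refine ⟨⟨R, faceCoeff o tr R, r1, ?_, ?_, ?_, fun a b hab hd z hz _ => hcob a b hab hd.1 z hz,
    ?_, ?_, ?_, ?_⟩⟩
  · intro a b hab hd w hw hreg
    have hB := inRegionBoundary_iff (K := K) (tr := tr) (t := {a, b}) (w := w)
    rcases flags_one_cases hw with ⟨p, q, hpq, hf, rfl⟩ | ⟨p, T, hT, hp, rfl⟩ | ⟨p, q, r, h, rfl⟩
    · by_cases hp : p ∈ ({a, b} : Finset E3)
      · rcases hB.1 (hreg.resolve_left (not_not.2 ((inRegion_node_iff hw).2 hp))) with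
          ⟨htr, x, y, hxy, -, hb, hs⟩ | ⟨x, y, z, h, -, -, hs⟩
        · rw [isSubflag_one_one_iff hw (mem_flags_node_edge hxy (hBf hb))] at hs
          rw [hs]; exact (r4 a b hab hd.1).1 htr x y hxy hb
        · rw [isSubflag_one_one_iff hw h.flags_edge_triangle] at hs
          exact absurd (congrFun hs 0) (hcard h.1)
      · simp only [mem_insert, mem_singleton, not_or] at hp
        exact r2 a b p _ hp.1 hp.2
    · by_cases hp : p ∈ ({a, b} : Finset E3)
      · rcases hB.1 (hreg.resolve_left (not_not.2 ((inRegion_node_iff hw).2 hp))) with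
          ⟨htr, x, y, hxy, -, hb, hs⟩ | ⟨x, y, z, h, -, -, hs⟩
        · rw [isSubflag_one_one_iff hw (mem_flags_node_edge hxy (hBf hb))] at hs
          exact absurd (congrFun hs 1).symm (pair_ne_triangle hT)
        · rw [isSubflag_one_one_iff hw h.flags_edge_triangle] at hs
          exact absurd (congrFun hs 0) (hcard h.1)
      · simp only [mem_insert, mem_singleton, not_or] at hp
        exact r2 a b p _ hp.1 hp.2
    · rw [r3 a b p q _ hab h.1 h.2.2.2]
      split_ifs with he
      · have hp : p ∈ ({a, b} : Finset E3) := by rw [← he]; simp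
        rcases hB.1 (hreg.resolve_left (not_not.2 (h.inRegion_edge_iff.2 (.inl hp)))) with
          ⟨htr, x, y, hxy, -, hb, hs⟩ | ⟨x, y, z, h', -, hy, hs⟩
        · rw [isSubflag_one_one_iff hw (mem_flags_node_edge hxy (hBf hb))] at hs
          exact absurd (congrFun hs 0).symm (hcard h.1)
        · rw [isSubflag_one_one_iff hw h'.flags_edge_triangle] at hs
          have e0 : ({p, q} : Finset E3) = {x, y} := congrFun hs 0
          exact absurd (by rw [← he, e0]; simp) hy
      · rfl
  · intro a b hab hd w hw h0
    rw [card_flags_edge hab]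
    rcases flags_one_cases hw with ⟨p, q, hpq, hf, rfl⟩ | ⟨p, T, hT, hp, rfl⟩ | ⟨p, q, r, h, rfl⟩
    · exact absurd h0 (hcard hab)
    · exact absurd h0 (hcard hab)
    · exact (r3 a b p q _ hab h.1 h.2.2.2).trans (if_pos h0)
  · intro a b hab hd w hw h0 hB
    rcases flags_one_cases hw with ⟨p, q, hpq, hf, rfl⟩ | ⟨p, T, hT, hp, rfl⟩ | ⟨p, q, r, h, rfl⟩
    · rcases finset_pair_eq_pair_iff.1 h0 with ⟨rfl, rfl⟩ | ⟨rfl, rfl⟩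
      · exact (r4 _ _ hab hd.1).2.1 hB
      · rw [r1 p q, (r4 p q hpq hf).2.1 hB, neg_zero]
    · exact absurd h0.symm (pair_ne_triangle hT)
    · exact absurd h0.symm (pair_ne_triangle h.2.2.2)
  · intro T hT w hw hreg
    have hs := mem_flags_zero.1 hw
    rw [hw1 w] at hreg ⊢
    obtain ⟨s, hws⟩ : ∃ s, s = w 0 := ⟨_, rfl⟩
    rw [← hws] at hreg hs ⊢
    by_cases hsT : s ⊆ T
    · obtain ⟨x, hx⟩ := K.nonempty_of_mem_faces hs
      have hB := hreg.resolve_left (not_not.2 ((inRegion_zero hs).2 ⟨x, hx, hsT hx⟩))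
      rcases inRegionBoundary_iff.1 hB with ⟨htr, x, y, hxy, hxT, hb, hs'⟩ | ⟨x, y, z, h, -, hy, hs'⟩
      · have h1 : faceCoeff o tr R T ![{x, y}] = 0 := by
          have hd : K.IsDof tr {x, y} := ⟨hBf hb, fun h => by rw [htr] at h; cases h⟩
          rw [faceCoeff_pair o hT hxy, if_pos hd, (onBoundary_pair_iff hxy).1 hb]; simp
        rcases isSubflag_zero_one_iff.1 hs' with e1 | e1
        · change {x} = s at e1
          rw [← e1, ← hnode hT hxT (mem_flags_node_edge hxy (hBf hb)), h1,
            hsum0 hT fun a b hab hf => (r4 a b hab hf).1 htr x y hxy hb, zero_add]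
        · change {x, y} = s at e1
          rw [← e1, h1]
      · refine absurd (hsT ?_) hy
        rcases isSubflag_zero_one_iff.1 hs' with e1 | e1 <;> rw [← e1] <;> simp
    · have : s ≠ T := by rintro rfl; exact hsT subset_rfl
      simp [faceCoeff, hsT, this]
  · intro T hT w hw h0
    rw [faceCoeff, if_pos h0]
  · intro T hT z hz hreg
    rw [coboundary_zero]
    change _ = - boundarySum o tr R T z
    rcases flags_one_cases hz with ⟨p, q, hpq, hf, rfl⟩ | ⟨p, S, hS, hp, rfl⟩ | ⟨p, q, r, h, rfl⟩
    · exact eq_neg_of_add_eq_zero_left (by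
        linarith [hnode hT ((inRegion_node_iff hz).1 hreg) hz] : faceCoeff o tr R T ![{p, q}] -
          faceCoeff o tr R T ![{p}] + boundarySum o tr R T ![{p}, {p, q}] = 0)
    · exact eq_neg_of_add_eq_zero_left (by
        linarith [hnode hT ((inRegion_node_iff hz).1 hreg) hz] : faceCoeff o tr R T ![S] -
          faceCoeff o tr R T ![{p}] + boundarySum o tr R T ![{p}, S] = 0)
    · rw [boundarySum_edge o r3 hT h, neg_sub]; rfl
  · intro htr T hT w hw hB hc
    rw [hw1 w]
    obtain ⟨p, hp⟩ := card_eq_one.1 hc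
    rw [hp] at hB ⊢
    by_cases hpT : p ∈ T
    · obtain ⟨h1, h2⟩ := he p hB
      rw [← hnode hT hpT (mem_flags_node_edge h1 (hBf h2)),
        hsum0 hT fun a b hab hf => (r4 a b hab hf).2.2.1 htr p hB, add_zero, faceCoeff_pair o hT h1]
      split_ifs
      · exact sub_nonneg.2 (Nat.cast_inv_le_one _)
      · norm_num
      · rfl
    · rw [faceCoeff_node o hT, if_neg hpT]

end Existence

end MeshCoupling

/-! ### The theorem -/

theorem mainTheorem1 (Ki Kj : MeshCoupling.SurfaceMesh) (hΓ : Ki.space = Kj.space)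
    (o : Kj.Orientation) (tr : MeshCoupling.ZeroTrace) :
    Nonempty (MeshCoupling.BCBasis Kj o tr) ∧
    ∀ μ : MeshCoupling.BCBasis Kj o tr,
      (∀ (q r : ℕ) (h : q + r = 2),
        ∃! Q : MeshCoupling.whitneySpace Ki tr r →ₗ[ℝ] MeshCoupling.whitneySpace Kj tr r,
          MeshCoupling.IsCouplingOperator Ki μ h Q) ∧
      (∀ (q r : ℕ) (h : q + r = 2)
        (Q : MeshCoupling.whitneySpace Ki tr r →ₗ[ℝ] MeshCoupling.whitneySpace Kj tr r),
        MeshCoupling.IsCouplingOperator Ki μ h Q →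
          ∀ (ω : MeshCoupling.whitneySpace Ki tr r) (η : MeshCoupling.whitneySpace Kj tr r),
            MeshCoupling.Coincide Ki Kj (ω : MeshCoupling.Form r) (η : MeshCoupling.Form r) →
              Q ω = η) ∧
      (∀ (q r : ℕ) (h : (q + 1) + r = 2) (h' : q + (r + 1) = 2)
        (Q : MeshCoupling.whitneySpace Ki tr r →ₗ[ℝ] MeshCoupling.whitneySpace Kj tr r)
        (Q' : MeshCoupling.whitneySpace Ki tr (r + 1) →ₗ[ℝ]
          MeshCoupling.whitneySpace Kj tr (r + 1)),
        MeshCoupling.IsCouplingOperator Ki μ h Q →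
        MeshCoupling.IsCouplingOperator Ki μ h' Q' →
          ∀ ω : MeshCoupling.whitneySpace Ki tr r,
            ∃ hω : MeshCoupling.surfaceD Ki.triangles (ω : MeshCoupling.Form r) ∈
                MeshCoupling.whitneySpace Ki tr (r + 1),
              MeshCoupling.surfaceD Kj.triangles (Q ω : MeshCoupling.Form r) =
                (Q' ⟨MeshCoupling.surfaceD Ki.triangles (ω : MeshCoupling.Form r), hω⟩ :
                  MeshCoupling.Form (r + 1))) := by

  refine ⟨MeshCoupling.exists_bcBasis o tr, fun μ => ⟨fun q r h => ?_, ?_, ?_⟩⟩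
  · obtain ⟨Q, hQ⟩ := (μ.nondegenerate_and_exists h).2 Ki
    refine ⟨Q, hQ, fun Q' hQ' => LinearMap.ext fun ω => Subtype.ext ?_⟩
    exact μ.eq_of_pairing_eq h (Q' ω).2 (Q ω).2 fun R hR =>
      (hQ' ω _ (μ.sdForm_mem_space hR)).trans (hQ ω _ (μ.sdForm_mem_space hR)).symm
  · intro q r h Q hQ ω η H
    exact Subtype.ext (μ.eq_of_pairing_eq h (Q ω).2 η.2 fun R hR =>
      (hQ ω _ (μ.sdForm_mem_space hR)).trans (MeshCoupling.pairing_eq_of_coincide hΓ h _ H).symm)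
  · intro q r h h' Q Q' hQ hQ' ω
    have hω := MeshCoupling.surfaceD_mem_whitneySpace (by omega) ω.2
    exact ⟨hω, μ.surfaceD_coupling hΓ h h' ω.2 (Q ω).2 (Q' ⟨_, hω⟩).2 (hQ ω) (hQ' ⟨_, hω⟩)⟩
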